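/- **Setting.** Let $k$ be a commutative ring and $A=\bigoplus_{i\ge 0}A_i$ a positively graded, augmented, unital differential graded associative $k$-algebra with $\deg d=+1$; put $\bar A=\ker(\varepsilon\colon A\to k)$. Koszul signs are used throughout. The normalized Hochschild chain complex is $C=C_*(A,A)=A\otimes T(s\bar A)$, where $a_0[a_1,\dots,a_n]$ has degree $|a_0|+\sum_{i\ge1}|a_i|-n$; with $\epsilon_i=|a_0|+\dots+|a_{i-1}|-i+1$, its differential $D$ (of degree $+1$) sends $a_0[a_1,\dots,a_n]$ to $$da_0[a_1,\dots,a_n]-\sum_{i=1}^n(-1)^{\epsilon_i}a_0[\dots,da_i,\dots]+(-1)^{|a_0|}a_0a_1[a_2,\dots,a_n]+\sum_{i=2}^n(-1)^{\epsilon_i}a_0[\dots,a_{i-1}a_i,\dots]-(-1)^{\epsilon_n(|a_n|+1)}a_na_0[a_1,\dots,a_{n-1}],$$ and the Connes operator (of degree $-1$) is $$B(a_0[a_1,\dots,a_n])=\sum_{i=1}^{n+1}(-1)^{(|a_0|+\dots+|a_{i-1}|-i)(|a_i|+\dots+|a_n|-n+i-1)}\,1[a_i,\dots,a_n,a_0,\dots,a_{i-1}].$$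 A *symmetric open Frobenius structure of degree $m$* on $A$ is a map $\delta\colon A\to A\otimes A$, $\delta x=\sum x'\otimes x''$, of degree $m$ with $(\delta\otimes1)\delta=(-1)^m(1\otimes\delta)\delta$, $\delta d=(-1)^m(d\otimes1+1\otimes d)\delta$, $\delta(xy)=(-1)^{m|x|}\sum xy'\otimes y''=\sum x'\otimes x''y$, and $\sum1'\otimes1''=\sum(-1)^{|1'||1''|+m}1''\otimes1'$. It induces the degree $m$ coproduct $$\theta(a_0[a_1,\dots,a_n])=\sum_{(a_0),\,0\le i\le n}(-1)^{|a_0'|(|a_0''|+|a_1|+\dots+|a_i|+i)}\,a_0''[a_1,\dots,a_i]\otimes a_0'[a_{i+1},\dots,a_n].$$ Write $C[m]$ for $C$ regraded so that $x$ has degree $|x|-m$; on $C[m]$, $\theta$ becomes the degree $0$ coproduct $\theta'=(s\otimes s)\theta s^{-1}$, where $s$ denotes the identity viewed as a map $C\to C[m]$ and $(s\otimes s)(x\otimes y)=(-1)^{m|x|}sx\otimes sy$. The complex $C^*(A,A^\vee)[m]$ is the graded dual of $C[m]$ (a functional supported on chains of degree $j$ in $C$ has degree $m-j$), with $D^\vee\phi=(-1)^{|\phi|}\phi\circ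 D$, $B^\vee\phi=(-1)^{|\phi|}\phi\circ B$ ($|\phi|$ the degree in this shifted grading) and product $\phi\odot\psi=(-1)^{mq}(\phi\otimes\psi)\circ\theta$, where $q$ is the degree of $\psi$ as a functional on the unshifted $C$ and $(\phi\otimes\psi)(x\otimes y)=(-1)^{q|x|}\phi(x)\psi(y)$. A *BV-algebra* is a (not necessarily unital) graded commutative associative algebra with an operator $\Delta$ of degree $-1$ such that $\Delta^2=0$ and $$\Delta(abc)=\Delta(ab)c+(-1)^{|a|}a\Delta(bc)+(-1)^{(|a|-1)|b|}b\Delta(ac)-\Delta(a)bc-(-1)^{|a|}a\Delta(b)c-(-1)^{|a|+|b|}ab\Delta(c);$$ its Gerstenhaber bracket is $[a,b]=(-1)^{|a|}\Delta(ab)-(-1)^{|a|}\Delta(a)b-a\Delta(b)$. A *coBV-coalgebra* is a (not necessarily counital) graded cocommutative coassociative coalgebra with an operator $B$ of degree $-1$ with $B^2=0$ satisfying the transposed seven-term relation. A *homotopy coBV-algebra* is a coassociative differential graded coalgebra with an operator $B$ of degree $-1$ that satisfies $B^2=0$ and anticommutes with the differential, such that cocommutativity and the transposed seven-term relation hold up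 to chain homotopy. **Theorem 3.1.** 1. Let $\delta$ be a symmetric open Frobenius structure of degree $m$ on $A$. Then $(C[m],D,\theta',B)$ is a homotopy coBV-algebra. Consequently: * if $k$ is a field, or more generally if the Künneth maps $H^{\otimes n}\to H_*(C[m]^{\otimes n})$, $H=HH_*(A,A)[m]$, are isomorphisms for $n=2,3$, then $\theta'$ and $B$ induce the structure of a coBV-coalgebra on $HH_*(A,A)[m]$; * over any $k$, the operations $\odot$ and $B^\vee$ induce the structure of a BV-algebra on $HH^*(A,A^\vee)[m]$, the cohomology of $C^*(A,A^\vee)[m]$. 2. Let $A$ be a closed Frobenius algebra of degree $m$: $A$ is finitely generated projective over $k$ and has an inner product $\langle-,-\rangle$ with $\langle x,y\rangle=0$ for homogeneous $x,y$ with $|x|+|y|\ne m$, $\langle x,y\rangle=(-1)^{|x||y|}\langle y,x\rangle$, $\langle xy,z\rangle=\langle x,yz\rangle$, $\langle dx,y\rangle=-(-1)^{|x|}\langle x,dy\rangle$, and $x\mapsto\langle x,-\rangle$ a bijection $A\to\operatorname{Hom}_k(A,k)$. Then there is exactly one $\delta\colon A\to A\otimes A$ with $\langle x,ab\rangle=\sum(-1)^{m|x'|}\langle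 x'',a\rangle\langle x',b\rangle$ for all $x,a,b$, and it is a symmetric open Frobenius structure of degree $m$. Let $C^*(A,A)$ be the complex of graded maps $f\colon T(s\bar A)\to A$, where $|f|$ is the degree of $f$ as a map, with Hochschild differential ($\epsilon_i=|f|+|a_1|+\dots+|a_{i-1}|-i+1$) $$(Df)(a_1,\dots,a_n)=d f(a_1,\dots,a_n)+\sum_{i\ge1}(-1)^{\epsilon_i}f(\dots,da_i,\dots)-(-1)^{(|a_1|+1)|f|}a_1f(a_2,\dots,a_n)-\sum_{i\ge2}(-1)^{\epsilon_i}f(\dots,a_{i-1}a_i,\dots)+(-1)^{\epsilon_n}f(a_1,\dots,a_{n-1})a_n,$$ cup product $(f\cup g)(a_1,\dots,a_n)=\sum_i(-1)^{|g|(|a_1|+\dots+|a_i|-i)}f(a_1,\dots,a_i)\,g(a_{i+1},\dots,a_n)$, and Gerstenhaber bracket $f\circ g-(-1)^{(|f|+1)(|g|+1)}g\circ f$, where $(f\circ g)(a_1,\dots,a_n)=\sum_{i\le j}(-1)^{(|g|+1)(|a_1|+\dots+|a_i|-i)}f(a_1,\dots,a_i,g(a_{i+1},\dots,a_j),a_{j+1},\dots,a_n)$.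 Then $$\tilde f(a_0[a_1,\dots,a_n])=(-1)^{(|a_0|+1)|f|}\langle a_0,f(a_1,\dots,a_n)\rangle$$ defines an isomorphism of complexes $C^*(A,A)\to C^*(A,A^\vee)[m]$ of degree $0$ with $\widetilde{f\cup g}=\tilde f\odot\tilde g$. On $HH^*(A,A)$, the cup product together with the operator that corresponds to $B^\vee$ under the induced isomorphism $HH^*(A,A)\cong HH^*(A,A^\vee)[m]$ form a BV-algebra (Tradler's), and the bracket of this BV-algebra is the bracket induced by the standard Gerstenhaber bracket. -/

import Mathlib

open scoped TensorProduct

noncomputable section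

namespace OpenFrobenius

universe u v w x

/-! ## Koszul signs on graded modules

A graded module is a module `V` with a family `gr : ℤ → Submodule k V`. -/

/-- The sign `(-1)^e`; integer degrees are cast to `ZMod 2`. -/
def ksign (k : Type u) [CommRing k] (e : ZMod 2) : k := if e = 0 then 1 else -1

section Signs

variable {k : Type u} [CommRing k]
variable {V : Type v} [AddCommGroup V] [Module k V]
variable {W : Type w} [AddCommGroup W] [Module k W]

open Classical in
/-- The projection of `V = ⨁ i, gr i` onto the sum of the `gr i` with `i ≡ e` mod `2`
(by convention `0` if `V` is not the direct sum of the `gr i`). -/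
def par (gr : ℤ → Submodule k V) (e : ZMod 2) : V →ₗ[k] V :=
  if h : Function.Bijective (DirectSum.coeLinearMap gr) then
    (DirectSum.toModule k ℤ V fun i => if (i : ZMod 2) = e then (gr i).subtype else 0) ∘ₗ
      ((LinearEquiv.ofBijective (DirectSum.coeLinearMap gr) h).symm : V →ₗ[k] _)
  else 0

theorem par_of_mem (gr : ℤ → Submodule k V) (h : DirectSum.IsInternal gr) (e : ZMod 2) (i : ℤ)
    (v : V) (hv : v ∈ gr i) : par gr e v = if (i : ZMod 2) = e then v else 0 := by
  have h' : Function.Bijective (DirectSum.coeLinearMap gr) := h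
  have hs : (LinearEquiv.ofBijective (DirectSum.coeLinearMap gr) h').symm v =
      DirectSum.lof k ℤ (fun i => gr i) i ⟨v, hv⟩ := by
    rw [LinearEquiv.symm_apply_eq]
    simp
  simp only [par, dif_pos h', LinearMap.comp_apply, LinearEquiv.coe_coe, hs,
    DirectSum.toModule_lof]
  split <;> simp

/-- `v ↦ (-1)^{e|v|} v`. -/
def sg (gr : ℤ → Submodule k V) (e : ZMod 2) : V →ₗ[k] V :=
  ∑ a : ZMod 2, ksign k (a * e) • par gr a

/-- `v ⊗ w ↦ (-1)^{|v||w|} v ⊗ w`. -/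
def ksgn (gr : ℤ → Submodule k V) (gr' : ℤ → Submodule k W) : V ⊗[k] W →ₗ[k] V ⊗[k] W :=
  ∑ a : ZMod 2, ∑ b : ZMod 2, ksign k (a * b) • TensorProduct.map (par gr a) (par gr' b)

/-- The Koszul flip `v ⊗ w ↦ (-1)^{|v||w|} w ⊗ v`. -/
def kswap (gr : ℤ → Submodule k V) (gr' : ℤ → Submodule k W) : V ⊗[k] W →ₗ[k] W ⊗[k] V :=
  (TensorProduct.comm k V W : V ⊗[k] W →ₗ[k] W ⊗[k] V) ∘ₗ ksgn gr gr'

/-- The grading of a tensor product. -/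
def tensorGr (gr : ℤ → Submodule k V) (gr' : ℤ → Submodule k W) (i : ℤ) :
    Submodule k (V ⊗[k] W) :=
  ⨆ p : ℤ, Submodule.map₂ (TensorProduct.mk k V W) (gr p) (gr' (i - p))

/-- `D ⊗ 1 + 1 ⊗ D'` for odd operators `D`, `D'`, with
`(1 ⊗ D') (v ⊗ w) = (-1)^{|v|} v ⊗ D' w`. -/
def tensorOdd (gr : ℤ → Submodule k V) (D : V →ₗ[k] V) (D' : W →ₗ[k] W) :
    V ⊗[k] W →ₗ[k] V ⊗[k] W :=
  TensorProduct.map D LinearMap.id + TensorProduct.map (sg gr 1) D'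

/-- The grading of the shifted module `V[m]`, in which `v` has degree `|v| - m`. -/
def shiftGr (m : ℤ) (gr : ℤ → Submodule k V) (i : ℤ) : Submodule k V := gr (i + m)

/-- The degree `i` part of the graded dual, `Hom_k(V_{-i}, k)`. -/
def dualGr (gr : ℤ → Submodule k V) (i : ℤ) : Submodule k (Module.Dual k V) where
  carrier := {φ | ∀ j, j ≠ -i → ∀ v ∈ gr j, φ v = 0}
  add_mem' := by
    intro φ ψ hφ hψ j hj v hv
    simp [hφ j hj v hv, hψ j hj v hv]
  zero_mem' := by intro j _ v _; simp
  smul_mem' := by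
    intro c φ hφ j hj v hv
    simp [hφ j hj v hv]

/-- The operator on the graded dual induced by an odd operator `D`: `φ ↦ (-1)^{|φ|} φ ∘ D`
(note that `|φ| = -|D v|` whenever `φ (D v) ≠ 0`). -/
def oddDual (gr : ℤ → Submodule k V) (D : V →ₗ[k] V) : Module.Dual k V →ₗ[k] Module.Dual k V :=
  LinearMap.dualMap (sg gr 1 ∘ₗ D)

end Signs

/-! ## Homology of a graded module with a differential -/

section Homology

variable {k : Type u} [CommRing k]
variable {V : Type v} [AddCommGroup V] [Module k V]
variable {W : Type w} [AddCommGroup W] [Module k W]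

/-- Cycles, in the graded module `⨆ i, gr i` (which may be a proper submodule of `V`). -/
def cyc (gr : ℤ → Submodule k V) (D : V →ₗ[k] V) : Submodule k V :=
  LinearMap.ker D ⊓ ⨆ i, gr i

/-- Boundaries. -/
def bdry (gr : ℤ → Submodule k V) (D : V →ₗ[k] V) : Submodule k V := (⨆ i, gr i).map D

/-- The (total) homology `ker D / im D`. -/
abbrev Homology (gr : ℤ → Submodule k V) (D : V →ₗ[k] V) : Type v :=
  ↥(cyc gr D) ⧸ (bdry gr D).submoduleOf (cyc gr D)

/-- The class of a cycle. -/
def cls (gr : ℤ → Submodule k V) (D : V →ₗ[k] V) : ↥(cyc gr D) →ₗ[k] Homology gr D :=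
  ((bdry gr D).submoduleOf (cyc gr D)).mkQ

/-- The grading of homology: classes of cycles of degree `i`. -/
def homologyGr (gr : ℤ → Submodule k V) (D : V →ₗ[k] V) (i : ℤ) :
    Submodule k (Homology gr D) :=
  ((gr i).submoduleOf (cyc gr D)).map (cls gr D)

/-- `F` is the map induced on homology by `f`. -/
def Induces (gr : ℤ → Submodule k V) (D : V →ₗ[k] V) (gr' : ℤ → Submodule k W) (D' : W →ₗ[k] W)
    (f : V → W) (F : Homology gr D → Homology gr' D') : Prop :=
  ∀ z : cyc gr D, ∃ h : f z ∈ cyc gr' D', F (cls gr D z) = cls gr' D' ⟨f z, h⟩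

/-- `F` is the bilinear operation induced on homology by `f`. -/
def InducesMul (gr : ℤ → Submodule k V) (D : V →ₗ[k] V) (f : V → V → V)
    (F : Homology gr D →ₗ[k] Homology gr D →ₗ[k] Homology gr D) : Prop :=
  ∀ z z' : cyc gr D, ∃ h : f z z' ∈ cyc gr D,
    F (cls gr D z) (cls gr D z') = cls gr D ⟨f z z', h⟩

/-- Tensor products of cycles, as elements of `V ⊗ V`. -/
def cycTwo (gr : ℤ → Submodule k V) (D : V →ₗ[k] V) :
    ↥(cyc gr D) ⊗[k] ↥(cyc gr D) →ₗ[k] V ⊗[k] V :=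
  TensorProduct.map (cyc gr D).subtype (cyc gr D).subtype

/-- Tensor products of cycles, as elements of `H ⊗ H`. -/
def clsTwo (gr : ℤ → Submodule k V) (D : V →ₗ[k] V) :
    ↥(cyc gr D) ⊗[k] ↥(cyc gr D) →ₗ[k] Homology gr D ⊗[k] Homology gr D :=
  TensorProduct.map (cls gr D) (cls gr D)

/-- `F : H → H ⊗ H` is induced by `f : V → V ⊗ V`: for a cycle `z`, `F [z]` is carried to the
class of `f z` by the Künneth map `[x] ⊗ [y] ↦ [x ⊗ y]`. -/
def InducesComul (gr : ℤ → Submodule k V) (D : V →ₗ[k] V) (f : V →ₗ[k] V ⊗[k] V)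
    (F : Homology gr D →ₗ[k] Homology gr D ⊗[k] Homology gr D) : Prop :=
  ∀ z : cyc gr D, ∃ c : ↥(cyc gr D) ⊗[k] ↥(cyc gr D),
    F (cls gr D z) = clsTwo gr D c ∧
      f z - cycTwo gr D c ∈ LinearMap.range (tensorOdd gr D D)

/-- The Künneth maps `H ⊗ H → H(V ⊗ V)` and `H ⊗ (H ⊗ H) → H(V ⊗ (V ⊗ V))` are bijective. -/
def KunnethIso (gr : ℤ → Submodule k V) (D : V →ₗ[k] V) : Prop :=
  ((∀ t ∈ LinearMap.ker (tensorOdd gr D D),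
      ∃ c, t - cycTwo gr D c ∈ LinearMap.range (tensorOdd gr D D)) ∧
    (∀ c, cycTwo gr D c ∈ LinearMap.range (tensorOdd gr D D) → clsTwo gr D c = 0)) ∧
  ((∀ t ∈ LinearMap.ker (tensorOdd gr D (tensorOdd gr D D)),
      ∃ c, t - TensorProduct.map (cyc gr D).subtype (cycTwo gr D) c ∈
        LinearMap.range (tensorOdd gr D (tensorOdd gr D D))) ∧
    (∀ c, TensorProduct.map (cyc gr D).subtype (cycTwo gr D) c ∈
        LinearMap.range (tensorOdd gr D (tensorOdd gr D D)) →
      TensorProduct.map (cls gr D) (clsTwo gr D) c = 0))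

/-- `f` and `g`, both of degree `e`, are chain homotopic:
`f - g = D' H + (-1)^e H D` with `H` of degree `e - 1`. -/
def ChainHomotopic (e : ℤ) (gr : ℤ → Submodule k V) (D : V →ₗ[k] V) (gr' : ℤ → Submodule k W)
    (D' : W →ₗ[k] W) (f g : V →ₗ[k] W) : Prop :=
  ∃ H : V →ₗ[k] W, (∀ i, ∀ v ∈ gr i, H v ∈ gr' (i + e - 1)) ∧
    f - g = D' ∘ₗ H + ksign k (e : ZMod 2) • (H ∘ₗ D)

end Homology

/-! ## BV-algebras, coBV-coalgebras, homotopy coBV-algebras -/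

section BV

variable {k : Type u} [CommRing k]
variable {V : Type v} [AddCommGroup V] [Module k V]

/-- A (not necessarily unital) BV-algebra: a graded commutative associative algebra with an
operator `Δ` of degree `-1` such that `Δ² = 0` and the seven-term relation holds. -/
structure IsBV (gr : ℤ → Submodule k V) (mul : V →ₗ[k] V →ₗ[k] V) (Δ : V →ₗ[k] V) : Prop where
  internal : DirectSum.IsInternal gr
  mul_mem : ∀ i j, ∀ a ∈ gr i, ∀ b ∈ gr j, mul a b ∈ gr (i + j)
  mul_assoc : ∀ a b c, mul (mul a b) c = mul a (mul b c)
  mul_comm : ∀ i j, ∀ a ∈ gr i, ∀ b ∈ gr j,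
    mul a b = ksign k ((i : ZMod 2) * (j : ZMod 2)) • mul b a
  op_mem : ∀ i, ∀ a ∈ gr i, Δ a ∈ gr (i - 1)
  op_op : ∀ a, Δ (Δ a) = 0
  seven_term : ∀ i j l, ∀ a ∈ gr i, ∀ b ∈ gr j, ∀ c ∈ gr l,
    Δ (mul (mul a b) c) =
      mul (Δ (mul a b)) c + ksign k (i : ZMod 2) • mul a (Δ (mul b c))
        + ksign k (((i - 1) * j : ℤ) : ZMod 2) • mul b (Δ (mul a c))
        - mul (mul (Δ a) b) c - ksign k (i : ZMod 2) • mul (mul a (Δ b)) c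
        - ksign k ((i + j : ℤ) : ZMod 2) • mul (mul a b) (Δ c)

/-- The bracket `(-1)^{|a|} Δ(ab) - (-1)^{|a|} Δ(a) b - a Δ(b)` of a BV-algebra, for `a` of
degree `i`. -/
def bvBracket (mul : V →ₗ[k] V →ₗ[k] V) (Δ : V →ₗ[k] V) (i : ℤ) (a b : V) : V :=
  ksign k (i : ZMod 2) • Δ (mul a b) - ksign k (i : ZMod 2) • mul (Δ a) b - mul a (Δ b)

/-- The left-hand side `θ³ ∘ B` of the seven-term coBV relation, `θ³ = (1 ⊗ θ) θ`. -/
def coSevenLeft (θ : V →ₗ[k] V ⊗[k] V) (B : V →ₗ[k] V) : V →ₗ[k] V ⊗[k] (V ⊗[k] V) :=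
  TensorProduct.map LinearMap.id θ ∘ₗ θ ∘ₗ B

/-- The right-hand side of the seven-term coBV relation (the transpose of the seven-term
relation of a BV-algebra):
`(θB ⊗ 1) θ + (1 ⊗ θB) θ + (τ ⊗ 1)(1 ⊗ θB) θ - (B ⊗ 1 ⊗ 1 + 1 ⊗ B ⊗ 1 + 1 ⊗ 1 ⊗ B) θ³`,
where `τ` is the Koszul flip. -/
def coSevenRight (gr : ℤ → Submodule k V) (θ : V →ₗ[k] V ⊗[k] V) (B : V →ₗ[k] V) :
    V →ₗ[k] V ⊗[k] (V ⊗[k] V) :=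
  (TensorProduct.assoc k V V V : _ →ₗ[k] _) ∘ₗ TensorProduct.map (θ ∘ₗ B) LinearMap.id ∘ₗ θ
    + TensorProduct.map (sg gr 1) (θ ∘ₗ B) ∘ₗ θ
    + (TensorProduct.assoc k V V V : _ →ₗ[k] _) ∘ₗ
        TensorProduct.map (kswap gr gr) LinearMap.id ∘ₗ
        ((TensorProduct.assoc k V V V).symm : V ⊗[k] (V ⊗[k] V) →ₗ[k] (V ⊗[k] V) ⊗[k] V) ∘ₗ
        TensorProduct.map (sg gr 1) (θ ∘ₗ B) ∘ₗ θ
    - tensorOdd gr B (tensorOdd gr B B) ∘ₗ TensorProduct.map LinearMap.id θ ∘ₗ θ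

/-- A (not necessarily counital) coBV-coalgebra: a graded cocommutative coassociative coalgebra
with an operator `B` of degree `-1` such that `B² = 0` and the seven-term coBV relation holds. -/
structure IsCoBV (gr : ℤ → Submodule k V) (θ : V →ₗ[k] V ⊗[k] V) (B : V →ₗ[k] V) : Prop where
  internal : DirectSum.IsInternal gr
  comul_mem : ∀ i, ∀ a ∈ gr i, θ a ∈ tensorGr gr gr i
  coassoc : (TensorProduct.assoc k V V V : _ →ₗ[k] _) ∘ₗ TensorProduct.map θ LinearMap.id ∘ₗ θ =
    TensorProduct.map LinearMap.id θ ∘ₗ θ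
  cocomm : kswap gr gr ∘ₗ θ = θ
  op_mem : ∀ i, ∀ a ∈ gr i, B a ∈ gr (i - 1)
  op_op : B ∘ₗ B = 0
  seven_term : coSevenLeft θ B = coSevenRight gr θ B

/-- A homotopy coBV-algebra: a coassociative differential graded coalgebra with an operator `B`
of degree `-1`, `B² = 0`, anticommuting with the differential, such that cocommutativity and the
seven-term coBV relation hold up to chain homotopy. -/
structure IsHomotopyCoBV (gr : ℤ → Submodule k V) (D : V →ₗ[k] V) (θ : V →ₗ[k] V ⊗[k] V)
    (B : V →ₗ[k] V) : Prop where
  internal : DirectSum.IsInternal gr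
  diff_mem : ∀ i, ∀ a ∈ gr i, D a ∈ gr (i + 1)
  diff_diff : D ∘ₗ D = 0
  comul_mem : ∀ i, ∀ a ∈ gr i, θ a ∈ tensorGr gr gr i
  comul_diff : θ ∘ₗ D = tensorOdd gr D D ∘ₗ θ
  coassoc : (TensorProduct.assoc k V V V : _ →ₗ[k] _) ∘ₗ TensorProduct.map θ LinearMap.id ∘ₗ θ =
    TensorProduct.map LinearMap.id θ ∘ₗ θ
  op_mem : ∀ i, ∀ a ∈ gr i, B a ∈ gr (i - 1)
  op_op : B ∘ₗ B = 0
  op_diff : B ∘ₗ D + D ∘ₗ B = 0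
  cocomm : ChainHomotopic 0 gr D (tensorGr gr gr) (tensorOdd gr D D) (kswap gr gr ∘ₗ θ) θ
  seven_term : ChainHomotopic (-1) gr D (tensorGr gr (tensorGr gr gr))
    (tensorOdd gr D (tensorOdd gr D D)) (coSevenLeft θ B) (coSevenRight gr θ B)

end BV

/-! ## Linear recursion on the tensor algebra -/

section Fold

variable {k : Type u} [CommRing k]
variable {U : Type v} [AddCommGroup U] [Module k U]
variable {M : Type w} [AddCommGroup M] [Module k M]

/-- One step of the recursion: `a` acts by `(t, x) ↦ (a t, G a t + H a x)`. -/
def foldStep (G : U →ₗ[k] TensorAlgebra k U →ₗ[k] M) (H : U →ₗ[k] M →ₗ[k] M) :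
    U →ₗ[k] Module.End k (TensorAlgebra k U × M) where
  toFun a := LinearMap.prod
    (LinearMap.mulLeft k (TensorAlgebra.ι k a) ∘ₗ LinearMap.fst k _ _)
    (G a ∘ₗ LinearMap.fst k _ _ + H a ∘ₗ LinearMap.snd k _ _)
  map_add' a b := by
    ext p <;> simp [add_mul]
  map_smul' c a := by
    ext p <;> simp

/-- The linear map `f : T(U) → M` with `f 1 = m₀` and `f (a t) = G a t + H a (f t)` for `a : U`. -/
def foldT (G : U →ₗ[k] TensorAlgebra k U →ₗ[k] M) (H : U →ₗ[k] M →ₗ[k] M) (m₀ : M) :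
    TensorAlgebra k U →ₗ[k] M :=
  LinearMap.snd k _ _ ∘ₗ LinearMap.applyₗ ((1, m₀) : TensorAlgebra k U × M) ∘ₗ
    (TensorAlgebra.lift k (foldStep G H)).toLinearMap

theorem foldT_one (G : U →ₗ[k] TensorAlgebra k U →ₗ[k] M) (H : U →ₗ[k] M →ₗ[k] M) (m₀ : M) :
    foldT G H m₀ 1 = m₀ := by
  simp [foldT]

theorem foldT_aux (G : U →ₗ[k] TensorAlgebra k U →ₗ[k] M) (H : U →ₗ[k] M →ₗ[k] M)
    (t s : TensorAlgebra k U) (m : M) :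
    (TensorAlgebra.lift k (foldStep G H) t (s, m)).1 = t * s := by
  induction t using TensorAlgebra.induction generalizing s m with
  | algebraMap r => simp [Algebra.smul_def]
  | ι a => simp [foldStep]
  | mul a b ha hb =>
    rw [map_mul, Module.End.mul_apply]
    have hs := hb s m
    generalize TensorAlgebra.lift k (foldStep G H) b (s, m) = p at hs
    obtain ⟨s', m'⟩ := p
    simp only at hs
    rw [ha, hs, mul_assoc]
  | add a b ha hb => simp [ha, hb, add_mul]

theorem foldT_ι_mul (G : U →ₗ[k] TensorAlgebra k U →ₗ[k] M) (H : U →ₗ[k] M →ₗ[k] M) (m₀ : M)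
    (a : U) (t : TensorAlgebra k U) :
    foldT G H m₀ (TensorAlgebra.ι k a * t) = G a t + H a (foldT G H m₀ t) := by
  have h := foldT_aux G H t 1 m₀
  rw [mul_one] at h
  have e : TensorAlgebra.lift k (foldStep G H) (TensorAlgebra.ι k a * t) =
      foldStep G H a * TensorAlgebra.lift k (foldStep G H) t := by
    rw [map_mul, TensorAlgebra.lift_ι_apply]
  change (TensorAlgebra.lift k (foldStep G H) (TensorAlgebra.ι k a * t) (1, m₀)).2 = _
  rw [e]
  change G a (TensorAlgebra.lift k (foldStep G H) t (1, m₀)).1 + _ = _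
  rw [h]
  rfl

end Fold

/-! ## Augmented differential graded algebras and the normalized Hochschild complex -/

/-- A positively graded augmented unital differential graded associative algebra structure on
`A`, with differential of degree `+1`. -/
structure DGAug (k : Type u) (A : Type v) [CommRing k] [Ring A] [Algebra k A] where
  /-- the homogeneous components -/
  gr : ℤ → Submodule k A
  /-- the differential -/
  d : A →ₗ[k] A
  /-- the augmentation -/
  ε : A →ₐ[k] k
  gr_neg : ∀ i, i < 0 → gr i = ⊥
  internal : DirectSum.IsInternal gr
  one_mem : (1 : A) ∈ gr 0
  mul_mem : ∀ i j, ∀ a ∈ gr i, ∀ b ∈ gr j, a * b ∈ gr (i + j)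
  d_mem : ∀ i, ∀ a ∈ gr i, d a ∈ gr (i + 1)
  d_d : ∀ a, d (d a) = 0
  leibniz : ∀ i, ∀ a ∈ gr i, ∀ b, d (a * b) = d a * b + ksign k (i : ZMod 2) • (a * d b)
  ε_gr : ∀ i, i ≠ 0 → ∀ a ∈ gr i, ε a = 0
  ε_d : ∀ a, ε (d a) = 0

namespace DGAug

variable {k : Type u} {A : Type v} [CommRing k] [Ring A] [Algebra k A] (S : DGAug k A)

/-- The augmentation ideal `Ā = ker ε`, as a `k`-module. -/
abbrev bar : Submodule k A := LinearMap.ker S.ε.toLinearMap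

/-- The projection `A = k ⊕ Ā → Ā`. -/
def toBar : A →ₗ[k] S.bar :=
  LinearMap.codRestrict S.bar (LinearMap.id - Algebra.linearMap k A ∘ₗ S.ε.toLinearMap)
    (by intro a; simp)

/-- The grading of the suspension `s Ā`: `s a` has degree `|a| - 1`. -/
def sgr (i : ℤ) : Submodule k S.bar := (S.gr (i + 1)).comap S.bar.subtype

/-- The tensor algebra `T(s Ā)`; the word `[a₁, …, aₙ]` is the product of the letters. -/
abbrev T : Type (max u v) := TensorAlgebra k S.bar

/-- Words in homogeneous letters, with their degree `∑ (|aᵢ| - 1)`. -/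
inductive IsWord : ℤ → S.T → Prop
  | nil : IsWord 0 1
  | cons (i j : ℤ) (a : S.bar) (t : S.T) : a ∈ S.sgr i → IsWord j t →
      IsWord (i + j) (TensorAlgebra.ι k a * t)

/-- The grading of `T(s Ā)`. -/
def tgr (i : ℤ) : Submodule k S.T := Submodule.span k {t | S.IsWord i t}

/-- The normalized Hochschild chains `C_*(A, A) = A ⊗ T(s Ā)`; `a₀ ⊗ [a₁, …, aₙ]` is
`a₀[a₁, …, aₙ]`. -/
abbrev C : Type (max u v) := A ⊗[k] S.T

/-- The grading of `C_*(A, A)`: `a₀[a₁, …, aₙ]` has degree `|a₀| + ∑ |aᵢ| - n`. -/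
def cgr : ℤ → Submodule k S.C := tensorGr S.gr S.tgr

/-- The product of two letters, projected to `Ā` (where it already lies). -/
def barMul : S.bar →ₗ[k] S.bar →ₗ[k] S.bar :=
  ((LinearMap.mul k A).compl₁₂ S.bar.subtype S.bar.subtype).compr₂ S.toBar

/-- Left multiplication by a letter. -/
def consL : S.bar →ₗ[k] S.T →ₗ[k] S.T := LinearMap.mul k S.T ∘ₗ TensorAlgebra.ι k

/-- Deconcatenation `[a₁, …, aₙ] ↦ ∑ᵢ [a₁, …, aᵢ] ⊗ [aᵢ₊₁, …, aₙ]`. -/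
def cut : S.T →ₗ[k] S.T ⊗[k] S.T :=
  foldT ((LinearMap.compRight k (TensorProduct.mk k S.T S.T 1)) ∘ₗ S.consL)
    (LinearMap.rTensorHom S.T ∘ₗ S.consL) (1 ⊗ₜ 1)

/-- Split off the first letter: `[a₁, …, aₙ] ↦ a₁ ⊗ [a₂, …, aₙ]`, and `[] ↦ 0`. -/
def popL : S.T →ₗ[k] S.bar ⊗[k] S.T :=
  foldT (M := S.bar ⊗[k] S.T) (TensorProduct.mk k S.bar S.T) 0 0

/-- Split off the last letter: `[a₁, …, aₙ] ↦ [a₁, …, aₙ₋₁] ⊗ aₙ`, and `[] ↦ 0`. -/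
def popR : S.T →ₗ[k] S.T ⊗[k] S.bar :=
  foldT (M := S.T ⊗[k] S.bar)
    { toFun := fun a => LinearMap.toSpanSingleton k (S.T ⊗[k] S.bar) (1 ⊗ₜ a) ∘ₗ
        TensorAlgebra.algebraMapInv.toLinearMap
      map_add' := by intro a b; ext t; simp [TensorProduct.tmul_add]
      map_smul' := by
        intro c a
        ext t
        simp only [LinearMap.comp_apply, LinearMap.toSpanSingleton_apply,
          TensorProduct.tmul_smul, RingHom.id_apply, LinearMap.smul_apply]
        exact smul_comm _ _ _ }
    (LinearMap.rTensorHom S.bar ∘ₗ S.consL) 0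

/-- Multiply a letter into the first letter of a word:
`a, [a₁, …, aₙ] ↦ [a a₁, a₂, …, aₙ]`, and `a, [] ↦ 0`. -/
def merge : S.bar →ₗ[k] S.T →ₗ[k] S.T where
  toFun a := TensorProduct.lift (S.consL ∘ₗ S.barMul a) ∘ₗ S.popL
  map_add' := by
    intro a b
    rw [← LinearMap.add_comp, LinearMap.map_add S.barMul a b, LinearMap.comp_add]
    congr 1
    ext; simp
  map_smul' := by
    intro c a
    have h (f : S.bar →ₗ[k] S.T →ₗ[k] S.T) :
        TensorProduct.lift (c • f) = c • TensorProduct.lift f :=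
      TensorProduct.ext' (by intro x y; simp)
    rw [LinearMap.map_smul S.barMul c a, LinearMap.comp_smul, RingHom.id_apply, h,
      LinearMap.smul_comp]

/-- The internal differential of `T(s Ā)`:
`[a₁, …, aₙ] ↦ -∑ᵢ (-1)^{|a₁| + ⋯ + |aᵢ₋₁| - i + 1} [a₁, …, d aᵢ, …, aₙ]`. -/
def dT : S.T →ₗ[k] S.T :=
  foldT (-(S.consL ∘ₗ S.toBar ∘ₗ S.d ∘ₗ S.bar.subtype)) (S.consL ∘ₗ sg S.sgr 1) 0

/-- The bar differential
`[a₁, …, aₙ] ↦ ∑_{i ≥ 2} (-1)^{|a₁| + ⋯ + |aᵢ₋₁| - i + 1} [a₁, …, aᵢ₋₁ aᵢ, …, aₙ]`. -/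
def bT : S.T →ₗ[k] S.T := foldT (S.merge ∘ₗ sg S.sgr 1) (S.consL ∘ₗ sg S.sgr 1) 0

/-- The part `d₀` of the Hochschild differential coming from the differential of `A`. -/
def d₀ : S.C →ₗ[k] S.C :=
  TensorProduct.map S.d LinearMap.id + TensorProduct.map (sg S.gr 1) S.dT

/-- `a₀[a₁, …, aₙ] ↦ (-1)^{|a₀|} a₀ a₁[a₂, …, aₙ]`. -/
def dFirst : S.C →ₗ[k] S.C :=
  TensorProduct.map (LinearMap.mul' k A ∘ₗ TensorProduct.map (sg S.gr 1) S.bar.subtype)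
      LinearMap.id ∘ₗ
    ((TensorProduct.assoc k A S.bar S.T).symm :
      A ⊗[k] (S.bar ⊗[k] S.T) →ₗ[k] (A ⊗[k] S.bar) ⊗[k] S.T) ∘ₗ
    TensorProduct.map LinearMap.id S.popL

/-- `a₀[a₁, …, aₙ] ↦ (-1)^{(|aₙ| - 1) |a₀[a₁, …, aₙ₋₁]|} aₙ a₀[a₁, …, aₙ₋₁]`. -/
def dLast : S.C →ₗ[k] S.C :=
  TensorProduct.map (LinearMap.mul' k A ∘ₗ TensorProduct.map S.bar.subtype LinearMap.id)
      LinearMap.id ∘ₗ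
    ((TensorProduct.assoc k S.bar A S.T).symm :
      S.bar ⊗[k] (A ⊗[k] S.T) →ₗ[k] (S.bar ⊗[k] A) ⊗[k] S.T) ∘ₗ
    kswap S.cgr S.sgr ∘ₗ
    ((TensorProduct.assoc k A S.T S.bar).symm :
      A ⊗[k] (S.T ⊗[k] S.bar) →ₗ[k] (A ⊗[k] S.T) ⊗[k] S.bar) ∘ₗ
    TensorProduct.map LinearMap.id S.popR

/-- The part `d₁` of the Hochschild differential coming from the product of `A`. -/
def d₁ : S.C →ₗ[k] S.C := S.dFirst + TensorProduct.map (sg S.gr 1) S.bT - S.dLast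

/-- The Hochschild differential of `C_*(A, A)`, of degree `+1`. -/
def D : S.C →ₗ[k] S.C := S.d₀ + S.d₁

/-- The Connes operator
`a₀[a₁, …, aₙ] ↦ ∑ᵢ (-1)^{εᵢ} 1[aᵢ, …, aₙ, a₀, …, aᵢ₋₁]`, `1 ≤ i ≤ n + 1`, where
`εᵢ = (|a₀| + ⋯ + |aᵢ₋₁| - i) (|aᵢ| + ⋯ + |aₙ| - n + i - 1)`. -/
def B : S.C →ₗ[k] S.C :=
  TensorProduct.mk k A S.T 1 ∘ₗ LinearMap.mul' k S.T ∘ₗ kswap S.tgr S.tgr ∘ₗ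
    TensorProduct.map (TensorProduct.lift (S.consL ∘ₗ S.toBar)) LinearMap.id ∘ₗ
    ((TensorProduct.assoc k A S.T S.T).symm :
      A ⊗[k] (S.T ⊗[k] S.T) →ₗ[k] (A ⊗[k] S.T) ⊗[k] S.T) ∘ₗ
    TensorProduct.map LinearMap.id S.cut

/-! ### Open and closed Frobenius structures -/

/-- `δ` makes `A` a differential graded open Frobenius algebra of degree `m`. -/
structure IsOpenFrobenius (m : ℤ) (δ : A →ₗ[k] A ⊗[k] A) : Prop where
  comul_mem : ∀ i, ∀ a ∈ S.gr i, δ a ∈ tensorGr S.gr S.gr (i + m)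
  coassoc : (TensorProduct.assoc k A A A : _ →ₗ[k] _) ∘ₗ TensorProduct.map δ LinearMap.id ∘ₗ δ =
    ksign k (m : ZMod 2) • (TensorProduct.map (sg S.gr (m : ZMod 2)) δ ∘ₗ δ)
  comul_diff : δ ∘ₗ S.d = ksign k (m : ZMod 2) • (tensorOdd S.gr S.d S.d ∘ₗ δ)
  comul_mul_left : ∀ i, ∀ x ∈ S.gr i, ∀ y, δ (x * y) =
    ksign k ((m : ZMod 2) * (i : ZMod 2)) •
      TensorProduct.map (LinearMap.mulLeft k x) LinearMap.id (δ y)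
  comul_mul_right : ∀ x y, δ (x * y) =
    TensorProduct.map LinearMap.id (LinearMap.mulRight k y) (δ x)

/-- The open Frobenius algebra is symmetric: `∑ 1' ⊗ 1'' = ∑ (-1)^{|1'||1''| + m} 1'' ⊗ 1'`. -/
def IsSymmetric (m : ℤ) (δ : A →ₗ[k] A ⊗[k] A) : Prop :=
  δ 1 = ksign k (m : ZMod 2) • kswap S.gr S.gr (δ 1)

/-- `form` makes `A` a closed Frobenius algebra of degree `m`: `A` is finitely generated
projective over `k`, and `form` is a graded symmetric inner product of degree `m`, compatible with
the product and the differential, with `x ↦ form x` an isomorphism of `A` onto its dual. For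
symmetric `form` the last three fields say that `x ↦ (y ↦ (-1)^{|x| + m} form x y)` is an
isomorphism of differential graded `A`-bimodules from `A` to its dual. -/
structure IsClosedFrobenius (m : ℤ) (form : A →ₗ[k] A →ₗ[k] k) : Prop where
  finite : Module.Finite k A
  projective : Module.Projective k A
  degree : ∀ i j, i + j ≠ m → ∀ x ∈ S.gr i, ∀ y ∈ S.gr j, form x y = 0
  symmetric : ∀ i j, ∀ x ∈ S.gr i, ∀ y ∈ S.gr j,
    form x y = ksign k ((i : ZMod 2) * (j : ZMod 2)) * form y x
  invariant : ∀ x y z, form (x * y) z = form x (y * z)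
  diff : ∀ i, ∀ x ∈ S.gr i, ∀ y, form (S.d x) y = -(ksign k (i : ZMod 2) * form x (S.d y))
  perfect : Function.Bijective form

/-- The coproduct dual to the product of a closed Frobenius algebra:
`⟨x, a b⟩ = ∑ (-1)^{m|x'|} ⟨x'', a⟩ ⟨x', b⟩`. -/
def IsDualCoproduct (m : ℤ) (form : A →ₗ[k] A →ₗ[k] k) (δ : A →ₗ[k] A ⊗[k] A) : Prop :=
  ∀ x a b, form x (a * b) =
    LinearMap.mul' k k
      (TensorProduct.map (form.flip b ∘ₗ sg S.gr (m : ZMod 2)) (form.flip a) (δ x))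

/-! ### The coproduct on Hochschild chains and the product on the dual -/

/-- The coproduct `θ` of degree `m` on `C_*(A, A)`,
`a₀[a₁, …, aₙ] ↦ ∑ (-1)^{|a₀'| (|a₀''| + |a₁| + ⋯ + |aᵢ| + i)} a₀''[a₁, …, aᵢ] ⊗ a₀'[aᵢ₊₁, …, aₙ]`,
the sum over `0 ≤ i ≤ n` and `δ a₀ = ∑ a₀' ⊗ a₀''`. -/
def theta (δ : A →ₗ[k] A ⊗[k] A) : S.C →ₗ[k] S.C ⊗[k] S.C :=
  (TensorProduct.assoc k S.C A S.T : (S.C ⊗[k] A) ⊗[k] S.T →ₗ[k] S.C ⊗[k] (A ⊗[k] S.T)) ∘ₗ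
    TensorProduct.map (kswap S.gr S.cgr) LinearMap.id ∘ₗ
    ((TensorProduct.assoc k A S.C S.T).symm :
      A ⊗[k] (S.C ⊗[k] S.T) →ₗ[k] (A ⊗[k] S.C) ⊗[k] S.T) ∘ₗ
    TensorProduct.map LinearMap.id ((TensorProduct.assoc k A S.T S.T).symm :
      A ⊗[k] (S.T ⊗[k] S.T) →ₗ[k] (A ⊗[k] S.T) ⊗[k] S.T) ∘ₗ
    (TensorProduct.assoc k A A (S.T ⊗[k] S.T) :
      (A ⊗[k] A) ⊗[k] (S.T ⊗[k] S.T) →ₗ[k] A ⊗[k] (A ⊗[k] (S.T ⊗[k] S.T))) ∘ₗ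
    TensorProduct.map δ S.cut

/-- The grading of `C_*(A, A)[m]`, in which `x` has degree `|x| - m`. -/
def cgrShift (m : ℤ) : ℤ → Submodule k S.C := shiftGr m S.cgr

/-- The coproduct of degree `0` on `C_*(A, A)[m]` corresponding to `θ`: with `s x` denoting `x`
in `C_*(A, A)[m]`, it is `(s ⊗ s) ∘ θ ∘ s⁻¹`, where `(s ⊗ s) (x ⊗ y) = (-1)^{m|x|} s x ⊗ s y`. -/
def thetaShift (m : ℤ) (δ : A →ₗ[k] A ⊗[k] A) : S.C →ₗ[k] S.C ⊗[k] S.C :=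
  TensorProduct.map (sg S.cgr (m : ZMod 2)) LinearMap.id ∘ₗ S.theta δ

/-- The grading of the graded dual of `C_*(A, A)[m]`: a functional supported on chains of
degree `j` in `C_*(A, A)` has degree `m - j`. -/
def dgr (m : ℤ) : ℤ → Submodule k (Module.Dual k S.C) := dualGr (S.cgrShift m)

/-- The differential `φ ↦ (-1)^{|φ|} φ ∘ D` of the graded dual of `C_*(A, A)[m]`. -/
def DDual (m : ℤ) : Module.Dual k S.C →ₗ[k] Module.Dual k S.C := oddDual (S.cgrShift m) S.D

/-- The operator `φ ↦ (-1)^{|φ|} φ ∘ B` on the graded dual of `C_*(A, A)[m]`. -/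
def BDual (m : ℤ) : Module.Dual k S.C →ₗ[k] Module.Dual k S.C := oddDual (S.cgrShift m) S.B

/-- The product `φ ⊙ ψ` of degree `0` on the graded dual of `C_*(A, A)[m]`: if `φ`, `ψ` have
degrees `p`, `q` as functionals on `C_*(A, A)`, it is `(-1)^{m q} (φ ⊗ ψ) ∘ θ`, where
`(φ ⊗ ψ) (x ⊗ y) = (-1)^{q |x|} φ(x) ψ(y)`; that is, `(-1)^{m p}` times the transpose
`(-1)^{m (p + q)} (φ ⊗ ψ) ∘ θ` of `θ`. -/
def odot (m : ℤ) (δ : A →ₗ[k] A ⊗[k] A) (φ ψ : Module.Dual k S.C) : Module.Dual k S.C :=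
  LinearMap.mul' k k ∘ₗ TensorProduct.map φ (ψ ∘ₗ sg S.cgr (m : ZMod 2)) ∘ₗ
    ksgn S.cgr S.cgr ∘ₗ S.theta δ

/-! ### Hochschild cochains with values in `A` -/

/-- Cochains of degree `i`: linear maps `T(s Ā) → A` of degree `i`. -/
def cochGr (i : ℤ) : Submodule k (S.T →ₗ[k] A) where
  carrier := {f | ∀ j, ∀ t ∈ S.tgr j, f t ∈ S.gr (j + i)}
  add_mem' := by
    intro f g hf hg j t ht
    exact Submodule.add_mem _ (hf j t ht) (hg j t ht)
  zero_mem' := by intro j t _; simp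
  smul_mem' := by
    intro c f hf j t ht
    exact Submodule.smul_mem _ c (hf j t ht)

/-- `f ↦ (-1)^{e|f|} f`. -/
def tw (e : ZMod 2) : (S.T →ₗ[k] A) →ₗ[k] (S.T →ₗ[k] A) :=
  LinearMap.lcomp k A (sg S.tgr e) ∘ₗ LinearMap.llcomp k S.T A A (sg S.gr e)

/-- The Hochschild differential of `C^*(A, A) = Hom_k(T(s Ā), A)`. With `|f|` the degree of `f`,
`(D f)[a₁, …, aₙ]` is the sum of
* `d (f[a₁, …, aₙ]) + ∑_{i ≥ 1} (-1)^{εᵢ} f[a₁, …, d aᵢ, …, aₙ]`,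
* `-(-1)^{(|a₁| + 1)|f|} a₁ f[a₂, …, aₙ]`,
* `-∑_{i ≥ 2} (-1)^{εᵢ} f[a₁, …, aᵢ₋₁ aᵢ, …, aₙ]`,
* `(-1)^{εₙ} f[a₁, …, aₙ₋₁] aₙ`,

where `εᵢ = |f| + |a₁| + ⋯ + |aᵢ₋₁| - i + 1`. -/
def DCoch : (S.T →ₗ[k] A) →ₗ[k] (S.T →ₗ[k] A) where
  toFun f :=
    S.d ∘ₗ f - S.tw 1 f ∘ₗ S.dT
      - ∑ e : ZMod 2, LinearMap.mul' k A ∘ₗ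
          TensorProduct.map (S.bar.subtype ∘ₗ par S.sgr e) (S.tw e f) ∘ₗ S.popL
      - S.tw 1 f ∘ₗ S.bT
      + LinearMap.mul' k A ∘ₗ TensorProduct.map (sg S.gr 1 ∘ₗ f) S.bar.subtype ∘ₗ S.popR
  map_add' f g := by
    simp only [map_add, LinearMap.comp_add, LinearMap.add_comp, TensorProduct.map_add_left,
      TensorProduct.map_add_right, Finset.sum_add_distrib]
    abel
  map_smul' c f := by
    simp only [map_smul, LinearMap.comp_smul, LinearMap.smul_comp, TensorProduct.map_smul_left,
      TensorProduct.map_smul_right, ← Finset.smul_sum, RingHom.id_apply, smul_sub, smul_add]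

/-- The cup product
`(f ∪ g)[a₁, …, aₙ] = ∑ᵢ (-1)^{|g| (|a₁| + ⋯ + |aᵢ| - i)} f[a₁, …, aᵢ] g[aᵢ₊₁, …, aₙ]`. -/
def cup (f g : S.T →ₗ[k] A) : S.T →ₗ[k] A :=
  ∑ e : ZMod 2, LinearMap.mul' k A ∘ₗ TensorProduct.map (f ∘ₗ par S.tgr e) (S.tw e g) ∘ₗ S.cut

/-- The operation on `T(s Ā)` given by
`[a₁, …, aₙ] ↦ ∑ (-1)^{(|g| + 1)(|a₁| + ⋯ + |aᵢ| - i)} [a₁, …, aᵢ, g[aᵢ₊₁, …, aⱼ], aⱼ₊₁, …, aₙ]`,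
the sum over `0 ≤ i ≤ j ≤ n`. -/
def insertion (g : S.T →ₗ[k] A) : S.T →ₗ[k] S.T :=
  ∑ e : ZMod 2, LinearMap.mul' k S.T ∘ₗ
    TensorProduct.map (par S.tgr e)
      (ksign k e • (TensorProduct.lift S.consL ∘ₗ
        TensorProduct.map (S.toBar ∘ₗ S.tw e g) LinearMap.id ∘ₗ S.cut)) ∘ₗ S.cut

/-- The Gerstenhaber bracket `f ∘ g - (-1)^{(i + 1)(j + 1)} g ∘ f` of cochains of degrees `i` and
`j`, where `(f ∘ g)[a₁, …, aₙ] = ∑ ± f[a₁, …, aᵢ, g[aᵢ₊₁, …, aⱼ], aⱼ₊₁, …, aₙ]`. -/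
def gerstenhaber (i j : ℤ) (f g : S.T →ₗ[k] A) : S.T →ₗ[k] A :=
  f ∘ₗ S.insertion g - ksign k (((i + 1) * (j + 1) : ℤ) : ZMod 2) • (g ∘ₗ S.insertion f)

/-- The identification of `C^*(A, A)` with the dual of `C_*(A, A)[m]` for a closed Frobenius
algebra: `f~(a₀[a₁, …, aₙ]) = (-1)^{(|a₀| + 1)|f|} ⟨a₀, f[a₁, …, aₙ]⟩`. -/
def tilde (form : A →ₗ[k] A →ₗ[k] k) : (S.T →ₗ[k] A) →ₗ[k] Module.Dual k S.C where
  toFun f := ∑ e : ZMod 2,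
    TensorProduct.lift (form.compl₁₂ (par S.gr e) (S.tw (e + 1) f))
  map_add' f g := by
    rw [← Finset.sum_add_distrib]
    refine Finset.sum_congr rfl fun e _ => TensorProduct.ext' fun a t => ?_
    simp
  map_smul' c f := by
    rw [RingHom.id_apply, Finset.smul_sum]
    refine Finset.sum_congr rfl fun e _ => TensorProduct.ext' fun a t => ?_
    simp

end DGAug

end OpenFrobenius

end

open scoped TensorProduct
noncomputable section
set_option linter.unusedSectionVars false
namespace OpenFrobenius
universe u v w x
open TensorProduct (map assoc map_comp map_tmul smul_tmul' ext' lift add_tmul map_add_left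
  map_add_right tmul_add zero_tmul map_smul_left map_zero_left tmul_zero assoc_tmul sub_tmul
  map_smul_right map_zero_right tmul_smul assoc_symm_tmul ext_threefold sum_tmul map_id neg_tmul lid
  mk)
open LinearMap (comp_apply comp_assoc id_apply comp_add add_comp smul_comp comp_id flip_apply mul'
  id_comp comp_smul mem_ker comp_sub mulLeft ker mulRight codRestrict mul'_apply comp_zero mk₂
  eqLocus mulLeft_apply sub_comp proj applyₗ congr_fun)
open DirectSum (IsInternal)
open Submodule (smul_mem mem_iSup_of_mem mem_comap)
open Module (Dual)

section Ksign
variable (k : Type u) [CommRing k]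

@[simp] lemma ksign_zero : ksign k 0 = 1 := by simp [ksign]

lemma ksign_one : ksign k 1 = -1 := by simp [ksign]

lemma ksign_add (a b : ZMod 2) : ksign k (a + b) = ksign k a * ksign k b := by
  have h : ∀ c : ZMod 2, c = 0 ∨ c = 1 := by decide
  have h2 : (1 + 1 : ZMod 2) = 0 := by decide
  rcases h a with rfl | rfl <;> rcases h b with rfl | rfl <;> simp [ksign, h2]

lemma ksign_mul_self (a : ZMod 2) : ksign k a * ksign k a = 1 := by
  rw [← ksign_add, CharTwo.add_self_eq_zero, ksign_zero]

lemma ksign_succ (a : ZMod 2) : ksign k (a + 1) = -ksign k a := by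
  rw [ksign_add, ksign_one, mul_neg_one]

lemma icast_sq (n : ℤ) : (n : ZMod 2) = n * n := by
  generalize (n : ZMod 2) = a
  revert a; decide

variable {k} {M : Type v} [AddCommGroup M] [Module k M]

lemma ksign_smul_smul (a b : ZMod 2) (x : M) : ksign k a • ksign k b • x = ksign k (a + b) • x := by
  rw [smul_smul, ksign_add]

lemma ksign_smul_self (a : ZMod 2) (x : M) : ksign k a • ksign k a • x = x := by
  rw [smul_smul, ksign_mul_self, one_smul]

lemma neg_ksign_smul (a : ZMod 2) (x : M) : -(ksign k a • x) = ksign k (a + 1) • x := by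
  rw [ksign_succ, neg_smul]

lemma ksign_congr {a b : ZMod 2} (h : a = b) (x : M) : ksign k a • x = ksign k b • x := by
  rw [h]

lemma ksign_mem {N : Submodule k M} {a : ZMod 2} {x : M} (h : x ∈ N) : ksign k a • x ∈ N := N.smul_mem _ h

end Ksign

section Graded
variable {k : Type u} [CommRing k]
variable {V : Type v} [AddCommGroup V] [Module k V]
variable {W : Type w} [AddCommGroup W] [Module k W]
variable {X : Type x} [AddCommMonoid X] [Module k X]
variable {gr : ℤ → Submodule k V} {gr' : ℤ → Submodule k W}

/-- The linear map on `V = ⨁ i, gr i` with given restrictions to the `gr i`. -/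
def extend (h : IsInternal gr) (f : ∀ i, gr i →ₗ[k] X) : V →ₗ[k] X := DirectSum.toModule k ℤ X f ∘ₗ
    ((LinearEquiv.ofBijective (DirectSum.coeLinearMap gr)
      (show Function.Bijective (DirectSum.coeLinearMap gr) from h)).symm : V →ₗ[k] _)

lemma extend_of_mem (h : IsInternal gr) (f : ∀ i, gr i →ₗ[k] X) {i : ℤ} {v : V}
    (hv : v ∈ gr i) : extend h f v = f i ⟨v, hv⟩ := by
  have hs : (LinearEquiv.ofBijective (DirectSum.coeLinearMap gr)
      (show Function.Bijective (DirectSum.coeLinearMap gr) from h)).symm v =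
      DirectSum.lof k ℤ (fun i => gr i) i ⟨v, hv⟩ := by
    rw [LinearEquiv.symm_apply_eq]
    simp
  simp only [extend, comp_apply, LinearEquiv.coe_coe, hs, DirectSum.toModule_lof]

/-- The projection to the component of degree `i`. -/
def prj (h : IsInternal gr) (i : ℤ) : V →ₗ[k] V := extend h fun j => if j = i then (gr j).subtype else 0

lemma prj_of_mem (h : IsInternal gr) (i : ℤ) {j : ℤ} {v : V} (hv : v ∈ gr j) : prj h i v = if j = i then v else 0 := by
  rw [prj, extend_of_mem h _ hv]
  split <;> simp

lemma homog_induction (h : IsInternal gr) {p : V → Prop} (v : V)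
    (hg : ∀ i, ∀ v ∈ gr i, p v) (h0 : p 0) (ha : ∀ v w, p v → p w → p (v + w)) : p v := by
  have hv : v ∈ ⨆ i, gr i := by rw [h.submodule_iSup_eq_top]; trivial
  exact Submodule.iSup_induction gr (motive := p) hv hg h0 ha

lemma homog_ext (h : IsInternal gr) {f g : V →ₗ[k] X} (hfg : ∀ i, ∀ v ∈ gr i, f v = g v) : f = g := by
  ext v
  refine homog_induction h v hfg (by simp) ?_
  intro v w hv hw
  rw [map_add, map_add, hv, hw]

lemma prj_mem (h : IsInternal gr) (i : ℤ) (v : V) : prj h i v ∈ gr i := by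
  refine homog_induction h (p := fun v => prj h i v ∈ gr i) v ?_ (by simp) ?_
  · intro j v hv
    rw [prj_of_mem h i hv]
    split
    · next e => exact e ▸ hv
    · exact zero_mem _
  · intro v w hv hw
    rw [map_add]; exact add_mem hv hw

lemma prj_self (h : IsInternal gr) {i : ℤ} {v : V} (hv : v ∈ gr i) : prj h i v = v := by
  rw [prj_of_mem h i hv, if_pos rfl]

lemma internal_of_section (p : V →ₗ[k] DirectSum ℤ fun i => gr i) (hp : ∀ v, DirectSum.coeLinearMap gr (p v) = v)
    (hl : ∀ i, ∀ v (hv : v ∈ gr i), p v = DirectSum.lof k ℤ (fun i => gr i) i ⟨v, hv⟩) :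
    IsInternal gr := by
  have e : p ∘ₗ DirectSum.coeLinearMap gr = .id := by
    refine DirectSum.linearMap_ext k fun i => ?_
    ext1 v
    simp only [comp_apply, DirectSum.coeLinearMap_lof, id_apply]
    exact hl i v v.2
  exact ⟨fun a b hab => by
    have := congrArg p hab
    exact (congr_fun e a).symm.trans (this.trans (congr_fun e b)), fun v => ⟨p v, hp v⟩⟩

lemma sg_of_mem (h : IsInternal gr) (e : ZMod 2) {i : ℤ} {v : V} (hv : v ∈ gr i) :
    sg gr e v = ksign k ((i : ZMod 2) * e) • v := by
  simp only [sg, LinearMap.sum_apply, LinearMap.smul_apply, par_of_mem gr h _ i v hv]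
  rw [Finset.sum_eq_single (i : ZMod 2)]
  · simp
  · intro b _ hb
    rw [if_neg (fun h => hb h.symm), smul_zero]
  · simp

lemma sg_mem (h : IsInternal gr) (e : ZMod 2) {i : ℤ} {v : V} (hv : v ∈ gr i) : sg gr e v ∈ gr i := by
  rw [sg_of_mem h e hv]; exact ksign_mem hv

lemma sg_sg (h : IsInternal gr) (e : ZMod 2) (v : V) : sg gr e (sg gr e v) = v := by
  have : sg gr e ∘ₗ sg gr e = .id := by
    refine homog_ext h fun i v hv => ?_
    rw [comp_apply, sg_of_mem h e hv, map_smul, sg_of_mem h e hv, ksign_smul_self]; rfl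
  exact congr_fun this v

lemma sg_odd (h : IsInternal gr) (h' : IsInternal gr') (e : ℤ)
    (he : (e : ZMod 2) = 1) (f : V →ₗ[k] W) (hf : ∀ i, ∀ v ∈ gr i, f v ∈ gr' (i + e)) (v : V) :
    sg gr' 1 (f v) = -f (sg gr 1 v) := by
  have : sg gr' 1 ∘ₗ f = -(f ∘ₗ sg gr 1) := by
    refine homog_ext h fun j v hv => ?_
    rw [comp_apply, sg_of_mem h' 1 (hf j v hv), LinearMap.neg_apply,
      comp_apply, sg_of_mem h 1 hv, map_smul, neg_ksign_smul]
    push_cast [he]; simp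
  exact congr_fun this v

lemma sg_even (h : IsInternal gr) (h' : IsInternal gr') (e : ℤ)
    (he : (e : ZMod 2) = 0) (f : V →ₗ[k] W) (hf : ∀ i, ∀ v ∈ gr i, f v ∈ gr' (i + e)) (v : V) :
    sg gr' 1 (f v) = f (sg gr 1 v) := by
  have : sg gr' 1 ∘ₗ f = f ∘ₗ sg gr 1 := by
    refine homog_ext h fun j v hv => ?_
    rw [comp_apply, sg_of_mem h' 1 (hf j v hv), comp_apply, sg_of_mem h 1 hv, map_smul]
    push_cast [he]; simp
  exact congr_fun this v

lemma ksgn_of_mem (h : IsInternal gr) (h' : IsInternal gr') {i j : ℤ}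
    {v : V} {w : W} (hv : v ∈ gr i) (hw : w ∈ gr' j) :
    ksgn gr gr' (v ⊗ₜ w) = ksign k ((i : ZMod 2) * j) • (v ⊗ₜ[k] w) := by
  simp only [ksgn, LinearMap.sum_apply, LinearMap.smul_apply, map_tmul,
    par_of_mem gr h _ i v hv, par_of_mem gr' h' _ j w hw]
  rw [Finset.sum_eq_single (i : ZMod 2)]
  · rw [Finset.sum_eq_single (j : ZMod 2)]
    · simp
    · intro b _ hb
      rw [if_neg (fun h : (j : ZMod 2) = b => hb h.symm), tmul_zero, smul_zero]
    · simp
  · intro b _ hb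
    refine Finset.sum_eq_zero fun c _ => ?_
    rw [if_neg (fun h : (i : ZMod 2) = b => hb h.symm), zero_tmul, smul_zero]
  · simp

lemma kswap_of_mem (h : IsInternal gr) (h' : IsInternal gr') {i j : ℤ}
    {v : V} {w : W} (hv : v ∈ gr i) (hw : w ∈ gr' j) :
    kswap gr gr' (v ⊗ₜ w) = ksign k ((i : ZMod 2) * j) • (w ⊗ₜ[k] v) := by
  rw [kswap, comp_apply, ksgn_of_mem h h' hv hw, map_smul]; rfl

lemma tmul_mem_tensorGr {i j n : ℤ} {v : V} {w : W} (hv : v ∈ gr i) (hw : w ∈ gr' j)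
    (hn : i + j = n) : v ⊗ₜ[k] w ∈ tensorGr gr gr' n := by
  refine mem_iSup_of_mem i ?_
  have e : n - i = j := by omega
  exact Submodule.apply_mem_map₂ _ hv (by rw [e]; exact hw)

lemma tensorGr_le {n : ℤ} {N : Submodule k (V ⊗[k] W)}
    (hN : ∀ i j, i + j = n → ∀ v ∈ gr i, ∀ w ∈ gr' j, v ⊗ₜ[k] w ∈ N) : tensorGr gr gr' n ≤ N := by
  refine iSup_le fun p => Submodule.map₂_le.2 fun v hv w hw => ?_
  exact hN p (n - p) (by ring) v hv w hw

lemma map_mem_of_tensorGr {gr'' : Submodule k X} {n : ℤ} (f : V ⊗[k] W →ₗ[k] X)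
    (hf : ∀ i j, i + j = n → ∀ v ∈ gr i, ∀ w ∈ gr' j, f (v ⊗ₜ[k] w) ∈ gr'') {t : V ⊗[k] W}
    (ht : t ∈ tensorGr gr gr' n) : f t ∈ gr'' :=
  tensorGr_le (N := gr''.comap f) hf ht

lemma tensorGr_internal (h : IsInternal gr) (h' : IsInternal gr') : IsInternal (tensorGr gr gr') := by
  let Y := DirectSum ℤ fun i => tensorGr gr gr' i
  let inner (p q : ℤ) : gr p →ₗ[k] gr' q →ₗ[k] Y :=
    mk₂ k (fun v w => DirectSum.lof k ℤ (fun i => tensorGr gr gr' i) (p + q)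
        ⟨(v : V) ⊗ₜ[k] (w : W), tmul_mem_tensorGr v.2 w.2 rfl⟩)
      (by intro a b c; rw [← map_add]; congr 1; ext; simp [add_tmul])
      (by intro a b c; rw [← map_smul]; congr 1)
      (by intro a b c; rw [← map_add]; congr 1; ext; simp [tmul_add])
      (by intro a b c; rw [← map_smul]; congr 1; ext; simp)
  let sec : V ⊗[k] W →ₗ[k] Y := lift (extend h fun p => (extend h' fun q => (inner p q).flip).flip)
  have key : ∀ i j, ∀ v (hv : v ∈ gr i), ∀ w (hw : w ∈ gr' j), sec (v ⊗ₜ w) =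
      DirectSum.lof k ℤ (fun i => tensorGr gr gr' i) (i + j) ⟨v ⊗ₜ[k] w, tmul_mem_tensorGr hv hw rfl⟩ := by
    intro i j v hv w hw
    change extend h (fun p => (extend h' fun q => (inner p q).flip).flip) v w = _
    rw [extend_of_mem h _ hv, flip_apply, extend_of_mem h' _ hw]
    rfl
  refine internal_of_section sec ?_ ?_
  · intro t
    have : DirectSum.coeLinearMap (tensorGr gr gr') ∘ₗ sec = .id := by
      refine TensorProduct.ext (homog_ext h fun i v hv => homog_ext h' fun j w hw => ?_)
      change DirectSum.coeLinearMap (tensorGr gr gr') (sec (v ⊗ₜ w)) = v ⊗ₜ w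
      rw [key i j v hv w hw, DirectSum.coeLinearMap_lof]
    exact congr_fun this t
  · intro n t ht
    let N : Submodule k (V ⊗[k] W) :=
      { carrier := {t | ∀ ht : t ∈ tensorGr gr gr' n,
          sec t = DirectSum.lof k ℤ (fun i => tensorGr gr gr' i) n ⟨t, ht⟩} ⊓ tensorGr gr gr' n
        add_mem' := by
          rintro a b ⟨ha, ha'⟩ ⟨hb, hb'⟩
          refine ⟨fun hab => ?_, add_mem ha' hb'⟩
          rw [map_add, ha ha', hb hb', ← map_add]; rfl
        zero_mem' := ⟨fun h0 => by
          rw [map_zero]; exact (map_zero _).symm, zero_mem _⟩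
        smul_mem' := by
          rintro c a ⟨ha, ha'⟩
          refine ⟨fun hab => ?_, smul_mem _ _ ha'⟩
          rw [map_smul, ha ha', ← map_smul]; rfl }
    have hle : tensorGr gr gr' n ≤ N := by
      refine tensorGr_le fun i j hij v hv w hw => ⟨fun hm => ?_, tmul_mem_tensorGr hv hw hij⟩
      subst hij
      exact key i j v hv w hw
    exact (hle ht).1 ht

lemma tensor_homog_ext (h : IsInternal gr) (h' : IsInternal gr')
    {f g : V ⊗[k] W →ₗ[k] X}
    (hfg : ∀ i j, ∀ v ∈ gr i, ∀ w ∈ gr' j, f (v ⊗ₜ w) = g (v ⊗ₜ w)) : f = g :=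
  TensorProduct.ext (homog_ext h fun i v hv => homog_ext h' fun j w hw => hfg i j v hv w hw)

lemma shiftGr_internal (h : IsInternal gr) (m : ℤ) : IsInternal (shiftGr m gr) := by
  let f : V →ₗ[k] DirectSum ℤ fun i => shiftGr m gr i := extend h fun i =>
    DirectSum.lof k ℤ (fun i => shiftGr m gr i) (i - m) ∘ₗ Submodule.inclusion (by simp [shiftGr])
  have key : ∀ i, ∀ v (hv : v ∈ shiftGr m gr i), f v = DirectSum.lof k ℤ (fun i => shiftGr m gr i) i ⟨v, hv⟩ := by
    intro i v hv
    have hv' : v ∈ gr (i + m) := hv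
    simp only [f]
    rw [extend_of_mem h _ hv', comp_apply]
    have e : i + m - m = i := by ring
    have : ∀ j (hj : j = i) (hv2 : v ∈ shiftGr m gr j), DirectSum.lof k ℤ (fun i => shiftGr m gr i) j ⟨v, hv2⟩ =
      DirectSum.lof k ℤ (fun i => shiftGr m gr i) i ⟨v, hv⟩ := by
      rintro j rfl _; rfl
    exact this _ e _
  refine internal_of_section f ?_ key
  intro v
  refine homog_induction h (p := fun v => DirectSum.coeLinearMap (shiftGr m gr) (f v) = v) v ?_
    (by simp) (fun v w hv hw => by rw [map_add, map_add, hv, hw])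
  intro i v hv
  have hv' : v ∈ shiftGr m gr (i - m) := by simpa [shiftGr] using hv
  rw [key _ v hv', DirectSum.coeLinearMap_lof]

lemma tensorOdd_tmul (h : IsInternal gr) (D : V →ₗ[k] V) (D' : W →ₗ[k] W) {i : ℤ}
    {v : V} (hv : v ∈ gr i) (w : W) : tensorOdd gr D D' (v ⊗ₜ w) =
      D v ⊗ₜ w + ksign k (i : ZMod 2) • (v ⊗ₜ[k] D' w) := by
  simp [tensorOdd, sg_of_mem h 1 hv, smul_tmul']

lemma tensorOdd_mem (h : IsInternal gr) {e : ℤ} {D : V →ₗ[k] V} {D' : W →ₗ[k] W}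
    (hD : ∀ i, ∀ v ∈ gr i, D v ∈ gr (i + e)) (hD' : ∀ i, ∀ v ∈ gr' i, D' v ∈ gr' (i + e))
    (i : ℤ) (t : V ⊗[k] W) (ht : t ∈ tensorGr gr gr' i) :
    tensorOdd gr D D' t ∈ tensorGr gr gr' (i + e) := by
  refine map_mem_of_tensorGr _ ?_ ht
  intro p q hpq v hv w hw
  rw [tensorOdd_tmul h D D' hv]
  exact add_mem (tmul_mem_tensorGr (hD p v hv) hw (by omega)) (ksign_mem (tmul_mem_tensorGr hv (hD' q w hw) (by omega)))

end Graded

namespace DGAug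

variable {k : Type u} {A : Type v} [CommRing k] [Ring A] [Algebra k A] (S : DGAug k A)
variable {M : Type w} [AddCommGroup M] [Module k M]
variable {N : Type x} [AddCommGroup N] [Module k N]

/-- A homogeneous element of `A` together with its degree. -/
@[ext] structure Mark where
  /-- the degree -/
  deg : ℤ
  /-- the element -/
  val : A
  mem : val ∈ S.gr deg

/-- A homogeneous element of `Ā` together with its (unsuspended) degree. -/
@[ext] structure Letter where
  /-- the degree -/
  deg : ℤ
  /-- the element -/
  val : S.bar
  mem : (val : A) ∈ S.gr deg

/-- The grading of `Ā`. -/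
def bgr (i : ℤ) : Submodule k S.bar := (S.gr i).comap S.bar.subtype

lemma ε_prj (i : ℤ) (hi : i ≠ 0) (a : A) : S.ε (prj S.internal i a) = 0 := S.ε_gr i hi _ (prj_mem S.internal i a)

lemma ε_prj_zero (a : A) : S.ε (prj S.internal 0 a) = S.ε a := by
  refine homog_induction S.internal (p := fun a => S.ε (prj S.internal 0 a) = S.ε a) a ?_ (by simp) ?_
  · intro i a ha
    rw [prj_of_mem _ _ ha]
    split
    · rfl
    · next h => rw [map_zero, S.ε_gr i h a ha]
  · intro a b ha hb
    rw [map_add, map_add, ha, hb, map_add]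

lemma bgr_internal : IsInternal S.bgr := by
  have hcomp : ∀ i (a : S.bar), prj S.internal i a ∈ S.bar := by
    intro i a
    by_cases hi : i = 0
    · subst hi
      exact (S.ε_prj_zero a).trans a.2
    · exact S.ε_prj i hi a
  let c (i : ℤ) : S.bar →ₗ[k] S.bgr i := codRestrict _ (codRestrict S.bar (prj S.internal i ∘ₗ S.bar.subtype)
      (hcomp i)) (fun a => prj_mem S.internal i a)
  have hfin : ∀ a : S.bar, ∃ s : Finset ℤ, (∀ i ∉ s, prj S.internal i (a : A) = 0) ∧
      (a : A) = ∑ i ∈ s, prj S.internal i a := by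
    intro a
    refine homog_induction S.internal (p := fun a : A => ∃ s : Finset ℤ,
      (∀ i ∉ s, prj S.internal i a = 0) ∧ a = ∑ i ∈ s, prj S.internal i a) (a : A) ?_ ?_ ?_
    · intro i a ha
      refine ⟨{i}, fun j hj => ?_, ?_⟩
      · rw [prj_of_mem _ _ ha, if_neg]
        simpa [eq_comm] using hj
      · simp [prj_self S.internal ha]
    · exact ⟨∅, by simp, by simp⟩
    · rintro a b ⟨s, hs, hs'⟩ ⟨t, ht, ht'⟩
      refine ⟨s ∪ t, fun i hi => ?_, ?_⟩
      · rw [Finset.mem_union, not_or] at hi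
        rw [map_add, hs i hi.1, ht i hi.2, add_zero]
      · simp only [map_add, Finset.sum_add_distrib]
        rw [← Finset.sum_subset Finset.subset_union_left (fun i _ hi => hs i hi),
          ← Finset.sum_subset Finset.subset_union_right (fun i _ hi => ht i hi), ← hs', ← ht']
  refine (DirectSum.isInternal_submodule_iff_iSupIndep_and_iSup_eq_top _).2 ⟨?_, ?_⟩
  · have hind := (DirectSum.isInternal_submodule_iff_iSupIndep_and_iSup_eq_top _).1 S.internal
    have h1 := hind.1
    rw [iSupIndep_def] at h1 ⊢
    intro i
    rw [Submodule.disjoint_def]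
    intro a ha hb
    have hb' : (a : A) ∈ ⨆ j, ⨆ (_ : j ≠ i), S.gr j := by
      have : (⨆ j, ⨆ (_ : j ≠ i), S.bgr j) ≤ (⨆ j, ⨆ (_ : j ≠ i), S.gr j).comap S.bar.subtype := by
        refine iSup₂_le fun j hj => ?_
        intro x hx
        exact mem_iSup_of_mem j (mem_iSup_of_mem hj hx)
      exact this hb
    exact Subtype.ext ((Submodule.disjoint_def.1 (h1 i)) a ha hb')
  · rw [eq_top_iff]
    rintro a -
    obtain ⟨s, -, hs⟩ := hfin a
    have : a = ∑ i ∈ s, (c i a : S.bar) := by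
      apply Subtype.ext
      rw [Submodule.coe_sum]
      exact hs
    rw [this]
    exact Submodule.sum_mem _ fun i _ => mem_iSup_of_mem i (c i a).2

lemma sgr_internal : IsInternal S.sgr := shiftGr_internal S.bgr_internal 1

variable {S}

/-- Words in `Ā`. -/
abbrev Wd := List S.Letter

/-- Functions of two homogeneous elements of `A` and two words. -/
abbrev Fn (M : Type w) := S.Mark → S.Wd → S.Mark → S.Wd → M

/-- The word `[a₁, …, aₙ]` of a list of letters. -/
def word (t : S.Wd) : S.T := (t.map fun b => TensorAlgebra.ι k b.val).prod

/-- The degree `∑ (|aᵢ| - 1)` of a list of letters. -/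
def wd (t : S.Wd) : ℤ := (t.map fun b => b.deg - 1).sum

@[simp] lemma word_nil : word ([] : S.Wd) = 1 := rfl
@[simp] lemma word_cons (b : S.Letter) (t) : word (b :: t) = TensorAlgebra.ι k b.val * word t := by
  simp [word]
@[simp] lemma word_append (s t : S.Wd) : word (s ++ t) = word s * word t := by
  simp [word]
@[simp] lemma wd_nil : wd ([] : S.Wd) = 0 := rfl
@[simp] lemma wd_cons (b : S.Letter) (t) : wd (b :: t) = b.deg - 1 + wd t := by
  simp [wd]
@[simp] lemma wd_append (s t : S.Wd) : wd (s ++ t) = wd s + wd t := by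
  simp [wd]

/-- The chain `a₀[a₁, …, aₙ]`. -/
def gen (x : S.Mark) (t : S.Wd) : S.C := x.val ⊗ₜ word t

/-- A function of lists of letters that is linear in each letter. -/
def MultiLin (F : S.Wd → M) : Prop := ∀ l r i, ∃ g : S.bgr i →ₗ[k] M, ∀ (b : S.bar) (hb : (b : A) ∈ S.gr i),
    F (l ++ ⟨i, b, hb⟩ :: r) = g ⟨b, hb⟩

/-- A function of homogeneous elements that is linear in each degree. -/
def Lin (F : S.Mark → M) : Prop := ∀ i, ∃ g : S.gr i →ₗ[k] M, ∀ (x : A) (hx : x ∈ S.gr i), F ⟨i, x, hx⟩ = g ⟨x, hx⟩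

lemma MultiLin.shift {F : S.Wd → M} (hF : MultiLin F) (b : S.Letter) :
    MultiLin fun t => F (b :: t) := fun l r i => hF (b :: l) r i

lemma exists_linear_word {F : S.Wd → M} (hF : MultiLin F) : ∃ φ : S.T →ₗ[k] M, ∀ t, φ (word t) = F t := by
  let Fn : Submodule k (S.Wd → M) :=
    { carrier := {F | MultiLin F}
      add_mem' := by
        intro F G hF hG l r i
        obtain ⟨f, hf⟩ := hF l r i
        obtain ⟨g, hg⟩ := hG l r i
        exact ⟨f + g, fun b hb => by simp [hf, hg]⟩
      zero_mem' := fun l r i => ⟨0, by simp⟩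
      smul_mem' := by
        intro c F hF l r i
        obtain ⟨f, hf⟩ := hF l r i
        exact ⟨c • f, fun b hb => by simp [hf]⟩ }
  let sh (i : ℤ) : S.bgr i →ₗ[k] Module.End k Fn := mk₂ k
    (fun b F => ⟨fun t => (F : S.Wd → M) (⟨i, b, b.2⟩ :: t), F.2.shift _⟩)
    (by
      intro a b F; ext t
      obtain ⟨g, hg⟩ := F.2 [] t i
      simp only [List.nil_append] at hg
      change F.1 _ = F.1 _ + F.1 _
      exact (hg _ _).trans ((map_add g _ _).trans (congrArg₂ (· + ·) (hg _ _).symm (hg _ _).symm)))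
    (by
      intro c a F; ext t
      obtain ⟨g, hg⟩ := F.2 [] t i
      simp only [List.nil_append] at hg
      change F.1 _ = c • F.1 _
      exact (hg _ _).trans ((map_smul g _ _).trans (congrArg (c • ·) (hg _ _).symm)))
    (by intro a F G; rfl) (by intro c a F; rfl)
  let ρ : S.bar →ₗ[k] Module.End k Fn := extend S.bgr_internal sh
  have hρ : ∀ (b : S.Letter) (F : Fn) t, (ρ b.val F).1 t = F.1 (b :: t) := by
    intro b F t
    have : ρ b.val = sh b.deg ⟨b.val, b.mem⟩ := extend_of_mem _ _ _
    rw [this]; rfl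
  let R : S.T →ₐ[k] (Module.End k Fn)ᵐᵒᵖ := TensorAlgebra.lift k ((MulOpposite.opLinearEquiv k).toLinearMap ∘ₗ ρ)
  have hR : ∀ t (F : Fn), (((R (word t)).unop F).1 []) = F.1 t := by
    intro t
    induction t with
    | nil => intro F; simp
    | cons b t ih =>
      intro F
      rw [word_cons, map_mul, MulOpposite.unop_mul, Module.End.mul_apply, ih, ← hρ]
      simp [R]
  refine ⟨proj [] ∘ₗ Fn.subtype ∘ₗ applyₗ (⟨F, hF⟩ : Fn) ∘ₗ
    (MulOpposite.opLinearEquiv k).symm.toLinearMap ∘ₗ R.toLinearMap, fun t => ?_⟩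
  exact hR t ⟨F, hF⟩

lemma word_ext {f g : S.T →ₗ[k] M} (h : ∀ t, f (word t) = g (word t)) : f = g := by
  have hall : ∀ f : S.T →ₗ[k] M, (∀ t, f (word t) = 0) → f = 0 := by
    intro f hf
    ext t
    have : t ∈ Submodule.span k (Set.range (word (S := S))) := by
      induction t using TensorAlgebra.induction with
      | algebraMap r =>
        rw [Algebra.algebraMap_eq_smul_one]
        exact smul_mem _ _ (Submodule.subset_span ⟨[], rfl⟩)
      | ι a =>
        refine homog_induction S.bgr_internal
          (p := fun a => TensorAlgebra.ι k a ∈ Submodule.span k (Set.range (word (S := S)))) a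
          ?_ (by simp) (fun a b ha hb => by rw [map_add]; exact add_mem ha hb)
        intro i a ha
        exact Submodule.subset_span ⟨[⟨i, a, ha⟩], by simp⟩
      | mul a b ha hb =>
        have := Submodule.mul_mem_mul ha hb
        rw [Submodule.span_mul_span] at this
        refine Submodule.span_mono ?_ this
        rintro _ ⟨_, ⟨s, rfl⟩, _, ⟨t, rfl⟩, rfl⟩
        exact ⟨s ++ t, by simp⟩
      | add a b ha hb => exact add_mem ha hb
    have hle : Submodule.span k (Set.range (word (S := S))) ≤ ker f :=
      Submodule.span_le.2 (by rintro _ ⟨t, rfl⟩; exact hf t)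
    exact hle this
  exact sub_eq_zero.1 (hall _ fun t => by simp [h])

/-! ### Gradings -/

lemma Letter.mem_sgr (b : S.Letter) : b.val ∈ S.sgr (b.deg - 1) := by
  simpa [sgr] using b.mem

lemma word_mem (t : S.Wd) : word t ∈ S.tgr (wd t) := by
  refine Submodule.subset_span ?_
  induction t with
  | nil => exact IsWord.nil
  | cons b t ih =>
    rw [word_cons, wd_cons]
    exact IsWord.cons _ _ _ _ b.mem_sgr ih

lemma IsWord.exists_list {i : ℤ} {t : S.T} (h : S.IsWord i t) : ∃ l : S.Wd, word l = t ∧ wd l = i := by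
  induction h with
  | nil => exact ⟨[], rfl, rfl⟩
  | cons i j a t ha _ ih =>
    obtain ⟨l, rfl, rfl⟩ := ih
    exact ⟨⟨i + 1, a, ha⟩ :: l, by simp, by simp⟩

lemma MultiLin.word_lof : MultiLin (S := S) fun t =>
    DirectSum.lof k ℤ (fun i => S.tgr i) (wd t) ⟨word t, word_mem t⟩ := by
  intro l r i
  have hm : ∀ b : S.bgr i, word l * (TensorAlgebra.ι k (b : S.bar) * word r) ∈ S.tgr (wd l + (i - 1 + wd r)) := by
    intro b
    have := word_mem (l ++ ⟨i, b, b.2⟩ :: r)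
    simpa using this
  refine ⟨DirectSum.lof k ℤ (fun i => S.tgr i) _ ∘ₗ codRestrict _
    (mulLeft k (word l) ∘ₗ mulRight k (word r) ∘ₗ TensorAlgebra.ι k ∘ₗ (S.bgr i).subtype) hm, fun b hb => ?_⟩
  have key : ∀ n (hn : n = wd l + (i - 1 + wd r)) (w : S.T) (hw : w ∈ S.tgr n)
      (e : w = word l * (TensorAlgebra.ι k b * word r)),
      DirectSum.lof k ℤ (fun i => S.tgr i) n ⟨w, hw⟩ =
        DirectSum.lof k ℤ (fun i => S.tgr i) (wd l + (i - 1 + wd r)) ⟨_, hm ⟨b, hb⟩⟩ := by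
    rintro n rfl w hw rfl; rfl
  exact key _ (by simp) _ _ (by simp)

lemma tgr_internal : IsInternal S.tgr := by
  obtain ⟨φ, hφ⟩ := exists_linear_word (S := S) MultiLin.word_lof
  refine internal_of_section φ ?_ ?_
  · intro v
    have : DirectSum.coeLinearMap S.tgr ∘ₗ φ = .id := by
      refine word_ext fun t => ?_
      rw [comp_apply, hφ, DirectSum.coeLinearMap_lof]; rfl
    exact congr_fun this v
  · intro i v hv
    refine Submodule.span_induction (p := fun v hv => φ v =
      DirectSum.lof k ℤ (fun i => S.tgr i) i ⟨v, hv⟩) ?_ ?_ ?_ ?_ hv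
    · intro t ht
      obtain ⟨l, rfl, rfl⟩ := IsWord.exists_list ht
      exact hφ l
    · rw [map_zero]; exact (map_zero _).symm
    · intro a b ha hb ha' hb'
      rw [map_add, ha', hb', ← map_add]; rfl
    · intro c a ha ha'
      rw [map_smul, ha', ← map_smul]; rfl

variable (S) in
lemma cgr_internal : IsInternal S.cgr := tensorGr_internal S.internal tgr_internal

lemma gen_mem (x : S.Mark) (t : S.Wd) : gen x t ∈ S.cgr (x.deg + wd t) := tmul_mem_tensorGr x.mem (word_mem t) rfl

lemma gen_ext {f g : S.C →ₗ[k] M} (h : ∀ x t, f (gen x t) = g (gen x t)) : f = g :=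
  TensorProduct.ext (homog_ext S.internal fun i x hx => word_ext fun t => h ⟨i, x, hx⟩ t)

lemma cgr_induction {n : ℤ} {P : Submodule k S.C} (h : ∀ x t, x.deg + wd t = n → gen x t ∈ P) : S.cgr n ≤ P := by
  refine tensorGr_le fun i j hij x hx w hw => ?_
  have : S.tgr j ≤ P.comap (TensorProduct.mk k A S.T x) := by
    refine Submodule.span_le.2 fun t ht => ?_
    obtain ⟨l, rfl, rfl⟩ := IsWord.exists_list ht
    exact h ⟨i, x, hx⟩ l hij
  exact this hw

lemma exists_linear_gen {F : S.Mark → S.Wd → M} (h1 : ∀ t, Lin fun x => F x t)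
    (h2 : ∀ x, MultiLin (F x)) : ∃ φ : S.C →ₗ[k] M, ∀ x t, φ (gen x t) = F x t := by
  choose g hg using h1
  let G (t : S.Wd) : A →ₗ[k] M := extend S.internal (g t)
  have hG : ∀ x t, G t x.val = F x t := fun x t =>
    (extend_of_mem S.internal _ x.mem).trans (hg t x.deg x.val x.mem).symm
  have hGm : MultiLin G := by
    intro l r i
    refine ⟨{ toFun := fun b => G (l ++ ⟨i, b, b.2⟩ :: r), map_add' := ?_, map_smul' := ?_ }, fun b hb => rfl⟩
    · intro b c
      refine homog_ext S.internal fun j x hx => ?_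
      obtain ⟨q, hq⟩ := h2 ⟨j, x, hx⟩ l r i
      rw [LinearMap.add_apply, hG ⟨j, x, hx⟩, hG ⟨j, x, hx⟩, hG ⟨j, x, hx⟩]
      exact (hq _ _).trans ((map_add q _ _).trans (congrArg₂ (· + ·) (hq _ _).symm (hq _ _).symm))
    · intro c b
      refine homog_ext S.internal fun j x hx => ?_
      obtain ⟨q, hq⟩ := h2 ⟨j, x, hx⟩ l r i
      rw [LinearMap.smul_apply, hG ⟨j, x, hx⟩, hG ⟨j, x, hx⟩]
      exact (hq _ _).trans ((map_smul q _ _).trans (congrArg (c • ·) (hq _ _).symm))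
  obtain ⟨φ, hφ⟩ := exists_linear_word hGm
  exact ⟨lift φ.flip, fun x t => by
    rw [gen, lift.tmul, flip_apply, hφ, hG]⟩

/-! ### Operations on homogeneous elements -/

lemma toBar_mem {i : ℤ} {a : A} (ha : a ∈ S.gr i) : (S.toBar a : A) ∈ S.gr i := by
  change a - Algebra.linearMap k A (S.ε a) ∈ S.gr i
  by_cases hi : i = 0
  · subst hi
    refine sub_mem ha ?_
    rw [Algebra.linearMap_apply, Algebra.algebraMap_eq_smul_one]
    exact smul_mem _ _ S.one_mem
  · rw [S.ε_gr i hi a ha, map_zero, sub_zero]; exact ha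

lemma toBar_of_mem (a : S.bar) : S.toBar (a : A) = a := by
  apply Subtype.ext
  change (a : A) - Algebra.linearMap k A (S.ε a) = a
  have : S.ε (a : A) = 0 := a.2
  rw [this, map_zero, sub_zero]

lemma coe_toBar (a : A) : (S.toBar a : A) = a - S.ε a • 1 := by
  change a - Algebra.linearMap k A (S.ε a) = _
  rw [Algebra.linearMap_apply, Algebra.algebraMap_eq_smul_one]

lemma toBar_one : S.toBar (1 : A) = 0 := by
  apply Subtype.ext; rw [coe_toBar]; simp

namespace Mark
variable (S) in
/-- The unit. -/
def one : S.Mark := ⟨0, 1, S.one_mem⟩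
/-- The differential. -/
def d (x : S.Mark) : S.Mark := ⟨x.deg + 1, S.d x.val, S.d_mem _ _ x.mem⟩
/-- The product. -/
def mul (x y : S.Mark) : S.Mark := ⟨x.deg + y.deg, x.val * y.val, S.mul_mem _ _ _ x.mem _ y.mem⟩
/-- The projection to `Ā`. -/
def bar (x : S.Mark) : S.Letter := ⟨x.deg, S.toBar x.val, toBar_mem x.mem⟩
end Mark

namespace Letter
/-- The underlying element of `A`. -/
def mark (b : S.Letter) : S.Mark := ⟨b.deg, b.val, b.mem⟩
/-- The differential. -/
def d (b : S.Letter) : S.Letter := b.mark.d.bar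
/-- The product. -/
def mul (b c : S.Letter) : S.Letter := (b.mark.mul c.mark).bar
end Letter

@[simp] lemma Mark.one_deg : (Mark.one S).deg = 0 := rfl
@[simp] lemma Mark.d_deg (x : S.Mark) : x.d.deg = x.deg + 1 := rfl
@[simp] lemma Mark.mul_deg (x y : S.Mark) : (x.mul y).deg = x.deg + y.deg := rfl
@[simp] lemma Mark.bar_deg (x : S.Mark) : x.bar.deg = x.deg := rfl
@[simp] lemma Letter.mark_deg (b : S.Letter) : b.mark.deg = b.deg := rfl
@[simp] lemma Letter.d_deg (b : S.Letter) : b.d.deg = b.deg + 1 := rfl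
@[simp] lemma Letter.mul_deg (b c : S.Letter) : (b.mul c).deg = b.deg + c.deg := rfl
@[simp] lemma Mark.one_val : (Mark.one S).val = 1 := rfl
@[simp] lemma Mark.d_val (x : S.Mark) : x.d.val = S.d x.val := rfl
@[simp] lemma Mark.mul_val (x y : S.Mark) : (x.mul y).val = x.val * y.val := rfl
@[simp] lemma Mark.bar_val (x : S.Mark) : x.bar.val = S.toBar x.val := rfl
@[simp] lemma Letter.mark_val (b : S.Letter) : b.mark.val = b.val := rfl
@[simp] lemma Letter.d_val (b : S.Letter) : b.d.val = S.toBar (S.d b.val) := rfl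
@[simp] lemma Letter.mul_val (b c : S.Letter) : (b.mul c).val = S.toBar (b.val * c.val) := rfl

/-! ### Sums over splittings of a list -/

/-- The sum of `f u v` over all `u ++ v = t`. -/
def spl (f : S.Wd → S.Wd → M) : S.Wd → M
  | [] => f [] []
  | b :: t => f [] (b :: t) + spl (fun u v => f (b :: u) v) t

/-- `m` if the list is empty, and `0` otherwise. -/
def nilc (m : M) : S.Wd → M
  | [] => m
  | _ :: _ => 0

/-- `g` evaluated at the first letter and the rest. -/
def onHead (g : S.Letter → S.Wd → M) : S.Wd → M
  | [] => 0
  | b :: t => g b t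

/-- `g` evaluated at the last letter and the rest. -/
def onLast (g : S.Wd → S.Letter → M) : S.Wd → M
  | [] => 0
  | b :: t => nilc (g [] b) t + onLast (fun u c => g (b :: u) c) t

/-- The bar differential, extended to functions of lists. -/
def dl (F : S.Wd → M) : S.Wd → M
  | [] => 0
  | b :: t => -F (b.d :: t) + ksign k ((b.deg - 1 : ℤ) : ZMod 2) • onHead (fun c t => F (b.mul c :: t)) t
      + ksign k ((b.deg - 1 : ℤ) : ZMod 2) • dl (fun t => F (b :: t)) t

section basic
variable (f g : S.Wd → S.Wd → M) (t : S.Wd)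

lemma spl_nil : spl f [] = f [] [] := rfl
lemma spl_cons (b : S.Letter) : spl f (b :: t) = f [] (b :: t) + spl (fun u v => f (b :: u) v) t := rfl

variable {f g} in
lemma spl_congr' (h : ∀ u v, u ++ v = t → f u v = g u v) : spl f t = spl g t := by
  induction t generalizing f g with
  | nil => exact h _ _ rfl
  | cons b t ih =>
    rw [spl_cons, spl_cons, h _ _ rfl, ih]
    rintro u v rfl; exact h _ _ rfl

lemma spl_add : spl (fun u v => f u v + g u v) t = spl f t + spl g t := by
  induction t generalizing f g with
  | nil => rfl
  | cons b t ih => rw [spl_cons, spl_cons, spl_cons, ih]; abel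

lemma map_spl (φ : M →ₗ[k] N) : φ (spl f t) = spl (fun u v => φ (f u v)) t := by
  induction t generalizing f with
  | nil => rfl
  | cons b t ih => rw [spl_cons, spl_cons, map_add, ih]

lemma spl_smul (c : k) : spl (fun u v => c • f u v) t = c • spl f t := (map_spl f t (c • .id)).symm

lemma spl_neg : spl (fun u v => -f u v) t = -spl f t := (map_spl (k := k) f t (-.id)).symm

lemma spl_zero : spl (fun _ _ => (0 : M)) t = 0 := by
  induction t with
  | nil => rfl
  | cons b t ih => rw [spl_cons, ih, add_zero]

lemma spl_sum {ι : Type*} (s : Finset ι) (f : ι → S.Wd → S.Wd → M) :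
    spl (fun u v => ∑ i ∈ s, f i u v) t = ∑ i ∈ s, spl (f i) t := by
  induction t generalizing f with
  | nil => rfl
  | cons b t ih => simp only [spl_cons, ih, Finset.sum_add_distrib]

lemma spl_comm (f : S.Wd → S.Wd → S.Wd → S.Wd → M) (s) :
    spl (fun u v => spl (fun p q => f u v p q) s) t = spl (fun p q => spl (fun u v => f u v p q) t) s := by
  induction t generalizing f with
  | nil => rfl
  | cons b t ih => simp only [spl_cons, ih, ← spl_add]

lemma spl_assoc (f : S.Wd → S.Wd → S.Wd → M) :
    spl (fun u w => spl (fun u v => f u v w) u) t = spl (fun u w => spl (fun v w => f u v w) w) t := by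
  induction t generalizing f with
  | nil => rfl
  | cons b t ih =>
    simp only [spl_cons, spl_nil, spl_add]
    rw [ih]; abel

lemma spl_append (b : S.Letter) (l r : S.Wd) : spl f (l ++ b :: r) =
    spl (fun u v => f u (v ++ b :: r)) l + spl (fun u v => f (l ++ b :: u) v) r := by
  induction l generalizing f with
  | nil => simp [spl_cons, spl_nil]
  | cons c l ih => simp only [List.cons_append, spl_cons, ih]; abel

end basic

@[simp] lemma nilc_nil (m : M) : nilc (S := S) m [] = m := rfl
@[simp] lemma nilc_cons (m : M) (b : S.Letter) (t) : nilc m (b :: t) = 0 := rfl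
@[simp] lemma onHead_nil (g : S.Letter → S.Wd → M) : onHead g [] = 0 := rfl
@[simp] lemma onHead_cons (g : S.Letter → S.Wd → M) (b t) : onHead g (b :: t) = g b t := rfl
@[simp] lemma onLast_nil (g : S.Wd → S.Letter → M) : onLast g [] = 0 := rfl
lemma onLast_cons (g : S.Wd → S.Letter → M) (b t) :
    onLast g (b :: t) = nilc (g [] b) t + onLast (fun u c => g (b :: u) c) t := rfl
@[simp] lemma dl_nil (F : S.Wd → M) : dl F [] = 0 := rfl
lemma dl_cons (F : S.Wd → M) (b t) : dl F (b :: t) = -F (b.d :: t)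
      + ksign k ((b.deg - 1 : ℤ) : ZMod 2) • onHead (fun c t => F (b.mul c :: t)) t
      + ksign k ((b.deg - 1 : ℤ) : ZMod 2) • dl (fun t => F (b :: t)) t := rfl

lemma map_nilc (φ : M →ₗ[k] N) (m : M) (t : S.Wd) : φ (nilc m t) = nilc (φ m) t := by
  cases t <;> simp
lemma nilc_add (m m' : M) (t : S.Wd) : nilc (m + m') t = nilc m t + nilc m' t := by
  cases t <;> simp
lemma map_onHead (φ : M →ₗ[k] N) (g : S.Letter → S.Wd → M) (t) :
    φ (onHead g t) = onHead (fun b t => φ (g b t)) t := by cases t <;> simp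
lemma onHead_add (g g' : S.Letter → S.Wd → M) (t) :
    onHead (fun b t => g b t + g' b t) t = onHead g t + onHead g' t := by cases t <;> simp
lemma onHead_smul (c : k) (g : S.Letter → S.Wd → M) (t) :
    onHead (fun b t => c • g b t) t = c • onHead g t := by cases t <;> simp
lemma onHead_neg (g : S.Letter → S.Wd → M) (t) : onHead (fun b t => -g b t) t = -onHead g t := by cases t <;> simp
lemma onHead_sum {ι : Type*} (s : Finset ι) (g : ι → S.Letter → S.Wd → M) (t) :
    onHead (fun b t => ∑ i ∈ s, g i b t) t = ∑ i ∈ s, onHead (g i) t := by cases t <;> simp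
lemma onHead_congr {g g' : S.Letter → S.Wd → M} (t)
    (h : ∀ b u, b :: u = t → g b u = g' b u) : onHead g t = onHead g' t := by
  cases t with
  | nil => rfl
  | cons b t => exact h _ _ rfl
lemma onLast_congr {g g' : S.Wd → S.Letter → M} (t)
    (h : ∀ u b, u ++ [b] = t → g u b = g' u b) : onLast g t = onLast g' t := by
  induction t generalizing g g' with
  | nil => rfl
  | cons b t ih =>
    rw [onLast_cons, onLast_cons, ih (g' := fun u c => g' (b :: u) c) (by rintro u c rfl; exact h _ _ rfl)]
    cases t with
    | nil => simp [h [] b rfl]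
    | cons => simp
lemma onLast_add (g g' : S.Wd → S.Letter → M) (t) :
    onLast (fun b t => g b t + g' b t) t = onLast g t + onLast g' t := by
  induction t generalizing g g' with
  | nil => simp
  | cons b t ih => simp only [onLast_cons, ih, nilc_add]; abel
lemma map_onLast (φ : M →ₗ[k] N) (g : S.Wd → S.Letter → M) (t) : φ (onLast g t) = onLast (fun b t => φ (g b t)) t := by
  induction t generalizing g with
  | nil => simp
  | cons b t ih => simp only [onLast_cons, map_add, ih, map_nilc]
lemma onLast_smul (c : k) (g : S.Wd → S.Letter → M) (t) : onLast (fun b t => c • g b t) t = c • onLast g t :=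
  (map_onLast (c • .id) g t).symm
lemma onLast_neg (g : S.Wd → S.Letter → M) (t) : onLast (fun b t => -g b t) t = -onLast g t :=
  (map_onLast (k := k) (-.id) g t).symm
lemma onLast_sum {ι : Type*} (s : Finset ι) (g : ι → S.Wd → S.Letter → M) (t) :
    onLast (fun b t => ∑ i ∈ s, g i b t) t = ∑ i ∈ s, onLast (g i) t := by
  induction t generalizing g with
  | nil => simp
  | cons b t ih =>
    simp only [onLast_cons, ih, Finset.sum_add_distrib]
    congr 1
    cases t <;> simp
lemma onLast_append (g : S.Wd → S.Letter → M) (b) (l r : S.Wd) :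
    onLast g (l ++ b :: r) = onLast (fun u c => g (l ++ u) c) (b :: r) := by
  induction l generalizing g with
  | nil => rfl
  | cons c l ih =>
    rw [List.cons_append, onLast_cons, ih]
    have : ∀ m : M, nilc m (l ++ b :: r) = 0 := by intro m; cases l <;> rfl
    rw [this, zero_add]; rfl
lemma map_dl (φ : M →ₗ[k] N) (F : S.Wd → M) (t) : φ (dl F t) = dl (fun t => φ (F t)) t := by
  induction t generalizing F with
  | nil => simp
  | cons b t ih => simp only [dl_cons, map_add, map_neg, map_smul, ih, map_onHead]
lemma dl_add (F G : S.Wd → M) (t) : dl (fun t => F t + G t) t = dl F t + dl G t := by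
  induction t generalizing F G with
  | nil => simp
  | cons b t ih => simp only [dl_cons, ih, onHead_add, smul_add]; abel
lemma dl_smul (c : k) (F : S.Wd → M) (t) : dl (fun t => c • F t) t = c • dl F t := (map_dl (c • .id) F t).symm
lemma dl_neg (F : S.Wd → M) (t) : dl (fun t => -F t) t = -dl F t := (map_dl (k := k) (-.id) F t).symm
lemma dl_sum {ι : Type*} (s : Finset ι) (F : ι → S.Wd → M) (t) :
    dl (fun t => ∑ i ∈ s, F i t) t = ∑ i ∈ s, dl (F i) t := by
  induction t generalizing F with
  | nil => simp
  | cons b t ih =>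
    simp only [dl_cons, ih, onHead_sum, Finset.sum_add_distrib, Finset.sum_neg_distrib, Finset.smul_sum]

lemma onHead_spl (g : S.Letter → S.Wd → S.Wd → M) (t) :
    onHead (fun b => spl (g b)) t = spl (fun u v => onHead (fun b u => g b u v) u) t := by
  cases t with
  | nil => rfl
  | cons b t => simp [spl_cons]

lemma onLast_spl (g : S.Wd → S.Wd → S.Letter → M) (t) : onLast (fun t b => spl (fun u v => g u v b) t) t =
      spl (fun u v => onLast (fun v b => g u v b) v) t := by
  induction t generalizing g with
  | nil => rfl
  | cons b t ih =>
    simp only [onLast_cons, spl_cons, spl_nil, onLast_add, ih]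
    abel

lemma spl_onLast_eq (c : S.Wd → S.Letter → S.Wd → M) (t) : spl (fun u v => onLast (fun u b => c u b v) u) t =
      spl (fun u v => onHead (fun b v => c u b v) v) t := by
  induction t generalizing c with
  | nil => rfl
  | cons b t ih =>
    simp only [onLast_cons, spl_cons, spl_add, onLast_nil, onHead_cons, zero_add, ih]
    congr 1
    cases t with
    | nil => rfl
    | cons a t =>
      rw [spl_cons]
      simp only [nilc_cons, nilc_nil, spl_zero, add_zero]

lemma dl_spl (f : S.Wd → S.Wd → M) (t) : dl (spl f) t = spl (fun u v => dl (fun u => f u v) u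
      + ksign k ((wd u : ℤ) : ZMod 2) • dl (fun v => f u v) v) t := by
  induction t generalizing f with
  | nil => simp [spl_nil]
  | cons b t ih =>
    have e : ∀ u : S.Wd, ksign k ((wd (b :: u) : ℤ) : ZMod 2) =
        ksign k ((b.deg - 1 : ℤ) : ZMod 2) * ksign k ((wd u : ℤ) : ZMod 2) := by
      intro u; rw [wd_cons, Int.cast_add, ksign_add]
    simp only [dl_cons, spl_cons, dl_nil, wd_nil, Int.cast_zero, ksign_zero, one_smul, zero_add,
      onHead_add, dl_add, ih, spl_add, e, smul_add, mul_smul, spl_smul, spl_neg, onHead_spl]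
    abel

/-- The part of a Hochschild type differential that involves the letters in a given slot:
the bar differential, and the absorption of the first and the last letter by the neighbours. -/
def slot (f : S.Wd → M) (gl : S.Letter → S.Wd → M) (gr : S.Wd → S.Letter → M) (t : S.Wd) : M :=
  dl f t + onHead gl t + onLast gr t

lemma slot_spl (g : S.Wd → S.Wd → M) (gl : S.Letter → S.Wd → S.Wd → M) (gr : S.Wd → S.Wd → S.Letter → M)
    (c : S.Wd → S.Letter → S.Wd → M) (t) :
    slot (spl g) (fun b => spl (gl b)) (fun t b => spl (fun u v => gr u v b) t) t =
      spl (fun u v => slot (fun u => g u v) (fun b u => gl b u v) (fun u b => c u b v) u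
        + slot (fun v => ksign k ((wd u : ℤ) : ZMod 2) • g u v) (fun b v => -c u b v) (fun v b => gr u v b) v) t := by
  simp only [slot, dl_spl, onHead_spl, onLast_spl, spl_add, spl_onLast_eq, onHead_neg, spl_neg, dl_smul]
  abel

lemma dl_append (F : S.Wd → M) (b) (u v : S.Wd) : dl F (u ++ b :: v) = dl (fun u => F (u ++ b :: v)) u
      + onLast (fun u c => ksign k ((wd u + c.deg - 1 : ℤ) : ZMod 2) • F (u ++ c.mul b :: v)) u
      + ksign k ((wd u : ℤ) : ZMod 2) • dl (fun w => F (u ++ w)) (b :: v) := by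
  induction u generalizing F with
  | nil => simp
  | cons c u ih =>
    have e : ∀ u : S.Wd, ksign k ((wd (c :: u) : ℤ) : ZMod 2) =
        ksign k ((c.deg - 1 : ℤ) : ZMod 2) * ksign k ((wd u : ℤ) : ZMod 2) := by
      intro u; rw [wd_cons, Int.cast_add, ksign_add]
    have e2 : ∀ (u : S.Wd) (b : S.Letter), ksign k ((wd (c :: u) + b.deg - 1 : ℤ) : ZMod 2) =
        ksign k ((c.deg - 1 : ℤ) : ZMod 2) * ksign k ((wd u + b.deg - 1 : ℤ) : ZMod 2) := by
      intro u b; rw [← ksign_add, wd_cons, ← Int.cast_add]; congr 3; ring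
    rw [List.cons_append, dl_cons, ih, dl_cons (t := u), onLast_cons]
    simp only [List.cons_append, e, e2, smul_add, mul_smul, onLast_smul, wd_nil, zero_add]
    cases u with
    | nil => simp only [List.nil_append, onHead_cons, onHead_nil, nilc_nil]; simp
    | cons a u => simp only [List.cons_append, onHead_cons, nilc_cons]; abel

end DGAug

/-- The sign `(-1)^n`. -/
def isg (k : Type u) [CommRing k] (n : ℤ) : k := ksign k (n : ZMod 2)

section isg
variable {k : Type u} [CommRing k] {M : Type v} [AddCommGroup M] [Module k M]

lemma isg_add (a b : ℤ) : isg k (a + b) = isg k a * isg k b := by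
  rw [isg, Int.cast_add, ksign_add]; rfl
@[simp] lemma isg_zero : isg k 0 = 1 := by simp [isg]
lemma isg_smul (a b : ℤ) (x : M) : isg k a • isg k b • x = isg k (a + b) • x := by
  rw [isg_add, smul_smul]
lemma isg_congr {a b : ℤ} (h : (a : ZMod 2) = b) (x : M) : isg k a • x = isg k b • x := by
  rw [isg, h]; rfl
lemma neg_isg_smul (a : ℤ) (x : M) : -(isg k a • x) = isg k (a + 1) • x := by
  rw [isg, neg_ksign_smul, isg]; push_cast; rfl
lemma neg_eq_isg (x : M) : -x = isg k 1 • x := by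
  simp [isg, ksign_one]
lemma isg_eq_one {a : ℤ} (h : (a : ZMod 2) = 0) (x : M) : isg k a • x = x := by
  rw [isg, h, ksign_zero, one_smul]

end isg

namespace DGAug

variable {k : Type u} {A : Type v} [CommRing k] [Ring A] [Algebra k A] {S : DGAug k A}
variable {M : Type w} [AddCommGroup M] [Module k M]
variable {N : Type x} [AddCommGroup N] [Module k N]

/-! ### Multilinearity -/

lemma spl_exists_linear {P : Type*} [AddCommGroup P] [Module k P]
    {f : P → S.Wd → S.Wd → M}
    (h : ∀ u v, ∃ g : P →ₗ[k] M, ∀ b, f b u v = g b) (t) :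
    ∃ g : P →ₗ[k] M, ∀ b, spl (f b) t = g b := by
  choose g hg using h
  refine ⟨spl g t, fun b => ?_⟩
  have := map_spl g t (applyₗ b : (P →ₗ[k] M) →ₗ[k] M)
  simp only [LinearMap.applyₗ_apply_apply] at this
  rw [this]
  congr 1
  ext u v
  exact hg u v b

lemma MultiLin.smul {c : S.Wd → k} {F : S.Wd → M}
    (hc : ∀ l r (b b' : S.Letter), b.deg = b'.deg → c (l ++ b :: r) = c (l ++ b' :: r))
    (hF : MultiLin F) : MultiLin fun t => c t • F t := by
  intro l r i
  obtain ⟨g, hg⟩ := hF l r i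
  refine ⟨c (l ++ ⟨i, 0, zero_mem _⟩ :: r) • g, fun b hb => ?_⟩
  rw [LinearMap.smul_apply, ← hg]
  exact congrArg (· • _) (hc _ _ _ _ rfl)

lemma MultiLin.sum {ι : Type*} {s : Finset ι} {F : ι → S.Wd → M}
    (hF : ∀ i, MultiLin (F i)) : MultiLin fun t => ∑ i ∈ s, F i t := by
  intro l r i
  choose g hg using fun j => hF j l r i
  exact ⟨∑ j ∈ s, g j, fun b hb => by simp [hg]⟩

lemma MultiLin.comp {F : S.Wd → M} (φ : M →ₗ[k] N) (hF : MultiLin F) : MultiLin fun t => φ (F t) := by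
  intro l r i
  obtain ⟨g, hg⟩ := hF l r i
  exact ⟨φ ∘ₗ g, fun b hb => congrArg φ (hg b hb)⟩

lemma MultiLin.append_left {F : S.Wd → M} (hF : MultiLin F) (u : S.Wd) : MultiLin fun t => F (u ++ t) := by
  intro l r i
  obtain ⟨g, hg⟩ := hF (u ++ l) r i
  exact ⟨g, fun b hb => by rw [← hg, List.append_assoc]⟩

lemma MultiLin.append_right {F : S.Wd → M} (hF : MultiLin F) (u : S.Wd) : MultiLin fun t => F (t ++ u) := by
  intro l r i
  obtain ⟨g, hg⟩ := hF l (r ++ u) i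
  exact ⟨g, fun b hb => by rw [← hg, ← List.cons_append, ← List.append_assoc]⟩

lemma MultiLin.spl_param {F : S.Wd → S.Wd → S.Wd → M}
    (hF : ∀ u v, MultiLin fun t => F t u v) (s) : MultiLin fun t => spl (F t) s := by
  intro l r i
  obtain ⟨g, hg⟩ := spl_exists_linear (f := fun b : S.bgr i => F (l ++ ⟨i, b, b.2⟩ :: r))
    (fun u v => (hF u v l r i).imp fun g hg b => hg b b.2) s
  exact ⟨g, fun b hb => hg ⟨b, hb⟩⟩

lemma MultiLin.spl {f : S.Wd → S.Wd → M} (h1 : ∀ v, MultiLin fun u => f u v)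
    (h2 : ∀ u, MultiLin (f u)) : MultiLin (spl f) := by
  intro l r i
  obtain ⟨g, hg⟩ := spl_exists_linear (P := S.bgr i)
    (f := fun (b : S.bgr i) u v => f u (v ++ (⟨i, b.1, b.2⟩ : S.Letter) :: r)) (fun u v => (h2 u v r i).imp fun g hg b => hg b b.2) l
  obtain ⟨g', hg'⟩ := spl_exists_linear (P := S.bgr i)
    (f := fun (b : S.bgr i) u v => f (l ++ (⟨i, b.1, b.2⟩ : S.Letter) :: u) v) (fun u v => (h1 v l u i).imp fun g hg b => hg b b.2) r
  exact ⟨g + g', fun b hb => (spl_append _ _ _ _).trans (congrArg₂ (· + ·) (hg ⟨b, hb⟩) (hg' ⟨b, hb⟩))⟩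

lemma Lin.smul {c : S.Mark → k} {F : S.Mark → M}
    (hc : ∀ b b' : S.Mark, b.deg = b'.deg → c b = c b') (hF : Lin F) : Lin fun t => c t • F t := by
  intro i
  obtain ⟨g, hg⟩ := hF i
  refine ⟨c ⟨i, 0, zero_mem _⟩ • g, fun b hb => ?_⟩
  rw [LinearMap.smul_apply, ← hg]
  exact congrArg (· • _) (hc _ _ rfl)

lemma Lin.sum {ι : Type*} {s : Finset ι} {F : ι → S.Mark → M} (hF : ∀ i, Lin (F i)) : Lin fun t => ∑ i ∈ s, F i t := by
  intro i
  choose g hg using fun j => hF j i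
  exact ⟨∑ j ∈ s, g j, fun b hb => by simp [hg]⟩

lemma Lin.comp {F : S.Mark → M} (φ : M →ₗ[k] N) (hF : Lin F) : Lin fun t => φ (F t) := by
  intro i
  obtain ⟨g, hg⟩ := hF i
  exact ⟨φ ∘ₗ g, fun b hb => congrArg φ (hg b hb)⟩

lemma Lin.spl_param {F : S.Mark → S.Wd → S.Wd → M}
    (hF : ∀ u v, Lin fun x => F x u v) (s) : Lin fun x => spl (F x) s := by
  intro i
  obtain ⟨g, hg⟩ := spl_exists_linear (f := fun x : S.gr i => F ⟨i, x, x.2⟩)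
    (fun u v => (hF u v i).imp fun g hg b => hg b b.2) s
  exact ⟨g, fun b hb => hg ⟨b, hb⟩⟩

lemma Lin.of_val (φ : A →ₗ[k] M) : Lin (S := S) fun x => φ x.val := fun i => ⟨φ ∘ₗ (S.gr i).subtype, fun _ _ => rfl⟩

lemma MultiLin.lin {F : S.Wd → M} (hF : MultiLin F) (l r : S.Wd) : Lin fun y : S.Mark => F (l ++ y.bar :: r) := by
  intro i
  obtain ⟨g, hg⟩ := hF l r i
  refine ⟨g ∘ₗ codRestrict _ (S.toBar ∘ₗ (S.gr i).subtype) (fun x => toBar_mem x.2), fun x hx => ?_⟩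
  exact hg (S.toBar x) (toBar_mem hx)

lemma Lin.mul_left {F : S.Mark → M} (hF : Lin F) (a : S.Mark) : Lin fun x => F (a.mul x) := by
  intro i
  obtain ⟨g, hg⟩ := hF (a.deg + i)
  exact ⟨g ∘ₗ (codRestrict _ (mulLeft k a.val ∘ₗ (S.gr i).subtype)
    (fun x => S.mul_mem _ _ _ a.mem _ x.2)), fun x hx => hg (a.val * x) (S.mul_mem _ _ _ a.mem _ hx)⟩

lemma Lin.mul_right {F : S.Mark → M} (hF : Lin F) (a : S.Mark) : Lin fun x => F (x.mul a) := by
  intro i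
  obtain ⟨g, hg⟩ := hF (i + a.deg)
  exact ⟨g ∘ₗ (codRestrict _ (mulRight k a.val ∘ₗ (S.gr i).subtype)
    (fun x => S.mul_mem _ _ _ x.2 _ a.mem)), fun x hx => hg (x * a.val) (S.mul_mem _ _ _ hx _ a.mem)⟩

lemma MultiLin.word : MultiLin (S := S) word := fun l r i =>
  ⟨mulLeft k (DGAug.word l) ∘ₗ mulRight k (DGAug.word r) ∘ₗ TensorAlgebra.ι k ∘ₗ (S.bgr i).subtype, fun b hb => by simp⟩

lemma MultiLin.gen (x : S.Mark) : MultiLin (gen x) := MultiLin.word.comp (TensorProduct.mk k A S.T x.val)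

lemma Lin.gen (t : S.Wd) : Lin fun x : S.Mark => gen x t := Lin.of_val ((TensorProduct.mk k A S.T).flip (DGAug.word t))

lemma Lin.exists_linear {F : S.Mark → M} (hF : Lin F) : ∃ φ : A →ₗ[k] M, ∀ x, φ x.val = F x := by
  choose g hg using hF
  exact ⟨extend S.internal g, fun x => (extend_of_mem _ _ x.mem).trans (hg _ _ _).symm⟩

lemma exists_linear_tensor {F : S.Mark → S.Mark → M} (h1 : ∀ z, Lin fun y => F y z)
    (h2 : ∀ y, Lin (F y)) : ∃ φ : A ⊗[k] A →ₗ[k] M, ∀ y z, φ (y.val ⊗ₜ z.val) = F y z := by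
  choose g hg using fun y => (h2 y).exists_linear
  have hgL : Lin g := by
    intro i
    refine ⟨{ toFun := fun b => g ⟨i, b, b.2⟩, map_add' := ?_, map_smul' := ?_ }, fun b hb => rfl⟩
    · intro b c
      refine homog_ext S.internal fun j x hx => ?_
      obtain ⟨q, hq⟩ := h1 ⟨j, x, hx⟩ i
      rw [LinearMap.add_apply, hg _ ⟨j, x, hx⟩, hg _ ⟨j, x, hx⟩, hg _ ⟨j, x, hx⟩]
      exact (hq _ _).trans (((map_add q b c)).trans (congrArg₂ (· + ·) (hq _ _).symm (hq _ _).symm))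
    · intro c b
      refine homog_ext S.internal fun j x hx => ?_
      obtain ⟨q, hq⟩ := h1 ⟨j, x, hx⟩ i
      rw [LinearMap.smul_apply, hg _ ⟨j, x, hx⟩, hg _ ⟨j, x, hx⟩]
      exact (hq _ _).trans (((map_smul q c b)).trans (congrArg (c • ·) (hq _ _).symm))
  obtain ⟨φ, hφ⟩ := hgL.exists_linear
  exact ⟨lift φ, fun y z => by rw [lift.tmul, hφ, hg]⟩

/-! ### Slots -/

lemma slot_add (f f' : S.Wd → M) (gl gl' gr gr' t) :
    slot (fun t => f t + f' t) (fun b t => gl b t + gl' b t) (fun t b => gr t b + gr' t b) t =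
      slot f gl gr t + slot f' gl' gr' t := by
  simp only [slot, dl_add, onHead_add, onLast_add]; abel

lemma slot_sum {ι : Type*} (s : Finset ι) (f : ι → S.Wd → M)
    (gl : ι → S.Letter → S.Wd → M) (gr : ι → S.Wd → S.Letter → M) (t) :
    slot (fun t => ∑ i ∈ s, f i t) (fun b t => ∑ i ∈ s, gl i b t) (fun t b => ∑ i ∈ s, gr i t b) t =
      ∑ i ∈ s, slot (f i) (gl i) (gr i) t := by
  simp only [slot, dl_sum, onHead_sum, onLast_sum, Finset.sum_add_distrib]

lemma map_slot (φ : M →ₗ[k] N) (f : S.Wd → M) (gl gr t) : φ (slot f gl gr t) =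
      slot (fun t => φ (f t)) (fun b t => φ (gl b t)) (fun t b => φ (gr t b)) t := by
  simp only [slot, map_add, map_dl, map_onHead, map_onLast]

lemma slot_smul (c : k) (f : S.Wd → M) (gl gr t) :
    slot (fun t => c • f t) (fun b t => c • gl b t) (fun t b => c • gr t b) t =
      c • slot f gl gr t := (map_slot (c • .id) f gl gr t).symm

lemma slot_congr {f f' : S.Wd → M} {gl gl' gr gr'} (t)
    (hf : ∀ t, f t = f' t) (hl : ∀ b u, b :: u = t → gl b u = gl' b u)
    (hr : ∀ u b, u ++ [b] = t → gr u b = gr' u b) : slot f gl gr t = slot f' gl' gr' t := by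
  rw [slot, slot, onHead_congr t hl, onLast_congr t hr, show f = f' from funext hf]

lemma slot_spl_comm (f : S.Wd → S.Wd → S.Wd → M) (gl : S.Letter → S.Wd → S.Wd → S.Wd → M)
    (gr : S.Wd → S.Letter → S.Wd → S.Wd → M) (t s) :
    slot (fun t => spl (f t) s) (fun b t => spl (gl b t) s) (fun t b => spl (gr t b) s) t = spl (fun u v =>
      slot (fun t => f t u v) (fun b t => gl b t u v) (fun t b => gr t b u v) t) s := by
  induction s generalizing f gl gr with
  | nil => rfl
  | cons b s ih => simp only [spl_cons, slot_add, ih]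

lemma Letter.mul_bar (F : S.Wd → M) (hF : MultiLin F) (u v) (c : S.Letter) (z : S.Mark) : F (u ++ c.mul z.bar :: v) =
      F (u ++ (c.mark.mul z).bar :: v) - S.ε z.val • F (u ++ c :: v) := by
  by_cases hz : z.deg = 0
  · obtain ⟨i, z, hz'⟩ := z
    obtain rfl : i = 0 := hz
    obtain ⟨g, hg⟩ := hF u v (c.deg + 0)
    have e : F (u ++ c :: v) = F (u ++ ⟨c.deg + 0, c.val, by simpa using c.mem⟩ :: v) := by
      congr 3; ext <;> simp
    have h1 := hg (S.toBar (c.val * S.toBar z)) (toBar_mem (S.mul_mem _ _ _ c.mem _ (toBar_mem hz')))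
    have h2 := hg (S.toBar (c.val * z)) (toBar_mem (S.mul_mem _ _ _ c.mem _ hz'))
    have h3 := hg c.val (by simpa using c.mem)
    rw [e, h3]
    refine h1.trans ((?_ : _ = _).trans (congrArg (· - _) h2.symm))
    rw [← map_smul, ← map_sub]
    congr 1
    apply Subtype.ext
    change S.toBar (c.val * S.toBar z) = S.toBar (c.val * z) - S.ε z • c.val
    rw [coe_toBar, mul_sub, mul_smul_comm, mul_one, map_sub, map_smul, toBar_of_mem]
  · rw [S.ε_gr _ hz _ z.mem, zero_smul, sub_zero]
    congr 3
    ext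
    · rfl
    · simp [coe_toBar, S.ε_gr _ hz _ z.mem]

lemma Mark.bar_mul (F : S.Wd → M) (hF : MultiLin F) (u v) (c : S.Letter) (z : S.Mark) : F (u ++ z.bar.mul c :: v) =
      F (u ++ (z.mul c.mark).bar :: v) - S.ε z.val • F (u ++ c :: v) := by
  by_cases hz : z.deg = 0
  · obtain ⟨i, z, hz'⟩ := z
    obtain rfl : i = 0 := hz
    obtain ⟨g, hg⟩ := hF u v (0 + c.deg)
    have e : F (u ++ c :: v) = F (u ++ ⟨0 + c.deg, c.val, by simpa using c.mem⟩ :: v) := by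
      congr 3; ext <;> simp
    have h1 := hg (S.toBar (S.toBar z * c.val)) (toBar_mem (S.mul_mem _ _ _ (toBar_mem hz') _ c.mem))
    have h2 := hg (S.toBar (z * c.val)) (toBar_mem (S.mul_mem _ _ _ hz' _ c.mem))
    have h3 := hg c.val (by simpa using c.mem)
    rw [e, h3]
    refine h1.trans ((?_ : _ = _).trans (congrArg (· - _) h2.symm))
    rw [← map_smul, ← map_sub]
    congr 1
    apply Subtype.ext
    change S.toBar (S.toBar z * c.val) = S.toBar (z * c.val) - S.ε z • c.val
    rw [coe_toBar, sub_mul, smul_mul_assoc, one_mul, map_sub, map_smul, toBar_of_mem]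
  · rw [S.ε_gr _ hz _ z.mem, zero_smul, sub_zero]
    congr 3
    ext
    · rfl
    · simp [coe_toBar, S.ε_gr _ hz _ z.mem]

lemma Lin.bar {F : S.Mark → M} (hF : Lin F) (z : S.Mark) : F z.bar.mark = F z - S.ε z.val • F (Mark.one S) := by
  obtain ⟨φ, hφ⟩ := hF.exists_linear
  rw [← hφ, ← hφ, ← hφ, ← map_smul, ← map_sub]
  simp [coe_toBar]

lemma onLast_snoc (G : S.Wd → M) (t) : onLast (fun u c => G (u ++ [c])) t = G t - nilc (G []) t := by
  induction t generalizing G with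
  | nil => simp
  | cons b t ih =>
    rw [onLast_cons]
    have := ih (fun t => G (b :: t))
    simp only [List.cons_append, List.nil_append] at this ⊢
    rw [this]; simp

lemma onHead_cons_eq (G : S.Wd → M) (t) : onHead (fun c u => G (c :: u)) t = G t - nilc (G []) t := by
  cases t <;> simp

lemma onHead_append (g : S.Letter → S.Wd → M) (t r b) :
    onHead g (t ++ b :: r) = nilc (g b r) t + onHead (fun c u => g c (u ++ b :: r)) t := by
  cases t <;> simp

lemma onLast_append' (g : S.Wd → S.Letter → M) (t r b) :
    onLast g (t ++ b :: r) = nilc (g t b) r + onLast (fun u c => g (t ++ b :: u) c) r := by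
  rw [onLast_append, onLast_cons, List.append_nil]

/-- The differential of a slot into which the letter `z` has been inserted. -/
lemma slot_insert {f : S.Wd → M} {yl : S.Mark → S.Wd → M}
    {yr : S.Wd → S.Mark → M} (hf : MultiLin f) (hl : ∀ r, Lin fun z => yl z r)
    (hr : ∀ s, Lin (yr s)) (hl1 : ∀ r, yl (Mark.one S) r = f r)
    (hr1 : ∀ s, yr s (Mark.one S) = isg k (wd s + 1) • f s) (s r) (z : S.Mark) :
    slot f (fun b => yl b.mark) (fun u b => yr u b.mark) (s ++ z.bar :: r) =
      slot (fun s => f (s ++ z.bar :: r)) (fun b s => yl b.mark (s ++ z.bar :: r))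
        (fun s c => isg k (wd s + c.deg - 1) • f (s ++ (c.mark.mul z).bar :: r)) s
      + isg k (wd s + 1) • f (s ++ z.d.bar :: r)
      + slot (fun r => isg k (wd s + z.deg - 1) • f (s ++ z.bar :: r))
          (fun c r => isg k (wd s + z.deg - 1) • f (s ++ (z.mul c.mark).bar :: r))
          (fun r b => yr (s ++ z.bar :: r) b.mark) r
      + nilc (yl z r) s + nilc (yr s z) r := by
  have hd : z.bar.d = z.d.bar := by
    ext
    · rfl
    · simp only [Letter.d_val, Mark.bar_val, Mark.d_val, coe_toBar]
      have h1 : S.d 1 = 0 := by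
        have := S.leibniz 0 1 S.one_mem 1
        simpa using this
      rw [map_sub, map_smul, h1, smul_zero, sub_zero]
  have e1 : onLast (fun u c => ksign k ((wd u + c.deg - 1 : ℤ) : ZMod 2) • f (u ++ c.mul z.bar :: r)) s =
      onLast (fun u c => isg k (wd u + c.deg - 1) • f (u ++ (c.mark.mul z).bar :: r)) s -
      S.ε z.val • (isg k (wd s) • f (s ++ r) - nilc (f r) s) := by
    have := onLast_snoc (fun u => isg k (wd u) • f (u ++ r)) s
    simp only [wd_nil, isg_zero, one_smul, List.nil_append] at this
    rw [← this, ← onLast_smul, sub_eq_add_neg, ← onLast_neg, ← onLast_add]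
    refine onLast_congr s fun u c _ => ?_
    rw [Letter.mul_bar f hf, smul_sub, smul_comm (S.ε z.val), sub_eq_add_neg]
    simp only [wd_append, wd_cons, wd_nil, List.append_assoc, List.cons_append, List.nil_append]
    congr 3
    simp only [isg]; congr 2; ring
  have e2 : onHead (fun c u => f (s ++ z.bar.mul c :: u)) r = onHead (fun c u => f (s ++ (z.mul c.mark).bar :: u)) r
        - S.ε z.val • (f (s ++ r) - nilc (f s) r) := by
    have := onHead_cons_eq (fun u => f (s ++ u)) r
    rw [List.append_nil] at this
    rw [← this, ← onHead_smul, sub_eq_add_neg, ← onHead_neg, ← onHead_add]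
    refine onHead_congr r fun u c _ => ?_
    rw [Mark.bar_mul f hf, sub_eq_add_neg]
  have hε : S.ε z.val • isg k (z.deg - 1) • f (s ++ r) = -(S.ε z.val • f (s ++ r)) ∧
      S.ε z.val • isg k (z.deg - 1) • nilc (f s) r = -(S.ε z.val • nilc (f s) r) := by
    by_cases hz : z.deg = 0
    · rw [hz]
      constructor <;> simp [isg, ksign]
    · simp [S.ε_gr _ hz _ z.mem]
  have hs : ∀ x : M, isg k (wd s + z.deg - 1) • x = isg k (wd s) • isg k (z.deg - 1) • x := by
    intro x; rw [isg_smul]; congr 2; ring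
  have hs1 : ∀ x : M, isg k (wd s + 1) • x = -(isg k (wd s) • x) := by
    intro x; rw [neg_isg_smul]
  have hw : ksign k ((wd s : ℤ) : ZMod 2) = isg k (wd s) := rfl
  have hw' : ksign k ((z.bar.deg - 1 : ℤ) : ZMod 2) = isg k (z.deg - 1) := rfl
  obtain ⟨c, hc⟩ : ∃ c, c = isg k (z.deg - 1) := ⟨_, rfl⟩
  rw [← hc] at hε hw'
  simp only [← hc] at hs
  simp only [slot, dl_append, dl_cons, e1, e2, onHead_append, onLast_append', hd, hw, hw']
  rw [(hl r).bar z, (hr s).bar z, hl1, hr1]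
  simp only [hs, hs1]
  simp only [sub_eq_add_neg, nilc_add, smul_add, smul_neg, onHead_smul, dl_smul]
  have n1 : nilc (-(S.ε z.val • f r)) s = -(S.ε z.val • nilc (f r) s) := by cases s <;> simp
  have n2 : nilc (- -(S.ε z.val • isg k (wd s) • f s)) r = isg k (wd s) • S.ε z.val • nilc (f s) r := by
    cases r <;> simp [smul_comm (S.ε z.val)]
  rw [n1, n2, smul_comm c (S.ε z.val) (f (s ++ r)), hε.1, smul_comm c (S.ε z.val) (nilc (f s) r), hε.2]
  simp only [smul_neg, smul_comm (S.ε z.val) (isg k (wd s))]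
  abel

end DGAug

lemma neg_one_pow_isg {k : Type u} [CommRing k] {M : Type v} [AddCommGroup M] [Module k M]
    {a b : ℤ} (h : (a : ZMod 2) = b + 1) (x : M) : isg k a • x = -(isg k b • x) := by
  rw [neg_isg_smul]; exact isg_congr (by push_cast; exact h) x

namespace DGAug

variable {k : Type u} {A : Type v} [CommRing k] [Ring A] [Algebra k A] {S : DGAug k A}
variable {M : Type w} [AddCommGroup M] [Module k M]
variable {N : Type x} [AddCommGroup N] [Module k N]

/-! ### Signs in slots -/

attribute [push_cast] wd_nil wd_cons wd_append Mark.one_deg Mark.d_deg Mark.mul_deg Mark.bar_deg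
  Letter.mark_deg Letter.d_deg Letter.mul_deg

lemma dl_isg (n c : ℤ) (f : S.Wd → M) (t) :
    dl (fun u => isg k ((wd u + 1) * n + c) • f u) t = isg k (wd t * n + c) • dl f t := by
  induction t generalizing f c with
  | nil => simp
  | cons b t ih =>
    have h1 : dl (fun u => isg k ((wd (b :: u) + 1) * n + c) • f (b :: u)) t =
        isg k (wd (b :: t) * n + c) • dl (fun u => f (b :: u)) t := by
      have := ih ((b.deg - 1) * n + c) (fun u => f (b :: u))
      rw [wd_cons, show (b.deg - 1 + wd t) * n + c = wd t * n + ((b.deg - 1) * n + c) by ring, ← this]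
      congr 1; ext u; rw [wd_cons]; congr 2; ring
    have h2 : onHead (fun c' u => isg k ((wd (b.mul c' :: u) + 1) * n + c) • f (b.mul c' :: u)) t =
        isg k (wd (b :: t) * n + c) • onHead (fun c' u => f (b.mul c' :: u)) t := by
      rw [← onHead_smul]
      refine onHead_congr t ?_
      rintro c' u rfl
      refine isg_congr ?_ _
      simp only [wd_cons, Letter.mul_deg]; push_cast; grind
    have h3 : isg k ((wd (b.d :: t) + 1) * n + c) • f (b.d :: t) = isg k (wd (b :: t) * n + c) • f (b.d :: t) := by
      refine isg_congr ?_ _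
      simp only [wd_cons, Letter.d_deg]; push_cast; clear * -; grind
    rw [dl_cons, dl_cons, h1, h2, h3]
    simp only [smul_add, smul_neg]
    rw [smul_comm (ksign k _), smul_comm (ksign k _)]

lemma slot_isg (n c : ℤ) {f f' : S.Wd → M} {gl gl' gr gr'} (t) (hf : ∀ u, f' u = isg k ((wd u + 1) * n + c) • f u)
    (hl : ∀ b u, gl' b u = isg k ((b.deg - 1 + wd u) * n + c) • gl b u)
    (hr : ∀ u b, gr' u b = isg k ((wd u + (b.deg - 1)) * n + c) • gr u b) :
    slot f' gl' gr' t = isg k (wd t * n + c) • slot f gl gr t := by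
  rw [slot, show f' = _ from funext hf, dl_isg, slot, smul_add, smul_add, ← onHead_smul, ← onLast_smul]
  congr 1
  · congr 1
    refine onHead_congr t ?_
    rintro b u rfl
    rw [hl, wd_cons]
  · refine onLast_congr t ?_
    rintro u b rfl
    rw [hr, wd_append, wd_cons, wd_nil, add_zero]

lemma slot_eq_isg (n c a : ℤ) {f f' : S.Wd → M} {gl gl' gr gr'} {t} (ha : ((wd t * n + c : ℤ) : ZMod 2) = a)
    (hf : ∀ u, f' u = isg k ((wd u + 1) * n + c) • f u)
    (hl : ∀ b u, gl' b u = isg k ((b.deg - 1 + wd u) * n + c) • gl b u)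
    (hr : ∀ u b, gr' u b = isg k ((wd u + (b.deg - 1)) * n + c) • gr u b) :
    slot f' gl' gr' t = isg k a • slot f gl gr t :=
  (slot_isg n c t hf hl hr).trans (isg_congr ha _)

lemma slot_eq_neg (n c a : ℤ) {f f' : S.Wd → M} {gl gl' gr gr'} {t} (ha : ((wd t * n + c : ℤ) : ZMod 2) = a + 1)
    (hf : ∀ u, f' u = isg k ((wd u + 1) * n + c) • f u)
    (hl : ∀ b u, gl' b u = isg k ((b.deg - 1 + wd u) * n + c) • gl b u)
    (hr : ∀ u b, gr' u b = isg k ((wd u + (b.deg - 1)) * n + c) • gr u b) :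
    slot f' gl' gr' t = -(isg k a • slot f gl gr t) :=
  (slot_isg n c t hf hl hr).trans (neg_one_pow_isg ha _)

/-! ### Differentials of functions of cyclic words -/

/-- The Hochschild differential of a function of `a₀[a₁, …, aₙ]`. -/
def D1 (F : S.Mark → S.Wd → M) (x : S.Mark) (t : S.Wd) : M :=
  F x.d t + slot (fun t => isg k x.deg • F x t) (fun b u => isg k x.deg • F (x.mul b.mark) u)
    (fun u b => isg k ((b.deg - 1) * (x.deg + wd u) + 1) • F (b.mark.mul x) u) t

/-- The differential of a function of cyclic words with two marked letters. -/
def D2 (F : S.Fn M) (x : S.Mark) (t : S.Wd) (y : S.Mark) (s : S.Wd) : M :=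
  F x.d t y s + slot (fun t => isg k x.deg • F x t y s) (fun b u => isg k x.deg • F (x.mul b.mark) u y s)
    (fun u b => isg k (x.deg + wd u + 1) • F x u (b.mark.mul y) s) t
  + (isg k (x.deg + wd t) • F x t y.d s + slot (fun s => isg k (x.deg + wd t + y.deg) • F x t y s)
    (fun b u => isg k (x.deg + wd t + y.deg) • F x t (y.mul b.mark) u)
    (fun u b => isg k ((b.deg - 1) * (x.deg + wd t + y.deg + wd u) + 1) • F (b.mark.mul x) t y u) s)

/-- The differential of a function of cyclic words with three marked letters. -/
def D3 (F : S.Mark → S.Wd → S.Fn M) (x : S.Mark) (t : S.Wd) (y : S.Mark) (s : S.Wd) (z : S.Mark) (r : S.Wd) : M :=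
  F x.d t y s z r + slot (fun t => isg k x.deg • F x t y s z r) (fun b u => isg k x.deg • F (x.mul b.mark) u y s z r)
    (fun u b => isg k (x.deg + wd u + 1) • F x u (b.mark.mul y) s z r) t
  + (isg k (x.deg + wd t) • F x t y.d s z r + slot (fun s => isg k (x.deg + wd t + y.deg) • F x t y s z r)
    (fun b u => isg k (x.deg + wd t + y.deg) • F x t (y.mul b.mark) u z r)
    (fun u b => isg k (x.deg + wd t + y.deg + wd u + 1) • F x t y u (b.mark.mul z) r) s)
  + (isg k (x.deg + wd t + y.deg + wd s) • F x t y s z.d r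
    + slot (fun r => isg k (x.deg + wd t + y.deg + wd s + z.deg) • F x t y s z r)
    (fun b u => isg k (x.deg + wd t + y.deg + wd s + z.deg) • F x t y s (z.mul b.mark) u)
    (fun u b => isg k ((b.deg - 1) * (x.deg + wd t + y.deg + wd s + z.deg + wd u) + 1) • F (b.mark.mul x) t y s z u) r)

lemma map_D1 (φ : M →ₗ[k] N) (F : S.Mark → S.Wd → M) (x t) : φ (D1 F x t) = D1 (fun x t => φ (F x t)) x t := by
  simp only [D1, map_add, map_slot, map_smul]

lemma Mark.mul_one' (x : S.Mark) : x.mul (Mark.one S) = x := by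
  ext <;> simp

lemma Mark.one_mul' (x : S.Mark) : (Mark.one S).mul x = x := by
  ext <;> simp

lemma S_d_one : S.d 1 = 0 := by
  have := S.leibniz 0 1 S.one_mem 1
  simpa using this

lemma Mark.mul_assoc' (x y z : S.Mark) : (x.mul y).mul z = x.mul (y.mul z) := by
  ext
  · simp [add_assoc]
  · simp [mul_assoc]

/-- Functions of `a₀[a₁, …, aₙ]` that come from linear maps. -/
def Lin1 (F : S.Mark → S.Wd → M) : Prop := (∀ t, Lin fun x => F x t) ∧ ∀ x, MultiLin (F x)

lemma Lin1.gen : Lin1 (S := S) gen := ⟨Lin.gen, MultiLin.gen⟩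

lemma Lin1.comp {F : S.Mark → S.Wd → M} (hF : Lin1 F) (φ : M →ₗ[k] N) :
    Lin1 fun x t => φ (F x t) := ⟨fun t => (hF.1 t).comp φ, fun x => (hF.2 x).comp φ⟩

lemma Lin1.exists {F : S.Mark → S.Wd → M} (hF : Lin1 F) :
    ∃ φ : S.C →ₗ[k] M, ∀ x t, φ (DGAug.gen x t) = F x t := exists_linear_gen hF.1 hF.2

/-- Demoting the second marked letter. -/
def iota (F : S.Mark → S.Wd → M) (x : S.Mark) (t : S.Wd) (y : S.Mark)
    (s : S.Wd) : M := isg k (x.deg + wd t) • F x (t ++ y.bar :: s)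

lemma Lin.isg {F : S.Mark → M} (s : ℤ → ℤ) (hF : Lin F) :
    Lin fun x => isg k (s x.deg) • F x := hF.smul (by intro b b' h; rw [h])

lemma MultiLin.isg {F : S.Wd → M} (s : ℤ → ℤ) (hF : MultiLin F) :
    MultiLin fun t => isg k (s (wd t)) • F t := hF.smul (by
      intro l r b b' h; simp only [wd_append, wd_cons, h])

lemma iota_aux {a : k} {A A' B B' s1 s1' s2 s2' n1 n1' n2 n2' : M} (hA : A' = -(a • A))
    (h1 : s1' = -(a • s1)) (hB : B' = -(a • B)) (h2 : s2' = -(a • s2)) (hn : a • n1 = n1')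
    (hn' : a • n2 = -n2') :
    a • (A + (s1 + B + s2 + n1 + n2)) + (A' + s1' + (B' + s2')) = n1' - n2' := by
  subst hA h1 hB h2 hn
  simp only [smul_add, hn']; abel

lemma D2_iota {F : S.Mark → S.Wd → M} (hF : Lin1 F) (x t y s) :
    isg k (x.deg + wd t) • D1 F x (t ++ y.bar :: s) + D2 (iota F) x t y s =
      nilc (F (x.mul y) s) t - nilc (isg k (y.deg * (x.deg + wd t)) • F (y.mul x) t) s := by
  have h := slot_insert (f := fun t => isg k x.deg • F x t) (yl := fun z r => isg k x.deg • F (x.mul z) r)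
    (yr := fun s z => isg k ((z.deg - 1) * (x.deg + wd s) + 1) • F (z.mul x) s)
    ((hF.2 x).isg fun _ => x.deg) (fun r => ((hF.1 r).mul_left x).isg fun _ => x.deg)
    (fun s => ((hF.1 s).mul_right x).isg fun z => (z - 1) * (x.deg + wd s) + 1)
    (fun r => by rw [Mark.mul_one'])
    (fun s => by
      rw [Mark.one_mul', isg_smul]; exact isg_congr (by push_cast; grind) _) t s y
  simp only [Letter.mark_deg] at h
  rw [D1, h, D2]
  clear h
  simp only [iota]
  refine iota_aux ?_ (slot_eq_neg 1 (x.deg + 1) _ ?_ ?_ ?_ ?_) ?_ (slot_eq_neg 0 (x.deg + wd t + 1) _ ?_ ?_ ?_ ?_) ?_ ?_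
  · exact neg_one_pow_isg (by push_cast; grind) _
  · push_cast; grind
  · intro u; simp only [isg_smul]; exact isg_congr (by push_cast; grind) _
  · intro b u; simp only [isg_smul]; exact isg_congr (by push_cast; grind) _
  · intro u b; simp only [isg_smul]; exact isg_congr (by push_cast; grind) _
  · simp only [isg_smul]; exact neg_one_pow_isg (by push_cast; grind) _
  · push_cast; grind
  · intro u; simp only [isg_smul]; exact isg_congr (by push_cast; grind) _
  · intro b u; simp only [isg_smul]; exact isg_congr (by push_cast; grind) _
  · intro u b; simp only [isg_smul]; exact isg_congr (by push_cast; grind [icast_sq]) _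
  · cases t
    · simp only [nilc_nil, isg_smul]; exact isg_eq_one (by push_cast; grind) _
    · simp
  · cases s
    · simp only [nilc_nil, isg_smul]; exact neg_one_pow_isg (by push_cast; grind [icast_sq]) _
    · simp

/-! ### The Casimir element -/

/-- Bilinear functions of two homogeneous elements. -/
def BiLin (F : S.Mark → S.Mark → M) : Prop := (∀ z, Lin fun y => F y z) ∧ ∀ y, Lin (F y)

lemma BiLin.isg {F : S.Mark → S.Mark → M} (hF : BiLin F) (s : ℤ → ℤ → ℤ) :
    BiLin fun y z => isg k (s y.deg z.deg) • F y z :=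
  ⟨fun z => (hF.1 z).isg fun i => s i z.deg, fun y => (hF.2 y).isg (s y.deg)⟩

lemma BiLin.flip {F : S.Mark → S.Mark → M} (hF : BiLin F) : BiLin fun y z => F z y := ⟨hF.2, hF.1⟩

variable (S) in
/-- An element of degree `m` of `A ⊗ A`, as a sum of homogeneous pure tensors, with the
properties of the coproduct of `1` in a symmetric open Frobenius algebra of degree `m`. -/
structure Casimir (m : ℤ) where
  /-- the number of summands -/
  n : ℕ
  /-- the first factors -/
  p : Fin n → S.Mark
  /-- the second factors -/
  q : Fin n → S.Mark
  deg : ∀ i, (p i).deg + (q i).deg = m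
  comm : ∀ a : S.Mark, ∑ i, (a.val * (p i).val) ⊗ₜ[k] (q i).val = ∑ i, (p i).val ⊗ₜ[k] ((q i).val * a.val)
  symm : ∑ i, (p i).val ⊗ₜ[k] (q i).val = ∑ i, isg k ((p i).deg * (q i).deg) • ((q i).val ⊗ₜ[k] (p i).val)
  diff : ∑ i, (S.d (p i).val ⊗ₜ[k] (q i).val + isg k ((p i).deg + m) • ((p i).val ⊗ₜ[k] S.d (q i).val)) = 0

namespace Casimir

variable {m : ℤ} (ω : S.Casimir m)

/-- The value of a bilinear function on the Casimir element. -/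
def cas (F : S.Mark → S.Mark → M) : M := ∑ i, F (ω.p i) (ω.q i)

lemma cas_congr {F G : S.Mark → S.Mark → M} (h : ∀ p q, p.deg + q.deg = m → F p q = G p q) :
    ω.cas F = ω.cas G := Finset.sum_congr rfl fun i _ => h _ _ (ω.deg i)

lemma cas_add (F G : S.Mark → S.Mark → M) :
    ω.cas (fun p q => F p q + G p q) = ω.cas F + ω.cas G := Finset.sum_add_distrib

lemma cas_neg (F : S.Mark → S.Mark → M) : ω.cas (fun p q => -F p q) = -ω.cas F := Finset.sum_neg_distrib _

lemma cas_zero : ω.cas (fun _ _ => (0 : M)) = 0 := Finset.sum_const_zero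

lemma map_cas (φ : M →ₗ[k] N) (F : S.Mark → S.Mark → M) : φ (ω.cas F) = ω.cas fun p q => φ (F p q) := map_sum φ _ _

lemma cas_smul (c : k) (F : S.Mark → S.Mark → M) : ω.cas (fun p q => c • F p q) = c • ω.cas F := Finset.smul_sum.symm

lemma cas_spl (f : S.Mark → S.Mark → S.Wd → S.Wd → M) (t) :
    ω.cas (fun p q => spl (f p q) t) = spl (fun u v => ω.cas fun p q => f p q u v) t :=
  (spl_sum t Finset.univ fun i => f (ω.p i) (ω.q i)).symm

lemma slot_cas (f : S.Mark → S.Mark → S.Wd → M) (gl : S.Mark → S.Mark → S.Letter → S.Wd → M)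
    (gr : S.Mark → S.Mark → S.Wd → S.Letter → M) (t) :
    slot (fun t => ω.cas fun p q => f p q t) (fun b t => ω.cas fun p q => gl p q b t)
      (fun t b => ω.cas fun p q => gr p q t b) t =
      ω.cas fun p q => slot (f p q) (gl p q) (gr p q) t :=
  slot_sum Finset.univ (fun i => f (ω.p i) (ω.q i)) (fun i => gl (ω.p i) (ω.q i)) (fun i => gr (ω.p i) (ω.q i)) t

/-- `a p ⊗ q = p ⊗ q a`. -/
lemma cas_mul {F : S.Mark → S.Mark → M} (hF : BiLin F) (a : S.Mark) :
    (ω.cas fun p q => F (a.mul p) q) = ω.cas fun p q => F p (q.mul a) := by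
  obtain ⟨φ, hφ⟩ := exists_linear_tensor hF.1 hF.2
  have := congrArg φ (ω.comm a)
  simp only [map_sum] at this
  simp only [cas, ← hφ]; exact this

/-- `p ⊗ q = (-1)^{|p||q|} q ⊗ p`. -/
lemma cas_symm {F : S.Mark → S.Mark → M} (hF : BiLin F) : ω.cas F = ω.cas fun p q => isg k (p.deg * q.deg) • F q p := by
  obtain ⟨φ, hφ⟩ := exists_linear_tensor hF.1 hF.2
  have := congrArg φ ω.symm
  simp only [map_sum, map_smul] at this
  simp only [cas, ← hφ]; exact this

lemma cas_d {F : S.Mark → S.Mark → M} (hF : BiLin F) :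
    ω.cas (fun p q => F p.d q) + ω.cas (fun p q => isg k (p.deg + m) • F p q.d) = 0 := by
  obtain ⟨φ, hφ⟩ := exists_linear_tensor hF.1 hF.2
  have := congrArg φ ω.diff
  simp only [map_sum, map_smul, map_add, map_zero] at this
  rw [← cas_add]
  simp only [cas, ← hφ]; exact this

/-- `p ⊗ a q = (-1)^{(m + 1)|a|} p a ⊗ q`. -/
lemma cas_mul' {F : S.Mark → S.Mark → M} (hF : BiLin F) (a : S.Mark) :
    (ω.cas fun p q => F p (a.mul q)) = ω.cas fun p q => isg k ((m + 1) * a.deg) • F (p.mul a) q := by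
  have h1 : BiLin fun y z => F y (a.mul z) := ⟨fun z => hF.1 _, fun y => (hF.2 y).mul_left a⟩
  have h2 : BiLin fun y z => F (y.mul a) z := ⟨fun z => (hF.1 z).mul_right a, fun y => hF.2 _⟩
  rw [ω.cas_symm h1, ω.cas_symm (h2.isg fun _ _ => (m + 1) * a.deg)]
  have h3 := ω.cas_mul (hF.flip.isg fun i j => (i - a.deg) * j) a
  rw [← ω.cas_congr (F := fun p q => OpenFrobenius.isg k (((a.mul p).deg - a.deg) * q.deg) • F q (a.mul p)), h3]
  · refine ω.cas_congr fun p q h => ?_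
    rw [isg_smul]; refine isg_congr ?_ _
    rw [← h]; push_cast; grind [icast_sq]
  · intro p q h
    refine isg_congr ?_ _
    push_cast; grind

end Casimir

/-! ### Splitting a slot by the Casimir element -/

namespace Casimir

variable {m : ℤ} (ω : S.Casimir m)

/-- The slot `t = t₁ t₂ t₃` is replaced by `t₁ p t₃`, and `q t₂` is split off. -/
def pinch (G : S.Wd → S.Fn M) : S.Wd → M := spl fun t1 => spl fun t2 t3 => ω.cas fun p q =>
    isg k (wd t3 * (m + q.deg + wd t2)) • G t1 p t3 q t2

lemma pinch_congr {G G' : S.Wd → S.Fn M} (t) (h : ∀ t1 t2 t3 p q, t1 ++ t2 ++ t3 = t → p.deg + q.deg = m →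
      G t1 p t3 q t2 = G' t1 p t3 q t2) : ω.pinch G t = ω.pinch G' t := by
  refine spl_congr' _ fun u v huv => spl_congr' _ fun u' v' huv' => ω.cas_congr fun p q hpq => ?_
  rw [h u u' v' p q (by rw [List.append_assoc, huv', huv]) hpq]

lemma pinch_add (G G' : S.Wd → S.Fn M) (t) : ω.pinch (fun t1 p t3 q t2 => G t1 p t3 q t2 + G' t1 p t3 q t2) t =
      ω.pinch G t + ω.pinch G' t := by
  refine (spl_congr' t fun u v _ => (spl_congr' v fun u' v' _ => ?_).trans (spl_add _ _ v)).trans (spl_add _ _ t)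
  simp only [smul_add, cas_add]

lemma pinch_smul (c : k) (G : S.Wd → S.Fn M) (t) :
    ω.pinch (fun t1 p t3 q t2 => c • G t1 p t3 q t2) t = c • ω.pinch G t := by
  refine (spl_congr' t fun u v _ => (spl_congr' v fun u' v' _ => ?_).trans (spl_smul _ v c)).trans (spl_smul _ t c)
  simp only [smul_comm _ c, cas_smul]

lemma map_pinch (φ : M →ₗ[k] N) (G : S.Wd → S.Fn M) (t) :
    φ (ω.pinch G t) = ω.pinch (fun t1 p t3 q t2 => φ (G t1 p t3 q t2)) t := by
  simp only [pinch, map_spl, map_cas, map_smul]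

lemma slot_pinch (c : ℤ)
    {G : S.Wd → S.Fn M}
    (hG : ∀ t1 t3 t2, BiLin fun p q => G t1 p t3 q t2)
    (gl : S.Letter → S.Wd → S.Fn M)
    (gr : S.Wd → S.Mark → S.Wd → S.Letter → S.Mark → S.Wd → M) (t) :
    slot (fun t => isg k c • ω.pinch G t) (fun b => ω.pinch (gl b)) (fun u b => ω.pinch (fun t1 p t3 q t2 =>
        isg k ((b.deg - 1) * (m + q.deg + wd t2)) • gr t1 p t3 b q t2) u) t =
    ω.pinch (fun t1 p t3 q t2 =>
      slot (fun t1 => isg k c • G t1 p t3 q t2) (fun b t1 => gl b t1 p t3 q t2)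
        (fun u b => isg k (c + wd u + 1) • G u (b.mark.mul p) t3 q t2) t1
      + (isg k (c + wd t1) • G t1 p.d t3 q t2 + slot (fun t3 => isg k (c + wd t1 + p.deg) • G t1 p t3 q t2)
          (fun b t3 => isg k (c + wd t1 + p.deg) • G t1 (p.mul b.mark) t3 q t2)
          (fun t3 b => gr t1 p t3 b q t2) t3)
      + isg k (m + c + wd t1 + p.deg + wd t3) • (G t1 p t3 q.d t2 + slot (fun t2 => isg k q.deg • G t1 p t3 q t2)
          (fun b t2 => isg k q.deg • G t1 p t3 (q.mul b.mark) t2)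
          (fun u b => isg k ((b.deg - 1) * (q.deg + wd u) + 1) • G t1 p t3 (b.mark.mul q) u) t2)) t := by
  simp only [pinch, ← spl_smul]
  rw [slot_spl (c := fun u b w => spl (fun t2 t3 => ω.cas fun p q =>
    isg k (wd t3 * (m + q.deg + wd t2)) • isg k (c + wd u + 1) • G u (b.mark.mul p) t3 q t2) w)]
  refine spl_congr' _ fun t1 w _ => ?_
  rw [slot_spl_comm]
  simp only [← spl_smul, ← spl_neg]
  rw [slot_spl (c := fun u b t3 => ω.cas fun p q =>
    isg k (wd t3 * (m + q.deg + wd u + (b.deg - 1))) • isg k (m + c + wd t1 + p.deg + wd t3) •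
      isg k ((b.deg - 1) * (q.deg + wd u) + 1) • G t1 p t3 (b.mark.mul q) u), ← spl_add]
  refine spl_congr' _ fun t2 t3 _ => ?_
  simp only [smul_add, cas_add]
  have hd : ω.cas (fun p q => isg k (wd t3 * (m + q.deg + wd t2)) • isg k (c + wd t1) • G t1 p.d t3 q t2)
      + ω.cas (fun p q => isg k (wd t3 * (m + q.deg + wd t2)) •
          isg k (m + c + wd t1 + p.deg + wd t3) • G t1 p t3 q.d t2) = 0 := by
    have := ω.cas_d ((hG t1 t3 t2).isg fun i j => wd t3 * (m + j + wd t2) + (c + wd t1))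
    rw [← this]
    congr 1 <;> refine ω.cas_congr fun p q h => ?_
    · rw [isg_smul]
    · simp only [isg_smul]
      exact isg_congr (by push_cast; grind) _
  have e1 : ∀ {a b d e f X Y Z : M}, a = X → b = Y → d = Z → e + f = 0 → X + (Y + Z) = a + (e + d) + (f + b) := by
    rintro _ _ _ e f X Y Z rfl rfl rfl h
    rw [eq_neg_of_add_eq_zero_right h]; abel
  refine e1 ?_ ?_ ?_ hd
  · simp only [← slot_smul]
    rw [← slot_cas]
    refine slot_congr _ (fun u => ?_) (fun b u _ => rfl) (fun u b _ => rfl)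
    rw [← cas_smul]
    exact ω.cas_congr fun p q _ => smul_comm _ _ _
  · have key : ∀ p q : S.Mark, isg k (wd t3 * (m + q.deg + wd t2)) • isg k (m + c + wd t1 + p.deg + wd t3) •
          slot (fun t2 => isg k q.deg • G t1 p t3 q t2) (fun b t2 => isg k q.deg • G t1 p t3 (q.mul b.mark) t2)
            (fun u b => isg k ((b.deg - 1) * (q.deg + wd u) + 1) • G t1 p t3 (b.mark.mul q) u) t2 =
        slot (fun u => isg k ((wd u + 1) * wd t3 + (wd t3 * (m + q.deg) +
            (m + c + wd t1 + p.deg + wd t3))) • isg k q.deg • G t1 p t3 q u)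
          (fun b u => isg k ((b.deg - 1 + wd u) * wd t3 + (wd t3 * (m + q.deg) +
            (m + c + wd t1 + p.deg + wd t3))) • isg k q.deg • G t1 p t3 (q.mul b.mark) u)
          (fun u b => isg k ((wd u + (b.deg - 1)) * wd t3 + (wd t3 * (m + q.deg) + (m + c + wd t1 + p.deg + wd t3))) •
            isg k ((b.deg - 1) * (q.deg + wd u) + 1) • G t1 p t3 (b.mark.mul q) u) t2 := by
      intro p q
      rw [isg_smul]
      refine (isg_congr ?_ _).trans (slot_isg _ _ t2 (fun _ => rfl) (fun _ _ => rfl) (fun _ _ => rfl)).symm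
      push_cast; ring
    simp only [key]
    rw [← slot_cas]
    refine slot_congr _ (fun u => ?_) (fun b u _ => ?_) (fun u b _ => ?_)
    · change _ = isg k (wd t1) • _
      rw [← cas_smul, ← cas_smul]
      refine ω.cas_congr fun p q h => ?_
      simp only [isg_smul]
      refine isg_congr ?_ _
      rw [← h]; push_cast; clear * -; grind [icast_sq]
    · have := ω.cas_mul ((hG t1 t3 u).isg fun i j =>
        wd t3 * (m + j + wd u) + (c + wd t1)) b.mark
      rw [← cas_neg]
      refine Eq.trans (ω.cas_congr fun p q h => ?_) (this.symm.trans (ω.cas_congr fun p q h => ?_))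
      · simp only [isg_smul]
        refine isg_congr ?_ _
        rw [← h]; push_cast; clear * -; grind [icast_sq]
      · simp only [isg_smul, neg_isg_smul]
        refine isg_congr ?_ _; push_cast; clear * -; grind [icast_sq]
    · refine ω.cas_congr fun p q h => ?_
      simp only [isg_smul]
      refine isg_congr ?_ _; push_cast; clear * -; grind [icast_sq]
  · have key : ∀ p q : S.Mark, isg k (wd t3 * (m + q.deg + wd t2)) •
        slot (fun t3 => isg k (c + wd t1 + p.deg) • G t1 p t3 q t2)
          (fun b t3 => isg k (c + wd t1 + p.deg) • G t1 (p.mul b.mark) t3 q t2)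
          (fun t3 b => gr t1 p t3 b q t2) t3 =
        slot (fun u => isg k ((wd u + 1) * (m + q.deg + wd t2) + 0) • isg k (c + wd t1 + p.deg) • G t1 p u q t2)
          (fun b u => isg k ((b.deg - 1 + wd u) * (m + q.deg + wd t2) + 0) •
            isg k (c + wd t1 + p.deg) • G t1 (p.mul b.mark) u q t2)
          (fun u b => isg k ((wd u + (b.deg - 1)) * (m + q.deg + wd t2) + 0) • gr t1 p u b q t2) t3 := by
      intro p q
      refine (isg_congr ?_ _).trans (slot_isg _ _ t3 (fun _ => rfl) (fun _ _ => rfl) (fun _ _ => rfl)).symm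
      push_cast; ring
    simp only [key]
    rw [← slot_cas]
    refine slot_congr _ (fun u => ?_) (fun b u _ => ?_) (fun u b _ => ?_)
    · change _ = isg k (wd t2) • isg k (wd t1) • _
      simp only [← cas_smul]
      refine ω.cas_congr fun p q h => ?_
      simp only [isg_smul]
      refine isg_congr ?_ _
      rw [← h]; push_cast; clear * -; grind [icast_sq]
    · have := ω.cas_mul' ((hG t1 u t2).isg fun i j =>
        wd u * (m + (j - b.deg) + wd t2 + (b.deg - 1)) + (m + c + wd t1 + i + wd u) +
          ((b.deg - 1) * (j - b.deg + wd t2))) b.mark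
      refine Eq.trans (ω.cas_congr fun p q h => ?_) (this.symm.trans
        (Eq.trans (ω.cas_congr fun p q h => ?_) (ω.cas_neg _)))
      · simp only [isg_smul]
        refine isg_congr ?_ _
        rw [← h]; push_cast; clear * -; grind [icast_sq]
      · simp only [isg_smul, neg_isg_smul]
        refine isg_congr ?_ _; push_cast; clear * -; grind [icast_sq]
    · refine ω.cas_congr fun p q h => ?_
      simp only [isg_smul]
      refine isg_congr ?_ _; push_cast; clear * -; grind [icast_sq]

end Casimir

lemma Lin.leibniz {F : S.Mark → M} (hF : Lin F) (x y : S.Mark) :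
    F (x.mul y).d = F (x.d.mul y) + OpenFrobenius.isg k x.deg • F (x.mul y.d) := by
  obtain ⟨φ, hφ⟩ := hF.exists_linear
  rw [← hφ, ← hφ, ← hφ, ← map_smul, ← map_add]
  exact congrArg φ (S.leibniz _ _ x.mem _)

lemma slot_smul_eq (n c : ℤ) {a a' a'' : ℤ} {f f' : S.Wd → M} {gl gl' gr gr'} {t}
    (ha : ((a + (wd t * n + c) : ℤ) : ZMod 2) = ((a' + a'' : ℤ) : ZMod 2))
    (hf : ∀ u, f' u = isg k ((wd u + 1) * n + c) • f u)
    (hl : ∀ b u, gl' b u = isg k ((b.deg - 1 + wd u) * n + c) • gl b u)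
    (hr : ∀ u b, gr' u b = isg k ((wd u + (b.deg - 1)) * n + c) • gr u b) :
    isg k a • slot f' gl' gr' t = isg k a' • isg k a'' • slot f gl gr t := by
  rw [slot_isg n c t hf hl hr, isg_smul, isg_smul]
  exact isg_congr ha _

namespace Casimir

variable {m : ℤ} (ω : S.Casimir m)

/-- The coproduct, on functions of two chains. -/
def split (G : S.Fn M) (x : S.Mark) : S.Wd → M :=
  spl fun t1 t2 => ω.cas fun p q => isg k (p.deg * (x.deg + wd t1)) • G (p.mul x) t1 q t2

/-- The differential on functions of two chains. -/
def _root_.OpenFrobenius.DGAug.D11 (m : ℤ) (G : S.Fn M) (x : S.Mark) (t : S.Wd) (y : S.Mark) (s : S.Wd) : M :=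
  D1 (fun x t => G x t y s) x t + isg k (m + x.deg + wd t) • D1 (G x t) y s

lemma D1_split {G : S.Fn M} (hG : ∀ t s, BiLin fun x y => G x t y s) (x t) :
    D1 (ω.split G) x t = ω.split (D11 m G) x t := by
  have e : ∀ u (b : S.Letter), isg k ((b.deg - 1) * (x.deg + wd u) + 1) • ω.split G (b.mark.mul x) u =
      spl (fun t1 t2 => ω.cas fun p q => isg k ((b.deg - 1) * (x.deg + (wd t1 + wd t2)) + 1 +
        p.deg * ((b.mark.mul x).deg + wd t1)) • G (p.mul (b.mark.mul x)) t1 q t2) u := by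
    intro u b
    rw [split, ← spl_smul]
    refine spl_congr' _ ?_
    rintro t1 t2 rfl
    simp only [← cas_smul, isg_smul, wd_append]
  simp only [D1, e]
  simp only [split, ← spl_smul]
  rw [slot_spl (c := fun u b t2 => ω.cas fun p q => isg k (p.deg * (x.deg + (wd u + (b.deg - 1)))) •
    isg k ((b.deg - 1) * (p.deg + x.deg + wd u) + 1) • G (b.mark.mul (p.mul x)) u q t2), ← spl_add]
  refine spl_congr' _ fun t1 t2 _ => ?_
  simp only [D11, D1, smul_add, cas_add]
  have hx : ∀ t1 t2, BiLin fun p q => G (p.mul x) t1 q t2 := fun t1 t2 =>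
    ⟨fun q => ((hG t1 t2).1 q).mul_right x, fun p => (hG t1 t2).2 _⟩
  have hd : ω.cas (fun p q => isg k (p.deg * (x.deg + wd t1)) • G (p.mul x).d t1 q t2)
      + ω.cas (fun p q => isg k (p.deg * (x.deg + wd t1)) • isg k (m + (p.mul x).deg + wd t1) • G (p.mul x) t1 q.d t2) =
      ω.cas (fun p q => isg k (p.deg * (x.d.deg + wd t1)) • G (p.mul x.d) t1 q t2) := by
    have := ω.cas_d ((hx t1 t2).isg fun i j => (i - 1) * (x.deg + wd t1))
    have h1 : ∀ p q : S.Mark, isg k (p.deg * (x.deg + wd t1)) • G (p.mul x).d t1 q t2 =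
        isg k ((p.d.deg - 1) * (x.deg + wd t1)) • G (p.d.mul x) t1 q t2
          + isg k (p.deg * (x.d.deg + wd t1)) • G (p.mul x.d) t1 q t2 := by
      intro p q
      rw [show G (p.mul x).d t1 q t2 = _ from ((hG t1 t2).1 q).leibniz p x, smul_add, isg_smul]
      congr 1 <;> refine isg_congr ?_ _ <;> push_cast <;> ring
    simp only [h1, cas_add]
    rw [add_right_comm, eq_comm, ← sub_eq_iff_eq_add, sub_self, ← this]
    congr 1
    refine ω.cas_congr fun p q h => ?_
    simp only [isg_smul]
    refine isg_congr ?_ _; push_cast; clear * -; grind [icast_sq]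
  have e1 : ∀ {a b d e f X Y : M}, a = X → b = Y → e + f = d → d + (X + Y) = e + a + (f + b) := by
    rintro _ _ _ e f X Y rfl rfl rfl
    abel
  refine e1 ?_ ?_ hd
  · have key : ∀ p q : S.Mark, isg k (p.deg * (x.deg + wd t1)) •
          slot (fun t1 => isg k (p.mul x).deg • G (p.mul x) t1 q t2)
            (fun b t1 => isg k (p.mul x).deg • G ((p.mul x).mul b.mark) t1 q t2)
            (fun u b => isg k ((b.deg - 1) * ((p.mul x).deg + wd u) + 1) • G (b.mark.mul (p.mul x)) u q t2) t1 =
        slot (fun u => isg k ((wd u + 1) * p.deg + p.deg * x.deg) • isg k (p.mul x).deg • G (p.mul x) u q t2)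
          (fun b u => isg k ((b.deg - 1 + wd u) * p.deg + p.deg * x.deg) •
            isg k (p.mul x).deg • G ((p.mul x).mul b.mark) u q t2)
          (fun u b => isg k ((wd u + (b.deg - 1)) * p.deg + p.deg * x.deg) •
            isg k ((b.deg - 1) * ((p.mul x).deg + wd u) + 1) • G (b.mark.mul (p.mul x)) u q t2) t1 := by
      intro p q
      refine (isg_congr ?_ _).trans (slot_isg _ _ t1 (fun _ => rfl) (fun _ _ => rfl) (fun _ _ => rfl)).symm
      push_cast; ring
    simp only [key]
    rw [← slot_cas]
    refine slot_congr _ (fun u => ?_) (fun b u _ => ?_) (fun u b _ => ?_)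
    · rw [← cas_smul]
      refine ω.cas_congr fun p q h => ?_
      simp only [isg_smul]
      refine isg_congr ?_ _; push_cast; clear * -; grind [icast_sq]
    · rw [← cas_smul]
      refine ω.cas_congr fun p q h => ?_
      simp only [isg_smul, Mark.mul_assoc']
      refine isg_congr ?_ _; push_cast; clear * -; grind [icast_sq]
    · refine ω.cas_congr fun p q h => ?_
      simp only [isg_smul]
      refine isg_congr ?_ _; push_cast; clear * -; grind [icast_sq]
  · have key : ∀ p q : S.Mark, isg k (p.deg * (x.deg + wd t1)) • isg k (m + (p.mul x).deg + wd t1) •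
          slot (fun t2 => isg k q.deg • G (p.mul x) t1 q t2)
            (fun b t2 => isg k q.deg • G (p.mul x) t1 (q.mul b.mark) t2)
            (fun u b => isg k ((b.deg - 1) * (q.deg + wd u) + 1) • G (p.mul x) t1 (b.mark.mul q) u) t2 =
        isg k (p.deg * (x.deg + wd t1) + (m + (p.mul x).deg + wd t1)) • 
          slot (fun t2 => isg k q.deg • G (p.mul x) t1 q t2)
            (fun b t2 => isg k q.deg • G (p.mul x) t1 (q.mul b.mark) t2)
            (fun u b => isg k ((b.deg - 1) * (q.deg + wd u) + 1) • G (p.mul x) t1 (b.mark.mul q) u) t2 :=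
      fun p q => isg_smul _ _ _
    simp only [key, ← slot_smul]
    rw [← slot_cas]
    refine slot_congr _ (fun u => ?_) (fun b u _ => ?_) (fun u b _ => ?_)
    · change _ = isg k (wd t1) • _
      rw [← cas_smul, ← cas_smul]
      refine ω.cas_congr fun p q h => ?_
      simp only [isg_smul]
      refine isg_congr ?_ _
      rw [← h]; push_cast; clear * -; grind [icast_sq]
    · have := ω.cas_mul ((hx t1 u).isg fun i j => i * (x.deg + wd t1) + wd t1 + x.deg) b.mark
      rw [← cas_neg]
      refine Eq.trans (ω.cas_congr fun p q h => ?_) (this.symm.trans (ω.cas_congr fun p q h => ?_))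
      · simp only [isg_smul]
        refine isg_congr ?_ _
        rw [← h]; push_cast; clear * -; grind [icast_sq]
      · simp only [isg_smul, neg_isg_smul, Mark.mul_assoc']
        refine isg_congr ?_ _; push_cast; clear * -; grind [icast_sq]
    · have := ω.cas_mul' ((hx t1 u).isg fun i j =>
        (b.deg - 1) * (j + wd u) + 1 + i * (x.deg + wd t1) + (j - b.deg) + x.deg + wd t1) b.mark
      refine Eq.trans (ω.cas_congr fun p q h => ?_) (this.trans (ω.cas_congr fun p q h => ?_))
      · simp only [isg_smul]
        refine isg_congr ?_ _
        rw [← h]; push_cast; clear * -; grind [icast_sq]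
      · simp only [isg_smul, Mark.mul_assoc']
        refine isg_congr ?_ _
        rw [← h]; push_cast; clear * -; grind [icast_sq]

/-! ### Pinching in functions of cyclic words -/

/-- The differential of a function of a cyclic word with two marked letters and a chain. -/
def _root_.OpenFrobenius.DGAug.D21 (m : ℤ) (G : S.Mark → S.Wd → S.Fn M)
    (x : S.Mark) (t : S.Wd) (y : S.Mark) (s : S.Wd) (z : S.Mark)
    (r : S.Wd) : M :=
  D2 (fun x t y s => G x t y s z r) x t y s + isg k (m + x.deg + wd t + y.deg + wd s) • D1 (G x t y s) z r

/-- The differential of a function of a cyclic word with three marked letters and a chain. -/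
def _root_.OpenFrobenius.DGAug.D31 (m : ℤ) (G : S.Mark → S.Wd → S.Mark → S.Wd → S.Mark → S.Wd → S.Mark → S.Wd → M)
    (x : S.Mark) (t : S.Wd) (y : S.Mark) (s : S.Wd) (z : S.Mark)
    (r : S.Wd) (a : S.Mark) (l : S.Wd) : M :=
  D3 (fun x t y s z r => G x t y s z r a l) x t y s z r
    + isg k (m + x.deg + wd t + y.deg + wd s + z.deg + wd r) • D1 (G x t y s z r) a l

lemma D1_pinch {G : S.Mark → S.Wd → S.Fn M} (hG : ∀ x t1 t3 t2, BiLin fun p q => G x t1 p t3 q t2) (x t) :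
    D1 (fun x => ω.pinch (G x)) x t = ω.pinch (D21 m G x) t := by
  rw [D1]
  have e : ∀ u (b : S.Letter), isg k ((b.deg - 1) * (x.deg + wd u) + 1) • ω.pinch (G (b.mark.mul x)) u =
      ω.pinch (fun t1 p t3 q t2 => isg k ((b.deg - 1) * (m + q.deg + wd t2)) •
        isg k ((b.deg - 1) * (x.deg + wd t1 + p.deg + wd t3) + 1) • G (b.mark.mul x) t1 p t3 q t2) u := by
    intro u b
    rw [← pinch_smul]
    refine ω.pinch_congr u fun t1 t2 t3 p q h hpq => ?_
    subst h
    rw [isg_smul]; refine isg_congr ?_ _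
    rw [← hpq]; push_cast; clear * -; grind
  have e' : ∀ (b : S.Letter) u, isg k x.deg • ω.pinch (G (x.mul b.mark)) u =
      ω.pinch (fun t1 p t3 q t2 => isg k x.deg • G (x.mul b.mark) t1 p t3 q t2) u :=
    fun b u => (ω.pinch_smul _ _ _).symm
  simp only [e, e']
  have := ω.slot_pinch x.deg (hG x) (fun b t1 p t3 q t2 => isg k x.deg • G (x.mul b.mark) t1 p t3 q t2)
    (fun t1 p t3 b q t2 => isg k ((b.deg - 1) * (x.deg + wd t1 + p.deg + wd t3) + 1) • G (b.mark.mul x) t1 p t3 q t2) t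
  refine (congrArg (ω.pinch (G x.d) t + ·) this).trans ?_
  rw [← pinch_add]
  refine ω.pinch_congr t fun t1 t2 t3 p q h hpq => ?_
  simp only [D21, D2, D1]
  abel

/-- Pinching the first slot of a cyclic word with two marked letters. -/
def pinch2 (G : S.Mark → S.Wd → S.Mark → S.Wd → S.Mark → S.Wd → S.Mark → S.Wd → M)
    (x : S.Mark) (t : S.Wd) (y : S.Mark) (s : S.Wd) : M :=
  ω.pinch (fun t1 p t3 q t2 => isg k ((m + q.deg + wd t2) * (y.deg + wd s)) • G x t1 p t3 y s q t2) t

lemma slot_pinch_comm (f : S.Wd → S.Wd → S.Fn M) (gl : S.Letter → S.Wd → S.Wd → S.Fn M)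
    (gr : S.Wd → S.Letter → S.Wd → S.Fn M)
    (s t) :
    slot (fun s => ω.pinch (f s) t) (fun b s => ω.pinch (gl b s) t) (fun s b => ω.pinch (gr s b) t) s =
      ω.pinch (fun t1 p t3 q t2 => slot (fun s => f s t1 p t3 q t2) (fun b s => gl b s t1 p t3 q t2)
        (fun s b => gr s b t1 p t3 q t2) s) t := by
  simp only [pinch]
  rw [slot_spl_comm]
  refine spl_congr' _ fun u v _ => ?_
  rw [slot_spl_comm]
  refine spl_congr' _ fun u v _ => ?_
  rw [slot_cas]
  simp only [slot_smul]

lemma D2_pinch2 {G : S.Mark → S.Wd → S.Mark → S.Wd → S.Mark → S.Wd → S.Mark → S.Wd → M}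
    (hG : ∀ x t1 t3 y s t2, BiLin fun p q => G x t1 p t3 y s q t2) (x t y s) :
    D2 (ω.pinch2 G) x t y s = ω.pinch2 (D31 m G) x t y s := by
  rw [D2]
  have e : ∀ u (b : S.Letter), isg k (x.deg + wd u + 1) • ω.pinch2 G x u (b.mark.mul y) s =
      ω.pinch (fun t1 p t3 q t2 => isg k ((b.deg - 1) * (m + q.deg + wd t2)) •
        isg k (x.deg + wd t1 + p.deg + wd t3 + 1 + (m + q.deg + wd t2) * (y.deg + wd s)) • 
          G x t1 p t3 (b.mark.mul y) s q t2) u := by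
    intro u b
    rw [pinch2, ← pinch_smul]
    refine ω.pinch_congr u fun t1 t2 t3 p q h hpq => ?_
    subst h
    simp only [isg_smul]
    refine isg_congr ?_ _
    rw [← hpq]; push_cast; clear * -; grind
  have e' : ∀ (b : S.Letter) u, isg k x.deg • ω.pinch2 G (x.mul b.mark) u y s =
      ω.pinch (fun t1 p t3 q t2 => isg k x.deg • isg k ((m + q.deg + wd t2) * (y.deg + wd s)) •
        G (x.mul b.mark) t1 p t3 y s q t2) u :=
    fun b u => (ω.pinch_smul _ _ _).symm
  simp only [e, e']
  have := ω.slot_pinch x.deg (fun t1 t3 t2 => (hG x t1 t3 y s t2).isg fun i j => (m + j + wd t2) * (y.deg + wd s))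
    (fun b t1 p t3 q t2 => isg k x.deg • isg k ((m + q.deg + wd t2) * (y.deg + wd s)) •
      G (x.mul b.mark) t1 p t3 y s q t2)
    (fun t1 p t3 b q t2 =>
      isg k (x.deg + wd t1 + p.deg + wd t3 + 1 + (m + q.deg + wd t2) * (y.deg + wd s)) •
      G x t1 p t3 (b.mark.mul y) s q t2) t
  refine Eq.trans (congrArg (fun X => ω.pinch2 G x.d t y s + X +
    (isg k (x.deg + wd t) • ω.pinch2 G x t y.d s + slot _ _ _ s)) this) ?_
  simp only [pinch2, ← pinch_smul]
  rw [slot_pinch_comm]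
  simp only [← pinch_add]
  refine ω.pinch_congr t fun t1 t2 t3 p q h hpq => ?_
  subst h
  simp only [D31, D3, D1]
  have e1 : ∀ {κ c c' : k} {X X' s1 s1' P P' s3 s3' Q Q' s2 s2' Y Y' sy sy' : M}, X' = κ • X →
      s1' = κ • s1 → P' = κ • P → s3' = κ • s3 → c • Q' = κ • c' • Q → c • s2' = κ • c' • s2 →
      Y' = κ • Y → sy' = κ • sy →
      X' + (s1' + (P' + s3') + c • (Q' + s2')) + (Y' + sy') = κ • (X + s1 + (P + s3) + (Y + sy) + c' • (Q + s2)) := by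
    rintro κ c c' X _ s1 _ P _ s3 _ Q Q' s2 s2' Y _ sy _ rfl rfl rfl rfl h1 h2 rfl rfl
    simp only [smul_add, h1, h2]; abel
  refine e1 rfl (slot_eq_isg 0 ((m + q.deg + wd t2) * (y.deg + wd s)) _ ?_ ?_ ?_ ?_) ?_
    (slot_eq_isg 0 ((m + q.deg + wd t2) * (y.deg + wd s)) _ ?_ ?_ ?_ ?_) ?_
    (slot_smul_eq (y.deg + wd s) ((m + q.deg + 1) * (y.deg + wd s)) ?_ ?_ ?_ ?_) ?_
    (slot_eq_isg (m + q.deg + wd t2) ((m + q.deg + wd t2) * y.deg) _ ?_ ?_ ?_ ?_)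
  all_goals first
    | (intros; simp only [isg_smul]; refine isg_congr ?_ _; rw [← hpq]; push_cast; clear * -
       grind [icast_sq])
    | (rw [← hpq]; push_cast; clear * -; grind [icast_sq])

end Casimir

/-! ### Rotations -/

/-- Cyclic rotation of a chain with the letter `1` inserted. -/
def rot (G : S.Fn M) (x : S.Mark) : S.Wd → M :=
  spl fun t1 t2 => isg k ((x.deg + wd t1) * wd t2) • G (Mark.one S) t2 x t1

/-- Cyclic rotation of a cyclic word with two marked letters, with the letter `1` inserted in
the first slot. -/
def rot2 (G : S.Mark → S.Wd → S.Fn M) (x : S.Mark) (t : S.Wd) (y : S.Mark) (s : S.Wd) : M :=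
  spl (fun t1 t2 => isg k ((x.deg + wd t1) * (wd t2 + y.deg + wd s)) • G (Mark.one S) t2 y s x t1) t

lemma Lin.one_d {F : S.Mark → M} (hF : Lin F) : F (Mark.one S).d = 0 := by
  obtain ⟨φ, hφ⟩ := hF.exists_linear
  rw [← hφ]
  simp [S_d_one]

lemma D1_rot {G : S.Fn M} (hG : ∀ t y s, Lin fun x => G x t y s) (x t) : D1 (rot G) x t = rot (D2 G) x t := by
  have e : ∀ u (b : S.Letter), isg k ((b.deg - 1) * (x.deg + wd u) + 1) • rot G (b.mark.mul x) u =
      spl (fun t1 t2 => isg k ((b.deg - 1) * (x.deg + (wd t1 + wd t2)) + 1 +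
        (((b.mark.mul x).deg + wd t1) * wd t2)) • G (Mark.one S) t2 (b.mark.mul x) t1) u := by
    intro u b
    rw [rot, ← spl_smul]
    refine spl_congr' _ ?_
    rintro t1 t2 rfl
    simp only [isg_smul, wd_append]
  simp only [D1, e]
  simp only [rot, ← spl_smul]
  rw [slot_spl (c := fun u b t2 => isg k ((b.deg - 1) * (wd t2 + x.deg + wd u) + 1 +
    (x.deg + (wd u + (b.deg - 1))) * wd t2) • G b.mark t2 x u), ← spl_add]
  refine spl_congr' _ fun t1 t2 _ => ?_
  simp only [D2, (hG t2 x t1).one_d]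
  have e1 : ∀ {κ : k} {X X' s1 s1' s2 s2' : M}, X' = κ • X → s1' = κ • s1 → s2' = κ • s2 →
      X' + (s1' + s2') = κ • (0 + s2 + (X + s1)) := by
    rintro κ X _ s1 _ s2 _ rfl rfl rfl
    simp only [smul_add, smul_zero, zero_add]; abel
  refine e1 ?_ (slot_eq_isg (wd t2) (x.deg * wd t2) _ ?_ ?_ ?_ ?_) (slot_eq_isg (x.deg + wd t1) 0 _ ?_ ?_ ?_ ?_)
  case refine_5 | refine_8 =>
    intros
    simp only [Mark.mul_one', Mark.one_mul', isg_smul, neg_isg_smul]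
    refine isg_congr ?_ _; push_cast; clear * -
    grind [icast_sq]
  case refine_7 =>
    intros; change isg k (wd t1) • _ = _
    simp only [isg_smul]; refine isg_congr ?_ _; push_cast; clear * -
    grind [icast_sq]
  all_goals first
    | (intros; simp only [isg_smul]; refine isg_congr ?_ _; push_cast; clear * -
       grind [icast_sq])
    | (push_cast; clear * -; grind [icast_sq])

lemma D2_rot2 {G : S.Mark → S.Wd → S.Fn M} (hG : ∀ t y s z r, Lin fun x => G x t y s z r) (x t y s) :
    D2 (rot2 G) x t y s = rot2 (D3 G) x t y s := by
  have e : ∀ u (b : S.Letter), isg k (x.deg + wd u + 1) • rot2 G x u (b.mark.mul y) s =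
      spl (fun t1 t2 => isg k (x.deg + (wd t1 + wd t2) + 1 +
        ((x.deg + wd t1) * (wd t2 + (b.mark.mul y).deg + wd s))) •
          G (Mark.one S) t2 (b.mark.mul y) s x t1) u := by
    intro u b
    rw [rot2, ← spl_smul]
    refine spl_congr' _ ?_
    rintro t1 t2 rfl
    simp only [isg_smul, wd_append]
  simp only [D2, e]
  simp only [rot2, ← spl_smul]
  rw [slot_spl (g := fun u v => isg k x.deg • isg k ((x.deg + wd u) * (wd v + y.deg + wd s)) • G (Mark.one S) v y s x u)
    (gl := fun b u v => isg k x.deg • isg k (((x.mul b.mark).deg + wd u) * (wd v + y.deg + wd s)) •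
      G (Mark.one S) v y s (x.mul b.mark) u)
    (c := fun u b t2 => isg k ((b.deg - 1) * (wd t2 + y.deg + wd s + x.deg + wd u) + 1 +
    (x.deg + (wd u + (b.deg - 1))) * (wd t2 + y.deg + wd s)) • G b.mark t2 y s x u),
    slot_spl_comm]
  simp only [← spl_add]
  refine spl_congr' _ ?_
  rintro t1 t2 rfl
  simp only [D3, (hG t2 y s x t1).one_d]
  have e1 : ∀ {κ : k} {X X' s1 s1' s2 s2' Y Y' s3 s3' : M}, X' = κ • X →
      s1' = κ • s1 → s2' = κ • s2 → Y' = κ • Y → s3' = κ • s3 → 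
      X' + (s1' + s2') + (Y' + s3') = κ • (0 + s2 + (Y + s3) + (X + s1)) := by
    rintro κ X _ s1 _ s2 _ Y _ s3 _ rfl rfl rfl rfl rfl
    simp only [smul_add, smul_zero, zero_add]; abel
  refine e1 ?_ (slot_eq_isg (wd t2 + y.deg + wd s) (x.deg * (wd t2 + y.deg + wd s)) _ ?_ ?_ ?_ ?_)
    (slot_eq_isg (x.deg + wd t1) ((x.deg + wd t1) * (y.deg + wd s)) _ ?_ ?_ ?_ ?_) ?_
    (slot_eq_isg (x.deg + wd t1) ((x.deg + wd t1) * (wd t2 + y.deg)) _ ?_ ?_ ?_ ?_)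
  case refine_5 | refine_8 =>
    intros
    simp only [Mark.mul_one', Mark.one_mul', isg_smul, neg_isg_smul]
    refine isg_congr ?_ _; push_cast; clear * -
    grind [icast_sq]
  case refine_7 =>
    intros; change isg k (wd t1) • _ = _
    simp only [isg_smul]; refine isg_congr ?_ _; push_cast; clear * -
    grind [icast_sq]
  all_goals first
    | (intros; simp only [isg_smul]; refine isg_congr ?_ _; push_cast; clear * -
       grind [icast_sq])
    | (push_cast; clear * -; grind [icast_sq])

/-! ### Insertion of a third marked letter -/

/-- Demoting the third marked letter. -/
def iota3 (G : S.Fn M) (x : S.Mark) (t : S.Wd) (y : S.Mark) (s : S.Wd) (z : S.Mark) (r : S.Wd) : M :=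
  isg k (x.deg + wd t + y.deg + wd s) • G x t y (s ++ z.bar :: r)

lemma D3_iota3 {G : S.Fn M} (h1 : ∀ t y s, Lin fun x => G x t y s) (h2 : ∀ x t s, Lin fun y => G x t y s)
    (h3 : ∀ x t y, MultiLin (G x t y)) (x t y s z r) :
    isg k (x.deg + wd t + y.deg + wd s) • D2 G x t y (s ++ z.bar :: r) + D3 (iota3 G) x t y s z r =
      nilc (G x t (y.mul z) r) s - nilc (isg k (z.deg * (x.deg + wd t + y.deg + wd s)) • G (z.mul x) t y s) r := by
  have h := slot_insert (f := fun s => isg k (x.deg + wd t + y.deg) • G x t y s)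
    (yl := fun z r => isg k (x.deg + wd t + y.deg) • G x t (y.mul z) r)
    (yr := fun s z => isg k ((z.deg - 1) * (x.deg + wd t + y.deg + wd s) + 1) • G (z.mul x) t y s)
    ((h3 x t y).isg fun _ => x.deg + wd t + y.deg)
    (fun r => ((h2 x t r).mul_left y).isg fun _ => x.deg + wd t + y.deg)
    (fun s => ((h1 t y s).mul_right x).isg fun z => (z - 1) * (x.deg + wd t + y.deg + wd s) + 1)
    (fun r => by rw [Mark.mul_one'])
    (fun s => by
      rw [Mark.one_mul', isg_smul]; exact isg_congr (by push_cast; grind) _) s r z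
  simp only [Letter.mark_deg] at h
  rw [D2, h, D3]
  clear h
  have e1 : ∀ {a : k} {A A' B B' s1 s1' s2 s2' n1 n1' n2 n2' X X' s0 s0' : M}, X' = -(a • X) →
      s0' = -(a • s0) → A' = -(a • A) →
      s1' = -(a • s1) → B' = -(a • B) → s2' = -(a • s2) → a • n1 = n1' → a • n2 = -n2' →
      a • (X + s0 + (A + (s1 + B + s2 + n1 + n2))) + (X' + s0' + (A' + s1') + (B' + s2')) = n1' - n2' := by
    rintro a A _ B _ s1 _ s2 _ n1 _ n2 n2' X _ s0 _ rfl rfl rfl rfl rfl rfl rfl h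
    simp only [smul_add, h]; abel
  simp only [iota3]
  refine e1 ?_ (slot_eq_neg 1 (x.deg + y.deg + wd s + 1) _ ?_ ?_ ?_ ?_) ?_
    (slot_eq_neg 1 (x.deg + wd t + y.deg + 1) _ ?_ ?_ ?_ ?_) ?_
    (slot_eq_neg 0 (x.deg + wd t + y.deg + wd s + 1) _ ?_ ?_ ?_ ?_) ?_ ?_
  case refine_16 =>
    cases s
    · simp only [nilc_nil, isg_smul]; exact isg_eq_one (by push_cast; grind) _
    · simp
  case refine_17 =>
    cases r
    · simp only [nilc_nil, isg_smul]; exact neg_one_pow_isg (by push_cast; grind [icast_sq]) _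
    · simp
  all_goals first
    | (try simp only [isg_smul]
       refine neg_one_pow_isg ?_ _; push_cast; clear * -
       grind [icast_sq])
    | (intros; simp only [isg_smul]; refine isg_congr ?_ _; push_cast; clear * -
       grind [icast_sq])
    | (push_cast; clear * -; grind [icast_sq])

/-! ### The Hochschild operators on generators -/

lemma cut_word (t : S.Wd) : S.cut (word t) = spl (fun u v => word u ⊗ₜ[k] word v) t := by
  induction t with
  | nil => rw [word_nil, cut, foldT_one]; rfl
  | cons b t ih =>
    rw [word_cons, cut, foldT_ι_mul, spl_cons]
    congr 1
    · change LinearMap.rTensor S.T (S.consL b.val) (S.cut (word t)) = _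
      rw [ih, map_spl]
      refine spl_congr' _ fun u v _ => ?_
      rw [word_cons]; rfl

lemma popL_word (t : S.Wd) : S.popL (word t) = onHead (fun b u => b.val ⊗ₜ[k] word u) t := by
  cases t with
  | nil => rw [word_nil, popL, foldT_one]; rfl
  | cons b t => rw [word_cons, popL, foldT_ι_mul]; simp

lemma popR_word (t : S.Wd) : S.popR (word t) = onLast (fun u b => word u ⊗ₜ[k] b.val) t := by
  induction t with
  | nil => rw [word_nil, popR, foldT_one]; rfl
  | cons b t ih =>
    rw [word_cons, popR, foldT_ι_mul, onLast_cons]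
    congr 1
    · change TensorAlgebra.algebraMapInv (word t) • ((1 : S.T) ⊗ₜ[k] b.val) = _
      cases t with
      | nil => simp
      | cons c t =>
        rw [word_cons, map_mul]
        simp [TensorAlgebra.algebraMapInv]
    · change LinearMap.rTensor S.bar (S.consL b.val) (S.popR (word t)) = _
      rw [ih, map_onLast]
      refine onLast_congr _ fun u v _ => ?_
      rw [word_cons]; rfl

lemma sg_letter (b : S.Letter) : sg S.sgr 1 b.val = isg k (b.deg - 1) • b.val := by
  rw [sg_of_mem S.sgr_internal 1 b.mem_sgr, mul_one]; rfl

lemma sg_mark (e : ZMod 2) (x : S.Mark) :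
    sg S.gr e x.val = ksign k ((x.deg : ZMod 2) * e) • x.val := sg_of_mem S.internal e x.mem

lemma dT_bT_word (t : S.Wd) : S.dT (word t) + S.bT (word t) = dl word t := by
  induction t with
  | nil => rw [word_nil, dT, bT, foldT_one, foldT_one]; simp
  | cons b t ih =>
    rw [word_cons, dT, bT, foldT_ι_mul, foldT_ι_mul]
    change -(TensorAlgebra.ι k (S.toBar (S.d b.val)) * word t) + TensorAlgebra.ι k (sg S.sgr 1 b.val) * S.dT (word t) +
      (lift (S.consL ∘ₗ S.barMul (sg S.sgr 1 b.val)) (S.popL (word t)) +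
        TensorAlgebra.ι k (sg S.sgr 1 b.val) * S.bT (word t)) = _
    have h2 : lift (S.consL ∘ₗ S.barMul (sg S.sgr 1 b.val)) (S.popL (word t)) =
        isg k (b.deg - 1) • onHead (fun c t => word (b.mul c :: t)) t := by
      refine (congrArg _ (popL_word t)).trans ((map_onHead (M := ↥S.bar ⊗[k] S.T) _ _ t).trans ?_)
      rw [← onHead_smul]
      refine onHead_congr _ fun c u _ => ?_
      rw [sg_letter, map_smul]
      simp only [comp_smul, word_cons]
      rfl
    have h3 : dl (fun t => word (b :: t)) t = TensorAlgebra.ι k b.val * dl word t :=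
      (map_dl (mulLeft k (TensorAlgebra.ι k b.val)) word t).symm
    rw [dl_cons, h3, ← ih, h2, sg_letter, map_smul]
    simp only [word_cons, mul_add, smul_add, smul_mul_assoc, Letter.d_val]
    rw [show ksign k ((b.deg - 1 : ℤ) : ZMod 2) = isg k (b.deg - 1) from rfl]
    abel

lemma D_gen' (x : S.Mark) (t : S.Wd) : S.D (gen x t) = D1 gen x t := by
  have hx : sg S.gr 1 x.val = isg k x.deg • x.val := by rw [sg_mark, mul_one]; rfl
  have h0 : S.d₀ (gen x t) = gen x.d t + isg k x.deg • (x.val ⊗ₜ[k] S.dT (word t)) := by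
    rw [d₀, LinearMap.add_apply, gen, map_tmul, map_tmul, hx, smul_tmul']
    rfl
  have h1 : map (sg S.gr 1) S.bT (gen x t) = isg k x.deg • (x.val ⊗ₜ[k] S.bT (word t)) := by
    rw [gen, map_tmul, hx, smul_tmul']
  have h2 : S.dFirst (gen x t) = onHead (fun b u => isg k x.deg • gen (x.mul b.mark) u) t := by
    let Ψ : S.bar ⊗[k] S.T →ₗ[k] S.C := (map (mul' k A ∘ₗ map (sg S.gr 1) S.bar.subtype) .id ∘ₗ
    ((assoc k A S.bar S.T).symm :
      A ⊗[k] (S.bar ⊗[k] S.T) →ₗ[k] (A ⊗[k] S.bar) ⊗[k] S.T)) ∘ₗ TensorProduct.mk k _ _ x.val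
    change Ψ (S.popL (word t)) = _
    refine (congrArg _ (popL_word t)).trans ((map_onHead (M := ↥S.bar ⊗[k] S.T) Ψ _ t).trans ?_)
    refine onHead_congr _ fun b u _ => ?_
    change (sg S.gr 1 x.val * (b.val : A)) ⊗ₜ[k] word u = _
    rw [hx, smul_mul_assoc]
    exact (smul_tmul' _ _ _).symm
  have h3 : S.dLast (gen x t) = onLast (fun u b => isg k ((b.deg - 1) * (x.deg + wd u)) • gen (b.mark.mul x) u) t := by
    let Ψ : S.T ⊗[k] S.bar →ₗ[k] S.C := (map (mul' k A ∘ₗ map S.bar.subtype .id) .id ∘ₗ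
    ((assoc k S.bar A S.T).symm :
      S.bar ⊗[k] (A ⊗[k] S.T) →ₗ[k] (S.bar ⊗[k] A) ⊗[k] S.T) ∘ₗ
    kswap S.cgr S.sgr ∘ₗ
    ((assoc k A S.T S.bar).symm :
      A ⊗[k] (S.T ⊗[k] S.bar) →ₗ[k] (A ⊗[k] S.T) ⊗[k] S.bar)) ∘ₗ TensorProduct.mk k _ _ x.val
    change Ψ (S.popR (word t)) = _
    refine (congrArg _ (popR_word t)).trans ((map_onLast Ψ _ t).trans ?_)
    refine onLast_congr _ fun u b _ => ?_
    have : kswap S.cgr S.sgr (gen x u ⊗ₜ b.val) =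
      ksign k (((x.deg + wd u : ℤ) : ZMod 2) * ((b.deg - 1 : ℤ) : ZMod 2)) • (b.val ⊗ₜ[k] gen x u) :=
      kswap_of_mem S.cgr_internal S.sgr_internal (gen_mem x u) b.mem_sgr
    change map (mul' k A ∘ₗ map S.bar.subtype .id) .id ((assoc k S.bar A S.T).symm (kswap S.cgr S.sgr
        (gen x u ⊗ₜ b.val))) = _
    rw [this, map_smul, map_smul, ← Int.cast_mul, mul_comm]
    rfl
  rw [D, LinearMap.add_apply, d₁, LinearMap.sub_apply, LinearMap.add_apply, h0, h1, h2, h3, D1, slot]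
  have h4 : dl (fun t => isg k x.deg • gen x t) t = isg k x.deg • (x.val ⊗ₜ[k] dl word t) := by
    rw [dl_smul]
    congr 1
    exact (map_dl (TensorProduct.mk k A S.T x.val) word t).symm
  have h5 : onLast (fun u b => isg k ((b.deg - 1) * (x.deg + wd u) + 1) • gen (b.mark.mul x) u) t =
      -onLast (fun u b => isg k ((b.deg - 1) * (x.deg + wd u)) • gen (b.mark.mul x) u) t := by
    rw [← onLast_neg]; simp only [neg_isg_smul]
  rw [h4, h5, ← dT_bT_word, tmul_add, smul_add]
  abel

lemma D_gen (φ : S.C →ₗ[k] M) (x : S.Mark) (t : S.Wd) : φ (S.D (gen x t)) = D1 (fun x t => φ (gen x t)) x t := by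
  rw [D_gen', map_D1]

lemma B_gen (φ : S.C →ₗ[k] M) (x : S.Mark) (t : S.Wd) : φ (S.B (gen x t)) = rot (iota fun x t => φ (gen x t)) x t := by
  let Ψ : S.T ⊗[k] S.T →ₗ[k] M := φ ∘ₗ (TensorProduct.mk k A S.T 1 ∘ₗ mul' k S.T ∘ₗ kswap S.tgr S.tgr ∘ₗ
    map (lift (S.consL ∘ₗ S.toBar)) .id ∘ₗ
    ((assoc k A S.T S.T).symm :
      A ⊗[k] (S.T ⊗[k] S.T) →ₗ[k] (A ⊗[k] S.T) ⊗[k] S.T)) ∘ₗ TensorProduct.mk k _ _ x.val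
  change Ψ (S.cut (word t)) = _
  rw [cut_word, map_spl, rot]
  refine spl_congr' _ fun u v _ => ?_
  have : kswap S.tgr S.tgr (word (x.bar :: u) ⊗ₜ word v) =
      ksign k (((wd (x.bar :: u) : ℤ) : ZMod 2) * ((wd v : ℤ) : ZMod 2)) • (word v ⊗ₜ[k] word (x.bar :: u)) :=
      kswap_of_mem tgr_internal tgr_internal (word_mem _) (word_mem _)
  have h2 : word (x.bar :: u) = TensorAlgebra.ι k (S.toBar x.val) * word u := by simp
  rw [h2] at this
  change φ (TensorProduct.mk k A S.T 1 (mul' k S.T (kswap S.tgr S.tgr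
    ((TensorAlgebra.ι k (S.toBar x.val) * word u) ⊗ₜ[k] word v)))) = _
  rw [this, ← h2, ← Int.cast_mul, map_smul, map_smul, map_smul, mul'_apply, ← word_append,
    iota, isg_smul]; refine isg_congr (x := φ (gen (Mark.one S) (v ++ x.bar :: u))) ?_
  push_cast; clear * -; grind [icast_sq]

lemma theta_gen {m : ℤ} (ω : S.Casimir m) {δ : A →ₗ[k] A ⊗[k] A}
    (hω : ∀ x, δ x = ∑ i, isg k (m * (1 + (ω.p i).deg)) • ((ω.p i).val ⊗ₜ[k] ((ω.q i).val * x)))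
    (φ : S.C ⊗[k] S.C →ₗ[k] M) (x : S.Mark) (t : S.Wd) :
    φ (S.thetaShift m δ (gen x t)) = ω.split (fun x t y s => φ (gen x t ⊗ₜ gen y s)) x t := by
  let Ξ : (A ⊗[k] A) ⊗[k] (S.T ⊗[k] S.T) →ₗ[k] M := φ ∘ₗ map (sg S.cgr (m : ZMod 2)) .id ∘ₗ ((assoc k S.C A S.T).1 ∘ₗ
    map (kswap S.gr S.cgr) .id ∘ₗ
    ((assoc k A S.C S.T).symm :
      A ⊗[k] (S.C ⊗[k] S.T) →ₗ[k] (A ⊗[k] S.C) ⊗[k] S.T) ∘ₗ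
    map .id ((assoc k A S.T S.T).symm : A ⊗[k] (S.T ⊗[k] S.T) →ₗ[k] (A ⊗[k] S.T) ⊗[k] S.T) ∘ₗ
    (assoc k A A (S.T ⊗[k] S.T) : (A ⊗[k] A) ⊗[k] (S.T ⊗[k] S.T) →ₗ[k] A ⊗[k] (A ⊗[k] (S.T ⊗[k] S.T))))
  let Ψ : S.T ⊗[k] S.T →ₗ[k] M := Ξ ∘ₗ TensorProduct.mk k _ _ (δ x.val)
  change Ψ (S.cut (word t)) = _
  rw [cut_word, map_spl, Casimir.split]
  refine spl_congr' _ fun u v _ => ?_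
  have key : ∀ p q : S.Mark, map (sg S.cgr (m : ZMod 2)) .id (((assoc k S.C A S.T).1 ∘ₗ map (kswap S.gr S.cgr) .id ∘ₗ
    ((assoc k A S.C S.T).symm :
      A ⊗[k] (S.C ⊗[k] S.T) →ₗ[k] (A ⊗[k] S.C) ⊗[k] S.T) ∘ₗ
    map .id ((assoc k A S.T S.T).symm : A ⊗[k] (S.T ⊗[k] S.T) →ₗ[k] (A ⊗[k] S.T) ⊗[k] S.T) ∘ₗ
    (assoc k A A (S.T ⊗[k] S.T) : (A ⊗[k] A) ⊗[k] (S.T ⊗[k] S.T) →ₗ[k] A ⊗[k] (A ⊗[k] (S.T ⊗[k] S.T))))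
      ((p.val ⊗ₜ q.val) ⊗ₜ (word u ⊗ₜ word v))) =
      isg k (p.deg * (q.deg + wd u) + (q.deg + wd u) * m) • (gen q u ⊗ₜ[k] gen p v) := by
    intro p q
    have : kswap S.gr S.cgr (p.val ⊗ₜ gen q u) =
      ksign k ((p.deg : ZMod 2) * ((q.deg + wd u : ℤ) : ZMod 2)) • (gen q u ⊗ₜ[k] p.val) :=
      kswap_of_mem S.internal S.cgr_internal p.mem (gen_mem q u)
    change map (sg S.cgr (m : ZMod 2)) .id (assoc k S.C A S.T (kswap S.gr S.cgr (p.val ⊗ₜ gen q u) ⊗ₜ word v)) = _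
    rw [this, ← smul_tmul', map_smul, map_smul, assoc_tmul,
      map_tmul, sg_of_mem S.cgr_internal _ (gen_mem q u), ← smul_tmul']
    refine (ksign_smul_smul (M := S.C ⊗[k] S.C) _ _ _).trans ?_
    rw [isg]
    push_cast; rfl
  have hΨ : Ψ (word u ⊗ₜ word v) = ω.cas fun p q => isg k (m * (1 + p.deg) +
      (p.deg * ((q.mul x).deg + wd u) + ((q.mul x).deg + wd u) * m)) •
      φ (gen (q.mul x) u ⊗ₜ gen p v) := by
    change Ξ (δ x.val ⊗ₜ[k] (word u ⊗ₜ[k] word v)) = _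
    rw [hω, sum_tmul, map_sum, Casimir.cas]
    refine Finset.sum_congr rfl fun i _ => ?_
    rw [← smul_tmul', map_smul]
    refine (congrArg (fun z => isg k (m * (1 + (ω.p i).deg)) • φ z) (key (ω.p i) ((ω.q i).mul x))).trans ?_
    rw [map_smul, isg_smul]
  rw [hΨ]
  have hb : BiLin fun p q : S.Mark => φ (gen (q.mul x) u ⊗ₜ gen p v) :=
    ⟨fun q => (Lin.gen v).comp (φ ∘ₗ TensorProduct.mk k S.C S.C (gen (q.mul x) u)),
      fun p => ((Lin.gen u).mul_right x).comp (φ ∘ₗ (TensorProduct.mk k S.C S.C).flip (gen p v))⟩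
  refine (ω.cas_symm (hb.isg fun i j => m * (1 + i) +
      (i * ((j + x.deg) + wd u) + ((j + x.deg) + wd u) * m))).trans (ω.cas_congr fun p q h => ?_)
  rw [isg_smul]; refine isg_congr ?_ _
  rw [← h]; push_cast; clear * -; grind [icast_sq]

/-! ### The Casimir element of an open Frobenius algebra -/

lemma exists_pure {n : ℤ} {t : A ⊗[k] A} (ht : t ∈ tensorGr S.gr S.gr n) :
    ∃ (N : ℕ) (p q : Fin N → S.Mark), (∀ i, (p i).deg + (q i).deg = n) ∧ t = ∑ i, (p i).val ⊗ₜ[k] (q i).val := by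
  let P : Submodule k (A ⊗[k] A) :=
    { carrier := {t | ∃ (N : ℕ) (p q : Fin N → S.Mark), (∀ i, (p i).deg + (q i).deg = n) ∧
        t = ∑ i, (p i).val ⊗ₜ[k] (q i).val}
      zero_mem' := ⟨0, Fin.elim0, Fin.elim0, fun i => i.elim0, by simp⟩
      add_mem' := by
        rintro _ _ ⟨N, p, q, h, rfl⟩ ⟨N', p', q', h', rfl⟩
        refine ⟨N + N', Fin.append p p', Fin.append q q', fun i => ?_, ?_⟩
        · refine Fin.addCases (fun i => ?_) (fun i => ?_) i
          · simpa using h i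
          · simpa using h' i
        · rw [Fin.sum_univ_add]; simp
      smul_mem' := by
        rintro c _ ⟨N, p, q, h, rfl⟩
        refine ⟨N, fun i => ⟨(p i).deg, c • (p i).val, smul_mem _ _ (p i).mem⟩, q, h, ?_⟩
        rw [Finset.smul_sum]
        rfl }
  refine tensorGr_le (N := P) (fun i j hij v hv w hw => ?_) ht
  exact ⟨1, fun _ => ⟨i, v, hv⟩, fun _ => ⟨j, w, hw⟩, fun _ => hij, by simp⟩

lemma IsOpenFrobenius.exists_casimir {m : ℤ} {δ : A →ₗ[k] A ⊗[k] A} (h : S.IsOpenFrobenius m δ)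
    (hs : S.IsSymmetric m δ) : ∃ ω : S.Casimir m, ∀ x, δ x =
      ∑ i, isg k (m * (1 + (ω.p i).deg)) • ((ω.p i).val ⊗ₜ[k] ((ω.q i).val * x)) := by
  let Λ : A ⊗[k] A →ₗ[k] A ⊗[k] A := isg k m • map (sg S.gr (m : ZMod 2)) .id
  have hΛ : ∀ (p : S.Mark) (b : A), Λ (p.val ⊗ₜ b) = isg k (m * (1 + p.deg)) • (p.val ⊗ₜ[k] b) := by
    intro p b
    simp only [Λ, LinearMap.smul_apply, map_tmul, sg_mark, id_apply]
    rw [← smul_tmul', ← Int.cast_mul]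
    refine (isg_smul _ _ _).trans (isg_congr ?_ _)
    push_cast; ring
  have hΛΛ : ∀ t, Λ (Λ t) = t := by
    have : Λ ∘ₗ Λ = .id := by
      refine tensor_homog_ext S.internal S.internal fun i j v hv w hw => ?_
      rw [comp_apply, hΛ ⟨i, v, hv⟩, map_smul, hΛ ⟨i, v, hv⟩, isg_smul]
      exact isg_eq_one (by push_cast; grind) _
    exact congr_fun this
  have h1 : Λ (δ 1) ∈ tensorGr S.gr S.gr m := by
    have := h.comul_mem 0 1 S.one_mem
    rw [zero_add] at this
    refine map_mem_of_tensorGr Λ (fun i j hij v hv w hw => ?_) this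
    rw [hΛ ⟨i, v, hv⟩]
    exact smul_mem _ _ (tmul_mem_tensorGr hv hw hij)
  obtain ⟨n, p, q, hpq, e⟩ := exists_pure h1
  have e1 : δ 1 = ∑ i, isg k (m * (1 + (p i).deg)) • ((p i).val ⊗ₜ[k] (q i).val) := by
    rw [← hΛΛ (δ 1), e, map_sum]
    exact Finset.sum_congr rfl fun i _ => hΛ _ _
  have e2 : ∀ x, δ x = ∑ i, isg k (m * (1 + (p i).deg)) • ((p i).val ⊗ₜ[k] ((q i).val * x)) := by
    intro x
    rw [← one_mul x, h.comul_mul_right, e1, map_sum, one_mul]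
    refine Finset.sum_congr rfl fun i _ => ?_
    rw [map_smul]; rfl
  refine ⟨⟨n, p, q, hpq, fun a => ?_, ?_, ?_⟩, e2⟩
  · have h2 := h.comul_mul_left a.deg a.val a.mem 1
    rw [mul_one, e2, e1] at h2
    have h3 := congrArg Λ h2
    simp only [map_sum, map_smul, map_tmul, mulLeft_apply, id_apply, hΛ, Finset.smul_sum] at h3
    refine (Finset.sum_congr rfl fun i _ => ?_).trans (h3.symm.trans (Finset.sum_congr rfl fun i _ => ?_))
    · refine Eq.trans ?_ (congrArg (fun z => ksign k ((m : ZMod 2) * (a.deg : ZMod 2)) •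
        isg k (m * (1 + (p i).deg)) • z) (hΛ (a.mul (p i)) (q i).val)).symm
      rw [isg_smul, ← Int.cast_mul]
      refine Eq.trans ?_ (isg_smul _ _ _).symm
      refine (isg_eq_one ?_ _).symm
      push_cast; clear * -; grind [icast_sq]
    · rw [isg_smul]
      refine isg_eq_one ?_ _
      push_cast; clear * -; grind [icast_sq]
  · have h3 := congrArg Λ hs
    rw [e, e1] at h3
    rw [h3]
    simp only [map_sum, map_smul, Finset.smul_sum]
    refine Finset.sum_congr rfl fun i _ => ?_
    rw [kswap_of_mem S.internal S.internal (p i).mem (q i).mem, map_smul, hΛ, ← Int.cast_mul]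
    refine ((congrArg _ ((congrArg _ (isg_smul _ _ _)).trans (isg_smul _ _ _))).trans
      (isg_smul _ _ _)).trans (isg_congr ?_ _)
    rw [← hpq i]; push_cast; clear * -; grind [icast_sq]
  · have h2 := congr_fun h.comul_diff 1
    rw [comp_apply, S_d_one, map_zero, LinearMap.smul_apply, comp_apply] at h2
    have h3 := congrArg (fun z => isg k m • Λ (ksign k (m : ZMod 2) • z)) h2
    simp only [ksign_smul_self, smul_zero, map_zero] at h3
    rw [h3, e1]
    simp only [map_sum, map_smul, Finset.smul_sum]
    refine Finset.sum_congr rfl fun i _ => ?_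
    rw [tensorOdd_tmul S.internal _ _ (p i).mem, map_add, map_smul, hΛ]
    refine Eq.trans ?_ (congrArg (fun z => isg k m • isg k (m * (1 + (p i).deg)) • (z +
      isg k (p i).deg • isg k (m * (1 + (p i).deg)) • ((p i).val ⊗ₜ[k] S.d (q i).val)))
      (hΛ (p i).d (q i).val)).symm
    simp only [smul_add, isg_smul]
    congr 1
    · refine (isg_eq_one ?_ _).symm
      push_cast; clear * -; grind [icast_sq]
    · refine isg_congr ?_ _; push_cast; clear * -; grind [icast_sq]

/-! ### Membership -/

lemma spl_mem {P : Submodule k M} {f : S.Wd → S.Wd → M} {t}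
    (h : ∀ u v, wd u + wd v = wd t → f u v ∈ P) : spl f t ∈ P := by
  induction t generalizing f with
  | nil => exact h [] [] (by simp)
  | cons b t ih =>
    rw [spl_cons]
    exact add_mem (h _ _ (by simp)) (ih fun u v e => h _ _ (by simp only [wd_cons]; omega))

lemma Casimir.cas_mem {m : ℤ} (ω : S.Casimir m) {P : Submodule k M} {F : S.Mark → S.Mark → M}
    (h : ∀ p q, p.deg + q.deg = m → F p q ∈ P) : ω.cas F ∈ P :=
  Submodule.sum_mem _ fun i _ => h _ _ (ω.deg i)

lemma onLast_mem {P : Submodule k M} {g : S.Wd → S.Letter → M} {t}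
    (h : ∀ u b, wd u + (b.deg - 1) = wd t → g u b ∈ P) : onLast g t ∈ P := by
  induction t generalizing g with
  | nil => exact zero_mem _
  | cons b t ih =>
    rw [onLast_cons]
    refine add_mem ?_ (ih fun u c e => h _ _ (by simp only [wd_cons]; omega))
    cases t
    · exact h _ _ (by simp)
    · exact zero_mem _

lemma onHead_mem {P : Submodule k M} {g : S.Letter → S.Wd → M} {t}
    (h : ∀ b u, (b.deg - 1) + wd u = wd t → g b u ∈ P) : onHead g t ∈ P := by
  cases t
  · exact zero_mem _
  · exact h _ _ (by simp)

lemma dl_mem {P : Submodule k M} {F : S.Wd → M} {t} (h : ∀ u, wd u = wd t + 1 → F u ∈ P) : dl F t ∈ P := by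
  induction t generalizing F with
  | nil => exact zero_mem _
  | cons b t ih =>
    rw [dl_cons]
    refine add_mem (add_mem (neg_mem (h _ ?_)) (ksign_mem (onHead_mem fun c u e => h _ ?_)))
      (ksign_mem (ih fun u e => h _ ?_)) <;> simp only [wd_cons, Letter.d_deg, Letter.mul_deg] <;> omega

lemma D1_mem {P : Submodule k M} {F : S.Mark → S.Wd → M} {x t}
    (h : ∀ y s, y.deg + wd s = x.deg + wd t + 1 → F y s ∈ P) : D1 F x t ∈ P := by
  rw [D1, slot]
  refine add_mem (h _ _ ?_) (add_mem (add_mem (dl_mem fun u e => ksign_mem (h _ _ ?_))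
    (onHead_mem fun b u e => ksign_mem (h _ _ ?_))) (onLast_mem fun u b e => ksign_mem (h _ _ ?_))) <;>
    (try simp only [Mark.d_deg, Mark.mul_deg, Letter.mark_deg]) <;> omega

lemma D_mem (i : ℤ) (a : S.C) (ha : a ∈ S.cgr i) : S.D a ∈ S.cgr (i + 1) := by
  refine cgr_induction (P := (S.cgr (i + 1)).comap S.D) (fun x t e => ?_) ha
  rw [mem_comap, D_gen']
  exact D1_mem fun y s e' => by
    have := gen_mem y s
    rwa [e', e] at this

lemma B_mem (i : ℤ) (a : S.C) (ha : a ∈ S.cgr i) : S.B a ∈ S.cgr (i - 1) := by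
  refine cgr_induction (P := (S.cgr (i - 1)).comap S.B) (fun x t e => ?_) ha
  rw [mem_comap]
  refine (congrArg (· ∈ S.cgr (i - 1)) (B_gen .id x t)).mpr (spl_mem fun u v e' => ksign_mem (ksign_mem ?_))
  have := gen_mem (Mark.one S) (v ++ x.bar :: u)
  rw [show (Mark.one S).deg + wd (v ++ x.bar :: u) = i - 1 by
    simp only [wd_append, wd_cons, Mark.one_deg, Mark.bar_deg]; omega] at this
  exact this

lemma gen_mem_shift {m i : ℤ} {x : S.Mark} {t} (h : x.deg + wd t = i + m) : gen x t ∈ S.cgrShift m i := by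
  have := gen_mem x t
  rwa [h] at this

lemma cgrShift_internal (m : ℤ) : IsInternal (S.cgrShift m) := shiftGr_internal S.cgr_internal m

lemma cgrShift_induction {m n : ℤ} {P : Submodule k S.C}
    (h : ∀ x t, x.deg + wd t = n + m → gen x t ∈ P) : S.cgrShift m n ≤ P := cgr_induction h

lemma gen2_mem {m n : ℤ} {x y : S.Mark} {t s} (h : x.deg + wd t + y.deg + wd s = n + m + m) :
    gen x t ⊗ₜ[k] gen y s ∈ tensorGr (S.cgrShift m) (S.cgrShift m) n :=
  tmul_mem_tensorGr (gen_mem_shift (i := x.deg + wd t - m) (by omega))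
    (gen_mem_shift (i := y.deg + wd s - m) (by omega)) (by omega)

/-! ### `D² = 0` -/

lemma Letter.ε_val (b : S.Letter) : S.ε b.val = 0 := b.val.2

lemma Letter.coe_d (b : S.Letter) : (b.d.val : A) = S.d b.val := by
  rw [Letter.d_val, coe_toBar, S.ε_d, zero_smul, sub_zero]

lemma Letter.coe_mul (b c : S.Letter) : ((b.mul c).val : A) = b.val * c.val := by
  rw [Letter.mul_val, coe_toBar, map_mul, b.ε_val, zero_mul, zero_smul, sub_zero]

lemma Letter.d_d (b : S.Letter) {F : S.Wd → M} (hF : MultiLin F) (t : S.Wd) : F (b.d.d :: t) = 0 := by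
  obtain ⟨g, hg⟩ := hF [] t b.d.d.deg
  refine (hg b.d.d.val b.d.d.mem).trans ?_
  have h0 : b.d.d.val = 0 := Subtype.ext (by rw [coe_d, coe_d, S.d_d]; rfl)
  rw [← map_zero g]
  exact congrArg g (Subtype.ext h0)

lemma Letter.mul_d (b c : S.Letter) : (b.mul c).d = (b.mark.mul c.mark).d.bar := by
  ext
  · rfl
  · rw [coe_d, coe_mul, Mark.bar_val, coe_toBar, Mark.d_val, S.ε_d, zero_smul, sub_zero]; rfl

lemma Letter.mark_d (b : S.Letter) : b.d.mark = b.mark.d := by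
  ext
  · rfl
  · exact coe_d b

lemma Letter.mark_mul (b c : S.Letter) : (b.mul c).mark = b.mark.mul c.mark := by
  ext
  · rfl
  · exact coe_mul b c

lemma Letter.d_mul (b c : S.Letter) {F : S.Wd → M} (hF : MultiLin F) (t : S.Wd) :
    F ((b.mul c).d :: t) = F (b.d.mul c :: t) + isg k b.deg • F (b.mul c.d :: t) := by
  have h := (hF.lin [] t).leibniz b.mark c.mark
  rw [mul_d, mul, mul, mark_d, mark_d]
  exact h

lemma Letter.mul_assoc' (b c e : S.Letter) : (b.mul c).mul e = b.mul (c.mul e) := by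
  change ((b.mul c).mark.mul e.mark).bar = (b.mark.mul (c.mul e).mark).bar
  rw [mark_mul, mark_mul, Mark.mul_assoc']

lemma isg_neg_congr {a b : ℤ} (h : (a : ZMod 2) = b + 1) (x : M) : isg k a • x = -(isg k b • x) := by
  rw [neg_isg_smul]; exact isg_congr (by push_cast; exact h) x

lemma dl_dl {F : S.Wd → M} (hF : MultiLin F) (t : S.Wd) : dl (dl F) t = 0 := by
  induction t generalizing F with
  | nil => rfl
  | cons b t ih =>
    have hk : ∀ n : ℤ, ksign k (n : ZMod 2) = isg k n := fun _ => rfl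
    simp only [dl_cons, b.d_d hF, hk, dl_add, dl_smul, dl_neg, Letter.d_deg, ih (hF.shift b)]
    cases t with
    | nil => simp
    | cons c t =>
      simp only [onHead_cons, dl_cons, hk, Letter.mul_deg, b.d_mul c hF, Letter.mul_assoc', smul_add,
        smul_neg, isg_smul, neg_isg_smul, neg_add, neg_zero, zero_add, smul_zero, neg_neg]
      have e : ∀ {a1 a2 b1 b2 c1 c2 d1 d2 f1 f2 g1 g2 h1 h2 : M}, a1 = -a2 → b1 = -b2 → c1 = -c2 →
          d1 = -d2 → f1 = -f2 → g1 = -g2 → h1 = -h2 →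
          a1 + (b1 + c1 + d1) + (a2 + f1 + g1 + h1) + (b2 + c2 + d2 + (f2 + g2 + h2) + 0) = 0 := by
        rintro _ a _ b _ c _ d _ f _ g _ h rfl rfl rfl rfl rfl rfl rfl; abel
      refine e ?_ ?_ ?_ ?_ ?_ ?_ ?_ <;>
      · refine isg_neg_congr ?_ _
        push_cast; clear * -; grind [icast_sq]

lemma onLast_snoc_eq (g : S.Wd → S.Letter → M) (l c) : onLast g (l ++ [c]) = g l c := by
  rw [onLast_append', nilc_nil, onLast_nil, add_zero]

lemma dl_snoc (F : S.Wd → M) (l c) : dl F (l ++ [c]) = dl (fun u => F (u ++ [c])) l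
      + onLast (fun u b => isg k (wd u + b.deg - 1) • F (u ++ [b.mul c])) l
      - isg k (wd l) • F (l ++ [c.d]) := by
  rw [dl_append, dl_cons]
  simp [isg, sub_eq_add_neg]

lemma dl_onLast_snoc (g : S.Wd → S.Letter → M) (l c) : dl (onLast g) (l ++ [c]) =
    dl (fun u => g u c) l + onLast (fun u b => isg k (wd u + b.deg - 1) • g u (b.mul c)) l
      - isg k (wd l) • g l c.d := by
  simp only [dl_snoc, onLast_snoc_eq]

lemma dl_onHead_cons (g : S.Letter → S.Wd → M) (b t) : dl (onHead g) (b :: t) =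
    -g b.d t + isg k (b.deg - 1) • onHead (fun c u => g (b.mul c) u) t + isg k (b.deg - 1) • dl (g b) t := rfl

lemma Lin.d_d {F : S.Mark → M} (hF : Lin F) (x : S.Mark) : F x.d.d = 0 := by
  obtain ⟨φ, hφ⟩ := hF.exists_linear
  rw [← hφ]
  simp [S.d_d]

lemma D1_D1 {F : S.Mark → S.Wd → M} (hF : Lin1 F) (x t) : D1 (D1 F) x t = 0 := by
  rcases t with _ | ⟨b, t⟩
  · simp [D1, slot, (hF.1 []).d_d]
  rcases t.eq_nil_or_concat with rfl | ⟨l, c, rfl⟩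
  · have h1 := (hF.1 []).leibniz x b.mark
    have h2 := (hF.1 []).leibniz b.mark x
    have h3 := b.d_d (hF.2 x) []
    simp only [D1, slot, onLast_cons, onHead_cons, dl_cons, onHead_nil, onLast_nil, dl_nil, nilc_nil,
      smul_zero, add_zero, (hF.1 _).d_d, Letter.mark_d, h1, h2, h3, neg_zero, smul_add, smul_neg,
      isg_smul, neg_isg_smul, neg_add, zero_add]
    have e : ∀ {a1 a2 b1 b2 c1 c2 d1 d2 f1 f2 : M}, a1 = -a2 → b1 = -b2 → c1 = -c2 → d1 = -d2 → f1 = -f2 →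
        a1 + b1 + c1 + (a2 + (d1 + f1) + (b2 + d2) + (f2 + c2)) = 0 := by
      rintro _ a _ b _ c _ d _ f rfl rfl rfl rfl rfl; abel
    refine e ?_ ?_ ?_ ?_ ?_ <;>
    · refine isg_neg_congr ?_ _
      push_cast; clear * -; grind [icast_sq]
  · rw [List.concat_eq_append]
    have h1 := (hF.1 (l ++ [c])).leibniz x b.mark
    have h2 := (hF.1 (b :: l)).leibniz c.mark x
    have e0 : b :: (l ++ [c]) = (b :: l) ++ [c] := rfl
    have h3 : dl (onHead fun b u => isg k x.deg • F (x.mul b.mark) u) (b :: (l ++ [c])) = _ := dl_onHead_cons _ _ _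
    have h4 : dl (onLast fun u b => isg k ((b.deg - 1) * (x.deg + wd u) + 1) • F (b.mark.mul x) u)
      (b :: (l ++ [c])) = _ := (dl_onLast_snoc _ (b :: l) c).trans (sub_eq_add_neg _ _)
    have h5 : ∀ g : S.Wd → S.Letter → M, onLast g (b :: (l ++ [c])) = g (b :: l) c :=
      fun g => onLast_snoc_eq g (b :: l) c
    have h6 : dl (fun u => isg k ((c.deg - 1) * (x.deg + wd u) + 1) • F (c.mark.mul x) u) (b :: l) =
      isg k (wd (b :: l) * (c.deg - 1) + ((c.deg - 1) * (x.deg - 1) + 1)) • dl (F (c.mark.mul x)) (b :: l) := by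
      rw [← dl_isg]
      congr 1; ext u; congr 2; ring
    have h7 : dl (D1 F x) (b :: (l ++ [c])) = dl (F x.d) (b :: (l ++ [c])) +
        (dl (onHead fun b u => isg k x.deg • F (x.mul b.mark) u) (b :: (l ++ [c])) +
        dl (onLast fun u b => isg k ((b.deg - 1) * (x.deg + wd u) + 1) • F (b.mark.mul x) u) (b :: (l ++ [c]))) := by
      change dl (fun u => F x.d u + (dl (fun u => isg k x.deg • F x u) u + onHead _ u + onLast _ u)) _ = _
      rw [dl_add, dl_add, dl_add, dl_dl ((hF.2 x).isg fun _ => x.deg), zero_add]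
    rw [D1, slot, onHead_cons, h5, dl_smul, h7, h3, h4, h6]
    simp only [D1, slot, dl_smul, h5, onLast_snoc_eq, onHead_cons,
      Letter.mark_d, Letter.mark_mul, Mark.mul_assoc', h1, h2, (hF.1 _).d_d, ← onLast_smul, ← onHead_smul,
      smul_add, smul_neg, isg_smul, neg_isg_smul, zero_add, smul_zero]
    have e : ∀ {a1 a2 b1 b2 c1 c2 d1 d2 f1 f2 g1 g2 h1 h2 i1 i2 j1 j2 m1 m2 : M}, a1 = -a2 → b1 = -b2 →
        c1 = -c2 → d1 = -d2 → f1 = -f2 → g1 = -g2 → h1 = -h2 → i1 = -i2 → j1 = -j2 → m1 = -m2 →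
        a1 + b1 + c1 + (a2 + (d1 + f1 + g1 + (h1 + i1 + j1))
          + (b2 + d2 + (g2 + f2 + m1)) + (j2 + c2 + (h2 + m2 + i2))) = 0 := by
      rintro _ a _ b _ c _ d _ f _ g _ h _ i _ j _ m rfl rfl rfl rfl rfl rfl rfl rfl rfl rfl; abel
    refine e ?_ ?_ ?_ ?_ ?_ ?_ ?_ ?_ ?_ ?_
    case refine_5 =>
      rw [neg_eq_isg (k := k), ← onHead_smul]
      refine onHead_congr _ fun c u _ => ?_
      rw [isg_smul]; refine isg_congr ?_ _; push_cast; clear * -; grind [icast_sq]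
    case refine_8 =>
      rw [neg_eq_isg (k := k), ← onLast_smul]
      refine onLast_congr _ fun u b hu => ?_
      rw [isg_smul, ← hu]; refine isg_congr ?_ _; push_cast; clear * -; grind [icast_sq]
    all_goals
      refine isg_neg_congr ?_ _
      push_cast; clear * -; grind [icast_sq]

lemma D_D : S.D ∘ₗ S.D = 0 := by
  refine gen_ext fun x t => ?_
  rw [comp_apply, D_gen' x t, map_D1, LinearMap.zero_apply]
  refine Eq.trans ?_ (D1_D1 Lin1.gen x t)
  congr 1
  ext x t
  exact D_gen' x t

/-! ### Linearity of functions of cyclic words -/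

/-- Functions of cyclic words with two marked letters that come from linear maps. -/
structure Lin2 (G : S.Fn M) : Prop where
  fst (t y s) : Lin fun x => G x t y s
  fst' (x y s) : MultiLin fun t => G x t y s
  snd (x t s) : Lin fun y => G x t y s
  snd' (x t y) : MultiLin fun s => G x t y s

/-- Functions of cyclic words with three marked letters that come from linear maps. -/
structure Lin3 (G : S.Mark → S.Wd → S.Fn M) :
    Prop where
  fst (t y s z r) : Lin fun x => G x t y s z r
  fst' (x y s z r) : MultiLin fun t => G x t y s z r
  snd (x t s z r) : Lin fun y => G x t y s z r
  snd' (x t y z r) : MultiLin fun s => G x t y s z r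
  trd (x t y s r) : Lin fun z => G x t y s z r
  trd' (x t y s z) : MultiLin fun r => G x t y s z r

lemma MultiLin.insert_left {F : S.Wd → M} (hF : MultiLin F) (y : S.Letter) (s) :
    MultiLin fun t => F (t ++ y :: s) := hF.append_right _

lemma MultiLin.insert_right {F : S.Wd → M} (hF : MultiLin F) (y : S.Letter) (t) :
    MultiLin fun s => F (t ++ y :: s) := (hF.append_left t).shift y

lemma Lin1.iota {F : S.Mark → S.Wd → M} (hF : Lin1 F) : Lin2 (iota F) where
  fst t y s := (hF.1 _).isg fun i => i + wd t
  fst' x y s := ((hF.2 x).insert_left y.bar s).isg fun i => x.deg + i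
  snd x t s := ((hF.2 x).lin t s).isg fun _ => x.deg + wd t
  snd' x t y := ((hF.2 x).insert_right y.bar t).isg fun _ => x.deg + wd t

lemma Lin2.iota3 {G : S.Fn M} (hG : Lin2 G) : Lin3 (iota3 G) where
  fst t y s z r := (hG.fst t y _).isg fun i => i + wd t + y.deg + wd s
  fst' x y s z r := (hG.fst' x y _).isg fun i => x.deg + i + y.deg + wd s
  snd x t s z r := (hG.snd x t _).isg fun i => x.deg + wd t + i + wd s
  snd' x t y z r := ((hG.snd' x t y).insert_left z.bar r).isg fun i => x.deg + wd t + y.deg + i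
  trd x t y s r := ((hG.snd' x t y).lin s r).isg fun _ => x.deg + wd t + y.deg + wd s
  trd' x t y s z := ((hG.snd' x t y).insert_right z.bar s).isg fun _ => x.deg + wd t + y.deg + wd s

lemma Lin3.rot2 {G : S.Mark → S.Wd → S.Fn M} (hG : Lin3 G) : Lin2 (rot2 G) where
  fst t y s := Lin.spl_param (fun u v => (hG.trd _ v y s u).isg fun i => (i + wd u) * (wd v + y.deg + wd s)) t
  fst' x y s := MultiLin.spl (fun v => (hG.trd' _ v y s x).isg fun i => (x.deg + i) * (wd v + y.deg + wd s))
    fun u => (hG.fst' _ y s x u).isg fun i => (x.deg + wd u) * (i + y.deg + wd s)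
  snd x t s := Lin.spl_param (fun u v => (hG.snd _ v s x u).isg fun i => (x.deg + wd u) * (wd v + i + wd s)) t
  snd' x t y := MultiLin.spl_param (fun u v => (hG.snd' _ v y x u).isg fun i => (x.deg + wd u) * (wd v + y.deg + i)) t

/-- The linear map on chains given by a function of `a₀[a₁, …, aₙ]`. -/
def ofGen {F : S.Mark → S.Wd → M} (hF : Lin1 F) : S.C →ₗ[k] M := hF.exists.choose

lemma ofGen_gen {F : S.Mark → S.Wd → M} (hF : Lin1 F) (x t) : ofGen hF (gen x t) = F x t := hF.exists.choose_spec x t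

namespace Casimir

variable {m : ℤ} (ω : S.Casimir m)

lemma pinch_multiLin
    {G : S.Wd → S.Fn M}
    (h1 : ∀ p t3 q t2, MultiLin fun t1 => G t1 p t3 q t2)
    (h2 : ∀ t1 p q t2, MultiLin fun t3 => G t1 p t3 q t2)
    (h3 : ∀ t1 p t3 q, MultiLin (G t1 p t3 q)) : MultiLin (ω.pinch G) :=
  MultiLin.spl (fun v => MultiLin.spl_param (fun t2 t3 => MultiLin.sum fun i =>
      (h1 _ t3 _ t2).isg fun _ => wd t3 * (m + (ω.q i).deg + wd t2)) v)
    fun t1 => MultiLin.spl (fun t3 => MultiLin.sum fun i => (h3 _ _ _ _).isg fun j => wd t3 * (m + (ω.q i).deg + j))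
      (fun t2 => MultiLin.sum fun i => (h2 _ _ _ _).isg fun j => j * (m + (ω.q i).deg + wd t2))

lemma pinch_lin {G : S.Mark → S.Wd → S.Fn M}
    (h : ∀ t1 p t3 q t2, Lin fun x => G x t1 p t3 q t2) (t) : Lin fun x => ω.pinch (G x) t :=
  Lin.spl_param (fun t1 v => Lin.spl_param (fun t2 t3 => Lin.sum fun i =>
    (h _ _ _ _ _).isg fun _ => wd t3 * (m + (ω.q i).deg + wd t2)) v) t

lemma lin1_pinch
    {G : S.Mark → S.Wd → S.Fn M}
    (h : ∀ q l, Lin2 fun x t y s => G x t y s q l) (h' : ∀ x t y s, Lin1 (G x t y s)) :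
    Lin1 fun x => ω.pinch (G x) :=
  ⟨fun t => ω.pinch_lin (fun t1 p t3 q t2 => (h q t2).fst t1 p t3) t,
    fun x => ω.pinch_multiLin (fun p t3 q t2 => (h q t2).fst' x p t3)
      (fun t1 p q t2 => (h q t2).snd' x t1 p) (fun t1 p t3 q => (h' x t1 p t3).2 q)⟩

lemma lin2_pinch2 {G : S.Mark → S.Wd → S.Mark → S.Wd → S.Mark → S.Wd → S.Mark → S.Wd → M}
    (h : ∀ q l, Lin3 fun x t y s z r => G x t y s z r q l) (h' : ∀ x t y s z r, Lin1 (G x t y s z r)) :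
    Lin2 (ω.pinch2 G) where
  fst t y s := ω.pinch_lin (fun t1 p t3 q t2 => ((h q t2).fst t1 p t3 y s).isg fun _ =>
    (m + q.deg + wd t2) * (y.deg + wd s)) t
  fst' x y s := ω.pinch_multiLin
    (fun p t3 q t2 => ((h q t2).fst' x p t3 y s).isg fun _ => (m + q.deg + wd t2) * (y.deg + wd s))
    (fun t1 p q t2 => ((h q t2).snd' x t1 p y s).isg fun _ => (m + q.deg + wd t2) * (y.deg + wd s))
    fun t1 p t3 q => ((h' x t1 p t3 y s).2 q).isg fun i => (m + q.deg + i) * (y.deg + wd s)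
  snd x t s := ω.pinch_lin (G := fun y t1 p t3 q t2 => isg k ((m + q.deg + wd t2) * (y.deg + wd s)) •
    G x t1 p t3 y s q t2) (fun t1 p t3 q t2 => ((h q t2).trd x t1 p t3 s).isg fun i =>
    (m + q.deg + wd t2) * (i + wd s)) t
  snd' x t y := MultiLin.spl_param (fun t1 v => MultiLin.spl_param (fun t2 t3 => MultiLin.sum fun i =>
    (((h _ _).trd' x t1 _ t3 y).isg fun j => (m + (ω.q i).deg + wd t2) * (y.deg + j)).isg fun _ =>
      wd t3 * (m + (ω.q i).deg + wd t2)) v) t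

lemma lin1_split {G : S.Fn M} (hG : Lin2 G) : Lin1 (ω.split G) :=
  ⟨fun t => Lin.spl_param (fun u v => Lin.sum fun i => ((hG.fst u _ v).mul_left (ω.p i)).isg fun j =>
      (ω.p i).deg * (j + wd u)) t,
    fun x => MultiLin.spl (fun v => MultiLin.sum fun i => (hG.fst' _ _ v).isg fun j => (ω.p i).deg * (x.deg + j))
      fun u => MultiLin.sum fun i => (hG.snd' _ u _).isg fun _ => (ω.p i).deg * (x.deg + wd u)⟩

end Casimir

/-! ### The homotopies -/

lemma Lin1.tmul_left {F : S.Mark → S.Wd → M} (hF : Lin1 F) (n : N) :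
    Lin1 fun x t => F x t ⊗ₜ[k] n := hF.comp ((TensorProduct.mk k M N).flip n)

lemma Lin1.tmul_right {F : S.Mark → S.Wd → M} (hF : Lin1 F) (n : N) :
    Lin1 fun x t => n ⊗ₜ[k] F x t := hF.comp (TensorProduct.mk k N M n)

lemma lin2_gen : Lin2 fun x t (y : S.Mark) s => gen x t ⊗ₜ[k] gen y s where
  fst _ y s := (Lin1.gen.tmul_left (gen y s)).1 _
  fst' x y s := (Lin1.gen.tmul_left (gen y s)).2 x
  snd x t _ := (Lin1.gen.tmul_right (gen x t)).1 _
  snd' x t y := (Lin1.gen.tmul_right (gen x t)).2 y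

lemma map_D2 (φ : M →ₗ[k] N) (F : S.Fn M) (x t y s) : φ (D2 F x t y s) = D2 (fun x t y s => φ (F x t y s)) x t y s := by
  simp only [D2, map_add, map_slot, map_smul]

namespace Casimir

variable {m : ℤ} (ω : S.Casimir m)

lemma pinch_sub (G G' : S.Wd → S.Fn M) (t) :
    ω.pinch (fun t1 p t3 q t2 => G t1 p t3 q t2 - G' t1 p t3 q t2) t = ω.pinch G t - ω.pinch G' t := by
  simp only [sub_eq_add_neg, neg_eq_isg (k := k), pinch_add, pinch_smul]

/-- The coproduct. -/
def th : S.C →ₗ[k] S.C ⊗[k] S.C := ofGen (ω.lin1_split lin2_gen)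

/-- The operator that pinches off a loop. -/
def op {c : S.Fn M} (hc : Lin2 c) : S.C →ₗ[k] M ⊗[k] S.C :=
  ofGen (ω.lin1_pinch (G := fun x t y s q l => c x t y s ⊗ₜ[k] gen q l)
    (fun q l => ⟨fun t y s => (hc.fst t y s).comp ((TensorProduct.mk k M S.C).flip (gen q l)),
      fun x y s => (hc.fst' x y s).comp ((TensorProduct.mk k M S.C).flip (gen q l)),
      fun x t s => (hc.snd x t s).comp ((TensorProduct.mk k M S.C).flip (gen q l)),
      fun x t y => (hc.snd' x t y).comp ((TensorProduct.mk k M S.C).flip (gen q l))⟩)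
    fun x t y s => Lin1.gen.tmul_right (c x t y s))

lemma op_gen {c : S.Fn M} (hc : Lin2 c) (φ : M ⊗[k] S.C →ₗ[k] N) (x t) : φ (ω.op hc (gen x t)) =
    ω.pinch (fun t1 p t3 q t2 => φ (c x t1 p t3 ⊗ₜ[k] gen q t2)) t := by
  rw [op, ofGen_gen, map_pinch]

lemma th_gen (φ : S.C ⊗[k] S.C →ₗ[k] M) (x t) : φ (ω.th (gen x t)) =
    ω.split (fun x t y s => φ (gen x t ⊗ₜ[k] gen y s)) x t := by
  rw [th, ofGen_gen, split, map_spl]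
  simp only [map_cas, map_smul]; rfl

end Casimir

lemma tensorOdd_gen_tmul (m : ℤ) (D₁ : S.C →ₗ[k] S.C) (D₂ : N →ₗ[k] N) (x : S.Mark) (t) (n : N) :
    tensorOdd (S.cgrShift m) D₁ D₂ (gen x t ⊗ₜ n) =
      D₁ (gen x t) ⊗ₜ n + isg k (x.deg + wd t + m) • (gen x t ⊗ₜ[k] D₂ n) := by
  have h : gen x t ∈ S.cgrShift m (x.deg + wd t - m) := gen_mem_shift (by omega)
  have := tensorOdd_tmul (V := S.C) (W := N) (gr := S.cgrShift m) (cgrShift_internal m) D₁ D₂ h n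
  rw [this]
  congr 1
  refine isg_congr (M := S.C ⊗[k] N) ?_ _
  push_cast; clear * -; grind

lemma kswap_gen (m : ℤ) (x y : S.Mark) (t s) : kswap (S.cgrShift m) (S.cgrShift m) (gen x t ⊗ₜ gen y s) =
      isg k ((x.deg + wd t + m) * (y.deg + wd s + m)) • (gen y s ⊗ₜ[k] gen x t) := by
  have h : gen x t ∈ S.cgrShift m (x.deg + wd t - m) := gen_mem_shift (by omega)
  have h' : gen y s ∈ S.cgrShift m (y.deg + wd s - m) := gen_mem_shift (by omega)
  have := kswap_of_mem (V := S.C) (W := S.C) (gr := S.cgrShift m) (gr' := S.cgrShift m)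
    (cgrShift_internal m) (cgrShift_internal m) h h'
  rw [this, ← Int.cast_mul]
  refine isg_congr (M := S.C ⊗[k] S.C) ?_ _
  push_cast; clear * -; grind

/-- The differential of `C[m] ⊗ C[m]`. -/
lemma tensorOdd_gen (m : ℤ) (φ : S.C ⊗[k] S.C →ₗ[k] M) (x t y s) :
    φ (tensorOdd (S.cgrShift m) S.D S.D (gen x t ⊗ₜ gen y s)) =
      D11 m (fun x t y s => φ (gen x t ⊗ₜ[k] gen y s)) x t y s := by
  rw [tensorOdd_gen_tmul, map_add, map_smul, D11]
  congr 1
  · exact D_gen (φ ∘ₗ (TensorProduct.mk k S.C S.C).flip (gen y s)) x t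
  · refine (congrArg _ (D_gen (φ ∘ₗ TensorProduct.mk k S.C S.C (gen x t)) y s)).trans (isg_congr ?_ _)
    push_cast; clear * -; grind

lemma spl_nilc_left (f : S.Wd → S.Wd → M) (t) : spl (fun u v => nilc (f u v) u) t = f [] t := by
  cases t with
  | nil => rfl
  | cons b t => rw [spl_cons]; simp [spl_zero]

lemma spl_nilc_right (f : S.Wd → S.Wd → M) (t) : spl (fun u v => nilc (f u v) v) t = f t [] := by
  induction t generalizing f with
  | nil => rfl
  | cons b t ih => rw [spl_cons, ih]; simp

namespace Casimir

variable {m : ℤ} (ω : S.Casimir m)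

lemma th_D : ω.th ∘ₗ S.D = tensorOdd (S.cgrShift m) S.D S.D ∘ₗ ω.th := by
  refine gen_ext fun x t => ?_
  have h1 : ω.th (S.D (gen x t)) = _ := D_gen ω.th x t
  refine h1.trans ?_
  have e : (fun x t => ω.th (gen x t)) = ω.split fun x t y s => gen x t ⊗ₜ[k] gen y s := by
    ext x t; exact ω.th_gen .id x t
  rw [e, ω.D1_split fun t s => ⟨fun y => lin2_gen.fst t y s, fun x => lin2_gen.snd x t s⟩]
  refine Eq.trans ?_ (ω.th_gen (tensorOdd (S.cgrShift m) S.D S.D) x t).symm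
  congr 1
  ext x t y s
  have := tensorOdd_gen m (.id : S.C ⊗[k] S.C →ₗ[k] S.C ⊗[k] S.C) x t y s
  simp only [id_apply] at this
  exact this.symm

/-- The flipped coproduct. -/
lemma swap_th_gen (φ : S.C ⊗[k] S.C →ₗ[k] M) (x t) : φ (kswap (S.cgrShift m) (S.cgrShift m) (ω.th (gen x t))) =
      spl (fun t1 t2 => ω.cas fun p q => isg k (wd t2 * (m + q.deg + wd t1)) •
        φ (gen (x.mul p) t2 ⊗ₜ[k] gen q t1)) t := by
  refine (ω.th_gen (φ ∘ₗ kswap (S.cgrShift m) (S.cgrShift m)) x t).trans ?_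
  refine spl_congr' _ fun t1 t2 _ => ?_
  have hb : BiLin fun y z : S.Mark => φ (gen y t2 ⊗ₜ[k] gen z t1) :=
    ⟨fun z => (lin2_gen.fst t2 z t1).comp φ, fun y => (lin2_gen.snd y t2 t1).comp φ⟩
  have h1 := ω.cas_mul (hb.isg fun i j => wd t2 * (m + j + wd t1)) x
  have h2 := ω.cas_symm (F := fun p q => isg k (p.deg * (x.deg + wd t1) +
    (p.deg + x.deg + wd t1 + m) * (q.deg + wd t2 + m)) • φ (gen q t2 ⊗ₜ[k] gen (p.mul x) t1))
    ⟨fun z => (((hb.2 z).mul_right x).isg fun i => i * (x.deg + wd t1) +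
    (i + x.deg + wd t1 + m) * (z.deg + wd t2 + m)), fun y => ((hb.1 (y.mul x)).isg fun i =>
    y.deg * (x.deg + wd t1) + (y.deg + x.deg + wd t1 + m) * (i + wd t2 + m))⟩
  refine (ω.cas_congr fun p q hpq => ?_).trans (h2.trans ((ω.cas_congr fun p q hpq => ?_).trans h1.symm))
  · change isg k _ • φ (kswap _ _ _) = _
    rw [kswap_gen, map_smul, isg_smul]; rfl
  · rw [isg_smul]; refine isg_congr ?_ _
    rw [← hpq]; push_cast; clear * -; grind [icast_sq]

lemma op_D {c : S.Fn M} (hc : Lin2 c) (x t) :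
    ω.op hc (S.D (gen x t)) = ω.pinch (fun t1 p t3 q t2 => D2 c x t1 p t3 ⊗ₜ[k] gen q t2 +
      isg k (m + x.deg + wd t1 + p.deg + wd t3) • (c x t1 p t3 ⊗ₜ[k] S.D (gen q t2))) t := by
  have h1 : ω.op hc (S.D (gen x t)) = _ := D_gen (ω.op hc) x t
  refine h1.trans ?_
  have e : (fun x t => ω.op hc (gen x t)) = fun x => ω.pinch fun t1 p t3 q t2 => c x t1 p t3 ⊗ₜ[k] gen q t2 := by
    ext x t; exact ω.op_gen hc .id x t
  rw [e]
  refine (ω.D1_pinch (G := fun x t1 p t3 q t2 => c x t1 p t3 ⊗ₜ[k] gen q t2)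
    (fun x t1 t3 t2 => ⟨fun q => (hc.snd x t1 t3).comp ((TensorProduct.mk k M S.C).flip (gen q t2)),
      fun p => (Lin1.gen.tmul_right (c x t1 p t3)).1 t2⟩) x t).trans ?_
  congr 1
  ext t1 p t3 q t2
  rw [D21]
  congr 1
  · have := map_D2 ((TensorProduct.mk k M S.C).flip (gen q t2)) c x t1 p t3
    exact this.symm
  · exact congrArg _ (D_gen (TensorProduct.mk k M S.C (c x t1 p t3)) q t2).symm

lemma op_comm {gr : ℤ → Submodule k M} (hgr : IsInternal gr) (d : M →ₗ[k] M) {e e' : ℤ}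
    (he : (e' : ZMod 2) = e + m) {c : S.Fn M}
    (hc : Lin2 c) (hd : ∀ x t y s, c x t y s ∈ gr (x.deg + wd t + y.deg + wd s + e')) (x t) :
    tensorOdd gr d S.D (ω.op hc (gen x t)) - isg k e • ω.op hc (S.D (gen x t)) =
      ω.pinch (fun t1 p t3 q t2 => (d (c x t1 p t3) - isg k e • D2 c x t1 p t3) ⊗ₜ[k] gen q t2) t := by
  rw [ω.op_gen hc (tensorOdd gr d S.D), ω.op_D hc, ← pinch_smul, ← pinch_sub]
  refine ω.pinch_congr t fun t1 t2 t3 p q _ hpq => ?_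
  rw [tensorOdd_tmul hgr d S.D (hd x t1 p t3), smul_add, isg_smul, sub_tmul, ← smul_tmul']
  have : isg k (e + (m + x.deg + wd t1 + p.deg + wd t3)) • (c x t1 p t3 ⊗ₜ[k] S.D (gen q t2)) =
      ksign k ((x.deg + wd t1 + p.deg + wd t3 + e' : ℤ) : ZMod 2) •
        (c x t1 p t3 ⊗ₜ[k] S.D (gen q t2)) := isg_congr (by push_cast; rw [he]; ring) _
  rw [this]; abel

lemma op_comm_odd {gr : ℤ → Submodule k M} (hgr : IsInternal gr) (d : M →ₗ[k] M) {e' : ℤ}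
    (he : (e' : ZMod 2) = 1 + m) {c : S.Fn M}
    (hc : Lin2 c) (hd : ∀ x t y s, c x t y s ∈ gr (x.deg + wd t + y.deg + wd s + e')) (x t) :
    tensorOdd gr d S.D (ω.op hc (gen x t)) + ω.op hc (S.D (gen x t)) =
      ω.pinch (fun t1 p t3 q t2 => (d (c x t1 p t3) + D2 c x t1 p t3) ⊗ₜ[k] gen q t2) t := by
  have h := ω.op_comm hgr d (e := 1) (by push_cast; exact he) hc hd x t
  have e1 : isg k 1 = -1 := by simp [isg, ksign_one]
  simpa only [e1, neg_smul, one_smul, sub_neg_eq_add] using h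

lemma op_comm_even {gr : ℤ → Submodule k M} (hgr : IsInternal gr) (d : M →ₗ[k] M) {e' : ℤ}
    (he : (e' : ZMod 2) = m) {c : S.Fn M}
    (hc : Lin2 c) (hd : ∀ x t y s, c x t y s ∈ gr (x.deg + wd t + y.deg + wd s + e')) (x t) :
    tensorOdd gr d S.D (ω.op hc (gen x t)) - ω.op hc (S.D (gen x t)) =
      ω.pinch (fun t1 p t3 q t2 => (d (c x t1 p t3) - D2 c x t1 p t3) ⊗ₜ[k] gen q t2) t := by
  have h := ω.op_comm hgr d (e := 0) (by push_cast; rw [he, zero_add]) hc hd x t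
  simpa only [isg_zero, one_smul] using h

end Casimir

lemma map_iota (φ : M →ₗ[k] N) (F : S.Mark → S.Wd → M) (x t y s) :
    φ (iota F x t y s) = iota (fun x t => φ (F x t)) x t y s := map_smul φ _ _

lemma map_rot (φ : M →ₗ[k] N) (G : S.Fn M) (x t) : φ (rot G x t) = rot (fun x t y s => φ (G x t y s)) x t := by
  simp only [rot, map_spl, map_smul]

lemma map_rot2 (φ : M →ₗ[k] N) (G : S.Mark → S.Wd → S.Fn M) (x t y s) :
    φ (rot2 G x t y s) = rot2 (fun x t y s z r => φ (G x t y s z r)) x t y s := by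
  simp only [rot2, map_spl, map_smul]

lemma map_D3 (φ : M →ₗ[k] N) (F : S.Mark → S.Wd → S.Fn M) (x t y s z r) :
    φ (D3 F x t y s z r) = D3 (fun x t y s z r => φ (F x t y s z r)) x t y s z r := by
  simp only [D3, map_add, map_slot, map_smul]

/-! ### The Connes operator -/

lemma gen_bar_one (x : S.Mark) (u v) : gen x (u ++ (Mark.one S).bar :: v) = 0 := by
  obtain ⟨g, hg⟩ := MultiLin.gen x u v 0
  refine (hg (Mark.one S).bar.val (Mark.one S).bar.mem).trans ?_
  rw [← map_zero g]
  refine congrArg g (Subtype.ext ?_)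
  exact toBar_one

lemma B_B : S.B ∘ₗ S.B = 0 := by
  refine gen_ext fun x t => ?_
  have h : S.B (S.B (gen x t)) = _ := B_gen S.B x t
  refine h.trans ?_
  have h0 : ∀ l, S.B (gen (Mark.one S) l) = 0 := by
    intro l
    have h : S.B (gen (Mark.one S) l) = _ := B_gen .id (Mark.one S) l
    rw [h]
    simp [rot, iota, gen_bar_one, spl_zero]
  simp [rot, iota, h0, spl_zero]

lemma D_iota (x t y s) : S.D (iota gen x t y s) + D2 (S := S) (iota gen) x t y s =
    nilc (gen (x.mul y) s) t - nilc (isg k (y.deg * (x.deg + wd t)) • gen (y.mul x) t) s := by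
  rw [← D2_iota Lin1.gen, map_iota, iota, D_gen']

lemma B_D : S.B ∘ₗ S.D + S.D ∘ₗ S.B = 0 := by
  refine gen_ext fun x t => ?_
  have h1 : S.B (S.D (gen x t)) = _ := D_gen S.B x t
  have e : (fun x t => S.B (gen x t)) = rot (iota gen) := by
    ext x t; exact B_gen .id x t
  rw [e, D1_rot fun t y s => Lin1.gen.iota.fst t y s] at h1
  have h2 : S.D (S.B (gen x t)) = S.D (rot (iota gen) x t) := congrArg S.D (B_gen .id x t)
  rw [LinearMap.add_apply, comp_apply, comp_apply, h1, h2, map_rot]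
  simp only [rot]
  rw [← spl_add]
  have e3 : ∀ u v : S.Wd, isg k ((x.deg + wd u) * wd v) • D2 (iota gen) (Mark.one S) v x u +
      isg k ((x.deg + wd u) * wd v) • S.D (iota gen (Mark.one S) v x u) = 
      nilc (isg k ((x.deg + wd u) * wd v) • gen x u) v +
        -nilc (isg k ((x.deg + wd u) * wd v + x.deg * wd v) • gen x v) u := by
    intro u v
    rw [← smul_add, add_comm (D2 (iota gen) (Mark.one S) v x u), D_iota, smul_sub, sub_eq_add_neg, Mark.mul_one', Mark.one_mul']
    congr 1
    · cases v <;> simp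
    · cases u
      · simp [isg_smul]
      · simp
  simp only [e3]
  rw [spl_add, spl_neg, spl_nilc_left, spl_nilc_right]
  simp only [wd_nil, mul_zero, add_zero, isg_zero, one_smul]
  rw [isg_eq_one (a := x.deg * wd t + x.deg * wd t) (by push_cast; grind), add_neg_cancel]
  rfl

lemma D_iota3 (x t y s z r) : S.D (iota3 (iota gen) x t y s z r) - D3 (S := S) (iota3 (iota gen)) x t y s z r =
      nilc (isg k (x.deg + wd t + y.deg + wd s) • gen (x.mul y) (s ++ z.bar :: r)) t -
      nilc (iota gen x t (y.mul z) r) s +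
      nilc (isg k (z.deg * (x.deg + wd t + y.deg + wd s)) • iota gen (z.mul x) t y s) r := by
  have h1 := D3_iota3 (G := iota (gen (S := S))) (fun t y s => Lin1.gen.iota.fst t y s)
    (fun x t s => Lin1.gen.iota.snd x t s) (fun x t y => Lin1.gen.iota.snd' x t y) x t y s z r
  have h2 := D_iota (S := S) x t y (s ++ z.bar :: r)
  have h3 : ∀ a : S.C, nilc a (s ++ z.bar :: r) = 0 := by intro a; cases s <;> rfl
  rw [h3, sub_zero] at h2
  have h4 : nilc (isg k (x.deg + wd t + y.deg + wd s) • gen (x.mul y) (s ++ z.bar :: r)) t =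
    isg k (x.deg + wd t + y.deg + wd s) • nilc (gen (x.mul y) (s ++ z.bar :: r)) t := by
    cases t <;> simp
  rw [h4, ← h2, eq_sub_of_add_eq' h1, iota3, map_smul, smul_add]
  abel

namespace Casimir

variable {m : ℤ} (ω : S.Casimir m)

lemma pinch_nilc_left (X : S.Fn M) (t) : ω.pinch (fun t1 p t3 q t2 => nilc (X p t3 q t2) t1) t =
      spl (fun t2 t3 => ω.cas fun p q => isg k (wd t3 * (m + q.deg + wd t2)) • X p t3 q t2) t := by
  rw [pinch, ← spl_nilc_left (fun _ v => spl (fun t2 t3 => ω.cas fun p q =>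
    isg k (wd t3 * (m + q.deg + wd t2)) • X p t3 q t2) v) t]
  refine spl_congr' _ fun u v _ => ?_
  cases u <;> simp [cas_zero, spl_zero]

lemma pinch_nilc_right (X : S.Wd → S.Mark → S.Mark → S.Wd → M) (t) :
    ω.pinch (fun t1 p t3 q t2 => nilc (X t1 p q t2) t3) t = spl (fun t1 t2 => ω.cas fun p q => X t1 p q t2) t := by
  rw [pinch]
  refine spl_congr' _ fun t1 v _ => ?_
  rw [← spl_nilc_right (fun t2 _ => ω.cas fun p q => X t1 p q t2) v]
  refine spl_congr' _ fun t2 t3 _ => ?_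
  cases t3 <;> simp [cas_zero]

lemma pinch_zero (t : S.Wd) : ω.pinch (fun _ _ _ _ _ => (0 : M)) t = 0 := by
  simp only [pinch, cas_zero, smul_zero]
  exact (spl_congr' _ fun u v _ => spl_zero v).trans (spl_zero t)

lemma map_pinch2 (φ : M →ₗ[k] N) (G : S.Mark → S.Wd → S.Mark → S.Wd → S.Mark → S.Wd → S.Mark → S.Wd → M) (x t y s) :
    φ (ω.pinch2 G x t y s) = ω.pinch2 (fun x t p s y r q l => φ (G x t p s y r q l)) x t y s := by
  simp only [pinch2, map_pinch, map_smul]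

lemma cas_comm (F : S.Mark → S.Mark → S.Mark → S.Mark → M) : (ω.cas fun p q => ω.cas fun p' q' => F p q p' q') =
      ω.cas fun p' q' => ω.cas fun p q => F p q p' q' := Finset.sum_comm

/-- Coassociativity of the coproduct of an open Frobenius algebra. -/
lemma cas_coassoc {Φ : S.Mark → S.Mark → S.Mark → M} (h1 : ∀ y z, Lin fun x => Φ x y z)
    (h2 : ∀ x z, Lin fun y => Φ x y z) (h3 : ∀ x y, Lin fun z => Φ x y z) :
    (ω.cas fun p q => ω.cas fun p' q' => Φ (p'.mul p) q' q) =
      ω.cas fun p q => ω.cas fun p' q' => isg k (p'.deg * q'.deg) • Φ p (p'.mul q) q' := by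
  rw [cas_comm]
  refine (ω.cas_congr fun p' q' _ =>
    ω.cas_mul (F := fun y z => Φ y q' z) ⟨fun z => h1 _ _, fun y => h3 _ _⟩ p').trans ?_
  rw [cas_comm]
  refine ω.cas_congr fun p q hpq => ?_
  refine (ω.cas_symm (F := fun y z => Φ p z (q.mul y)) ⟨fun z => (h3 p z).mul_left q, fun y => h2 _ _⟩).trans ?_
  refine Eq.trans (ω.cas_congr fun p' q' h => ?_) ((ω.cas_mul' (F := fun y z =>
    isg k (y.deg * (z.deg - q.deg)) • Φ p y z) (BiLin.isg ⟨fun z => h2 _ _, fun y => h3 _ _⟩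
      fun i j => i * (j - q.deg)) q).trans (ω.cas_congr fun p' q' h => ?_))
  · refine isg_congr ?_ _; push_cast; clear * -; grind
  · rw [isg_smul]; refine isg_congr ?_ _
    rw [← h]; push_cast; clear * -; grind [icast_sq]

/-- The homotopy for cocommutativity. -/
def h : S.C →ₗ[k] S.C ⊗[k] S.C := ω.op Lin1.gen.iota

/-- The homotopy for `θ B`. -/
def hB : S.C →ₗ[k] S.C ⊗[k] S.C := ω.op Lin1.gen.iota.iota3.rot2

lemma h_comm : tensorOdd (S.cgrShift m) S.D S.D ∘ₗ ω.h + ω.h ∘ₗ S.D =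
    kswap (S.cgrShift m) (S.cgrShift m) ∘ₗ ω.th - ω.th := by
  refine gen_ext fun x t => ?_
  have h1 := ω.op_comm_odd (M := S.C) (gr := S.cgrShift m) (cgrShift_internal m) S.D (e' := -1 - m)
    (by push_cast; grind)
    Lin1.gen.iota (fun x t y s => smul_mem _ _ (gen_mem_shift
      (by simp only [wd_append, wd_cons, Mark.bar_deg]; ring))) x t
  simp only [D_iota] at h1
  refine h1.trans ?_
  have h2 := ω.swap_th_gen .id x t
  have h3 := ω.th_gen .id x t
  simp only [id_apply] at h2 h3
  rw [LinearMap.sub_apply, comp_apply, h2, h3]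
  rw [← ω.pinch_nilc_left (fun p t3 q t2 => gen (x.mul p) t3 ⊗ₜ[k] gen q t2), split,
    ← ω.pinch_nilc_right (fun t1 p q t2 =>
      isg k (p.deg * (x.deg + wd t1)) • gen (p.mul x) t1 ⊗ₜ[k] gen q t2), ← pinch_sub]
  refine ω.pinch_congr t fun t1 t2 t3 p q _ _ => ?_
  rw [sub_tmul]
  congr 1
  · cases t1 <;> simp
  · cases t3 <;> simp [smul_tmul']

end Casimir

lemma isg_smul_tensor (a b : ℤ) (z : M ⊗[k] N) : isg k a • isg k b • z = isg k (a + b) • z := isg_smul a b z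

namespace Casimir

variable {m : ℤ} (ω : S.Casimir m)

/-! ### The Connes operator and the coproduct -/

lemma h_gen (φ : S.C ⊗[k] S.C →ₗ[k] M) (x t) : φ (ω.h (gen x t)) = ω.pinch (fun t1 p t3 q t2 =>
      isg k (x.deg + wd t1) • φ (gen x (t1 ++ p.bar :: t3) ⊗ₜ[k] gen q t2)) t := by
  rw [h, op_gen]
  refine ω.pinch_congr t fun t1 t2 t3 p q _ _ => ?_
  rw [iota, ← smul_tmul', map_smul]

/-- Half of the coproduct of the Connes operator. -/
def thB : S.C →ₗ[k] S.C ⊗[k] S.C := tensorOdd (S.cgrShift m) S.D S.D ∘ₗ ω.hB - ω.hB ∘ₗ S.D + map S.B .id ∘ₗ ω.th - ω.h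

lemma thB_gen (x t) : ω.thB (gen x t) = ω.pinch (fun t1 p t3 q t2 =>
    isg k ((x.deg + wd t1) * (p.deg + wd t3) + p.deg + wd t3) • (gen p (t3 ++ x.bar :: t1) ⊗ₜ[k] gen q t2)) t := by
  have h1 := ω.op_comm_even (M := S.C) (gr := S.cgrShift m) (cgrShift_internal m) S.D (e' := -2 - m)
    (by push_cast; grind)
    Lin1.gen.iota.iota3.rot2 (fun x t y s => spl_mem fun u v e => smul_mem _ _
      (smul_mem _ _ (smul_mem _ _ (gen_mem_shift
      (by simp only [wd_append, wd_cons, Mark.bar_deg, Mark.one_deg]; omega))))) x t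
  have h2 := ω.th_gen (map S.B .id) x t
  have h3 := ω.h_gen .id x t
  have h4 : ω.thB (gen x t) = tensorOdd (S.cgrShift m) S.D S.D (ω.hB (gen x t)) -
    ω.hB (S.D (gen x t)) + map S.B .id (ω.th (gen x t)) - ω.h (gen x t) := rfl
  rw [h4, hB, h1, h2, ← id_apply (R := k) (ω.h (gen x t)), h3]
  clear h1 h2 h3 h4
  have e2 : ω.split (fun x t y s => map S.B .id (gen x t ⊗ₜ[k] gen y s)) x t =
    ω.pinch (fun t1 p t3 q t2 => nilc ((isg k (p.deg * (x.deg + wd t1)) •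
      rot (iota gen) (p.mul x) t1) ⊗ₜ[k] gen q t2) t3) t := by
    rw [ω.pinch_nilc_right (fun t1 p q t2 => (isg k (p.deg * (x.deg + wd t1)) •
      rot (iota gen) (p.mul x) t1) ⊗ₜ[k] gen q t2)]
    refine spl_congr' _ fun t1 t2 _ => ω.cas_congr fun p q _ => ?_
    rw [← smul_tmul']
    refine congrArg (fun z => isg k (p.deg * (x.deg + wd t1)) • (z ⊗ₜ[k] gen q t2)) ?_
    exact B_gen .id (p.mul x) t1
  rw [e2, ← pinch_add, ← pinch_sub]
  refine ω.pinch_congr t fun t1 t2 t3 p q _ hpq => ?_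
  rw [map_rot2, D2_rot2 fun t y s z r => Lin1.gen.iota.iota3.fst t y s z r]
  have e3 : rot2 (fun x t y s z r => S.D (iota3 (iota gen) x t y s z r)) x t1 p t3 -
      rot2 (D3 (iota3 (iota gen))) x t1 p t3 = 
      isg k ((x.deg + wd t1) * (p.deg + wd t3) + p.deg + wd t3) • gen p (t3 ++ x.bar :: t1)
      - nilc (isg k (p.deg * (x.deg + wd t1)) • rot (iota gen) (p.mul x) t1) t3
      + iota gen x t1 p t3 := by
    simp only [rot2]
    rw [sub_eq_add_neg, ← spl_neg, ← spl_add]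
    have e4 : ∀ u v, isg k ((x.deg + wd u) * (wd v + p.deg + wd t3)) • S.D (iota3 (iota gen) (Mark.one S) v p t3 x u) +
        -(isg k ((x.deg + wd u) * (wd v + p.deg + wd t3)) •
          D3 (iota3 (iota gen)) (Mark.one S) v p t3 x u) =
        nilc (isg k ((x.deg + wd u) * (wd v + p.deg + wd t3) + (wd v + p.deg + wd t3)) • gen p (t3 ++ x.bar :: u)) v
        + -(isg k ((x.deg + wd u) * (wd v + p.deg + wd t3)) • nilc (iota gen (Mark.one S) v (p.mul x) u) t3)
        + nilc (isg k ((x.deg + wd u) * (wd v + p.deg + wd t3) + x.deg * (wd v + p.deg + wd t3)) •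
          iota gen x v p t3) u := by
      intro u v
      rw [← sub_eq_add_neg, ← smul_sub, D_iota3, smul_add, smul_sub, Mark.mul_one', Mark.one_mul', sub_eq_add_neg]
      congr 2
      · cases v <;> simp [isg_smul]
      · cases u <;> simp [isg_smul]
    simp only [e4]
    rw [spl_add, spl_add, spl_nilc_left, spl_nilc_right, spl_neg, sub_eq_add_neg]
    refine congrArg₂ (· + ·) (congrArg₂ (· + ·) ?_ (congrArg Neg.neg ?_)) ?_
    · refine isg_congr ?_ _; push_cast; clear * -; grind
    · cases t3 with
      | cons => simp [spl_zero]
      | nil =>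
        simp only [nilc_nil, rot]
        rw [← spl_smul]
        refine spl_congr' _ ?_
        rintro u v rfl
        rw [isg_smul]; refine isg_congr ?_ _; push_cast; clear * -; grind
    · refine isg_eq_one ?_ _
      push_cast; clear * -; grind
  rw [e3]
  simp only [add_tmul, sub_tmul, id_apply, iota]
  rw [smul_tmul', smul_tmul']
  cases t3 with
  | nil => simp only [nilc_nil]; abel
  | cons => simp only [nilc_cons, zero_tmul]; abel

lemma th_B : ω.th ∘ₗ S.B = ω.thB + kswap (S.cgrShift m) (S.cgrShift m) ∘ₗ ω.thB := by
  refine gen_ext fun x t => ?_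
  have h1 : ω.th (S.B (gen x t)) = _ := B_gen ω.th x t
  have h2 : kswap (S.cgrShift m) (S.cgrShift m) (ω.thB (gen x t)) = _ :=
    (congrArg _ (ω.thB_gen x t)).trans (ω.map_pinch _ _ t)
  rw [comp_apply, h1, LinearMap.add_apply, comp_apply, h2, thB_gen, add_comm]
  clear h1 h2
  have e : ∀ u v, isg k ((x.deg + wd u) * wd v) • iota (fun x t => ω.th (gen x t)) (Mark.one S) v x u =
      spl (fun t2 t3 => ω.cas fun p q => isg k ((x.deg + wd u) * wd v + wd v + p.deg * wd t2) •
        (gen p t2 ⊗ₜ[k] gen q (t3 ++ x.bar :: u))) v +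
      spl (fun t1 t2 => ω.cas fun p q => isg k ((x.deg + wd u) * wd v + wd v +
        p.deg * (wd v + x.deg + 1 + wd t1)) • (gen p (v ++ x.bar :: t1) ⊗ₜ[k] gen q t2)) u := by
    intro u v
    have h3 := ω.th_gen .id (Mark.one S) (v ++ x.bar :: u)
    rw [id_apply] at h3
    rw [iota, h3, split, spl_append, smul_add, smul_add]
    simp only [← spl_smul, ← cas_smul, isg_smul, Mark.mul_one', id_apply]
    congr 1
    · refine spl_congr' _ fun _ _ _ => ω.cas_congr fun p q _ => isg_congr ?_ _; push_cast; clear * -; grind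
    · refine spl_congr' _ fun _ _ _ => ω.cas_congr fun p q _ => isg_congr ?_ _; push_cast; clear * -; grind
  rw [rot]
  simp only [e]
  rw [spl_add]
  congr 1
  · rw [pinch]
    refine spl_congr' _ fun t1 v _ => ?_
    refine spl_congr' _ ?_
    rintro t2 t3 rfl
    have hb : BiLin fun p q => gen p t2 ⊗ₜ[k] gen q (t3 ++ x.bar :: t1) :=
      ⟨fun q => lin2_gen.fst _ _ _, fun p => lin2_gen.snd _ _ _⟩
    refine (ω.cas_symm (hb.isg fun i j => (x.deg + wd t1) * wd (t2 ++ t3) + wd (t2 ++ t3) +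
      i * wd t2)).trans (ω.cas_congr fun p q hpq => ?_)
    have hk : ∀ c, kswap (S.cgrShift m) (S.cgrShift m) (isg k c • (gen p (t3 ++ x.bar :: t1) ⊗ₜ[k] gen q t2))
      = isg k (c + (p.deg + wd (t3 ++ x.bar :: t1) + m) * (q.deg + wd t2 + m)) •
        (gen q t2 ⊗ₜ[k] gen p (t3 ++ x.bar :: t1)) := fun c =>
      (map_smul _ _ _).trans ((congrArg _ (kswap_gen m _ _ _ _)).trans (isg_smul_tensor _ _ _))
    rw [hk, isg_smul_tensor, isg_smul_tensor]
    refine isg_congr (M := S.C ⊗[k] S.C) ?_ _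
    rw [← hpq]; push_cast; clear * -; grind [icast_sq]
  · have h3 : ∀ u v, spl (fun t1 t2 => ω.cas fun p q => isg k ((x.deg + wd u) * wd v + wd v +
        p.deg * (wd v + x.deg + 1 + wd t1)) • (gen p (v ++ x.bar :: t1) ⊗ₜ[k] gen q t2)) u =
        spl (fun t1 t2 => ω.cas fun p q => isg k ((x.deg + wd (t1 ++ t2)) * wd v + wd v +
        p.deg * (wd v + x.deg + 1 + wd t1)) • (gen p (v ++ x.bar :: t1) ⊗ₜ[k] gen q t2)) u :=
      fun u v => spl_congr' _ fun t1 t2 ht => by rw [ht]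
    simp only [h3]
    rw [spl_assoc t fun t1 t2 v => ω.cas fun p q => isg k ((x.deg + wd (t1 ++ t2)) * wd v + wd v +
        p.deg * (wd v + x.deg + 1 + wd t1)) • (gen p (v ++ x.bar :: t1) ⊗ₜ[k] gen q t2)]
    rw [pinch]
    refine spl_congr' _ fun t1 v _ => spl_congr' _ fun t2 t3 _ => ω.cas_congr fun p q hpq => ?_
    rw [isg_smul_tensor]
    refine isg_congr (M := S.C ⊗[k] S.C) ?_ _
    rw [← hpq]; push_cast; clear * -; grind [icast_sq]

end Casimir

lemma sg_gen (m : ℤ) (x : S.Mark) (t) : sg (S.cgrShift m) 1 (gen x t) = isg k (x.deg + wd t + m) • gen x t := by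
  have h : gen x t ∈ S.cgrShift m (x.deg + wd t - m) := gen_mem_shift (by omega)
  have := sg_of_mem (V := S.C) (gr := S.cgrShift m) (cgrShift_internal m) 1 h
  rw [this, mul_one]
  refine isg_congr (M := S.C) ?_ _
  push_cast; clear * -; grind

namespace Casimir

variable {m : ℤ} (ω : S.Casimir m)

lemma pinch2_comm {gr : ℤ → Submodule k M} (hgr : IsInternal gr) (d : M →ₗ[k] M) {e : ℤ} (he : (e : ZMod 2) = m)
    {c : S.Mark → S.Wd → S.Fn M} (hc : Lin3 c)
    (hd : ∀ x t y s z r, c x t y s z r ∈ gr (x.deg + wd t + y.deg + wd s + z.deg + wd r + e))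
    (x t y s) :
    tensorOdd gr d S.D (ω.pinch2 (fun x t p s y r q l => c x t p s y r ⊗ₜ[k] gen q l) x t y s)
      - D2 (ω.pinch2 fun x t p s y r q l => c x t p s y r ⊗ₜ[k] gen q l) x t y s =
      ω.pinch2 (fun x t p s y r q l => (d (c x t p s y r) - D3 c x t p s y r) ⊗ₜ[k] gen q l)
        x t y s := by
  have h := ω.D2_pinch2 (G := fun x t p s y r q l => c x t p s y r ⊗ₜ[k] gen q l)
    (fun x t1 t3 y s t2 => ⟨fun q => (hc.snd x t1 t3 y s).comp
    ((TensorProduct.mk k M S.C).flip (gen q t2)), fun p => (Lin1.gen.tmul_right _).1 t2⟩) x t y s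
  rw [map_pinch2]
  refine (congrArg _ h).trans ?_
  rw [pinch2, pinch2, pinch2, ← pinch_sub]
  refine ω.pinch_congr t fun t1 t2 t3 p q _ hpq => ?_
  rw [← smul_sub]
  congr 1
  rw [tensorOdd_tmul hgr d S.D (hd x t1 p t3 y s), sub_tmul, D31]
  have h1 : D3 (fun x t p s y r => c x t p s y r ⊗ₜ[k] gen q t2) x t1 p t3 y s = D3 c x t1 p t3 y s ⊗ₜ[k] gen q t2 :=
    (map_D3 ((TensorProduct.mk k M S.C).flip (gen q t2)) c x t1 p t3 y s).symm
  have h2 : isg k (m + x.deg + wd t1 + p.deg + wd t3 + y.deg + wd s) •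
      D1 (fun q l => c x t1 p t3 y s ⊗ₜ[k] gen q l) q t2 =
      ksign k ((x.deg + wd t1 + p.deg + wd t3 + y.deg + wd s + e : ℤ) : ZMod 2) •
        (c x t1 p t3 y s ⊗ₜ[k] S.D (gen q t2)) :=
    (congrArg _ (D_gen (TensorProduct.mk k M S.C (c x t1 p t3 y s)) q t2).symm).trans
      (isg_congr (by push_cast; rw [he]; ring) _)
  rw [h1, h2]; abel

lemma lin2_pinch3 : Lin2 (ω.pinch2 fun x t p s y r q l =>
    iota3 (iota (gen (S := S))) x t p s y r ⊗ₜ[k] gen q l) :=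
  ω.lin2_pinch2 (fun q l => ⟨
      fun t y s z r => (Lin1.gen.iota.iota3.fst t y s z r).comp ((TensorProduct.mk k S.C S.C).flip _),
      fun x y s z r => (Lin1.gen.iota.iota3.fst' x y s z r).comp ((TensorProduct.mk k S.C S.C).flip _),
      fun x t s z r => (Lin1.gen.iota.iota3.snd x t s z r).comp ((TensorProduct.mk k S.C S.C).flip _),
      fun x t y z r => (Lin1.gen.iota.iota3.snd' x t y z r).comp ((TensorProduct.mk k S.C S.C).flip _),
      fun x t y s r => (Lin1.gen.iota.iota3.trd x t y s r).comp ((TensorProduct.mk k S.C S.C).flip _),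
      fun x t y s z => (Lin1.gen.iota.iota3.trd' x t y s z).comp ((TensorProduct.mk k S.C S.C).flip _)⟩)
    fun x t y s z r => Lin1.gen.tmul_right _

/-- The homotopy relating `(1 ⊗ θ) h` to `(h ⊗ 1) θ`. -/
def hθ : S.C →ₗ[k] (S.C ⊗[k] S.C) ⊗[k] S.C := ω.op ω.lin2_pinch3

lemma pinch3_mem (x : S.Mark) (t) (y : S.Mark) (s) :
    ω.pinch2 (fun x t p s y r q l => iota3 (iota (gen (S := S))) x t p s y r ⊗ₜ[k] gen q l) x t y s ∈
      tensorGr (S.cgrShift m) (S.cgrShift m) (x.deg + wd t + y.deg + wd s + (-2 - m)) := by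
  refine spl_mem fun t1 v e => spl_mem fun t2 t3 e' => ω.cas_mem fun p q hpq =>
    smul_mem _ _ (smul_mem _ _ ?_)
  simp only [iota3, iota, ← smul_tmul']
  exact smul_mem _ _ (smul_mem _ _ (gen2_mem (by simp only [wd_append, wd_cons, Mark.bar_deg]; omega)))

lemma pinch2_sub_add (G G' G'' : S.Mark → S.Wd → S.Mark → S.Wd → S.Mark → S.Wd → S.Mark → S.Wd → M) (x t y s) :
    ω.pinch2 (fun x t p s y r q l => G x t p s y r q l - G' x t p s y r q l + G'' x t p s y r q l)
      x t y s = ω.pinch2 G x t y s - ω.pinch2 G' x t y s + ω.pinch2 G'' x t y s := by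
  simp only [pinch2, smul_add, smul_sub, pinch_sub, pinch_add]

lemma pinch_sub_add (G G' G'' : S.Wd → S.Fn M) (t) :
    ω.pinch (fun t1 p t3 q t2 => G t1 p t3 q t2 - G' t1 p t3 q t2 + G'' t1 p t3 q t2) t =
      ω.pinch G t - ω.pinch G' t + ω.pinch G'' t := by
  simp only [pinch_sub, pinch_add]

lemma map_op_comm_even {gr : ℤ → Submodule k M} (hgr : IsInternal gr) (d : M →ₗ[k] M)
    {e' : ℤ} (he : (e' : ZMod 2) = m) {c : S.Fn M}
    (hc : Lin2 c) (hd : ∀ x t y s, c x t y s ∈ gr (x.deg + wd t + y.deg + wd s + e'))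
    (Θ : M ⊗[k] S.C →ₗ[k] N) (x t) :
    Θ (tensorOdd gr d S.D (ω.op hc (gen x t)) - ω.op hc (S.D (gen x t))) =
      ω.pinch (fun t1 p t3 q t2 => Θ ((d (c x t1 p t3) - D2 c x t1 p t3) ⊗ₜ[k] gen q t2)) t := by
  rw [ω.op_comm_even hgr d he hc hd, map_pinch]

lemma hθ_gen (Θ : (S.C ⊗[k] S.C) ⊗[k] S.C →ₗ[k] M) (x t) :
    Θ (tensorOdd (tensorGr (S.cgrShift m) (S.cgrShift m)) (tensorOdd (S.cgrShift m) S.D S.D) S.D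
      (ω.hθ (gen x t)) - ω.hθ (S.D (gen x t))) =
    ω.pinch (fun t1 p t3 q t2 => ω.pinch2 (fun x t p' s y r q' l =>
      nilc (isg k (x.deg + wd t + p'.deg + wd s) •
        Θ ((gen (x.mul p') (s ++ y.bar :: r) ⊗ₜ gen q' l) ⊗ₜ gen q t2)) t) x t1 p t3) t
    - ω.pinch (fun t1 p t3 q t2 => ω.pinch2 (fun x t p' s y r q' l =>
      nilc (isg k (x.deg + wd t) • Θ ((gen x (t ++ (p'.mul y).bar :: r) ⊗ₜ gen q' l) ⊗ₜ gen q t2)) s) x t1 p t3) t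
    + ω.pinch (fun t1 p t3 q t2 => ω.pinch2 (fun x t p' s y r q' l =>
      nilc (isg k (y.deg * (x.deg + wd t + p'.deg + wd s) + ((y.mul x).deg + wd t)) •
        Θ ((gen (y.mul x) (t ++ p'.bar :: s) ⊗ₜ gen q' l) ⊗ₜ gen q t2)) r) x t1 p t3) t := by
  have h1 := ω.map_op_comm_even (M := S.C ⊗[k] S.C) (gr := tensorGr (S.cgrShift m) (S.cgrShift m))
    (tensorGr_internal (cgrShift_internal m) (cgrShift_internal m))
    (tensorOdd (S.cgrShift m) S.D S.D) (e' := -2 - m) (by push_cast; grind)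
    ω.lin2_pinch3 ω.pinch3_mem Θ x t
  rw [← pinch_sub_add]
  refine h1.trans ?_
  refine ω.pinch_congr t fun t1 t2 t3 p q _ hpq => ?_
  have h2 := ω.pinch2_comm (M := S.C) (gr := S.cgrShift m) (cgrShift_internal m) S.D (e := -2 - m)
    (by push_cast; grind) Lin1.gen.iota.iota3 (fun x t y s z r => smul_mem _ _ (smul_mem _ _ (gen_mem_shift
        (by simp only [wd_append, wd_cons, Mark.bar_deg]; ring)))) x t1 p t3
  rw [h2]
  let Λ (q' : S.Mark) (l : S.Wd) : S.C →ₗ[k] M :=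
    Θ ∘ₗ (TensorProduct.mk k _ _).flip (gen q t2) ∘ₗ (TensorProduct.mk k _ _).flip (gen q' l)
  refine (ω.map_pinch2 (Θ ∘ₗ (TensorProduct.mk k (S.C ⊗[k] S.C) S.C).flip (gen q t2)) _ x t1 p t3).trans ?_
  rw [← pinch2_sub_add]
  congr 1
  ext x t p' s y r q' l
  change Λ q' l (S.D _ - D3 _ x t p' s y r) = _
  rw [D_iota3, map_add, map_sub, map_nilc, map_nilc, map_nilc, map_smul, map_smul, map_iota, map_iota,
    iota, iota, isg_smul]
  rfl

end Casimir

lemma smul_nilc (c : k) (a : M) (t : S.Wd) : c • nilc a t = nilc (c • a) t := by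
  cases t <;> simp

namespace Casimir

variable {m : ℤ} (ω : S.Casimir m)

/-- The Koszul flip of the last two factors. -/
def swap23 (m : ℤ) : (S.C ⊗[k] S.C) ⊗[k] S.C →ₗ[k] (S.C ⊗[k] S.C) ⊗[k] S.C := (assoc k S.C S.C S.C).symm.1 ∘ₗ
    map .id (kswap (S.cgrShift m) (S.cgrShift m)) ∘ₗ
    (assoc k S.C S.C S.C).1

lemma swap23_gen (m : ℤ) (Θ : (S.C ⊗[k] S.C) ⊗[k] S.C →ₗ[k] M) (a : S.C) (x y : S.Mark) (t s) :
    Θ (swap23 m ((a ⊗ₜ gen x t) ⊗ₜ gen y s)) =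
      isg k ((x.deg + wd t + m) * (y.deg + wd s + m)) • Θ ((a ⊗ₜ gen y s) ⊗ₜ gen x t) := by
  let L : S.C ⊗[k] S.C →ₗ[k] M := Θ ∘ₗ ((assoc k S.C S.C S.C).symm :
    S.C ⊗[k] (S.C ⊗[k] S.C) →ₗ[k] (S.C ⊗[k] S.C) ⊗[k] S.C) ∘ₗ TensorProduct.mk k S.C (S.C ⊗[k] S.C) a
  have := congrArg L (kswap_gen m x y t s)
  rw [map_smul] at this
  exact this

lemma map_h_th_gen (Θ : (S.C ⊗[k] S.C) ⊗[k] S.C →ₗ[k] M) (x t) : Θ (map ω.h .id (ω.th (gen x t))) =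
    ω.pinch (fun t1 p t3 q t2 => ω.pinch2 (fun x t p' s y r q' l =>
      nilc (isg k (y.deg * (x.deg + wd t + p'.deg + wd s) + ((y.mul x).deg + wd t)) •
        Θ ((gen (y.mul x) (t ++ p'.bar :: s) ⊗ₜ gen q' l) ⊗ₜ gen q t2)) r) x t1 p t3) t := by
  refine (ω.th_gen (Θ ∘ₗ map ω.h .id) x t).trans ?_
  rw [split]
  refine (ω.pinch_nilc_right (fun t1 p q t2 => isg k (p.deg * (x.deg + wd t1)) •
    (Θ ∘ₗ map ω.h .id) (gen (p.mul x) t1 ⊗ₜ[k] gen q t2)) t).symm.trans ?_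
  refine ω.pinch_congr t fun t1 t2 t3 p q _ hpq => ?_
  cases t3 with
  | cons => simp only [nilc_cons, pinch2, smul_zero]; exact (ω.pinch_zero t1).symm
  | nil =>
    simp only [nilc_nil, pinch2]
    refine (congrArg _ (ω.h_gen (Θ ∘ₗ (TensorProduct.mk k _ _).flip (gen q t2)) (p.mul x) t1)).trans ?_
    rw [← pinch_smul]
    refine ω.pinch_congr t1 fun u1 u2 u3 p' q' ht hpq' => ?_
    rw [isg_smul, isg_smul]; refine isg_congr ?_ _
    rw [← ht]
    simp only [wd_append, wd_nil, Mark.mul_deg]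
    rw [← hpq']
    push_cast; clear * -; grind [icast_sq]

lemma map_swap_h_swap_th_gen (Θ : (S.C ⊗[k] S.C) ⊗[k] S.C →ₗ[k] M) (x t) : Θ (swap23 m (map ω.h .id
      (kswap (S.cgrShift m) (S.cgrShift m) (ω.th (gen x t))))) =
    ω.pinch (fun t1 p t3 q t2 => ω.pinch2 (fun x t p' s y r q' l =>
      nilc (isg k (x.deg + wd t + p'.deg + wd s) •
        Θ ((gen (x.mul p') (s ++ y.bar :: r) ⊗ₜ gen q' l) ⊗ₜ gen q t2)) t) x t1 p t3) t := by
  let E (x : S.Mark) (t : S.Wd) (y : S.Mark) (s) (z : S.Mark) (r) : M := Θ ((gen x t ⊗ₜ gen y s) ⊗ₜ gen z r)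
  refine (ω.swap_th_gen (Θ ∘ₗ swap23 m ∘ₗ map ω.h .id) x t).trans ?_
  let G (u2 u3 t2 t3 : S.Wd) : M := ω.cas fun p q => ω.cas fun p' q' =>
    isg k (wd t3 * (m + q.deg + wd t2) + (m + q'.deg + wd u2) * (p.deg + wd t3) +
      wd u3 * (m + q'.deg + wd u2) + (x.deg + p'.deg + wd u3)) •
    E (x.mul p') (u3 ++ p.bar :: t3) q' u2 q t2
  have h1 : ω.pinch (fun t1 p t3 q t2 => ω.pinch2 (fun x t p' s y r q' l =>
      nilc (isg k (x.deg + wd t + p'.deg + wd s) •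
        Θ ((gen (x.mul p') (s ++ y.bar :: r) ⊗ₜ gen q' l) ⊗ₜ gen q t2)) t) x t1 p t3) t =
      spl (fun t1 v => spl (fun t2 t3 => spl (fun u2 u3 => G u2 u3 t2 t3) t1) v) t := by
    refine spl_congr' _ fun t1 v _ => spl_congr' _ fun t2 t3 _ => ?_
    rw [← cas_spl]
    refine ω.cas_congr fun p q hpq => ?_
    simp only [pinch2, smul_nilc]
    have e : ∀ t1, ω.pinch (fun t p' s q' l => nilc (isg k ((m + q'.deg + wd l) * (p.deg + wd t3)) •
        isg k (x.deg + wd t + p'.deg + wd s) •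
        Θ ((gen (x.mul p') (s ++ p.bar :: t3) ⊗ₜ gen q' l) ⊗ₜ gen q t2)) t) t1 =
        ω.pinch (fun t p' s q' l => nilc (isg k ((m + q'.deg + wd l) * (p.deg + wd t3)) •
        isg k (x.deg + p'.deg + wd s) •
        Θ ((gen (x.mul p') (s ++ p.bar :: t3) ⊗ₜ gen q' l) ⊗ₜ gen q t2)) t) t1 := fun t1 =>
      ω.pinch_congr t1 fun u1 _ _ _ _ _ _ => by cases u1 <;> simp
    rw [e, ω.pinch_nilc_left (fun p' s q' t2' => isg k ((m + q'.deg + wd t2') * (p.deg + wd t3)) •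
        isg k (x.deg + p'.deg + wd s) •
        Θ ((gen (x.mul p') (s ++ p.bar :: t3) ⊗ₜ gen q' t2') ⊗ₜ gen q t2)),
        ← spl_smul]
    refine spl_congr' _ fun u2 u3 _ => ?_
    rw [← cas_smul]
    refine ω.cas_congr fun p' q' _ => ?_
    rw [isg_smul, isg_smul, isg_smul]; refine isg_congr ?_ _
    push_cast; ring
  rw [h1]
  refine Eq.trans ?_ ((spl_congr' _ fun t1 v _ => spl_comm v (fun t2 t3 u2 u3 => G u2 u3 t2 t3) t1).trans
      (spl_assoc t fun u2 u3 v => spl (fun t2 t3 => G u2 u3 t2 t3) v)).symm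
  refine spl_congr' _ fun u2 w _ => ?_
  refine (ω.cas_congr fun p' q' hpq => congrArg _ (ω.h_gen (Θ ∘ₗ swap23 m ∘ₗ
    (TensorProduct.mk k _ _).flip (gen q' u2)) (x.mul p') w)).trans ?_
  simp only [pinch, ← spl_smul]
  rw [cas_spl]
  refine spl_congr' _ fun u3 v hw => ?_
  rw [cas_spl]
  refine spl_congr' _ fun t2 t3 hv => ?_
  subst hv hw
  simp only [← cas_smul]
  rw [cas_comm]
  refine ω.cas_congr fun p q hpq => ω.cas_congr fun p' q' hpq' => ?_
  refine (congrArg _ (congrArg _ (congrArg _ (swap23_gen m Θ (gen (x.mul p') (u3 ++ p.bar :: t3))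
    q q' t2 u2)))).trans ?_
  rw [isg_smul, isg_smul, isg_smul]; refine isg_congr ?_ _
  simp only [wd_append, wd_cons, Mark.mul_deg, Mark.bar_deg]
  rw [show p.deg = m - q.deg by omega, ← hpq']; push_cast; clear * -; grind [icast_sq]

lemma map_th_h_gen (Θ : (S.C ⊗[k] S.C) ⊗[k] S.C →ₗ[k] M) (x t) :
    Θ ((assoc k S.C S.C S.C).symm (map .id ω.th (ω.h (gen x t)))) =
    ω.pinch (fun t1 p t3 q t2 => ω.pinch2 (fun x t p' s y r q' l =>
      nilc (isg k (x.deg + wd t) • Θ ((gen x (t ++ (p'.mul y).bar :: r) ⊗ₜ gen q' l) ⊗ₜ gen q t2)) s) x t1 p t3) t := by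
  let E (x : S.Mark) (t : S.Wd) (y : S.Mark) (s) (z : S.Mark) (r) : M := Θ ((gen x t ⊗ₜ gen y s) ⊗ₜ gen z r)
  refine (ω.h_gen (Θ ∘ₗ ((assoc k S.C S.C S.C).symm : S.C ⊗[k] (S.C ⊗[k] S.C) →ₗ[k] (S.C ⊗[k] S.C) ⊗[k] S.C) ∘ₗ
    map .id ω.th) x t).trans ?_
  have h1 : ω.pinch (fun t1 p t3 q t2 => ω.pinch2 (fun x t p' s y r q' l =>
      nilc (isg k (x.deg + wd t) • Θ ((gen x (t ++ (p'.mul y).bar :: r) ⊗ₜ gen q' l) ⊗ₜ gen q t2)) s) x t1 p t3) t =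
      spl (fun t1 v => spl (fun v1 t3 => spl (fun u2 t2 => ω.cas fun p q => ω.cas fun p' q' =>
        isg k (wd t3 * (m + q.deg + wd t2) + (m + q'.deg + wd u2) * (p.deg + wd t3) + (x.deg + wd t1)) •
        E x (t1 ++ (p'.mul p).bar :: t3) q' u2 q t2) v1) v) t := by
    let G (u1 u2 t2 t3 : S.Wd) : M := ω.cas fun p q => ω.cas fun p' q' =>
        isg k (wd t3 * (m + q.deg + wd t2) + (m + q'.deg + wd u2) * (p.deg + wd t3) + (x.deg + wd u1)) •
        E x (u1 ++ (p'.mul p).bar :: t3) q' u2 q t2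
    have h3 : ω.pinch (fun t1 p t3 q t2 => ω.pinch2 (fun x t p' s y r q' l =>
        nilc (isg k (x.deg + wd t) •
        Θ ((gen x (t ++ (p'.mul y).bar :: r) ⊗ₜ gen q' l) ⊗ₜ gen q t2)) s) x t1 p t3) t =
        spl (fun t1 v => spl (fun t2 t3 => spl (fun u1 u2 => G u1 u2 t2 t3) t1) v) t := by
      refine spl_congr' _ fun t1 v _ => spl_congr' _ fun t2 t3 _ => ?_
      rw [← cas_spl]
      refine ω.cas_congr fun p q hpq => ?_
      simp only [pinch2, smul_nilc]
      rw [ω.pinch_nilc_right (fun t1 p' q' t2' => isg k ((m + q'.deg + wd t2') * (p.deg + wd t3)) •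
        isg k (x.deg + wd t1) • Θ ((gen x (t1 ++ (p'.mul p).bar :: t3) ⊗ₜ gen q' t2') ⊗ₜ gen q t2)),
        ← spl_smul]
      refine spl_congr' _ fun u1 u2 _ => ?_
      rw [← cas_smul]
      refine ω.cas_congr fun p' q' _ => ?_
      rw [isg_smul, isg_smul]
    rw [h3]
    refine (spl_congr' _ fun t1 v _ => spl_comm v (fun t2 t3 u1 u2 => G u1 u2 t2 t3) t1).trans
      ((spl_assoc t fun u1 u2 v => spl (fun t2 t3 => G u1 u2 t2 t3) v).trans ?_)
    exact spl_congr' _ fun u1 w _ => (spl_assoc w fun u2 t2 t3 => G u1 u2 t2 t3).symm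
  have h2 : ω.pinch (fun t1 p t3 q t2 => isg k (x.deg + wd t1) • (Θ ∘ₗ ((assoc k S.C S.C S.C).symm :
    S.C ⊗[k] (S.C ⊗[k] S.C) →ₗ[k] (S.C ⊗[k] S.C) ⊗[k] S.C) ∘ₗ
    map .id ω.th) (gen x (t1 ++ p.bar :: t3) ⊗ₜ[k] gen q t2)) t =
      spl (fun t1 v => spl (fun v1 t3 => spl (fun u2 t2 => ω.cas fun p q => ω.cas fun p' q' =>
        isg k (wd t3 * (m + q.deg + wd v1) + (x.deg + wd t1) + p'.deg * (q.deg + wd u2)) •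
        E x (t1 ++ p.bar :: t3) (p'.mul q) u2 q' t2) v1) v) t := by
    refine spl_congr' _ fun t1 v _ => spl_congr' _ fun v1 t3 _ => ?_
    rw [← cas_spl]
    refine ω.cas_congr fun p q hpq => ?_
    refine (congrArg _ (congrArg _ (ω.th_gen (Θ ∘ₗ ((assoc k S.C S.C S.C).symm :
    S.C ⊗[k] (S.C ⊗[k] S.C) →ₗ[k] (S.C ⊗[k] S.C) ⊗[k] S.C) ∘ₗ
    TensorProduct.mk k _ _ (gen x (t1 ++ p.bar :: t3))) q v1))).trans ?_
    rw [split, ← spl_smul, ← spl_smul]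
    refine spl_congr' _ fun u2 t2 _ => ?_
    rw [← cas_smul, ← cas_smul]
    refine ω.cas_congr fun p' q' hpq' => ?_
    rw [isg_smul, isg_smul]; refine isg_congr ?_ _; push_cast; clear * -; grind [icast_sq]
  rw [h1]; refine h2.trans ?_
  refine spl_congr' _ fun t1 v _ => spl_congr' _ fun v1 t3 _ => spl_congr' _ fun u2 t2 hv => ?_
  subst hv
  have hE1 : ∀ y z, Lin fun w : S.Mark => E x (t1 ++ w.bar :: t3) y u2 z t2 := fun y z =>
    (Lin1.gen.2 x).lin t1 t3 |>.comp (Θ ∘ₗ (TensorProduct.mk k _ _).flip (gen z t2) ∘ₗ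
      (TensorProduct.mk k S.C S.C).flip (gen y u2))
  have hE2 : ∀ w z : S.Mark, Lin fun y : S.Mark => E x (t1 ++ w.bar :: t3) y u2 z t2 := fun w z =>
    (Lin1.gen.1 u2).comp (Θ ∘ₗ (TensorProduct.mk k _ _).flip (gen z t2) ∘ₗ
      (TensorProduct.mk k S.C S.C) (gen x (t1 ++ w.bar :: t3)))
  have hE3 : ∀ w y : S.Mark, Lin fun z : S.Mark => E x (t1 ++ w.bar :: t3) y u2 z t2 := fun w y =>
    (Lin1.gen.1 t2).comp (Θ ∘ₗ (TensorProduct.mk k _ _) (gen x (t1 ++ w.bar :: t3) ⊗ₜ gen y u2))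
  have h3 := ω.cas_coassoc (Φ := fun a b c => isg k (wd t3 * (m + c.deg + wd t2) +
      (m + b.deg + wd u2) * (m - c.deg + wd t3) + (x.deg + wd t1)) • E x (t1 ++ a.bar :: t3) b u2 c t2)
    (fun y z => (hE1 y z).isg fun _ => (wd t3 * (m + z.deg + wd t2) +
      (m + y.deg + wd u2) * (m - z.deg + wd t3) + (x.deg + wd t1)))
    (fun w z => (hE2 w z).isg fun i => (wd t3 * (m + z.deg + wd t2) +
      (m + i + wd u2) * (m - z.deg + wd t3) + (x.deg + wd t1)))
    (fun w y => (hE3 w y).isg fun i => (wd t3 * (m + i + wd t2) +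
      (m + y.deg + wd u2) * (m - i + wd t3) + (x.deg + wd t1)))
  refine Eq.trans ?_ (h3.symm.trans ?_)
  · refine ω.cas_congr fun p q hpq => ω.cas_congr fun p' q' hpq' => ?_
    rw [isg_smul]; refine isg_congr ?_ _
    simp only [wd_append, Mark.mul_deg]
    rw [← hpq']; push_cast; clear * -; grind [icast_sq]
  · refine ω.cas_congr fun p q hpq => ω.cas_congr fun p' q' hpq' => ?_
    refine isg_congr ?_ _
    rw [← hpq]; push_cast; clear * -; grind [icast_sq]

lemma hθ_D (c : S.C) : tensorOdd (tensorGr (S.cgrShift m) (S.cgrShift m))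
      (tensorOdd (S.cgrShift m) S.D S.D) S.D (ω.hθ c) +
      (assoc k S.C S.C S.C).symm (map .id ω.th (ω.h c)) =
    ω.hθ (S.D c) + swap23 m (map ω.h .id (kswap (S.cgrShift m) (S.cgrShift m) (ω.th c))) + map ω.h .id (ω.th c) := by
  have h : tensorOdd (tensorGr (S.cgrShift m) (S.cgrShift m)) (tensorOdd (S.cgrShift m) S.D S.D) S.D ∘ₗ ω.hθ +
      (assoc k S.C S.C S.C).symm.1 ∘ₗ map .id ω.th ∘ₗ ω.h =
      ω.hθ ∘ₗ S.D + swap23 m ∘ₗ map ω.h .id ∘ₗ kswap (S.cgrShift m) (S.cgrShift m) ∘ₗ ω.th +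
      map ω.h .id ∘ₗ ω.th := by
    refine gen_ext (M := (S.C ⊗[k] S.C) ⊗[k] S.C) fun x t => ?_
    have h := ω.hθ_gen (M := (S.C ⊗[k] S.C) ⊗[k] S.C) (.id (R := k) (M := (S.C ⊗[k] S.C) ⊗[k] S.C)) x t
    rw [← ω.map_swap_h_swap_th_gen, ← ω.map_th_h_gen, ← ω.map_h_th_gen] at h
    have e : ∀ {X : Type _} [AddCommGroup X] (a b c d e : X), a - b = c - d + e → a + d = b + c + e := by
      intro X _ a b c d e h
      rw [sub_eq_iff_eq_add] at h; rw [h]; abel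
    exact e (X := (S.C ⊗[k] S.C) ⊗[k] S.C) _ _ _ _ _ h
  exact congr_fun h c

lemma coassoc : (assoc k S.C S.C S.C).1 ∘ₗ map ω.th .id ∘ₗ ω.th = map .id ω.th ∘ₗ ω.th := by
  refine gen_ext fun x t => ?_
  let E (x : S.Mark) (t : S.Wd) (y : S.Mark) (s) (z : S.Mark) (r) : S.C ⊗[k] (S.C ⊗[k] S.C) :=
    gen x t ⊗ₜ (gen y s ⊗ₜ gen z r)
  have h1 := ω.th_gen ((assoc k S.C S.C S.C).1 ∘ₗ map ω.th .id) x t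
  have h2 := ω.th_gen (map .id ω.th) x t
  refine h1.trans (Eq.trans ?_ h2.symm)
  have e1 : ω.split (fun x t y s => ((assoc k S.C S.C S.C).1 ∘ₗ map ω.th .id) (gen x t ⊗ₜ gen y s)) x t =
      spl (fun u w => spl (fun t1 t2 => ω.cas fun p q => ω.cas fun p' q' =>
        isg k (p.deg * (x.deg + wd u) + p'.deg * (p.deg + x.deg + wd t1)) •
          E ((p'.mul p).mul x) t1 q' t2 q w) u) t := by
    refine spl_congr' _ fun u w _ => ?_
    rw [← cas_spl]
    refine ω.cas_congr fun p q hpq => ?_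
    refine (congrArg _ (ω.th_gen ((assoc k S.C S.C S.C).1 ∘ₗ
      (TensorProduct.mk k _ _).flip (gen q w)) (p.mul x) u)).trans ?_
    rw [split, ← spl_smul]
    refine spl_congr' _ fun t1 t2 _ => ?_
    rw [← cas_smul]
    refine ω.cas_congr fun p' q' hpq' => ?_
    rw [isg_smul, Mark.mul_assoc']
    rfl
  have e2 : ω.split (fun x t y s => (map .id ω.th) (gen x t ⊗ₜ gen y s)) x t =
      spl (fun t1 v => spl (fun t2 w => ω.cas fun p q => ω.cas fun p' q' =>
        isg k (p.deg * (x.deg + wd t1) + p'.deg * (q.deg + wd t2)) • E (p.mul x) t1 (p'.mul q) t2 q' w) v) t := by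
    refine spl_congr' _ fun t1 v _ => ?_
    rw [← cas_spl]
    refine ω.cas_congr fun p q hpq => ?_
    refine (congrArg _ (ω.th_gen (TensorProduct.mk k _ _ (gen (p.mul x) t1)) q v)).trans ?_
    rw [split, ← spl_smul]
    refine spl_congr' _ fun t2 w _ => ?_
    rw [← cas_smul]
    refine ω.cas_congr fun p' q' hpq' => ?_
    rw [isg_smul]
    rfl
  refine e1.trans (Eq.trans ?_ e2.symm)
  refine Eq.trans (spl_congr' t fun u w _ => spl_congr' u fun t1 t2 hu => ?_)
    (spl_assoc t fun t1 t2 w => ω.cas fun p q => ω.cas fun p' q' =>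
        isg k (p.deg * (x.deg + wd t1) + p'.deg * (q.deg + wd t2)) • E (p.mul x) t1 (p'.mul q) t2 q' w)
  subst hu
  have h3 := ω.cas_coassoc (Φ := fun a b c => isg k (a.deg * (x.deg + wd t1) +
      (m - c.deg) * wd t2 + (m - b.deg) * (m - c.deg)) • E (a.mul x) t1 b t2 c w)
    (fun b c => ((Lin1.gen.1 t1).mul_right x |>.comp
      ((TensorProduct.mk k S.C (S.C ⊗[k] S.C)).flip (gen b t2 ⊗ₜ gen c w))).isg fun i => i * (x.deg + wd t1) +
      (m - c.deg) * wd t2 + (m - b.deg) * (m - c.deg))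
    (fun a c => ((Lin1.gen.1 t2).comp ((TensorProduct.mk k S.C (S.C ⊗[k] S.C)) (gen (a.mul x) t1) ∘ₗ
      (TensorProduct.mk k S.C S.C).flip (gen c w))).isg fun i => a.deg * (x.deg + wd t1) +
      (m - c.deg) * wd t2 + (m - i) * (m - c.deg))
    (fun a b => ((Lin1.gen.1 w).comp ((TensorProduct.mk k S.C (S.C ⊗[k] S.C)) (gen (a.mul x) t1) ∘ₗ
      (TensorProduct.mk k S.C S.C) (gen b t2))).isg fun i => a.deg * (x.deg + wd t1) +
      (m - i) * wd t2 + (m - b.deg) * (m - i))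
  refine Eq.trans ?_ (h3.trans ?_)
  · refine ω.cas_congr fun p q hpq => ω.cas_congr fun p' q' hpq' => isg_congr (M := S.C ⊗[k] (S.C ⊗[k] S.C)) ?_ _
    simp only [wd_append, Mark.mul_deg]
    rw [show m - q.deg = p.deg by omega, show m - q'.deg = p'.deg by omega]
    push_cast; clear * -; grind [icast_sq]
  · refine ω.cas_congr fun p q hpq => ω.cas_congr fun p' q' hpq' => ?_
    refine (isg_smul (M := S.C ⊗[k] (S.C ⊗[k] S.C)) _ _ _).trans (isg_congr (M := S.C ⊗[k] (S.C ⊗[k] S.C)) ?_ _)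
    simp only [wd_append, Mark.mul_deg]
    rw [show m - q'.deg = p'.deg by omega]
    have : (m : ZMod 2) = p.deg + q.deg := by rw [← hpq]; push_cast; rfl
    push_cast
    have h' : (q'.deg : ZMod 2) = m - p'.deg := by rw [← hpq']; push_cast; ring
    rw [h', this]; clear * -; grind [icast_sq]

lemma map_th_h_gen' (Θ : (S.C ⊗[k] S.C) ⊗[k] S.C →ₗ[k] M) (x t) : Θ (map ω.th .id (ω.h (gen x t))) =
    Θ (swap23 m (map ω.h .id (ω.th (gen x t)))) +
    Θ ((assoc k S.C S.C S.C).symm (map (sg (S.cgrShift m) 1) ω.h (ω.th (gen x t)))) := by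
  let E (x : S.Mark) (t : S.Wd) (y : S.Mark) (s) (z : S.Mark) (r) : M := Θ ((gen x t ⊗ₜ gen y s) ⊗ₜ gen z r)
  have h1 := ω.h_gen (Θ ∘ₗ map ω.th .id) x t
  have h2 := ω.th_gen (Θ ∘ₗ swap23 m ∘ₗ map ω.h .id) x t
  have h3 := ω.th_gen (Θ ∘ₗ ((assoc k S.C S.C S.C).symm : S.C ⊗[k] (S.C ⊗[k] S.C) →ₗ[k] (S.C ⊗[k] S.C) ⊗[k] S.C) ∘ₗ
    map (sg (S.cgrShift m) 1) ω.h) x t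
  refine h1.trans (Eq.trans ?_ (congrArg₂ (· + ·) h2 h3).symm)
  clear h1 h2 h3
  let P (t1 t2 u v : S.Wd) : M := ω.cas fun p q => ω.cas fun p' q' =>
    isg k (wd (u ++ v) * (m + q.deg + wd t2) + (x.deg + wd t1) +
      p'.deg * (x.deg + wd t1 + p.deg - 1 + wd u)) • E (p'.mul x) (t1 ++ p.bar :: u) q' v q t2
  let Q (u v t2 t3 : S.Wd) : M := ω.cas fun p q => ω.cas fun p' q' =>
    isg k (wd t3 * (m + q.deg + wd t2) + (x.deg + wd (u ++ v)) + p'.deg * (x.deg + wd u)) •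
      E (p'.mul x) u q' (v ++ p.bar :: t3) q t2
  have e1 : ω.pinch (fun t1 p t3 q t2 => isg k (x.deg + wd t1) •
      (Θ ∘ₗ map ω.th .id) (gen x (t1 ++ p.bar :: t3) ⊗ₜ[k] gen q t2)) t =
      spl (fun t1 w => spl (fun t2 t3 => spl (fun u v => P t1 t2 u v) t3) w) t +
      spl (fun t1 w => spl (fun t2 t3 => spl (fun u v => Q u v t2 t3) t1) w) t := by
    rw [pinch, ← spl_add]
    refine spl_congr' _ fun t1 w _ => ?_
    rw [← spl_add]
    refine spl_congr' _ fun t2 t3 _ => ?_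
    simp only [P, Q]
    rw [← cas_spl, ← cas_spl, ← cas_add]
    refine ω.cas_congr fun p q hpq => ?_
    refine (congrArg _ (congrArg _ (ω.th_gen (Θ ∘ₗ (TensorProduct.mk k (S.C ⊗[k] S.C) S.C).flip (gen q t2)) x
      (t1 ++ p.bar :: t3)))).trans ?_
    rw [split, spl_append, smul_add, smul_add]
    refine (add_comm _ _).trans (congrArg₂ (· + ·) ?_ ?_)
    · rw [← spl_smul, ← spl_smul]
      refine spl_congr' _ fun u v ht => ?_
      rw [← cas_smul, ← cas_smul]
      refine ω.cas_congr fun p' q' _ => ?_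
      rw [isg_smul, isg_smul]; refine isg_congr ?_ _
      subst ht
      simp only [wd_append, wd_cons, Mark.bar_deg]
      push_cast; clear * -; grind
    · rw [← spl_smul, ← spl_smul]
      refine spl_congr' _ fun u v ht => ?_
      rw [← cas_smul, ← cas_smul]
      refine ω.cas_congr fun p' q' _ => ?_
      rw [isg_smul, isg_smul]; refine isg_congr ?_ _
      subst ht
      push_cast; clear * -; grind
  refine e1.trans (congrArg₂ (· + ·) ?_ ?_)
  · have e2 : ω.split (fun x t y s => (Θ ∘ₗ swap23 m ∘ₗ map ω.h .id) (gen x t ⊗ₜ[k] gen y s)) x t =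
        spl (fun a v => spl (fun t1 b => spl (fun t2 u => P t1 t2 u v) b) a) t := by
      refine spl_congr' _ fun a v _ => ?_
      refine (ω.cas_congr fun p' q' hpq' => congrArg _ (ω.h_gen (Θ ∘ₗ swap23 m ∘ₗ
        (TensorProduct.mk k (S.C ⊗[k] S.C) S.C).flip (gen q' v)) (p'.mul x) a)).trans ?_
      simp only [pinch, ← spl_smul]
      rw [cas_spl]
      refine spl_congr' _ fun t1 b hb => ?_
      rw [cas_spl]
      refine spl_congr' _ fun t2 u ha => ?_
      subst ha hb
      simp only [← cas_smul]
      rw [cas_comm]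
      refine ω.cas_congr fun p q hpq => ω.cas_congr fun p' q' hpq' => ?_
      refine (congrArg _ (congrArg _ (congrArg _ (swap23_gen m Θ _ q q' t2 v)))).trans ?_
      rw [isg_smul, isg_smul, isg_smul]; refine isg_congr ?_ _
      simp only [wd_append, Mark.mul_deg]
      rw [show q'.deg = m - p'.deg by omega, show p.deg = m - q.deg by omega]
      push_cast; clear * -; grind [icast_sq]
    rw [e2]
    refine Eq.trans ?_ (spl_congr' t fun a v _ => spl_assoc a fun t1 t2 u => P t1 t2 u v)
    refine Eq.trans ?_ (spl_congr' t fun a v _ => (spl_assoc a fun t1 t2 u => P t1 t2 u v).symm)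
    refine Eq.trans ?_ (spl_assoc t fun t1 b v => spl (fun t2 u => P t1 t2 u v) b).symm
    refine spl_congr' _ fun t1 w _ => ?_
    exact (spl_assoc w fun t2 u v => P t1 t2 u v).symm
  · have e3 : ω.split (fun x t y s => (Θ ∘ₗ ((assoc k S.C S.C S.C).symm :
        S.C ⊗[k] (S.C ⊗[k] S.C) →ₗ[k] (S.C ⊗[k] S.C) ⊗[k] S.C) ∘ₗ
        map (sg (S.cgrShift m) 1) ω.h) (gen x t ⊗ₜ[k] gen y s)) x t =
        spl (fun u w => spl (fun v b => spl (fun t2 t3 => Q u v t2 t3) b) w) t := by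
      refine spl_congr' _ fun u w _ => ?_
      have e4 : ∀ y z : S.Mark, (Θ ∘ₗ ((assoc k S.C S.C S.C).symm :
        S.C ⊗[k] (S.C ⊗[k] S.C) →ₗ[k] (S.C ⊗[k] S.C) ⊗[k] S.C) ∘ₗ
        map (sg (S.cgrShift m) 1) ω.h) (gen y u ⊗ₜ[k] gen z w) =
        isg k (y.deg + wd u + m) • ω.pinch (fun v p t3 q t2 => isg k (z.deg + wd v) •
          E y u z (v ++ p.bar :: t3) q t2) w := by
        intro y z
        have h := ω.h_gen (Θ ∘ₗ ((assoc k S.C S.C S.C).symm : S.C ⊗[k] (S.C ⊗[k] S.C) →ₗ[k] (S.C ⊗[k] S.C) ⊗[k] S.C) ∘ₗ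
          TensorProduct.mk k S.C (S.C ⊗[k] S.C) (gen y u)) z w
        refine Eq.trans ?_ (congrArg _ h)
        have h' := congrArg (Θ ∘ₗ ((assoc k S.C S.C S.C).symm :
          S.C ⊗[k] (S.C ⊗[k] S.C) →ₗ[k] (S.C ⊗[k] S.C) ⊗[k] S.C) ∘ₗ
          (TensorProduct.mk k S.C (S.C ⊗[k] S.C)).flip (ω.h (gen z w))) (sg_gen m y u)
        rw [map_smul] at h'
        exact h'
      refine (ω.cas_congr fun p' q' hpq' => congrArg _ (e4 _ _)).trans ?_
      simp only [pinch, ← spl_smul]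
      rw [cas_spl]
      refine spl_congr' _ fun v b hb => ?_
      rw [cas_spl]
      refine spl_congr' _ fun t2 t3 ha => ?_
      subst ha hb
      simp only [← cas_smul]
      rw [cas_comm]
      refine ω.cas_congr fun p q hpq => ω.cas_congr fun p' q' hpq' => ?_
      rw [isg_smul, isg_smul, isg_smul]; refine isg_congr ?_ _
      simp only [wd_append, Mark.mul_deg]
      rw [show q'.deg = m - p'.deg by omega]
      push_cast; clear * -; grind [icast_sq]
    rw [e3]
    refine (spl_congr' _ fun t1 v _ => spl_comm v (fun t2 t3 u v => Q u v t2 t3) t1).trans ?_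
    exact spl_assoc t fun u v b => spl (fun t2 t3 => Q u v t2 t3) b

lemma th_h (c : S.C) : map ω.th .id (ω.h c) = swap23 m (map ω.h .id (ω.th c)) +
    (assoc k S.C S.C S.C).symm (map (sg (S.cgrShift m) 1) ω.h (ω.th c)) := by
  have h : map ω.th .id ∘ₗ ω.h = swap23 m ∘ₗ map ω.h .id ∘ₗ ω.th + (assoc k S.C S.C S.C).symm.1 ∘ₗ
        map (sg (S.cgrShift m) 1) ω.h ∘ₗ ω.th :=
    gen_ext (M := (S.C ⊗[k] S.C) ⊗[k] S.C) fun x t => ω.map_th_h_gen'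
      (M := (S.C ⊗[k] S.C) ⊗[k] S.C) (.id (R := k) (M := (S.C ⊗[k] S.C) ⊗[k] S.C)) x t
  exact congr_fun h c

/-! ### Degrees -/

lemma pinch_mem {P : Submodule k M} {G : S.Wd → S.Fn M} (t) (h : ∀ t1 t2 t3 p q, wd t1 + wd t2 + wd t3 = wd t → p.deg + q.deg = m →
      G t1 p t3 q t2 ∈ P) : ω.pinch G t ∈ P :=
  spl_mem fun t1 v e => spl_mem fun t2 t3 e' => ω.cas_mem fun p q hpq =>
    smul_mem _ _ (h _ _ _ _ _ (by omega) hpq)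

lemma th_mem (i : ℤ) (c : S.C) (hc : c ∈ S.cgrShift m i) : ω.th c ∈ tensorGr (S.cgrShift m) (S.cgrShift m) i := by
  refine cgrShift_induction (P := (tensorGr (S.cgrShift m) (S.cgrShift m) i).comap ω.th) ?_ hc
  intro x t e
  have h := ω.th_gen .id x t
  refine (mem_comap).2 ?_
  refine (congrArg (· ∈ _) h).mpr (spl_mem fun t1 t2 e' => ω.cas_mem fun p q hpq =>
    smul_mem _ _ (gen2_mem ?_))
  simp only [Mark.mul_deg]; omega

lemma h_mem (i : ℤ) (c : S.C) (hc : c ∈ S.cgrShift m i) : ω.h c ∈ tensorGr (S.cgrShift m) (S.cgrShift m) (i - 1) := by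
  refine cgrShift_induction (P := (tensorGr (S.cgrShift m) (S.cgrShift m) (i - 1)).comap ω.h) ?_ hc
  intro x t e
  have h := ω.h_gen .id x t
  refine (mem_comap).2 ?_
  refine (congrArg (· ∈ _) h).mpr (ω.pinch_mem t fun t1 t2 t3 p q e' hpq =>
    smul_mem _ _ (gen2_mem ?_))
  simp only [wd_append, wd_cons, Mark.bar_deg]; omega

lemma hB_mem (i : ℤ) (c : S.C) (hc : c ∈ S.cgrShift m i) : ω.hB c ∈ tensorGr (S.cgrShift m) (S.cgrShift m) (i - 2) := by
  refine cgrShift_induction (P := (tensorGr (S.cgrShift m) (S.cgrShift m) (i - 2)).comap ω.hB) ?_ hc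
  intro x t e
  have h := ω.op_gen (Lin1.gen (S := S)).iota.iota3.rot2 .id x t
  refine (mem_comap).2 ?_
  refine (congrArg (· ∈ _) h).mpr (ω.pinch_mem t fun t1 t2 t3 p q e' hpq => ?_)
  have : ∀ P : Submodule k S.C, (∀ u v, wd u + wd v = wd t1 → gen (Mark.one S) (v ++ p.bar :: (t3 ++ x.bar :: u)) ∈ P) →
      rot2 (iota3 (iota gen)) x t1 p t3 ∈ P := fun P h => spl_mem fun u v e => smul_mem _ _
      (smul_mem _ _ (smul_mem _ _ (h u v e)))
  refine tmul_mem_tensorGr (V := S.C) (W := S.C) (i := wd t1 + (p.deg - 1) + wd t3 + (x.deg - 1) - m)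
    (j := q.deg + wd t2 - m) ?_ (gen_mem_shift (by ring)) ?_
  · refine this _ fun u v e => gen_mem_shift ?_
    simp only [wd_append, wd_cons, Mark.bar_deg, Mark.one_deg]; omega
  · omega

lemma op_gen_mem {gr : ℤ → Submodule k M} {c : S.Fn M}
    (hc : Lin2 c) {e : ℤ} (hd : ∀ x t y s, c x t y s ∈ gr (x.deg + wd t + y.deg + wd s + e))
    {n : ℤ} (x t) (hn : x.deg + wd t + e = n) :
    ω.op hc (gen x t) ∈ tensorGr gr (S.cgrShift m) n := by
  have h := ω.op_gen hc .id x t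
  rw [id_apply] at h
  rw [h]
  exact ω.pinch_mem t fun t1 t2 t3 p q e' hpq => tmul_mem_tensorGr (W := S.C) (hd _ _ _ _)
    (gen_mem_shift (i := q.deg + wd t2 - m) (by ring)) (by omega)

lemma hθ_mem (i : ℤ) (c : S.C) (hc : c ∈ S.cgrShift m i) : ω.hθ c ∈ tensorGr
    (tensorGr (S.cgrShift m) (S.cgrShift m)) (S.cgrShift m) (i - 2) := by
  refine cgrShift_induction (P := (tensorGr
    (tensorGr (S.cgrShift m) (S.cgrShift m)) (S.cgrShift m) (i - 2)).comap ω.hθ) ?_ hc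
  exact fun x t e => ω.op_gen_mem ω.lin2_pinch3 ω.pinch3_mem x t (by omega)

end Casimir

end DGAug

section NullHom

variable {k : Type u} [CommRing k]
variable {V : Type v} [AddCommGroup V] [Module k V] {gr : ℤ → Submodule k V} {D : V →ₗ[k] V}
variable {W : Type w} [AddCommGroup W] [Module k W] {gr' : ℤ → Submodule k W} {D' : W →ₗ[k] W}
variable {X : Type x} [AddCommGroup X] [Module k X] {gr'' : ℤ → Submodule k X} {D'' : X →ₗ[k] X}

/-- `f` is a linear map of degree `e`. -/
def HasDeg (gr : ℤ → Submodule k V) (gr' : ℤ → Submodule k W) (e : ℤ) (f : V →ₗ[k] W) : Prop :=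
  ∀ i, ∀ v ∈ gr i, f v ∈ gr' (i + e)

lemma HasDeg.comp {d e n : ℤ} {g : W →ₗ[k] X} {f : V →ₗ[k] W} (hg : HasDeg gr' gr'' e g)
    (hf : HasDeg gr gr' d f) (hn : d + e = n) : HasDeg gr gr'' n (g ∘ₗ f) := fun i v hv => by
  have := hg _ _ (hf i v hv)
  rwa [add_assoc, hn] at this

lemma HasDeg.add {d : ℤ} {f g : V →ₗ[k] W} (hf : HasDeg gr gr' d f)
    (hg : HasDeg gr gr' d g) : HasDeg gr gr' d (f + g) :=
  fun i v hv => add_mem (hf i v hv) (hg i v hv)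

lemma HasDeg.id : HasDeg gr gr 0 .id := fun i v hv => by rwa [add_zero]

lemma HasDeg.sg (h : IsInternal gr) : HasDeg gr gr 0 (sg gr 1) := fun i v hv => by
  rw [add_zero]; exact sg_mem h 1 hv

lemma HasDeg.map {V' W' : Type*} [AddCommGroup V'] [Module k V'] [AddCommGroup W'] [Module k W']
    {gv : ℤ → Submodule k V'} {gw : ℤ → Submodule k W'} {d e n : ℤ} {f : V →ₗ[k] W}
    {g : V' →ₗ[k] W'} (hf : HasDeg gr gr' d f) (hg : HasDeg gv gw e g) (hn : d + e = n) :
    HasDeg (tensorGr gr gv) (tensorGr gr' gw) n (TensorProduct.map f g) := fun _ _ ht =>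
  map_mem_of_tensorGr _ (fun i j hij v hv w hw => tmul_mem_tensorGr (hf i v hv) (hg j w hw) (by omega)) ht

lemma HasDeg.kswap (h : IsInternal gr) (h' : IsInternal gr') :
    HasDeg (tensorGr gr gr') (tensorGr gr' gr) 0 (kswap gr gr') := fun n _ ht =>
  map_mem_of_tensorGr _ (fun i j hij v hv w hw => by
    rw [kswap_of_mem h h' hv hw]
    exact ksign_mem (tmul_mem_tensorGr hw hv (by omega))) ht

lemma HasDeg.assoc : HasDeg (tensorGr (tensorGr gr gr') gr'') (tensorGr gr (tensorGr gr' gr'')) 0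
    (TensorProduct.assoc k V W X : _ →ₗ[k] _) := fun n _ ht =>
  map_mem_of_tensorGr _ (fun i j hij v hv x hx => by
    refine map_mem_of_tensorGr (gr'' := tensorGr gr (tensorGr gr' gr'') (n + 0))
      ((TensorProduct.assoc k V W X : _ →ₗ[k] _) ∘ₗ (mk k _ _).flip x) ?_ hv
    intro i' j' hij' v hv w hw
    exact tmul_mem_tensorGr hv (tmul_mem_tensorGr hw hx rfl) (by omega)) ht

lemma HasDeg.assoc_symm : HasDeg (tensorGr gr (tensorGr gr' gr'')) (tensorGr (tensorGr gr gr') gr'') 0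
    ((TensorProduct.assoc k V W X).symm : V ⊗[k] (W ⊗[k] X) →ₗ[k] (V ⊗[k] W) ⊗[k] X) := fun n _ ht =>
  map_mem_of_tensorGr _ (fun i j hij v hv x hx => by
    refine map_mem_of_tensorGr (gr'' := tensorGr (tensorGr gr gr') gr'' (n + 0))
      (((TensorProduct.assoc k V W X).symm : V ⊗[k] (W ⊗[k] X) →ₗ[k] (V ⊗[k] W) ⊗[k] X) ∘ₗ
        mk k _ _ v) ?_ hx
    intro i' j' hij' w hw x hx
    exact tmul_mem_tensorGr (tmul_mem_tensorGr hv hw rfl) hx (by omega)) ht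

lemma sg_comp_odd (h : IsInternal gr) (h' : IsInternal gr') {e : ℤ}
    (he : (e : ZMod 2) = 1) {f : V →ₗ[k] W} (hf : HasDeg gr gr' e f) :
    sg gr' 1 ∘ₗ f = -(f ∘ₗ sg gr 1) := LinearMap.ext fun v => sg_odd h h' e he f hf v

lemma sg_comp_even (h : IsInternal gr) (h' : IsInternal gr') {e : ℤ}
    (he : (e : ZMod 2) = 0) {f : V →ₗ[k] W} (hf : HasDeg gr gr' e f) :
    sg gr' 1 ∘ₗ f = f ∘ₗ sg gr 1 := LinearMap.ext fun v => sg_even h h' e he f hf v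

/-- Null homotopic maps of degree `e`. -/
def nullHom (e : ℤ) (gr : ℤ → Submodule k V) (D : V →ₗ[k] V) (gr' : ℤ → Submodule k W)
    (D' : W →ₗ[k] W) : Submodule k (V →ₗ[k] W) where
  carrier := {f | ∃ H : V →ₗ[k] W, HasDeg gr gr' (e - 1) H ∧ f = D' ∘ₗ H + ksign k (e : ZMod 2) • (H ∘ₗ D)}
  add_mem' := by
    rintro f g ⟨H, hH, rfl⟩ ⟨K, hK, rfl⟩
    refine ⟨H + K, hH.add hK, ?_⟩
    simp only [comp_add, add_comp, smul_add]; abel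
  zero_mem' := ⟨0, fun _ _ _ => zero_mem _, by simp⟩
  smul_mem' := by
    rintro c f ⟨H, hH, rfl⟩
    refine ⟨c • H, fun i v hv => smul_mem _ _ (hH i v hv), ?_⟩
    rw [comp_smul, smul_comp, smul_add, smul_comm]

lemma mem_nullHom {e : ℤ} {f : V →ₗ[k] W} : f ∈ nullHom e gr D gr' D' ↔
    ∃ H : V →ₗ[k] W, HasDeg gr gr' (e - 1) H ∧ f = D' ∘ₗ H + ksign k (e : ZMod 2) • (H ∘ₗ D) := Iff.rfl

lemma chainHomotopic_iff {e : ℤ} {f g : V →ₗ[k] W} :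
    ChainHomotopic e gr D gr' D' f g ↔ f - g ∈ nullHom e gr D gr' D' := by
  simp only [ChainHomotopic, mem_nullHom, HasDeg, add_sub_assoc]

lemma nullHom_comp_left {d e n : ℤ} {f : V →ₗ[k] W} (hf : f ∈ nullHom e gr D gr' D')
    {g : W →ₗ[k] X} (hg : HasDeg gr' gr'' d g) (hD : g ∘ₗ D' = ksign k (d : ZMod 2) • (D'' ∘ₗ g))
    (hn : e + d = n) : g ∘ₗ f ∈ nullHom n gr D gr'' D'' := by
  obtain ⟨H, hH, rfl⟩ := hf
  refine ⟨ksign k (d : ZMod 2) • (g ∘ₗ H), fun i v hv => ksign_mem (hg.comp hH (by omega) i v hv), ?_⟩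
  rw [comp_add, ← comp_assoc, hD, comp_smul, comp_smul, smul_comp, smul_comp, ksign_smul_smul, ← hn]
  congr 1
  rw [← comp_assoc]
  refine ksign_congr ?_ _; push_cast; clear * -; grind

lemma nullHom_comp_right {d e n : ℤ} {f : W →ₗ[k] X} (hf : f ∈ nullHom e gr' D' gr'' D'')
    {g : V →ₗ[k] W} (hg : HasDeg gr gr' d g) (hD : g ∘ₗ D = ksign k (d : ZMod 2) • (D' ∘ₗ g))
    (hn : e + d = n) : f ∘ₗ g ∈ nullHom n gr D gr'' D'' := by
  obtain ⟨H, hH, rfl⟩ := hf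
  refine ⟨H ∘ₗ g, hH.comp hg (by omega), ?_⟩
  rw [comp_assoc _ g H, hD, comp_smul, ksign_smul_smul, add_comp, smul_comp, comp_assoc, comp_assoc]
  congr 1
  refine ksign_congr ?_ _
  rw [← hn]; push_cast; clear * -; grind

lemma mem_nullHom_odd {e : ℤ} (he : (e : ZMod 2) = 1) {H : V →ₗ[k] W} (hH : HasDeg gr gr' (e - 1) H) :
    D' ∘ₗ H - H ∘ₗ D ∈ nullHom e gr D gr' D' :=
  ⟨H, hH, by rw [he, ksign_one, neg_smul, one_smul, sub_eq_add_neg]⟩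

lemma mem_nullHom_even {e : ℤ} (he : (e : ZMod 2) = 0) {H : V →ₗ[k] W} (hH : HasDeg gr gr' (e - 1) H) :
    D' ∘ₗ H + H ∘ₗ D ∈ nullHom e gr D gr' D' :=
  ⟨H, hH, by rw [he, ksign_zero, one_smul]⟩

lemma nullHom_comp_left_odd {d e n : ℤ} {f : V →ₗ[k] W} (hf : f ∈ nullHom e gr D gr' D')
    {g : W →ₗ[k] X} (he : (d : ZMod 2) = 1) (hg : HasDeg gr' gr'' d g) (hD : g ∘ₗ D' = -(D'' ∘ₗ g))
    (hn : e + d = n) : g ∘ₗ f ∈ nullHom n gr D gr'' D'' :=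
  nullHom_comp_left hf hg (by rw [he, ksign_one, neg_smul, one_smul, hD]) hn

lemma nullHom_comp_left_zero {e : ℤ} {f : V →ₗ[k] W} (hf : f ∈ nullHom e gr D gr' D')
    {g : W →ₗ[k] X} (hg : HasDeg gr' gr'' 0 g) (hD : g ∘ₗ D' = D'' ∘ₗ g) :
    g ∘ₗ f ∈ nullHom e gr D gr'' D'' :=
  nullHom_comp_left hf hg (by rw [Int.cast_zero, ksign_zero, one_smul, hD]) (add_zero e)

lemma nullHom_comp_right_zero {e : ℤ} {f : W →ₗ[k] X} (hf : f ∈ nullHom e gr' D' gr'' D'')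
    {g : V →ₗ[k] W} (hg : HasDeg gr gr' 0 g) (hD : g ∘ₗ D = D' ∘ₗ g) :
    f ∘ₗ g ∈ nullHom e gr D gr'' D'' :=
  nullHom_comp_right hf hg (by rw [Int.cast_zero, ksign_zero, one_smul, hD]) (add_zero e)

lemma nullHom_map_id {U : Type*} [AddCommGroup U] [Module k U] {gu : ℤ → Submodule k U}
    {Du : U →ₗ[k] U} (h : IsInternal gr) (h' : IsInternal gr')
    {e : ℤ} {f : V →ₗ[k] W} (hf : f ∈ nullHom e gr D gr' D') :
    map f (.id : U →ₗ[k] U) ∈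
      nullHom e (tensorGr gr gu) (tensorOdd gr D Du) (tensorGr gr' gu) (tensorOdd gr' D' Du) := by
  obtain ⟨H, hH, rfl⟩ := hf
  refine ⟨map H .id, hH.map HasDeg.id (by omega), ?_⟩
  have hs : sg gr' 1 ∘ₗ H + ksign k (e : ZMod 2) • (H ∘ₗ sg gr 1) = 0 := by
    have hc : ∀ c : ZMod 2, c = 0 ∨ c = 1 := by decide
    rcases hc e with he | he
    · rw [sg_comp_odd h h' (by push_cast; rw [he]; decide) hH, he, ksign_zero, one_smul, neg_add_cancel]
    · rw [sg_comp_even h h' (by push_cast; rw [he]; decide) hH, he, ksign_one, neg_smul, one_smul, add_neg_cancel]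
  rw [tensorOdd, tensorOdd, add_comp, comp_add, smul_add, ← map_comp, ← map_comp, ← map_comp,
    ← map_comp, map_add_left, map_smul_left]
  simp only [id_comp, comp_id]
  have h2 : map (sg gr' 1 ∘ₗ H) Du + ksign k (e : ZMod 2) • map (H ∘ₗ sg gr 1) Du = 0 := by
    rw [← map_smul_left, ← map_add_left, hs, map_zero_left]
  rw [add_add_add_comm, h2, add_zero]

lemma nullHom_map_sg {U : Type*} [AddCommGroup U] [Module k U] {gu : ℤ → Submodule k U}
    {Du : U →ₗ[k] U} (hu : IsInternal gu) (hDu : HasDeg gu gu 1 Du) {e : ℤ}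
    (he : (e : ZMod 2) = 1) {f : V →ₗ[k] W} (hf : f ∈ nullHom e gr D gr' D') :
    map (sg gu 1) f ∈ nullHom e (tensorGr gu gr) (tensorOdd gu Du D) (tensorGr gu gr') (tensorOdd gu Du D') := by
  obtain ⟨H, hH, rfl⟩ := hf
  refine ⟨map .id H, HasDeg.id.map hH (by omega), ?_⟩
  rw [tensorOdd, tensorOdd, add_comp, comp_add, smul_add, ← map_comp, ← map_comp, ← map_comp,
    ← map_comp, map_add_right, map_smul_right, he, ksign_one]
  simp only [id_comp, comp_id, neg_smul, one_smul]
  module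

end NullHom

section Swap

variable {k : Type u} [CommRing k]
variable {V : Type v} [AddCommGroup V] [Module k V] {gr : ℤ → Submodule k V}
variable {W : Type w} [AddCommGroup W] [Module k W] {gr' : ℤ → Submodule k W}
variable {X : Type x} [AddCommGroup X] [Module k X] {gr'' : ℤ → Submodule k X}

lemma map_neg_left' {V' W' : Type*} [AddCommGroup V'] [Module k V'] [AddCommGroup W'] [Module k W']
    (f : V →ₗ[k] W) (g : V' →ₗ[k] W') : map (-f) g = -map f g := by
  refine eq_neg_of_add_eq_zero_left ?_
  rw [← map_add_left, neg_add_cancel, map_zero_left]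

lemma map_neg_right' {V' W' : Type*} [AddCommGroup V'] [Module k V'] [AddCommGroup W'] [Module k W']
    (f : V →ₗ[k] W) (g : V' →ₗ[k] W') : map f (-g) = -map f g := by
  refine eq_neg_of_add_eq_zero_left ?_
  rw [← map_add_right, neg_add_cancel, map_zero_right]

lemma map_sub_left' {V' W' : Type*} [AddCommGroup V'] [Module k V'] [AddCommGroup W'] [Module k W']
    (f f' : V →ₗ[k] W) (g : V' →ₗ[k] W') :
    map (f - f') g = map f g - map f' g := by
  rw [sub_eq_add_neg, map_add_left, map_neg_left', ← sub_eq_add_neg]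

lemma map_sub_right' {V' W' : Type*} [AddCommGroup V'] [Module k V'] [AddCommGroup W'] [Module k W']
    (f : V →ₗ[k] W) (g g' : V' →ₗ[k] W') :
    map f (g - g') = map f g - map f g' := by
  rw [sub_eq_add_neg, map_add_right, map_neg_right', ← sub_eq_add_neg]

/-- Odd operators on different factors anticommute. -/
lemma map_id_tensorOdd (h : IsInternal gr) {d e : ℤ} (hd : (d : ZMod 2) = 1)
    (he : (e : ZMod 2) = 1) {B D : V →ₗ[k] V} (hB : HasDeg gr gr d B) (hD : HasDeg gr gr e D)
    (hBD : B ∘ₗ D = -(D ∘ₗ B)) (D' : W →ₗ[k] W) :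
    map B .id ∘ₗ tensorOdd gr D D' = -(tensorOdd gr D D' ∘ₗ map B .id) := by
  rw [tensorOdd, comp_add, add_comp, ← map_comp, ← map_comp,
    ← map_comp, ← map_comp, sg_comp_odd h h hd hB, hBD, map_neg_left',
    map_neg_left', neg_add, neg_neg, id_comp, id_comp, comp_id]

lemma map_sg_tensorOdd (h : IsInternal gr) {e : ℤ} 
    (he : (e : ZMod 2) = 1) {D : V →ₗ[k] V} (hD : HasDeg gr gr e D) {B D' : W →ₗ[k] W}
    (hBD : B ∘ₗ D' = -(D' ∘ₗ B)) :
    map (sg gr 1) B ∘ₗ tensorOdd gr D D' = -(tensorOdd gr D D' ∘ₗ map (sg gr 1) B) := by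
  rw [tensorOdd, comp_add, add_comp, ← map_comp, ← map_comp,
    ← map_comp, ← map_comp, sg_comp_odd h h he hD, hBD, map_neg_left',
    map_neg_right', neg_add, id_comp, comp_id]

lemma kswap_kswap (h : IsInternal gr) (h' : IsInternal gr') : kswap gr' gr ∘ₗ kswap gr gr' = .id :=
  tensor_homog_ext h h' fun i j v hv w hw => by
    rw [comp_apply, kswap_of_mem h h' hv hw, map_smul, kswap_of_mem h' h hw hv,
      ksign_smul_smul, show (i * j + j * i : ZMod 2) = 0 by clear * -; grind, ksign_zero, one_smul]; rfl

lemma kswap_map_even (h : IsInternal gr) (h' : IsInternal gr')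
    (h'' : IsInternal gr'') {e : ℤ} (he : (e : ZMod 2) = 0) {f : V →ₗ[k] W}
    (hf : HasDeg gr gr' e f) : kswap gr' gr'' ∘ₗ map f .id = map .id f ∘ₗ kswap gr gr'' :=
  tensor_homog_ext h h'' fun i j v hv w hw => by
    rw [comp_apply, comp_apply, kswap_of_mem h h'' hv hw, map_smul, map_tmul, map_tmul, id_apply,
      kswap_of_mem h' h'' (hf i v hv) hw]
    refine ksign_congr ?_ _
    push_cast; rw [he]; clear * -; grind

lemma kswap_map_odd (h : IsInternal gr) (h' : IsInternal gr')
    (h'' : IsInternal gr'') {e : ℤ} (he : (e : ZMod 2) = 1) {f : V →ₗ[k] W}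
    (hf : HasDeg gr gr' e f) : kswap gr' gr'' ∘ₗ map f .id = map (sg gr'' 1) f ∘ₗ kswap gr gr'' :=
  tensor_homog_ext h h'' fun i j v hv w hw => by
    rw [comp_apply, comp_apply, kswap_of_mem h h'' hv hw, map_smul, map_tmul, map_tmul, id_apply,
      kswap_of_mem h' h'' (hf i v hv) hw, sg_of_mem h'' 1 hw, ← smul_tmul', ksign_smul_smul]
    refine ksign_congr ?_ _
    push_cast; rw [he]; clear * -; grind

lemma kswap_map_odd' (h : IsInternal gr) {e : ℤ} (he : (e : ZMod 2) = 1) {f : V →ₗ[k] V}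
    (hf : HasDeg gr gr e f) : kswap gr gr ∘ₗ map (sg gr 1) f = map f .id ∘ₗ kswap gr gr := by
  have h1 : kswap gr gr ∘ₗ (kswap gr gr ∘ₗ map f .id) ∘ₗ kswap gr gr =
      kswap gr gr ∘ₗ (map (sg gr 1) f ∘ₗ kswap gr gr) ∘ₗ kswap gr gr := by
    rw [kswap_map_odd h h h he hf]
  rw [comp_assoc, comp_assoc, kswap_kswap h h, comp_id, ← comp_assoc, kswap_kswap h h, id_comp] at h1
  exact h1.symm

lemma kswap_tensorOdd (h : IsInternal gr) {e : ℤ} (he : (e : ZMod 2) = 1) {f : V →ₗ[k] V}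
    (hf : HasDeg gr gr e f) : kswap gr gr ∘ₗ tensorOdd gr f f = tensorOdd gr f f ∘ₗ kswap gr gr := by
  rw [tensorOdd, comp_add, kswap_map_odd h h h he hf, kswap_map_odd' h he hf, add_comp, add_comm]

lemma tensor_homog_ext3 (h : IsInternal gr) (h' : IsInternal gr')
    (h'' : IsInternal gr'') {P : Type*} [AddCommGroup P] [Module k P]
    {f g : (V ⊗[k] W) ⊗[k] X →ₗ[k] P} (hfg : ∀ i j l, ∀ v ∈ gr i, ∀ w ∈ gr' j, ∀ x ∈ gr'' l,
      f ((v ⊗ₜ w) ⊗ₜ x) = g ((v ⊗ₜ w) ⊗ₜ x)) : f = g :=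
  TensorProduct.ext (tensor_homog_ext h h' fun i j v hv w hw => homog_ext h'' fun l x hx =>
    hfg i j l v hv w hw x hx)

lemma kswap_tensor (h : IsInternal gr) : kswap (tensorGr gr gr) gr = ((assoc k V V V).1 ∘ₗ map (kswap gr gr) .id ∘ₗ
        (assoc k V V V).symm.1) ∘ₗ
      map .id (kswap gr gr) ∘ₗ (assoc k V V V).1 := by
  refine tensor_homog_ext3 h h h fun i j l v hv w hw x hx => ?_
  have h2 := tensorGr_internal h h
  simp only [comp_apply, LinearEquiv.coe_coe, assoc_tmul, map_tmul, id_apply]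
  rw [kswap_of_mem h2 h (tmul_mem_tensorGr hv hw rfl) hx, kswap_of_mem h h hw hx,
    tmul_smul, map_smul, map_smul, map_smul, assoc_symm_tmul,
    map_tmul, kswap_of_mem h h hv hx, ← smul_tmul', map_smul,
    assoc_tmul, ksign_smul_smul, id_apply]
  refine ksign_congr ?_ _
  push_cast; ring

lemma assoc_tensorOdd (h : IsInternal gr) {D : V →ₗ[k] V} :
    (assoc k V V V).1 ∘ₗ tensorOdd (tensorGr gr gr) (tensorOdd gr D D) D =
      tensorOdd gr D (tensorOdd gr D D) ∘ₗ (assoc k V V V).1 := by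
  refine tensor_homog_ext3 h h h fun i j l v hv w hw x hx => ?_
  have h2 := tensorGr_internal h h
  rw [comp_apply, comp_apply, tensorOdd_tmul h2 _ _ (tmul_mem_tensorGr hv hw rfl), tensorOdd_tmul h _ _ hv]
  simp only [LinearEquiv.coe_coe, assoc_tmul]
  rw [tensorOdd_tmul h _ _ hv, tensorOdd_tmul h _ _ hw]
  simp only [map_add, map_smul, add_tmul, ← smul_tmul', assoc_tmul, tmul_add, tmul_smul, smul_add, ksign_smul_smul]
  push_cast
  abel

end Swap

section Homotopies

variable {k : Type u} [CommRing k] {V : Type v} [AddCommGroup V] [Module k V]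

/-- A coassociative differential graded coalgebra with an operator `B`, together with homotopies
from which the homotopies of a homotopy coBV-algebra are built. -/
structure CoBVHomotopies (gr : ℤ → Submodule k V) (D : V →ₗ[k] V) (θ : V →ₗ[k] V ⊗[k] V)
    (B : V →ₗ[k] V) (h hB : V →ₗ[k] V ⊗[k] V) (hθ : V →ₗ[k] (V ⊗[k] V) ⊗[k] V) : Prop where
  internal : IsInternal gr
  D_mem : HasDeg gr gr 1 D
  θ_mem : HasDeg gr (tensorGr gr gr) 0 θ
  B_mem : HasDeg gr gr (-1) B
  h_mem : HasDeg gr (tensorGr gr gr) (-1) h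
  hB_mem : HasDeg gr (tensorGr gr gr) (-2) hB
  hθ_mem : HasDeg gr (tensorGr (tensorGr gr gr) gr) (-2) hθ
  B_D : B ∘ₗ D = -(D ∘ₗ B)
  θ_D : θ ∘ₗ D = tensorOdd gr D D ∘ₗ θ
  coassoc : (assoc k V V V).1 ∘ₗ map θ .id ∘ₗ θ = map .id θ ∘ₗ θ
  h_comm : tensorOdd gr D D ∘ₗ h + h ∘ₗ D = kswap gr gr ∘ₗ θ - θ
  θ_B : θ ∘ₗ B = (tensorOdd gr D D ∘ₗ hB - hB ∘ₗ D + map B .id ∘ₗ θ - h) +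
    kswap gr gr ∘ₗ (tensorOdd gr D D ∘ₗ hB - hB ∘ₗ D + map B .id ∘ₗ θ - h)
  θ_h : (assoc k V V V).1 ∘ₗ map θ .id ∘ₗ h = map .id (kswap gr gr) ∘ₗ (assoc k V V V).1 ∘ₗ map h .id ∘ₗ θ +
      map (sg gr 1) h ∘ₗ θ
  h_θ : map .id θ ∘ₗ h = (assoc k V V V).1 ∘ₗ map h .id ∘ₗ θ + map .id (kswap gr gr) ∘ₗ (assoc k V V V).1 ∘ₗ
        map h .id ∘ₗ kswap gr gr ∘ₗ θ -
      (assoc k V V V).1 ∘ₗ (tensorOdd (tensorGr gr gr) (tensorOdd gr D D) D ∘ₗ hθ - hθ ∘ₗ D)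

variable {gr : ℤ → Submodule k V} {D : V →ₗ[k] V} {θ : V →ₗ[k] V ⊗[k] V}
    {B : V →ₗ[k] V} {h hB : V →ₗ[k] V ⊗[k] V} {hθ : V →ₗ[k] (V ⊗[k] V) ⊗[k] V}

/-- The Koszul flip of the first two factors. -/
def swap12 (gr : ℤ → Submodule k V) : V ⊗[k] (V ⊗[k] V) →ₗ[k] V ⊗[k] (V ⊗[k] V) :=
  (assoc k V V V).1 ∘ₗ map (kswap gr gr) .id ∘ₗ (assoc k V V V).symm.1

lemma HasDeg.swap12 (hg : IsInternal gr) : HasDeg (tensorGr gr (tensorGr gr gr))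
    (tensorGr gr (tensorGr gr gr)) 0 (swap12 gr) :=
  HasDeg.assoc.comp (((HasDeg.kswap hg hg).map HasDeg.id rfl).comp HasDeg.assoc_symm rfl) rfl

lemma swap12_assoc_map (F : V →ₗ[k] V ⊗[k] V) : swap12 gr ∘ₗ (assoc k V V V).1 ∘ₗ map F (.id : V →ₗ[k] V) =
    (assoc k V V V).1 ∘ₗ map (kswap gr gr ∘ₗ F) (.id : V →ₗ[k] V) := by
  ext v w
  simp [swap12]

lemma swap12_swap12 (hg : IsInternal gr) : swap12 gr ∘ₗ swap12 gr = .id := by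
  have : ∀ t : (V ⊗[k] V) ⊗[k] V, map (kswap gr gr) .id (map (kswap gr gr) .id t) = t := by
    intro t
    rw [← comp_apply, ← map_comp, kswap_kswap hg hg, id_comp, map_id, id_apply]
  refine LinearMap.ext fun t => ?_
  simp [swap12, this]

lemma kswap_tensor' (hg : IsInternal gr) : kswap (tensorGr gr gr) gr = swap12 gr ∘ₗ
    map .id (kswap gr gr) ∘ₗ (assoc k V V V).1 :=
  kswap_tensor hg

lemma map_kswap_map_kswap (hg : IsInternal gr) : map (.id : V →ₗ[k] V) (kswap gr gr) ∘ₗ map .id (kswap gr gr) =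
      .id := by
  rw [← map_comp, kswap_kswap hg hg, id_comp, map_id]

lemma swap12_tensorOdd (hg : IsInternal gr) {e : ℤ} (he : (e : ZMod 2) = 1)
    (hD : HasDeg gr gr e D) : swap12 gr ∘ₗ tensorOdd gr D (tensorOdd gr D D) =
      tensorOdd gr D (tensorOdd gr D D) ∘ₗ swap12 gr := by
  have h1 : map (kswap gr gr) .id ∘ₗ tensorOdd (tensorGr gr gr) (tensorOdd gr D D) D =
      tensorOdd (tensorGr gr gr) (tensorOdd gr D D) D ∘ₗ map (kswap gr gr) .id := by
    have hi := tensorGr_internal hg hg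
    rw [tensorOdd, comp_add, add_comp, ← map_comp, ← map_comp, ← map_comp, ← map_comp,
      kswap_tensorOdd hg he hD, sg_comp_even hi hi (e := 0) (by simp) (HasDeg.kswap hg hg)]
    simp only [comp_id, id_comp]
  have h2 := assoc_tensorOdd (D := D) hg
  have h3 : (assoc k V V V).symm.1 ∘ₗ
      tensorOdd gr D (tensorOdd gr D D) = tensorOdd (tensorGr gr gr) (tensorOdd gr D D) D ∘ₗ
      (assoc k V V V).symm.1 := by
    refine LinearMap.ext fun t => ?_
    have := congr_fun h2 ((assoc k V V V).symm t)
    simp only [comp_apply, LinearEquiv.coe_coe, LinearEquiv.apply_symm_apply] at this ⊢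
    rw [← this, LinearEquiv.symm_apply_apply]
  rw [swap12, comp_assoc, comp_assoc, h3, ← comp_assoc _ _ (map _ _), h1, comp_assoc, ← comp_assoc, h2, comp_assoc]

lemma swap12_map_mid (hg : IsInternal gr) {e : ℤ} (he : (e : ZMod 2) = 1) (hB : HasDeg gr gr e B) :
    swap12 gr ∘ₗ map (sg gr 1) (map B .id) = map B .id ∘ₗ swap12 gr := by
  refine ext' fun v t => ?_
  induction t with
  | zero => simp
  | add x y hx hy => simp only [tmul_add, map_add, hx, hy]
  | tmul w x =>
    have := congr_fun (kswap_map_odd' hg he hB) (v ⊗ₜ w)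
    simp only [comp_apply, map_tmul] at this
    simp only [swap12, comp_apply, LinearEquiv.coe_coe, map_tmul, assoc_symm_tmul, id_apply, this]
    generalize kswap gr gr (v ⊗ₜ w) = z
    induction z with
    | zero => simp
    | add y z hy hz => simp only [add_tmul, map_add, hy, hz]
    | tmul y z => simp

lemma swap12_map_last (hg : IsInternal gr) : swap12 gr ∘ₗ map (sg gr 1) (map (sg gr 1) B) =
      map (sg gr 1) (map (sg gr 1) B) ∘ₗ swap12 gr := by
  refine ext' fun v t => ?_
  induction t with
  | zero => simp
  | add x y hx hy => simp only [tmul_add, map_add, hx, hy]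
  | tmul w x =>
    have : kswap gr gr ∘ₗ map (sg gr 1) (sg gr 1) = map (sg gr 1) (sg gr 1) ∘ₗ kswap gr gr :=
      tensor_homog_ext hg hg fun i j v hv w hw => by
        rw [comp_apply, comp_apply, map_tmul,
          kswap_of_mem hg hg hv hw, kswap_of_mem hg hg (sg_mem hg 1 hv) (sg_mem hg 1 hw), map_smul]
        rfl
    have := congr_fun this (v ⊗ₜ w)
    simp only [comp_apply, map_tmul] at this
    simp only [swap12, comp_apply, LinearEquiv.coe_coe, map_tmul, assoc_symm_tmul, id_apply, this]
    generalize kswap gr gr (v ⊗ₜ w) = z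
    induction z with
    | zero => simp
    | add y z hy hz => simp only [add_tmul, map_add, hy, hz]
    | tmul y z => simp

namespace CoBVHomotopies

lemma swap_h_θ (H : CoBVHomotopies gr D θ B h hB hθ) : swap12 gr ∘ₗ map (sg gr 1) h ∘ₗ θ =
      map .id (kswap gr gr) ∘ₗ (assoc k V V V).1 ∘ₗ map h .id ∘ₗ kswap gr gr ∘ₗ θ := by
  have hi := H.internal
  have e := kswap_map_odd hi (tensorGr_internal hi hi) hi (by decide) H.h_mem
  rw [kswap_tensor' hi] at e
  have e1 : θ = kswap gr gr ∘ₗ kswap gr gr ∘ₗ θ := by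
    rw [← comp_assoc, kswap_kswap hi hi, id_comp]
  have e2 := congrArg (fun F => swap12 gr ∘ₗ F ∘ₗ kswap gr gr ∘ₗ θ) e
  simp only [comp_assoc] at e2
  rw [← e1] at e2
  rw [← e2]
  have e3 := swap12_swap12 hi
  refine LinearMap.ext fun v => ?_
  exact congr_fun e3 _

lemma map_swap_h (H : CoBVHomotopies gr D θ B h hB hθ) : map .id θ ∘ₗ kswap gr gr ∘ₗ h =
      (assoc k V V V).1 ∘ₗ map (kswap gr gr ∘ₗ h) .id ∘ₗ θ +
      swap12 gr ∘ₗ map (sg gr 1) (kswap gr gr ∘ₗ h) ∘ₗ θ := by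
  have hi := H.internal
  have e := kswap_map_even hi (tensorGr_internal hi hi) hi (by decide) H.θ_mem
  rw [← comp_assoc, ← e, kswap_tensor' hi]
  have e2 := H.θ_h
  have e3 := map_kswap_map_kswap hi
  have e4 := swap12_assoc_map (gr := gr) h
  refine LinearMap.ext fun v => ?_
  have e2' := congr_fun e2 v
  simp only [comp_apply, LinearMap.add_apply] at e2' ⊢
  rw [e2', map_add, map_add]
  refine congrArg₂ (· + ·) ?_ ?_
  · have e3' := congr_fun e3
    simp only [comp_apply, id_apply] at e3'
    rw [e3']
    exact congr_fun e4 (θ v)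
  · generalize θ v = t
    have : map .id (kswap gr gr) ∘ₗ map (sg gr 1) h = map (sg gr 1) (kswap gr gr ∘ₗ h) := by
      rw [← map_comp, id_comp]
    rw [← this]
    rfl

lemma map_sym_h (H : CoBVHomotopies gr D θ B h hB hθ) : map .id θ ∘ₗ (h + kswap gr gr ∘ₗ h) = (assoc k V V V).1 ∘ₗ
        map (h + kswap gr gr ∘ₗ h) .id ∘ₗ θ +
      swap12 gr ∘ₗ map (sg gr 1) (h + kswap gr gr ∘ₗ h) ∘ₗ θ -
      (assoc k V V V).1 ∘ₗ (tensorOdd (tensorGr gr gr) (tensorOdd gr D D) D ∘ₗ hθ - hθ ∘ₗ D) := by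
  rw [comp_add, H.map_swap_h, H.h_θ, ← H.swap_h_θ, map_add_left, map_add_right, add_comp, add_comp, comp_add, comp_add]
  abel

/-- The deviation of `B` from being a coderivation, up to `h + τ h`. -/
lemma deviation_mem (H : CoBVHomotopies gr D θ B h hB hθ) : θ ∘ₗ B - tensorOdd gr B B ∘ₗ θ + (h + kswap gr gr ∘ₗ h) ∈
      nullHom (-1) gr D (tensorGr gr gr) (tensorOdd gr D D) := by
  have hi := H.internal
  have e1 := kswap_map_odd hi hi hi (by decide) H.B_mem
  have hX := mem_nullHom_odd (D := D) (D' := tensorOdd gr D D) (e := -1) (by decide) H.hB_mem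
  have hY := mem_nullHom_even (D := D) (D' := tensorOdd gr D D) (e := 0) (by decide) H.h_mem
  have h1 : kswap gr gr ∘ₗ (tensorOdd gr D D ∘ₗ hB - hB ∘ₗ D) ∈
      nullHom (-1) gr D (tensorGr gr gr) (tensorOdd gr D D) := by
    exact nullHom_comp_left_zero hX (HasDeg.kswap hi hi) (kswap_tensorOdd hi (by decide) H.D_mem)
  have h2 : map (sg gr 1) B ∘ₗ (tensorOdd gr D D ∘ₗ h + h ∘ₗ D) ∈
      nullHom (-1) gr D (tensorGr gr gr) (tensorOdd gr D D) := by
    exact nullHom_comp_left_odd hY (d := -1) (by decide) ((HasDeg.sg hi).map H.B_mem rfl)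
      (map_sg_tensorOdd hi (by decide) H.D_mem H.B_D) rfl
  have e : θ ∘ₗ B - tensorOdd gr B B ∘ₗ θ + (h + kswap gr gr ∘ₗ h) =
      (tensorOdd gr D D ∘ₗ hB - hB ∘ₗ D) + kswap gr gr ∘ₗ (tensorOdd gr D D ∘ₗ hB - hB ∘ₗ D) +
      map (sg gr 1) B ∘ₗ (tensorOdd gr D D ∘ₗ h + h ∘ₗ D) := by
    rw [H.h_comm, H.θ_B]
    generalize tensorOdd gr D D ∘ₗ hB - hB ∘ₗ D = X
    have e2 : kswap gr gr ∘ₗ map B .id ∘ₗ θ = map (sg gr 1) B ∘ₗ kswap gr gr ∘ₗ θ := by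
      rw [← comp_assoc, e1, comp_assoc]
    simp only [tensorOdd, comp_add, comp_sub, add_comp, e2]
    abel
  rw [e]
  exact add_mem (add_mem hX h1) h2

lemma seven_term (H : CoBVHomotopies gr D θ B h hB hθ) : coSevenLeft θ B - coSevenRight gr θ B ∈
    nullHom (-1) gr D (tensorGr gr (tensorGr gr gr)) (tensorOdd gr D (tensorOdd gr D D)) := by
  have hi := H.internal
  have hi2 := tensorGr_internal hi hi
  have hγ := H.deviation_mem
  have hη := H.map_sym_h
  have hY := mem_nullHom_even (D := D) (D' := tensorOdd gr D D) (e := 0) (by decide) H.h_mem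
  set γ := θ ∘ₗ B - tensorOdd gr B B ∘ₗ θ + (h + kswap gr gr ∘ₗ h) with hγ'
  set η := h + kswap gr gr ∘ₗ h
  have hθB : θ ∘ₗ B = γ - η + (map B .id ∘ₗ θ + map (sg gr 1) B ∘ₗ θ) := by
    rw [hγ', tensorOdd, add_comp]; abel
  clear_value γ η
  clear hγ'
  rw [H.h_comm] at hY
  have n1 : map .id θ ∘ₗ γ ∈ nullHom (-1) gr D (tensorGr gr (tensorGr gr gr)) (tensorOdd gr D (tensorOdd gr D D)) := by
    refine nullHom_comp_left_zero hγ (HasDeg.id.map H.θ_mem rfl) ?_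
    rw [tensorOdd, comp_add, tensorOdd, add_comp, ← map_comp, ← map_comp, ← map_comp, ← map_comp, H.θ_D]
    simp only [comp_id, id_comp]; rfl
  have n2 : (assoc k V V V).1 ∘ₗ map γ .id ∘ₗ θ ∈
      nullHom (-1) gr D (tensorGr gr (tensorGr gr gr)) (tensorOdd gr D (tensorOdd gr D D)) :=
    nullHom_comp_left_zero (nullHom_comp_right_zero (nullHom_map_id hi hi2 hγ) H.θ_mem H.θ_D)
      HasDeg.assoc (assoc_tensorOdd hi)
  have n3 : swap12 gr ∘ₗ map (sg gr 1) γ ∘ₗ θ ∈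
      nullHom (-1) gr D (tensorGr gr (tensorGr gr gr)) (tensorOdd gr D (tensorOdd gr D D)) :=
    nullHom_comp_left_zero (nullHom_comp_right_zero (nullHom_map_sg hi H.D_mem (by decide) hγ) H.θ_mem H.θ_D)
      (HasDeg.swap12 hi) (swap12_tensorOdd hi (by decide) H.D_mem)
  have n4 : (assoc k V V V).1 ∘ₗ map (kswap gr gr ∘ₗ θ - θ) .id ∘ₗ θ ∈
      nullHom 0 gr D (tensorGr gr (tensorGr gr gr)) (tensorOdd gr D (tensorOdd gr D D)) :=
    nullHom_comp_left_zero (nullHom_comp_right_zero (nullHom_map_id hi hi2 hY) H.θ_mem H.θ_D)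
      HasDeg.assoc (assoc_tensorOdd hi)
  have n5 : map B .id ∘ₗ (assoc k V V V).1 ∘ₗ map (kswap gr gr ∘ₗ θ - θ) .id ∘ₗ θ ∈
      nullHom (-1) gr D (tensorGr gr (tensorGr gr gr)) (tensorOdd gr D (tensorOdd gr D D)) :=
    nullHom_comp_left_odd n4 (d := -1) (by decide) (H.B_mem.map HasDeg.id rfl)
      (map_id_tensorOdd hi (by decide) (by decide) H.B_mem H.D_mem H.B_D _) rfl
  have n6 : map (sg gr 1) (map (sg gr 1) B) ∘ₗ (assoc k V V V).1 ∘ₗ map (kswap gr gr ∘ₗ θ - θ) .id ∘ₗ θ ∈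
      nullHom (-1) gr D (tensorGr gr (tensorGr gr gr)) (tensorOdd gr D (tensorOdd gr D D)) :=
    nullHom_comp_left_odd n4 (d := -1) (by decide) ((HasDeg.sg hi).map ((HasDeg.sg hi).map H.B_mem rfl) rfl)
      (map_sg_tensorOdd hi (by decide) H.D_mem (map_sg_tensorOdd hi (by decide) H.D_mem H.B_D)) rfl
  have n7 : (assoc k V V V).1 ∘ₗ (tensorOdd (tensorGr gr gr) (tensorOdd gr D D) D ∘ₗ hθ - hθ ∘ₗ D) ∈
      nullHom (-1) gr D (tensorGr gr (tensorGr gr gr)) (tensorOdd gr D (tensorOdd gr D D)) :=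
    nullHom_comp_left_zero (mem_nullHom_odd (by decide) H.hθ_mem) HasDeg.assoc (assoc_tensorOdd hi)
  have e : coSevenLeft θ B - coSevenRight gr θ B = map .id θ ∘ₗ γ - (assoc k V V V).1 ∘ₗ map γ .id ∘ₗ θ
      - swap12 gr ∘ₗ map (sg gr 1) γ ∘ₗ θ
      - map B .id ∘ₗ (assoc k V V V).1 ∘ₗ map (kswap gr gr ∘ₗ θ - θ) .id ∘ₗ θ
      - map (sg gr 1) (map (sg gr 1) B) ∘ₗ (assoc k V V V).1 ∘ₗ map (kswap gr gr ∘ₗ θ - θ) .id ∘ₗ θ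
      + (assoc k V V V).1 ∘ₗ (tensorOdd (tensorGr gr gr) (tensorOdd gr D D) D ∘ₗ hθ - hθ ∘ₗ D) := by
    have c1 : map .id θ ∘ₗ map B .id ∘ₗ θ = map B .id ∘ₗ map .id θ ∘ₗ θ := by
      rw [← comp_assoc, ← comp_assoc, ← map_comp, ← map_comp]
      simp only [comp_id, id_comp]
    have c2 : map .id θ ∘ₗ map (sg gr 1) B ∘ₗ θ = map (sg gr 1) (θ ∘ₗ B) ∘ₗ θ := by
      rw [← comp_assoc, ← map_comp, id_comp]
    have c3 : (assoc k V V V).1 ∘ₗ map (map B .id ∘ₗ θ) .id ∘ₗ θ = map B .id ∘ₗ map .id θ ∘ₗ θ := by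
      rw [← H.coassoc, ← comp_assoc, ← comp_assoc, ← comp_assoc]
      refine congrArg (· ∘ₗ θ) (ext' fun v w => ?_)
      simp only [comp_apply, map_tmul, LinearEquiv.coe_coe]
      generalize θ v = z
      induction z with
      | zero => simp
      | add y z hy hz => simp only [add_tmul, map_add, hy, hz]
      | tmul y z => simp
    have c4 : (assoc k V V V).1 ∘ₗ map (map (sg gr 1) B ∘ₗ θ) .id ∘ₗ θ = map (sg gr 1) (map B .id) ∘ₗ
          map .id θ ∘ₗ θ := by
      rw [← H.coassoc, ← comp_assoc, ← comp_assoc, ← comp_assoc]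
      refine congrArg (· ∘ₗ θ) (ext' fun v w => ?_)
      simp only [comp_apply, map_tmul, LinearEquiv.coe_coe]
      generalize θ v = z
      induction z with
      | zero => simp
      | add y z hy hz => simp only [add_tmul, map_add, hy, hz]
      | tmul y z => simp
    have c5 : swap12 gr ∘ₗ map (sg gr 1) (map B .id ∘ₗ θ) ∘ₗ θ = map B .id ∘ₗ swap12 gr ∘ₗ map .id θ ∘ₗ θ := by
      rw [← comp_assoc _ (swap12 gr), ← swap12_map_mid hi (by decide) H.B_mem, comp_assoc,
        ← comp_assoc _ (map .id θ), ← map_comp,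
        comp_id]
    have c6 : swap12 gr ∘ₗ map (sg gr 1) (map (sg gr 1) B ∘ₗ θ) ∘ₗ θ = map (sg gr 1) (map (sg gr 1) B) ∘ₗ
          swap12 gr ∘ₗ map .id θ ∘ₗ θ := by
      rw [← comp_assoc _ (swap12 gr), ← swap12_map_last hi, comp_assoc, ← comp_assoc _ (map .id θ), ← map_comp, comp_id]
    have c7 : (assoc k V V V).1 ∘ₗ map (kswap gr gr ∘ₗ θ - θ) .id ∘ₗ θ =
        swap12 gr ∘ₗ map .id θ ∘ₗ θ - map .id θ ∘ₗ θ := by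
      rw [map_sub_left', sub_comp, comp_sub, H.coassoc, ← H.coassoc, ← comp_assoc, ← swap12_assoc_map]
      rfl
    have L : coSevenLeft θ B = map .id θ ∘ₗ γ - map .id θ ∘ₗ η + (map B .id ∘ₗ map .id θ ∘ₗ θ +
          map (sg gr 1) (θ ∘ₗ B) ∘ₗ θ) := by
      rw [coSevenLeft, hθB, comp_add, comp_sub, comp_add, c1, c2, hθB]
    have R1 : (assoc k V V V).1 ∘ₗ map (θ ∘ₗ B) .id ∘ₗ θ = (assoc k V V V).1 ∘ₗ map γ .id ∘ₗ θ -
        (assoc k V V V).1 ∘ₗ map η .id ∘ₗ θ +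
        (map B .id ∘ₗ map .id θ ∘ₗ θ +
        map (sg gr 1) (map B .id) ∘ₗ map .id θ ∘ₗ θ) := by
      rw [hθB, map_add_left, map_add_left, map_sub_left', ← c3, ← c4]
      simp only [add_comp, sub_comp, comp_add, comp_sub]
    have R3 : swap12 gr ∘ₗ map (sg gr 1) (θ ∘ₗ B) ∘ₗ θ = swap12 gr ∘ₗ map (sg gr 1) γ ∘ₗ θ -
        swap12 gr ∘ₗ map (sg gr 1) η ∘ₗ θ +
        (map B .id ∘ₗ swap12 gr ∘ₗ map .id θ ∘ₗ θ +
        map (sg gr 1) (map (sg gr 1) B) ∘ₗ swap12 gr ∘ₗ map .id θ ∘ₗ θ) := by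
      rw [hθB, map_add_right, map_add_right, map_sub_right', ← c5, ← c6]
      simp only [add_comp, sub_comp, comp_add, comp_sub]
    have R : coSevenRight gr θ B = (assoc k V V V).1 ∘ₗ map (θ ∘ₗ B) .id ∘ₗ θ + map (sg gr 1) (θ ∘ₗ B) ∘ₗ θ
        + swap12 gr ∘ₗ map (sg gr 1) (θ ∘ₗ B) ∘ₗ θ
        - tensorOdd gr B (tensorOdd gr B B) ∘ₗ map .id θ ∘ₗ θ := rfl
    have R4 : tensorOdd gr B (tensorOdd gr B B) = map B .id + (map (sg gr 1) (map B .id) +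
          map (sg gr 1) (map (sg gr 1) B)) := by
      rw [tensorOdd, tensorOdd, map_add_right]
    rw [L, R, R1, R3, R4, c7, hη]
    simp only [add_comp, comp_sub (map .id θ ∘ₗ θ), comp_sub (swap12 gr ∘ₗ map .id θ ∘ₗ θ)]
    abel
  rw [e]
  exact add_mem (sub_mem (sub_mem (sub_mem (sub_mem n1 n2) n3) n5) n6) n7

lemma isHomotopyCoBV (H : CoBVHomotopies gr D θ B h hB hθ) (hD : D ∘ₗ D = 0) (hB : B ∘ₗ B = 0) :
    IsHomotopyCoBV gr D θ B where
  internal := H.internal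
  diff_mem := H.D_mem
  diff_diff := hD
  comul_mem i a ha := by simpa using H.θ_mem i a ha
  comul_diff := H.θ_D
  coassoc := H.coassoc
  op_mem := H.B_mem
  op_op := hB
  op_diff := by rw [H.B_D, neg_add_cancel]
  cocomm := chainHomotopic_iff.2 (by
    rw [← H.h_comm]; exact mem_nullHom_even (by decide) H.h_mem)
  seven_term := chainHomotopic_iff.2 H.seven_term

end CoBVHomotopies

end Homotopies

namespace DGAug

variable {k : Type u} {A : Type v} [CommRing k] [Ring A] [Algebra k A] {S : DGAug k A}
variable {M : Type w} [AddCommGroup M] [Module k M]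
variable {N : Type x} [AddCommGroup N] [Module k N]

lemma D_hasDeg (m : ℤ) : HasDeg (S.cgrShift m) (S.cgrShift m) 1 S.D := fun i c hc => by
  have := D_mem (S := S) (i + m) c hc
  rwa [add_right_comm] at this

lemma B_hasDeg (m : ℤ) : HasDeg (S.cgrShift m) (S.cgrShift m) (-1) S.B := fun i c hc => by
  have := B_mem (S := S) (i + m) c hc
  rwa [sub_eq_add_neg, add_right_comm] at this

lemma Casimir.homotopies {m : ℤ} (ω : S.Casimir m) : CoBVHomotopies (S.cgrShift m) S.D ω.th S.B ω.h ω.hB ω.hθ where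
  internal := cgrShift_internal m
  D_mem := D_hasDeg m
  θ_mem i c hc := by rw [add_zero]; exact ω.th_mem i c hc
  B_mem := B_hasDeg m
  h_mem i c hc := ω.h_mem i c hc
  hB_mem i c hc := ω.hB_mem i c hc
  hθ_mem i c hc := ω.hθ_mem i c hc
  B_D := eq_neg_of_add_eq_zero_left B_D
  θ_D := ω.th_D
  coassoc := ω.coassoc
  h_comm := ω.h_comm
  θ_B := ω.th_B
  θ_h := by
    refine LinearMap.ext fun c => ?_
    have h := congrArg (assoc k S.C S.C S.C) (ω.th_h c)
    refine h.trans ((map_add (assoc k S.C S.C S.C) _ _).trans (congrArg₂ (· + ·) ?_ ?_))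
    · exact (assoc k S.C S.C S.C).apply_symm_apply _
    · exact (assoc k S.C S.C S.C).apply_symm_apply _
  h_θ := by
    have e : ∀ {X : Type _} [AddCommGroup X] (a b c d e : X), a + b = c + d + e → b = e + d - (a - c) := by
      intro X _ a b c d e h
      rw [eq_sub_iff_add_eq, ← add_sub_assoc, sub_eq_iff_eq_add, add_comm, h]; abel
    refine LinearMap.ext fun c => ?_
    have h := congrArg (assoc k S.C S.C S.C) (ω.hθ_D c)
    simp only [map_add, LinearEquiv.apply_symm_apply] at h
    have h1 : (assoc k S.C S.C S.C) (swap23 m (map ω.h .id (kswap (S.cgrShift m) (S.cgrShift m) (ω.th c)))) = map .id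
        (kswap (S.cgrShift m) (S.cgrShift m)) (assoc k S.C S.C S.C
        (map ω.h .id (kswap (S.cgrShift m) (S.cgrShift m) (ω.th c)))) :=
      (assoc k S.C S.C S.C).apply_symm_apply _
    rw [h1] at h
    refine (e (X := S.C ⊗[k] (S.C ⊗[k] S.C)) _ _ _ _ _ h).trans ?_
    refine congrArg₂ (· - ·) rfl ?_
    exact (map_sub (assoc k S.C S.C S.C) _ _).symm

/-- The coproduct of a symmetric open Frobenius algebra comes from a Casimir element. -/
lemma exists_casimir_thetaShift {m : ℤ} {δ : A →ₗ[k] A ⊗[k] A} (h : S.IsOpenFrobenius m δ)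
    (hs : S.IsSymmetric m δ) : ∃ ω : S.Casimir m, S.thetaShift m δ = ω.th ∧
      ∀ x, δ x = ∑ i, isg k (m * (1 + (ω.p i).deg)) • ((ω.p i).val ⊗ₜ[k] ((ω.q i).val * x)) := by
  obtain ⟨ω, hω⟩ := h.exists_casimir hs
  refine ⟨ω, gen_ext fun x t => ?_, hω⟩
  exact (theta_gen ω hω .id x t).trans (ω.th_gen .id x t).symm

lemma isHomotopyCoBV_thetaShift {m : ℤ} {δ : A →ₗ[k] A ⊗[k] A} (h : S.IsOpenFrobenius m δ)
    (hs : S.IsSymmetric m δ) : IsHomotopyCoBV (S.cgrShift m) S.D (S.thetaShift m δ) S.B := by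
  obtain ⟨ω, hω, -⟩ := exists_casimir_thetaShift h hs
  rw [hω]
  exact ω.homotopies.isHomotopyCoBV D_D B_B

end DGAug

section Homology

variable {k : Type u} [CommRing k]
variable {V : Type v} [AddCommGroup V] [Module k V] {gr : ℤ → Submodule k V} {D : V →ₗ[k] V}
variable {W : Type w} [AddCommGroup W] [Module k W] {gr' : ℤ → Submodule k W} {D' : W →ₗ[k] W}

lemma isInternal_of_proj (P : ℤ → V →ₗ[k] V) (h1 : ∀ i, ∀ v ∈ gr i, P i v = v)
    (h0 : ∀ i j, j ≠ i → ∀ v ∈ gr j, P i v = 0) (htop : ⨆ i, gr i = ⊤) : IsInternal gr := by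
  rw [DirectSum.isInternal_submodule_iff_iSupIndep_and_iSup_eq_top]
  refine ⟨fun i => ?_, htop⟩
  rw [Submodule.disjoint_def]
  intro v hv hv'
  have : (⨆ j, ⨆ (_ : j ≠ i), gr j) ≤ ker (P i) := iSup₂_le fun j hj v hv => h0 i j hj v hv
  rw [← h1 i v hv]
  exact this hv'

lemma cls_surjective : Function.Surjective (cls gr D) := Submodule.mkQ_surjective _

lemma cls_eq_zero {z : cyc gr D} : cls gr D z = 0 ↔ (z : V) ∈ bdry gr D := by
  rw [cls, Submodule.mkQ_apply, Submodule.Quotient.mk_eq_zero]; rfl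

lemma cls_eq {z z' : cyc gr D} : cls gr D z = cls gr D z' ↔ (z - z' : V) ∈ bdry gr D := by
  rw [← sub_eq_zero, ← map_sub, cls_eq_zero]; rfl

/-- The map induced on homology. -/
def homMap (f : V →ₗ[k] W) (hc : ∀ z ∈ cyc gr D, f z ∈ cyc gr' D')
    (hb : ∀ z ∈ bdry gr D, f z ∈ bdry gr' D') : Homology gr D →ₗ[k] Homology gr' D' :=
  Submodule.mapQ _ _ (f.restrict hc) fun z hz => hb z hz

lemma homMap_cls (f : V →ₗ[k] W) (hc : ∀ z ∈ cyc gr D, f z ∈ cyc gr' D')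
    (hb : ∀ z ∈ bdry gr D, f z ∈ bdry gr' D') (z : cyc gr D) :
    homMap f hc hb (cls gr D z) = cls gr' D' ⟨f z, hc z z.2⟩ := rfl

lemma HasDeg.mem_iSup {e : ℤ} {f : V →ₗ[k] W} (hf : HasDeg gr gr' e f) {v : V}
    (hv : v ∈ ⨆ i, gr i) : f v ∈ ⨆ i, gr' i := by
  have : (⨆ i, gr i) ≤ (⨆ i, gr' i).comap f := iSup_le fun i v hv => mem_iSup_of_mem (i + e) (hf i v hv)
  exact this hv

/-- Projections onto the graded components. -/
structure HasProj (gr : ℤ → Submodule k V) (P : ℤ → V →ₗ[k] V) : Prop where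
  mem : ∀ i v, v ∈ ⨆ i, gr i → P i v ∈ gr i
  self : ∀ i, ∀ v ∈ gr i, P i v = v
  other : ∀ i j, j ≠ i → ∀ v ∈ gr j, P i v = 0

lemma HasProj.comm {P : ℤ → V →ₗ[k] V} (hP : HasProj gr P) {e : ℤ} {f : V →ₗ[k] V}
    (hf : HasDeg gr gr e f) (i : ℤ) {v : V} (hv : v ∈ ⨆ i, gr i) : P (i + e) (f v) = f (P i v) := by
  have : (⨆ i, gr i) ≤ eqLocus (P (i + e) ∘ₗ f) (f ∘ₗ P i) := iSup_le fun j v hv => by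
    change P (i + e) (f v) = f (P i v)
    by_cases hij : j = i
    · subst hij; rw [hP.self _ _ (hf j v hv), hP.self _ _ hv]
    · rw [hP.other _ _ (by omega) _ (hf j v hv), hP.other _ _ hij _ hv, map_zero]
  exact this hv

lemma cyc_le_iSup {P : ℤ → V →ₗ[k] V} (hP : HasProj gr P) (hD : HasDeg gr gr 1 D) (z : cyc gr D) :
    z ∈ ⨆ i, (gr i).submoduleOf (cyc gr D) := by
  have key : ∀ v ∈ ⨆ i, gr i, ∃ s : Finset ℤ, v = ∑ i ∈ s, P i v := by
    intro v hv
    have h1 : ∀ v ∈ ⨆ i, gr i, ∃ s : Finset ℤ, ∀ s', s ⊆ s' → v = ∑ i ∈ s', P i v := by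
      intro v hv
      refine Submodule.iSup_induction gr (motive := fun v => ∃ s : Finset ℤ, ∀ s', s ⊆ s' →
        v = ∑ i ∈ s', P i v) hv (fun i v hv => ⟨{i}, fun s' hs => ?_⟩) ⟨∅, by simp⟩ ?_
      · rw [Finset.sum_eq_single i (fun j _ hj => hP.other j i hj.symm v hv)
          (fun h => absurd (hs (Finset.mem_singleton_self i)) h), hP.self i v hv]
      · rintro v w ⟨s, hs⟩ ⟨s', hs'⟩
        refine ⟨s ∪ s', fun r hr => ?_⟩
        simp only [map_add, Finset.sum_add_distrib]
        rw [← hs r (Finset.union_subset_left hr), ← hs' r (Finset.union_subset_right hr)]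
    obtain ⟨s, hs⟩ := h1 v hv
    exact ⟨s, hs s subset_rfl⟩
  obtain ⟨s, hs⟩ := key z z.2.2
  have hm : ∀ i, P i z ∈ cyc gr D := fun i => ⟨mem_ker.2 (by
    rw [← hP.comm hD i z.2.2, show D z = 0 from z.2.1, map_zero]),
    mem_iSup_of_mem i (hP.mem i z z.2.2)⟩
  have : z = ∑ i ∈ s, (⟨P i z, hm i⟩ : cyc gr D) := by
    ext1; rw [Submodule.coe_sum]; exact hs
  rw [this]
  exact Submodule.sum_mem _ fun i _ => mem_iSup_of_mem i (hP.mem i z z.2.2)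

lemma homologyGr_internal {P : ℤ → V →ₗ[k] V} (hP : HasProj gr P) (hD : HasDeg gr gr 1 D) :
    IsInternal (homologyGr gr D) := by
  have hc : ∀ i, ∀ z ∈ cyc gr D, P i z ∈ cyc gr D := fun i z hz => ⟨mem_ker.2 (by
    rw [← hP.comm hD i hz.2, show D z = 0 from hz.1, map_zero]),
    mem_iSup_of_mem i (hP.mem i z hz.2)⟩
  have hb : ∀ i, ∀ z ∈ bdry gr D, P i z ∈ bdry gr D := by
    rintro i _ ⟨y, hy, rfl⟩
    have := hP.comm hD (i - 1) hy
    rw [sub_add_cancel] at this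
    exact ⟨P (i - 1) y, mem_iSup_of_mem (i - 1) (hP.mem _ y hy), this.symm⟩
  refine isInternal_of_proj (fun i => homMap (P i) (hc i) (hb i)) ?_ ?_ ?_
  · rintro i _ ⟨z, hz, rfl⟩
    rw [homMap_cls]
    congr 1; ext1; exact hP.self i z hz
  · rintro i j hij _ ⟨z, hz, rfl⟩
    rw [homMap_cls, cls_eq_zero]
    have h := hP.other i j hij z hz
    change P i z ∈ _
    rw [h]; exact zero_mem _
  · rw [eq_top_iff]
    rintro h -
    obtain ⟨z, rfl⟩ := cls_surjective h
    have := Submodule.mem_map_of_mem (f := cls gr D) (cyc_le_iSup hP hD z)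
    rw [Submodule.map_iSup] at this
    exact this

lemma hasProj_prj (h : IsInternal gr) : HasProj gr (prj h) where
  mem i v _ := prj_mem h i v
  self i v hv := prj_self h hv
  other i j hij v hv := by rw [prj_of_mem h i hv, if_neg hij]

lemma mem_cyc (h : IsInternal gr) {v : V} : v ∈ cyc gr D ↔ D v = 0 := by
  rw [cyc, h.submodule_iSup_eq_top, inf_top_eq, mem_ker]

lemma mem_bdry (h : IsInternal gr) {v : V} : v ∈ bdry gr D ↔ ∃ y, D y = v := by
  rw [bdry, h.submodule_iSup_eq_top, Submodule.map_top, LinearMap.mem_range]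

lemma cyc_homog_induction (h : IsInternal gr) (hD : HasDeg gr gr 1 D)
    {N : Submodule k (cyc gr D)} (hN : ∀ i, ∀ z : cyc gr D, (z : V) ∈ gr i → z ∈ N) (z : cyc gr D) :
    z ∈ N := by
  have : (⨆ i, (gr i).submoduleOf (cyc gr D)) ≤ N := iSup_le fun i z hz => hN i z hz
  exact this (cyc_le_iSup (hasProj_prj h) hD z)

lemma cls_mem {i : ℤ} {z : cyc gr D} (hz : (z : V) ∈ gr i) : cls gr D z ∈ homologyGr gr D i := ⟨z, hz, rfl⟩

end Homology

/-! ### Relations between chains and homology classes -/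

section Rel

variable {k : Type u} [CommRing k]
variable {C U H : Type*} [AddCommGroup C] [Module k C] [AddCommGroup U] [Module k U]
  [AddCommGroup H] [Module k H] {cy : C →ₗ[k] U} {cl : C →ₗ[k] H} {D : U →ₗ[k] U}
variable {C' U' H' : Type*} [AddCommGroup C'] [Module k C'] [AddCommGroup U'] [Module k U']
  [AddCommGroup H'] [Module k H'] {cy' : C' →ₗ[k] U'} {cl' : C' →ₗ[k] H'} {D' : U' →ₗ[k] U'}
variable {C'' U'' H'' : Type*} [AddCommGroup C''] [Module k C''] [AddCommGroup U''] [Module k U'']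
  [AddCommGroup H''] [Module k H''] {cy'' : C'' →ₗ[k] U''} {cl'' : C'' →ₗ[k] H''} {D'' : U'' →ₗ[k] U''}

/-- The relation between cycles and classes, for cycles given modulo boundaries by `cy`. -/
def Rel (cy : C →ₗ[k] U) (cl : C →ₗ[k] H) (D : U →ₗ[k] U) : Submodule k (U × H) :=
  LinearMap.range ((cy.prod cl).coprod (D.prod 0))

lemma mem_rel {p : U × H} : p ∈ Rel cy cl D ↔ ∃ c s, p = (cy c + D s, cl c) := by
  constructor
  · rintro ⟨⟨c, s⟩, rfl⟩; exact ⟨c, s, by simp⟩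
  · rintro ⟨c, s, rfl⟩; exact ⟨(c, s), by simp⟩

lemma rel_cyc (c : C) : (cy c, cl c) ∈ Rel cy cl D := mem_rel.2 ⟨c, 0, by simp⟩

lemma rel_bdry (s : U) : (D s, (0 : H)) ∈ Rel cy cl D := mem_rel.2 ⟨0, s, by simp⟩

/-- `f` carries related pairs to related pairs. -/
def RelMap (R : Submodule k (U × H)) (R' : Submodule k (U' × H')) (f : U →ₗ[k] U') (F : H →ₗ[k] H') :
    Prop := ∀ p ∈ R, (f p.1, F p.2) ∈ R'

lemma relMap_of {R' : Submodule k (U' × H')} {f : U →ₗ[k] U'} {F : H →ₗ[k] H'}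
    (h1 : ∀ c, (f (cy c), F (cl c)) ∈ R') (h2 : ∀ s, (f (D s), 0) ∈ R') :
    RelMap (Rel cy cl D) R' f F := by
  intro p hp
  obtain ⟨c, s, rfl⟩ := mem_rel.1 hp
  have := R'.add_mem (h1 c) (h2 s)
  simpa using this

lemma RelMap.comp {R : Submodule k (U × H)} {R' : Submodule k (U' × H')}
    {R'' : Submodule k (U'' × H'')} {f : U →ₗ[k] U'} {F : H →ₗ[k] H'} {g : U' →ₗ[k] U''}
    {G : H' →ₗ[k] H''} (hg : RelMap R' R'' g G) (hf : RelMap R R' f F) :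
    RelMap R R'' (g ∘ₗ f) (G ∘ₗ F) := fun p hp => hg _ (hf p hp)

lemma RelMap.add {R : Submodule k (U × H)} {R' : Submodule k (U' × H')} {f g : U →ₗ[k] U'}
    {F G : H →ₗ[k] H'} (hf : RelMap R R' f F) (hg : RelMap R R' g G) : RelMap R R' (f + g) (F + G) :=
  fun p hp => R'.add_mem (hf p hp) (hg p hp)

lemma RelMap.sub {R : Submodule k (U × H)} {R' : Submodule k (U' × H')} {f g : U →ₗ[k] U'}
    {F G : H →ₗ[k] H'} (hf : RelMap R R' f F) (hg : RelMap R R' g G) : RelMap R R' (f - g) (F - G) :=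
  fun p hp => R'.sub_mem (hf p hp) (hg p hp)

lemma RelMap.id {R : Submodule k (U × H)} : RelMap R R .id .id := fun _ hp => hp

lemma RelMap.eq {R : Submodule k (U × H)} {f g : U →ₗ[k] U'} {F G : H →ₗ[k] H'}
    (hu : ∀ h, ((0 : U'), h) ∈ Rel cy' cl' D' → h = 0)
    (hf : RelMap R (Rel cy' cl' D') f F) (hg : RelMap R (Rel cy' cl' D') g G) {p : U × H} (hp : p ∈ R)
    (hfg : ∃ s, f p.1 - g p.1 = D' s) : F p.2 = G p.2 := by
  obtain ⟨s, hs⟩ := hfg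
  have h := (Rel cy' cl' D').sub_mem ((hf.sub hg) p hp) (rel_bdry (cy := cy') (cl := cl') s)
  rw [Prod.mk_sub_mk, LinearMap.sub_apply, hs, sub_self, sub_zero] at h
  exact sub_eq_zero.1 (hu _ h)

lemma exists_of_rel {X : Type*} [AddCommGroup X] [Module k X] {R : Submodule k (U × H)}
    (hu : ∀ h, ((0 : U), h) ∈ R → h = 0) (f : X →ₗ[k] U) (hf : ∀ x, ∃ h, (f x, h) ∈ R) :
    ∃ F : X →ₗ[k] H, ∀ x, (f x, F x) ∈ R := by
  choose F hF using hf
  refine ⟨⟨⟨F, fun x y => ?_⟩, fun c x => ?_⟩, hF⟩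
  · have := R.sub_mem (hF (x + y)) (R.add_mem (hF x) (hF y))
    rw [Prod.mk_add_mk, Prod.mk_sub_mk, map_add, sub_self] at this
    exact sub_eq_zero.1 (hu _ this)
  · have := R.sub_mem (hF (c • x)) (R.smul_mem c (hF x))
    rw [Prod.smul_mk, Prod.mk_sub_mk, map_smul, sub_self] at this
    exact sub_eq_zero.1 (hu _ this)

/-- The relation for a tensor product of complexes. -/
abbrev relTensor (cy : C →ₗ[k] U) (cl : C →ₗ[k] H) (cy' : C' →ₗ[k] U') (cl' : C' →ₗ[k] H')
    (D'' : U ⊗[k] U' →ₗ[k] U ⊗[k] U') : Submodule k ((U ⊗[k] U') × (H ⊗[k] H')) :=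
  Rel (map cy cy') (map cl cl') D''

lemma rel_tmul {gr : ℤ → Submodule k U} (hi : IsInternal gr) (hD : HasDeg gr gr 1 D)
    (hDD : D' ∘ₗ D' = 0) (hcy : D ∘ₗ cy = 0) (hcy' : D' ∘ₗ cy' = 0) {p : U × H} {q : U' × H'}
    (hp : p ∈ Rel cy cl D) (hq : q ∈ Rel cy' cl' D') :
    (p.1 ⊗ₜ q.1, p.2 ⊗ₜ q.2) ∈ relTensor cy cl cy' cl' (tensorOdd gr D D') := by
  obtain ⟨c, s, rfl⟩ := mem_rel.1 hp
  obtain ⟨c', s', rfl⟩ := mem_rel.1 hq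
  have e : D' (cy' c' + D' s') = 0 := by
    rw [map_add, ← comp_apply, hcy', ← comp_apply D' D', hDD]; simp
  have e' : D (sg gr 1 (cy c)) = 0 := by
    have h := sg_odd hi hi 1 (by decide) D hD (cy c)
    rw [show D (cy c) = 0 from congr_fun hcy c, map_zero] at h
    exact neg_eq_zero.1 h.symm
  refine mem_rel.2 ⟨c ⊗ₜ c', s ⊗ₜ (cy' c' + D' s') + sg gr 1 (cy c) ⊗ₜ s', ?_⟩
  have k1 : tensorOdd gr D D' (s ⊗ₜ (cy' c' + D' s')) = D s ⊗ₜ (cy' c' + D' s') := by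
    simp only [tensorOdd, LinearMap.add_apply, map_tmul, id_apply, e, tmul_zero, add_zero]
  have k2 : tensorOdd gr D D' (sg gr 1 (cy c) ⊗ₜ s') = cy c ⊗ₜ D' s' := by
    simp only [tensorOdd, LinearMap.add_apply, map_tmul, id_apply, e', zero_tmul, zero_add, sg_sg hi]
  refine Prod.ext ?_ rfl
  rw [map_add, k1, k2]
  simp only [map_tmul, add_tmul, tmul_add]
  abel

variable {C₁ U₁ H₁ : Type*} [AddCommGroup C₁] [Module k C₁] [AddCommGroup U₁] [Module k U₁]
  [AddCommGroup H₁] [Module k H₁] {cy₁ : C₁ →ₗ[k] U₁} {cl₁ : C₁ →ₗ[k] H₁} {D₁ : U₁ →ₗ[k] U₁}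

lemma relMap_tensor {gr : ℤ → Submodule k U} {gr'' : ℤ → Submodule k U''} {a b c : k}
    (hi : IsInternal gr) (hD : HasDeg gr gr 1 D)
    (hDD : D' ∘ₗ D' = 0) (hcy : D ∘ₗ cy = 0) (hcy' : D' ∘ₗ cy' = 0)
    {f : U'' →ₗ[k] U} {F : H'' →ₗ[k] H} {g : U₁ →ₗ[k] U'} {G : H₁ →ₗ[k] H'}
    (hf : RelMap (Rel cy'' cl'' D'') (Rel cy cl D) f F) (hg : RelMap (Rel cy₁ cl₁ D₁) (Rel cy' cl' D') g G)
    (hfD : f ∘ₗ D'' = a • (D ∘ₗ f)) (hfs : f ∘ₗ sg gr'' 1 = b • (sg gr 1 ∘ₗ f))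
    (hgD : g ∘ₗ D₁ = c • (D' ∘ₗ g)) (habc : a = b * c) :
    RelMap (relTensor cy'' cl'' cy₁ cl₁ (tensorOdd gr'' D'' D₁)) (relTensor cy cl cy' cl' (tensorOdd gr D D'))
      (map f g) (map F G) := by
  refine relMap_of (fun c => ?_) fun s => ?_
  · induction c with
    | zero => simp only [map_zero]; exact Submodule.zero_mem _
    | add x y hx hy => simp only [map_add]; exact Submodule.add_mem _ hx hy
    | tmul x y =>
      exact rel_tmul hi hD hDD hcy hcy' (hf _ (rel_cyc x)) (hg _ (rel_cyc y))
  · have hfg : map f g ∘ₗ tensorOdd gr'' D'' D₁ = a • (tensorOdd gr D D' ∘ₗ map f g) := ext' fun x y => by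
      have h1 : f (D'' x) = a • D (f x) := congr_fun hfD x
      have h2 : f (sg gr'' 1 x) = b • sg gr 1 (f x) := congr_fun hfs x
      have h3 : g (D₁ y) = c • D' (g y) := congr_fun hgD y
      simp only [tensorOdd, comp_apply, LinearMap.smul_apply, LinearMap.add_apply, map_add,
        map_tmul, id_apply, h1, h2, h3, smul_add, habc]
      rw [TensorProduct.smul_tmul_smul, ← smul_tmul']
    rw [← comp_apply (map f g), hfg, LinearMap.smul_apply, comp_apply, ← map_smul]
    exact rel_bdry _

end Rel

section CoBVHomology

variable {k : Type u} [CommRing k] {V : Type v} [AddCommGroup V] [Module k V]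
variable {gr : ℤ → Submodule k V} {D : V →ₗ[k] V}

/-- The relation between chains in `V` and homology. -/
abbrev relOne (gr : ℤ → Submodule k V) (D : V →ₗ[k] V) : Submodule k (V × Homology gr D) :=
  Rel (cyc gr D).subtype (cls gr D) D

/-- The relation between chains in `V ⊗ V` and `H ⊗ H`. -/
abbrev relTwo (gr : ℤ → Submodule k V) (D : V →ₗ[k] V) :
    Submodule k ((V ⊗[k] V) × (Homology gr D ⊗[k] Homology gr D)) :=
  Rel (cycTwo gr D) (clsTwo gr D) (tensorOdd gr D D)

/-- The relation between chains in `V ⊗ (V ⊗ V)` and `H ⊗ (H ⊗ H)`. -/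
abbrev relThree (gr : ℤ → Submodule k V) (D : V →ₗ[k] V) : Submodule k
    ((V ⊗[k] (V ⊗[k] V)) × (Homology gr D ⊗[k] (Homology gr D ⊗[k] Homology gr D))) :=
  relTensor (cyc gr D).subtype (cls gr D) (cycTwo gr D) (clsTwo gr D) (tensorOdd gr D (tensorOdd gr D D))

/-- The relation between chains in `(V ⊗ V) ⊗ V` and `(H ⊗ H) ⊗ H`. -/
abbrev relThree' (gr : ℤ → Submodule k V) (D : V →ₗ[k] V) : Submodule k
    (((V ⊗[k] V) ⊗[k] V) × ((Homology gr D ⊗[k] Homology gr D) ⊗[k] Homology gr D)) :=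
  relTensor (cycTwo gr D) (clsTwo gr D) (cyc gr D).subtype (cls gr D) (tensorOdd (tensorGr gr gr) (tensorOdd gr D D) D)

lemma rel_unique {C U H : Type*} [AddCommGroup C] [Module k C] [AddCommGroup U] [Module k U]
    [AddCommGroup H] [Module k H] {cy : C →ₗ[k] U} {cl : C →ₗ[k] H} {D : U →ₗ[k] U}
    (h : ∀ c, cy c ∈ LinearMap.range D → cl c = 0) (y : H) (hy : ((0 : U), y) ∈ Rel cy cl D) :
    y = 0 := by
  obtain ⟨c, s, e⟩ := mem_rel.1 hy
  obtain ⟨e1, e2⟩ := Prod.mk.inj e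
  rw [e2]
  exact h c ⟨-s, by rw [map_neg]; exact (eq_neg_of_add_eq_zero_left e1.symm).symm⟩

lemma tensorOdd_tensorOdd {W : Type w} [AddCommGroup W] [Module k W] (h : IsInternal gr)
    (hD : HasDeg gr gr 1 D) (hDD : D ∘ₗ D = 0) {D' : W →ₗ[k] W} (hDD' : D' ∘ₗ D' = 0) :
    tensorOdd gr D D' ∘ₗ tensorOdd gr D D' = 0 := by
  have hs : sg gr 1 ∘ₗ D = -(D ∘ₗ sg gr 1) := sg_comp_odd h h (by decide) hD
  refine ext' fun x y => ?_
  have h1 : D (D x) = 0 := congr_fun hDD x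
  have h2 : D' (D' y) = 0 := congr_fun hDD' y
  have h3 : sg gr 1 (D x) = -D (sg gr 1 x) := congr_fun hs x
  simp only [tensorOdd, comp_apply, LinearMap.add_apply, map_add, map_tmul,
    id_apply, h1, h2, h3, zero_tmul, tmul_zero, neg_tmul,
    LinearMap.zero_apply]
  abel

lemma tensorOdd_anticomm {W : Type w} [AddCommGroup W] [Module k W] (h : IsInternal gr)
    {B : V →ₗ[k] V} (hD : HasDeg gr gr 1 D) (hB : HasDeg gr gr (-1) B) (hBD : B ∘ₗ D = -(D ∘ₗ B))
    {B' D' : W →ₗ[k] W} (hBD' : B' ∘ₗ D' = -(D' ∘ₗ B')) :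
    tensorOdd gr B B' ∘ₗ tensorOdd gr D D' = -(tensorOdd gr D D' ∘ₗ tensorOdd gr B B') := by
  conv_lhs => rw [tensorOdd]
  rw [add_comp, map_id_tensorOdd h (by decide) (by decide) hB hD hBD,
    map_sg_tensorOdd h (by decide) hD hBD', ← neg_add, ← comp_add]
  rfl

lemma assoc_cycTwo : (assoc k V V V).1 ∘ₗ map (cycTwo gr D) (cyc gr D).subtype = map (cyc gr D).subtype (cycTwo gr D) ∘ₗ
        (assoc k (cyc gr D) (cyc gr D) (cyc gr D) : _ →ₗ[k] _) :=
  ext_threefold fun _ _ _ => rfl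

lemma assoc_clsTwo : (assoc k (Homology gr D) (Homology gr D) (Homology gr D) : _ →ₗ[k] _) ∘ₗ
        map (clsTwo gr D) (cls gr D) =
      map (cls gr D) (clsTwo gr D) ∘ₗ (assoc k (cyc gr D) (cyc gr D) (cyc gr D) : _ →ₗ[k] _) :=
  ext_threefold fun _ _ _ => rfl

section Basic

variable (hg : IsInternal gr) (hD : HasDeg gr gr 1 D) (hDD : D ∘ₗ D = 0)
include hg hD hDD

lemma comp_cyc : D ∘ₗ (cyc gr D).subtype = 0 := LinearMap.ext fun z => z.2.1

lemma tensorOdd_cycTwo : tensorOdd gr D D ∘ₗ cycTwo gr D = 0 := by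
  refine ext' fun z z' => ?_
  have h3 : D (sg gr 1 z) = 0 := by
    have := sg_odd hg hg 1 (by decide) D hD (z : V)
    rw [show D z = 0 from z.2.1, map_zero] at this
    exact neg_eq_zero.1 this.symm
  simp only [cycTwo, tensorOdd, comp_apply, LinearMap.add_apply, map_tmul,
    Submodule.subtype_apply, show D z = 0 from z.2.1, show D z' = 0 from z'.2.1, zero_tmul,
    tmul_zero, LinearMap.zero_apply, add_zero]

lemma homologyGr_isInternal : IsInternal (homologyGr gr D) := homologyGr_internal (hasProj_prj hg) hD

lemma relOne_sg : RelMap (relOne gr D) (relOne gr D) (sg gr 1) (sg (homologyGr gr D) 1) := by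
  have hH := homologyGr_isInternal hg hD hDD
  refine relMap_of (fun c => ?_) fun s => ?_
  · refine cyc_homog_induction hg hD (N := (relOne gr D).comap
      ((sg gr 1 ∘ₗ (cyc gr D).subtype).prod (sg (homologyGr gr D) 1 ∘ₗ cls gr D))) (fun i z hz => ?_) c
    change (sg gr 1 z, sg (homologyGr gr D) 1 (cls gr D z)) ∈ relOne gr D
    rw [sg_of_mem hg 1 hz, sg_of_mem hH 1 (cls_mem hz)]
    exact smul_mem _ _ (rel_cyc z)
  · have := sg_odd hg hg 1 (by decide) D hD s
    rw [this, ← map_neg]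
    exact rel_bdry _

lemma relTwo_of_homog {U' H' : Type*} [AddCommGroup U'] [Module k U'] [AddCommGroup H'] [Module k H']
    {R' : Submodule k (U' × H')} {f : V ⊗[k] V →ₗ[k] U'}
    {F : Homology gr D ⊗[k] Homology gr D →ₗ[k] H'}
    (h : ∀ i j, ∀ z z' : cyc gr D, (z : V) ∈ gr i → (z' : V) ∈ gr j →
      (f ((z : V) ⊗ₜ (z' : V)), F (cls gr D z ⊗ₜ cls gr D z')) ∈ R') (c) :
    (f (cycTwo gr D c), F (clsTwo gr D c)) ∈ R' := by
  induction c with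
  | zero => simp only [map_zero]; exact Submodule.zero_mem _
  | add x y hx hy => simp only [map_add]; exact Submodule.add_mem _ hx hy
  | tmul x y =>
    have hl : ∀ y : cyc gr D, ∀ j, (y : V) ∈ gr j → ∀ x : cyc gr D,
        (f ((x : V) ⊗ₜ (y : V)), F (cls gr D x ⊗ₜ cls gr D y)) ∈ R' := fun y j hy x =>
      cyc_homog_induction hg hD (N := R'.comap
        ((f ∘ₗ (mk k V V).flip y ∘ₗ (cyc gr D).subtype).prod
          (F ∘ₗ (mk k _ _).flip (cls gr D y) ∘ₗ cls gr D))) (fun i z hz => h i j z y hz hy) x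
    exact cyc_homog_induction hg hD (N := R'.comap
        ((f ∘ₗ mk k V V x ∘ₗ (cyc gr D).subtype).prod
          (F ∘ₗ mk k _ _ (cls gr D x) ∘ₗ cls gr D))) (fun j z hz => hl z j hz x) y

lemma relTwo_tmul {z z' : cyc gr D} : ((z : V) ⊗ₜ[k] (z' : V), cls gr D z ⊗ₜ[k] cls gr D z') ∈ relTwo gr D :=
  rel_cyc (z ⊗ₜ[k] z')

lemma relTwo_kswap : RelMap (relTwo gr D) (relTwo gr D) (kswap gr gr) (kswap (homologyGr gr D) (homologyGr gr D)) := by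
  have hH := homologyGr_isInternal hg hD hDD
  refine relMap_of (relTwo_of_homog hg hD hDD fun i j z z' hz hz' => ?_) fun s => ?_
  · rw [kswap_of_mem hg hg hz hz', kswap_of_mem hH hH (cls_mem hz) (cls_mem hz')]
    exact smul_mem _ _ (relTwo_tmul hg hD hDD)
  · have h := congr_fun (kswap_tensorOdd hg (by decide) hD) s
    rw [comp_apply] at h
    rw [h]
    exact rel_bdry _

lemma relTwo_prj (i : ℤ) : RelMap (relTwo gr D) (relTwo gr D) (prj (tensorGr_internal hg hg) i)
    (prj (tensorGr_internal (homologyGr_isInternal hg hD hDD) (homologyGr_isInternal hg hD hDD)) i) := by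
  have hH := homologyGr_isInternal hg hD hDD
  refine relMap_of (relTwo_of_homog hg hD hDD fun a b z z' hz hz' => ?_) fun s => ?_
  · rw [prj_of_mem _ i (tmul_mem_tensorGr hz hz' rfl),
      prj_of_mem _ i (tmul_mem_tensorGr (cls_mem hz) (cls_mem hz') rfl)]
    split
    · exact relTwo_tmul hg hD hDD
    · exact Submodule.zero_mem _
  · have h := (hasProj_prj (tensorGr_internal hg hg)).comm (e := 1) (f := tensorOdd gr D D)
      (tensorOdd_mem hg hD hD) (i - 1) (v := s) (by
        rw [(tensorGr_internal hg hg).submodule_iSup_eq_top]; exact Submodule.mem_top)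
    rw [sub_add_cancel] at h
    rw [h]
    exact rel_bdry _

lemma relThree_assoc : RelMap (H := (Homology gr D ⊗[k] Homology gr D) ⊗[k] Homology gr D)
    (H' := Homology gr D ⊗[k] (Homology gr D ⊗[k] Homology gr D)) (relThree' gr D) (relThree gr D)
    (assoc k V V V).1
    (assoc k (Homology gr D) (Homology gr D) (Homology gr D) : _ →ₗ[k] _) := by
  refine relMap_of (fun c => ?_) fun s => ?_
  · rw [← comp_apply, ← comp_apply, assoc_cycTwo, assoc_clsTwo]
    exact rel_cyc _
  · have h := congr_fun (assoc_tensorOdd hg (D := D)) s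
    rw [comp_apply] at h
    rw [h]
    exact rel_bdry _

lemma relThree_assoc_symm : RelMap (H' := (Homology gr D ⊗[k] Homology gr D) ⊗[k] Homology gr D)
    (H := Homology gr D ⊗[k] (Homology gr D ⊗[k] Homology gr D)) (relThree gr D) (relThree' gr D)
    (assoc k V V V).symm.1
    ((assoc k (Homology gr D) (Homology gr D) (Homology gr D)).symm :
      Homology gr D ⊗[k] (Homology gr D ⊗[k] Homology gr D) →ₗ[k] _) := by
  rintro p hp
  obtain ⟨c, s, rfl⟩ := mem_rel.1 hp
  obtain ⟨c, rfl⟩ := (assoc k _ _ _).surjective c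
  obtain ⟨s, rfl⟩ := (assoc k _ _ _).surjective s
  have h1 := congr_fun (assoc_cycTwo (gr := gr) (D := D)) c
  have h2 := congr_fun (assoc_clsTwo (gr := gr) (D := D)) c
  have h3 := congr_fun (assoc_tensorOdd hg (D := D)) s
  refine mem_rel.2 ⟨c, s, Prod.ext ?_ ?_⟩
  · refine (LinearEquiv.symm_apply_eq _).2 (Eq.trans ?_ (map_add (assoc k V V V) _ _).symm)
    exact (congrArg₂ (· + ·) h1 h3).symm
  · exact (LinearEquiv.symm_apply_eq _).2 h2.symm

end Basic

end CoBVHomology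

section CoBVHomology

variable {k : Type u} [CommRing k] {V : Type v} [AddCommGroup V] [Module k V]
variable {gr : ℤ → Submodule k V} {D : V →ₗ[k] V}
variable {θ : V →ₗ[k] V ⊗[k] V} {B : V →ₗ[k] V}

lemma ChainHomotopic.apply {W : Type w} [AddCommGroup W] [Module k W] {gr' : ℤ → Submodule k W}
    {D' : W →ₗ[k] W} {e : ℤ} {f g : V →ₗ[k] W} (h : ChainHomotopic e gr D gr' D' f g) (z : cyc gr D) :
    ∃ s, f z - g z = D' s := by
  obtain ⟨K, -, hK⟩ := h
  refine ⟨K z, ?_⟩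
  have := congr_fun hK z
  rw [LinearMap.add_apply, LinearMap.smul_apply, comp_apply K, show D z = 0 from z.2.1,
    map_zero, smul_zero, add_zero] at this
  exact this

lemma relMap_tensorOdd {C' U' H' : Type*} [AddCommGroup C'] [Module k C'] [AddCommGroup U'] [Module k U']
    [AddCommGroup H'] [Module k H'] {cy' : C' →ₗ[k] U'} {cl' : C' →ₗ[k] H'} {D' B' : U' →ₗ[k] U'}
    {BH' : H' →ₗ[k] H'} (hg : IsInternal gr) (hD : HasDeg gr gr 1 D) (hDD : D ∘ₗ D = 0)
    (hDD' : D' ∘ₗ D' = 0) (hcy' : D' ∘ₗ cy' = 0) (hB : HasDeg gr gr (-1) B)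
    (hBD : B ∘ₗ D = -(D ∘ₗ B)) (hBD' : B' ∘ₗ D' = -(D' ∘ₗ B')) {BH : Homology gr D →ₗ[k] Homology gr D}
    (h : RelMap (relOne gr D) (relOne gr D) B BH) (h' : RelMap (Rel cy' cl' D') (Rel cy' cl' D') B' BH') :
    RelMap (relTensor (cyc gr D).subtype (cls gr D) cy' cl' (tensorOdd gr D D'))
      (relTensor (cyc gr D).subtype (cls gr D) cy' cl' (tensorOdd gr D D')) (tensorOdd gr B B')
      (tensorOdd (homologyGr gr D) BH BH') := by
  have hc := comp_cyc hg hD hDD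
  refine RelMap.add ?_ ?_
  · refine relMap_tensor (a := -1) (b := -1) (c := 1) hg hD hDD' hc hcy' h RelMap.id ?_ ?_ ?_ (by simp)
    · rw [hBD, neg_smul, one_smul]
    · rw [sg_comp_odd hg hg (by decide) hB, neg_smul, one_smul, neg_neg]
    · rw [one_smul]; rfl
  · refine relMap_tensor (a := -1) (b := 1) (c := -1) hg hD hDD' hc hcy' (relOne_sg hg hD hDD) h' ?_ ?_ ?_ (by simp)
    · rw [sg_comp_odd hg hg (by decide) hD, neg_smul, one_smul]
    · rw [one_smul]
    · rw [hBD', neg_smul, one_smul]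

set_option maxHeartbeats 600000 in
/-- The homology of a homotopy coBV-algebra is a coBV-coalgebra if the Künneth maps are
isomorphisms. -/
lemma IsHomotopyCoBV.exists_isCoBV (h : IsHomotopyCoBV gr D θ B) (hK : KunnethIso gr D) :
    ∃ (θH : Homology gr D →ₗ[k] Homology gr D ⊗[k] Homology gr D) (BH : Homology gr D →ₗ[k] Homology gr D),
      InducesComul gr D θ θH ∧ Induces gr D gr D B BH ∧ IsCoBV (homologyGr gr D) θH BH := by
  obtain ⟨⟨hs2, hu2⟩, -, hu3⟩ := hK
  have hg := h.internal
  have hD : HasDeg gr gr 1 D := h.diff_mem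
  have hDD := h.diff_diff
  have hB : HasDeg gr gr (-1) B := h.op_mem
  have hBD : B ∘ₗ D = -(D ∘ₗ B) := eq_neg_of_add_eq_zero_left h.op_diff
  have hθ : HasDeg gr (tensorGr gr gr) 0 θ := fun i v hv => by rw [add_zero]; exact h.comul_mem i v hv
  have hg2 := tensorGr_internal hg hg
  have hD2 : HasDeg (tensorGr gr gr) (tensorGr gr gr) 1 (tensorOdd gr D D) := tensorOdd_mem hg hD hD
  have hDD2 := tensorOdd_tensorOdd hg hD hDD hDD
  have hc := comp_cyc hg hD hDD
  have hc2 := tensorOdd_cycTwo hg hD hDD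
  have hH := homologyGr_isInternal hg hD hDD
  have hu1 : ∀ y, ((0 : V), y) ∈ relOne gr D → y = 0 := rel_unique fun c ⟨y, hy⟩ =>
    cls_eq_zero.2 ((mem_bdry hg).2 ⟨y, hy⟩)
  have hu2 : ∀ y, ((0 : V ⊗[k] V), y) ∈ relTwo gr D → y = 0 := rel_unique hu2
  have hu3 : ∀ y, ((0 : V ⊗[k] (V ⊗[k] V)), y) ∈ relThree gr D → y = 0 := rel_unique hu3
  have hθD : ∀ x, θ (D x) = tensorOdd gr D D (θ x) := congr_fun h.comul_diff
  obtain ⟨F, hF⟩ := exists_of_rel hu2 (θ ∘ₗ (cyc gr D).subtype) (fun z => by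
    obtain ⟨c, s, hs⟩ := hs2 (θ z) (by
      rw [mem_ker, ← hθD, show D z = 0 from z.2.1, map_zero])
    refine ⟨clsTwo gr D c, mem_rel.2 ⟨c, s, Prod.ext ?_ rfl⟩⟩
    exact (sub_eq_iff_eq_add'.1 hs.symm))
  have hFb : (bdry gr D).submoduleOf (cyc gr D) ≤ ker F := fun z hz => by
    obtain ⟨y, hy⟩ := (mem_bdry hg).1 hz
    have h1 := (relTwo gr D).sub_mem (hF z) (rel_bdry (cy := cycTwo gr D) (cl := clsTwo gr D) (θ y))
    rw [← hθD, hy] at h1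
    have h2 : (θ ∘ₗ (cyc gr D).subtype) z - θ ((cyc gr D).subtype z) = 0 := sub_self _
    rw [Prod.mk_sub_mk, h2, sub_zero] at h1
    exact hu2 _ h1
  obtain ⟨θH, rθ⟩ : ∃ θH : Homology gr D →ₗ[k] Homology gr D ⊗[k] Homology gr D,
      RelMap (relOne gr D) (relTwo gr D) θ θH := ⟨Submodule.liftQ _ F hFb, relMap_of hF fun s => by
    rw [hθD]; exact rel_bdry _⟩
  have hBc : ∀ z ∈ cyc gr D, B z ∈ cyc gr D := fun z hz => (mem_cyc hg).2 (by
    have := congr_fun hBD z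
    rw [comp_apply, LinearMap.neg_apply, comp_apply, (mem_cyc hg).1 hz, map_zero] at this
    exact neg_eq_zero.1 this.symm)
  have hBb : ∀ z ∈ bdry gr D, B z ∈ bdry gr D := fun z hz => by
    obtain ⟨y, rfl⟩ := (mem_bdry hg).1 hz
    refine (mem_bdry hg).2 ⟨-B y, ?_⟩
    rw [map_neg]; exact (congr_fun hBD y).symm
  have rB : RelMap (relOne gr D) (relOne gr D) B (homMap B hBc hBb) :=
    relMap_of (fun c => rel_cyc (cy := (cyc gr D).subtype) (⟨B c, hBc c c.2⟩ : cyc gr D)) fun s => by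
      have : B (D s) = D (-B s) := by rw [map_neg]; exact congr_fun hBD s
      rw [this]; exact rel_bdry _
  have hBH : Induces gr D gr D B (homMap B hBc hBb) := fun z => ⟨hBc z z.2, homMap_cls B hBc hBb z⟩
  have hBH' : ∀ z, homMap B hBc hBb (cls gr D z) = cls gr D ⟨B z, hBc z z.2⟩ := homMap_cls B hBc hBb
  set BH := homMap B hBc hBb
  clear_value BH
  have rsg := relOne_sg hg hD hDD
  have sgD : sg gr 1 ∘ₗ D = (-1 : k) • (D ∘ₗ sg gr 1) := by
    rw [sg_comp_odd hg hg (by decide) hD, neg_smul, one_smul]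
  have sgθ : θ ∘ₗ sg gr 1 = (1 : k) • (sg (tensorGr gr gr) 1 ∘ₗ θ) := by
    rw [one_smul, sg_comp_even hg hg2 (by decide) hθ]
  have hθD' : θ ∘ₗ D = (1 : k) • (tensorOdd gr D D ∘ₗ θ) := by rw [one_smul, h.comul_diff]
  have hθB : HasDeg gr (tensorGr gr gr) (-1) (θ ∘ₗ B) := hθ.comp hB (by norm_num)
  have sgθB : (θ ∘ₗ B) ∘ₗ sg gr 1 = (-1 : k) • (sg (tensorGr gr gr) 1 ∘ₗ (θ ∘ₗ B)) := by
    rw [sg_comp_odd hg hg2 (by decide) hθB]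
    simp
  have hθBD : (θ ∘ₗ B) ∘ₗ D = (-1 : k) • (tensorOdd gr D D ∘ₗ (θ ∘ₗ B)) := LinearMap.ext fun x => by
    have := congr_fun hBD x
    simp only [comp_apply, LinearMap.neg_apply] at this
    simp only [comp_apply, this, map_neg, hθD, LinearMap.smul_apply, neg_smul, one_smul]
  have rl : RelMap (H' := (Homology gr D ⊗[k] Homology gr D) ⊗[k] Homology gr D)
      (relTwo gr D) (relThree' gr D) (map θ .id)
      (map θH .id) :=
    relMap_tensor (a := 1) (b := 1) (c := 1) hg2 hD2 hDD hc2 hc rθ RelMap.id hθD' sgθ (by rw [one_smul]; rfl) (by simp)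
  have rr : RelMap (H' := Homology gr D ⊗[k] (Homology gr D ⊗[k] Homology gr D))
      (relTwo gr D) (relThree gr D) (map .id θ)
      (map .id θH) :=
    relMap_tensor (a := 1) (b := 1) (c := 1) hg hD hDD2 hc hc2 RelMap.id rθ (by rw [one_smul]; rfl)
      (by rw [one_smul]; rfl) hθD' (by simp)
  have rBl : RelMap (H' := (Homology gr D ⊗[k] Homology gr D) ⊗[k] Homology gr D)
      (relTwo gr D) (relThree' gr D) (map (θ ∘ₗ B) .id)
      (map (θH ∘ₗ BH) .id) :=
    relMap_tensor (a := -1) (b := -1) (c := 1) hg2 hD2 hDD hc2 hc (rθ.comp rB) RelMap.id hθBD sgθB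
      (by rw [one_smul]; rfl) (by simp)
  have rBr : RelMap (H' := Homology gr D ⊗[k] (Homology gr D ⊗[k] Homology gr D))
      (relTwo gr D) (relThree gr D) (map (sg gr 1) (θ ∘ₗ B))
      (map (sg (homologyGr gr D) 1) (θH ∘ₗ BH)) :=
    relMap_tensor (a := -1) (b := 1) (c := -1) hg hD hDD2 hc hc2 rsg (rθ.comp rB) sgD (by rw [one_smul]) hθBD (by simp)
  have rτ := relTwo_kswap hg hD hDD
  have hτ : HasDeg (tensorGr gr gr) (tensorGr gr gr) 0 (kswap gr gr) := HasDeg.kswap hg hg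
  have rτl : RelMap (H := (Homology gr D ⊗[k] Homology gr D) ⊗[k] Homology gr D)
      (H' := (Homology gr D ⊗[k] Homology gr D) ⊗[k] Homology gr D) (relThree' gr D) (relThree' gr D) (map (kswap gr gr) .id)
      (map (kswap (homologyGr gr D) (homologyGr gr D)) .id) :=
    relMap_tensor (a := 1) (b := 1) (c := 1) hg2 hD2 hDD hc2 hc rτ RelMap.id
      (by rw [one_smul, kswap_tensorOdd hg (by decide) hD])
      (by rw [one_smul, sg_comp_even hg2 hg2 (by decide) hτ]) (by rw [one_smul]; rfl) (by simp)
  have ra := relThree_assoc hg hD hDD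
  have ra' := relThree_assoc_symm hg hD hDD
  have rB2 := relMap_tensorOdd hg hD hDD hDD hc hB hBD hBD rB rB
  have rB3 := relMap_tensorOdd hg hD hDD hDD2 hc2 hB hBD (tensorOdd_anticomm hg hD hB hBD hBD) rB rB2
  have rc : ∀ z : cyc gr D, ((z : V), cls gr D z) ∈ relOne gr D := fun z => rel_cyc z
  refine ⟨θH, BH, fun z => ?_, hBH, ⟨hH, ?_, ?_, ?_, ?_, ?_, ?_⟩⟩
  · obtain ⟨c, s, e⟩ := mem_rel.1 (rθ _ (rc z))
    obtain ⟨e1, e2⟩ := Prod.mk.inj e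
    exact ⟨c, e2, s, by rw [e1]; exact (add_sub_cancel_left _ _).symm⟩
  · rintro i _ ⟨z, hz, rfl⟩
    have h1 := rθ _ (rc z)
    have h2 := relTwo_prj hg hD hDD i _ h1
    rw [prj_self hg2 (h.comul_mem i z hz)] at h2
    have h3 := (relTwo gr D).sub_mem h1 h2
    rw [Prod.mk_sub_mk, sub_self] at h3
    rw [sub_eq_zero.1 (hu2 _ h3)]
    exact prj_mem _ _ _
  · refine LinearMap.ext fun y => ?_
    obtain ⟨z, rfl⟩ := cls_surjective y
    exact RelMap.eq hu3 (ra.comp (rl.comp rθ)) (rr.comp rθ) (rc z) ⟨0, by rw [h.coassoc, sub_self, map_zero]⟩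
  · refine LinearMap.ext fun y => ?_
    obtain ⟨z, rfl⟩ := cls_surjective y
    have h1 := h.cocomm.apply z
    have h2 := RelMap.eq hu2 (rτ.comp rθ) rθ (rc z) h1
    exact h2
  · rintro i _ ⟨z, hz, rfl⟩
    rw [hBH']
    exact cls_mem (h.op_mem i z hz)
  · refine LinearMap.ext fun y => ?_
    obtain ⟨z, rfl⟩ := cls_surjective y
    rw [comp_apply, hBH', hBH', LinearMap.zero_apply, cls_eq_zero]
    have : B (B z) = 0 := congr_fun h.op_op z
    exact (mem_bdry hg).2 ⟨0, by rw [map_zero]; exact this.symm⟩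
  · refine LinearMap.ext fun y => ?_
    obtain ⟨z, rfl⟩ := cls_surjective y
    have rL : RelMap (relOne gr D) (relThree gr D) (coSevenLeft θ B) (coSevenLeft θH BH) := rr.comp (rθ.comp rB)
    have r1 := (ra.comp (rBl.comp rθ)).add (rBr.comp rθ)
    have r2 := ra.comp (rτl.comp (ra'.comp (rBr.comp rθ)))
    have r3 := rB3.comp (rr.comp rθ)
    have rR : RelMap (relOne gr D) (relThree gr D) (coSevenRight gr θ B)
      (coSevenRight (homologyGr gr D) θH BH) := (r1.add r2).sub r3
    have h1 := h.seven_term.apply z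
    have h2 := RelMap.eq hu3 rL rR (rc z) h1
    exact h2

end CoBVHomology

section Kunneth

variable {k : Type u} [CommRing k] {V : Type v} [AddCommGroup V] [Module k V]
variable {gr : ℤ → Submodule k V} {D : V →ₗ[k] V}
variable {W : Type w} [AddCommGroup W] [Module k W] {D' : W →ₗ[k] W}

lemma exists_generalized_inverse_of_field {k : Type u} [Field k] {V : Type v} [AddCommGroup V]
    [Module k V] (D : V →ₗ[k] V) : ∃ h : V →ₗ[k] V, ∀ v, D (h (D v)) = D v := by
  obtain ⟨g, hg⟩ := D.rangeRestrict.exists_rightInverse_of_surjective (LinearMap.range_rangeRestrict D)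
  obtain ⟨h, hh⟩ := LinearMap.exists_extend g
  refine ⟨h, fun v => ?_⟩
  have h1 : h (D v) = g ⟨D v, v, rfl⟩ := congr_fun hh ⟨D v, v, rfl⟩
  rw [h1]
  exact congrArg Subtype.val (congr_fun hg ⟨D v, v, rfl⟩)

lemma exists_generalized_inverse (hk : IsField k) (D : V →ₗ[k] V) : ∃ h : V →ₗ[k] V, ∀ v, D (h (D v)) = D v := by
  let _ := hk.toField
  exact exists_generalized_inverse_of_field D

/-- A homotopy `h` from the identity to a projection `P` onto representatives of the homology. -/
structure Splitting (gr : ℤ → Submodule k V) (D P h : V →ₗ[k] V) : Prop where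
  deg : HasDeg gr gr (-1) h
  DP : ∀ v, D (P v) = 0
  PD : ∀ v, P (D v) = 0
  sub_eq : ∀ v, v - P v = D (h v) + h (D v)

lemma exists_splitting (hk : IsField k) (hg : IsInternal gr) (hD : HasDeg gr gr 1 D)
    (hDD : D ∘ₗ D = 0) : ∃ P h, Splitting gr D P h := by
  obtain ⟨h₀, h0⟩ := exists_generalized_inverse hk D
  set h : V →ₗ[k] V := extend hg fun i => prj hg (i - 1) ∘ₗ h₀ ∘ₗ (gr i).subtype
  have hh : ∀ i, ∀ v ∈ gr i, h v = prj hg (i - 1) (h₀ v) := fun i v hv => extend_of_mem hg _ hv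
  have hDD' : ∀ v, D (D v) = 0 := congr_fun hDD
  have hDh : ∀ v, D (h (D v)) = D v := by
    refine congr_fun (homog_ext hg (f := D ∘ₗ h ∘ₗ D) (g := D) fun i v hv => ?_)
    have h1 := (hasProj_prj hg).comm hD i (v := h₀ (D v)) (by
      rw [hg.submodule_iSup_eq_top]; exact Submodule.mem_top)
    rw [comp_apply, comp_apply, hh _ _ (hD i v hv), add_sub_cancel_right, ← h1, h0, prj_self hg (hD i v hv)]
  refine ⟨.id - D ∘ₗ h - h ∘ₗ D, h, fun i v hv => ?_, fun v => ?_, fun v => ?_, fun v => ?_⟩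
  · rw [hh i v hv]; exact prj_mem hg _ _
  · simp only [LinearMap.sub_apply, id_apply, comp_apply, map_sub, hDD', hDh]; simp
  · simp only [LinearMap.sub_apply, id_apply, comp_apply, hDD', hDh]; simp
  · simp only [LinearMap.sub_apply, id_apply, comp_apply]; abel

lemma Splitting.tensor {P h : V →ₗ[k] V} (hg : IsInternal gr) (hD : HasDeg gr gr 1 D)
    (H : Splitting gr D P h) {Q h' : W →ₗ[k] W} (hQ : ∀ w, w - Q w = D' (h' w) + h' (D' w)) :
    ∃ K : V ⊗[k] W →ₗ[k] V ⊗[k] W, ∀ t, t - map P Q t = tensorOdd gr D D' (K t) + K (tensorOdd gr D D' t) := by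
  have hs : ∀ x, sg gr 1 (h x) = -h (sg gr 1 x) := sg_odd hg hg (-1) (by decide) h H.deg
  have hsD : ∀ x, sg gr 1 (D x) = -D (sg gr 1 x) := sg_odd hg hg 1 (by decide) D hD
  have hsP : ∀ x, P (sg gr 1 x) = sg gr 1 (P x) := fun x => by
    have e : ∀ y, P y = y - (D (h y) + h (D y)) := fun y => by rw [← H.sub_eq, sub_sub_cancel]
    rw [e, e, map_sub, map_add, hsD, hs, hs, hsD, map_neg, map_neg, neg_neg, neg_neg]
  refine ⟨map h .id + map (sg gr 1 ∘ₗ P) h', ?_⟩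
  refine LinearMap.congr_fun (f := .id - map P Q) (g := tensorOdd gr D D' ∘ₗ (map h .id + map (sg gr 1 ∘ₗ P) h') +
      (map h .id + map (sg gr 1 ∘ₗ P) h') ∘ₗ tensorOdd gr D D') ?_
  refine ext' fun x y => ?_
  have h1 : D (sg gr 1 (P x)) = 0 := by
    have := hsD (P x)
    rw [H.DP, map_zero] at this
    exact neg_eq_zero.1 this.symm
  simp only [tensorOdd, LinearMap.sub_apply, LinearMap.add_apply, comp_apply, map_add,
    map_tmul, id_apply, h1, H.PD, hs, hsP, sg_sg hg, map_zero,
    zero_tmul, neg_tmul]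
  have e1 : x ⊗ₜ[k] y - P x ⊗ₜ[k] Q y = (x - P x) ⊗ₜ[k] y + P x ⊗ₜ[k] (y - Q y) := by
    simp only [sub_tmul, TensorProduct.tmul_sub]; abel
  rw [e1, H.sub_eq, hQ, add_tmul, tmul_add]
  abel

lemma kunnethIso_of_isField (hk : IsField k) (hg : IsInternal gr) (hD : HasDeg gr gr 1 D)
    (hDD : D ∘ₗ D = 0) : KunnethIso gr D := by
  obtain ⟨P, h, H⟩ := exists_splitting hk hg hD hDD
  obtain ⟨K, hK⟩ := H.tensor hg hD (Q := P) H.sub_eq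
  obtain ⟨L, hL⟩ := H.tensor hg hD (Q := map P P) hK
  set P' : V →ₗ[k] cyc gr D := P.codRestrict _ fun v => (mem_cyc hg).2 (H.DP v)
  have hP' : (cyc gr D).subtype ∘ₗ P' = P := rfl
  have hcl : cls gr D ∘ₗ P' ∘ₗ (cyc gr D).subtype = cls gr D := LinearMap.ext fun z => by
    rw [comp_apply, comp_apply, cls_eq, mem_bdry hg]
    refine ⟨-h z, ?_⟩
    have := H.sub_eq (z : V)
    rw [show D z = 0 from z.2.1, map_zero, add_zero] at this
    rw [map_neg, ← this, neg_sub]; rfl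
  have hPD : P' ∘ₗ D = 0 := LinearMap.ext fun v => Subtype.ext (H.PD v)
  have hcl2 : clsTwo gr D ∘ₗ map P' P' ∘ₗ cycTwo gr D = clsTwo gr D := by
    rw [clsTwo, cycTwo, ← map_comp, ← map_comp, hcl]
  have hPD2 : clsTwo gr D ∘ₗ map P' P' ∘ₗ tensorOdd gr D D = 0 := by
    rw [tensorOdd, comp_add, ← map_comp, ← map_comp, hPD, map_zero_left, map_zero_right, add_zero, comp_zero]
  refine ⟨⟨fun t ht => ⟨map P' P' t, K t, ?_⟩, fun c ⟨s, hs⟩ => ?_⟩,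
    fun t ht => ⟨map P' (map P' P') t, L t, ?_⟩, fun c ⟨s, hs⟩ => ?_⟩
  · have h1 : cycTwo gr D (map P' P' t) = map P P t := by
      rw [cycTwo, ← comp_apply, ← map_comp, hP']
    rw [h1, hK, mem_ker.1 ht, map_zero, add_zero]
  · have h1 := congr_fun hcl2 c
    rw [comp_apply, comp_apply, ← hs] at h1
    rw [← h1]
    exact congr_fun hPD2 s
  · have h1 : map (cyc gr D).subtype (cycTwo gr D) (map P' (map P' P') t) = map P (map P P) t := by
      rw [cycTwo, ← comp_apply, ← map_comp, ← map_comp, hP']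
    rw [h1, hL, mem_ker.1 ht, map_zero, add_zero]
  · have h1 : map (cls gr D ∘ₗ P') (clsTwo gr D ∘ₗ map P' P')
        (map (cyc gr D).subtype (cycTwo gr D) c) = map (cls gr D) (clsTwo gr D) c := by
      rw [← comp_apply, ← map_comp, comp_assoc, comp_assoc, hcl, hcl2]
    have h2 : map (cls gr D ∘ₗ P') (clsTwo gr D ∘ₗ map P' P') ∘ₗ tensorOdd gr D (tensorOdd gr D D) = 0 := by
      rw [tensorOdd, comp_add, ← map_comp, ← map_comp, comp_assoc, comp_assoc (tensorOdd gr D D), hPD, hPD2, comp_zero,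
        map_zero_left, map_zero_right, add_zero]
    rw [← h1, ← hs]
    exact congr_fun h2 s

end Kunneth

section DualGraded

variable {k : Type u} [CommRing k]
variable {V : Type v} [AddCommGroup V] [Module k V] {gr : ℤ → Submodule k V}
variable {W : Type w} [AddCommGroup W] [Module k W] {gr' : ℤ → Submodule k W}
variable {X : Type x} [AddCommGroup X] [Module k X] {gr'' : ℤ → Submodule k X}

/-- The functional `v ⊗ w ↦ φ v * ψ w`. -/
def ten (φ : Dual k V) (ψ : Dual k W) : Dual k (V ⊗[k] W) := mul' k k ∘ₗ map φ ψ

lemma ten_tmul (φ : Dual k V) (ψ : Dual k W) (v : V) (w : W) : ten φ ψ (v ⊗ₜ w) = φ v * ψ w := by simp [ten]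

lemma ten_smul_left (c : k) (φ : Dual k V) (ψ : Dual k W) :
    ten (c • φ) ψ = c • ten φ ψ := ext' fun v w => by simp [ten_tmul, mul_assoc]

lemma ten_smul_right (c : k) (φ : Dual k V) (ψ : Dual k W) :
    ten φ (c • ψ) = c • ten φ ψ := ext' fun v w => by simp [ten_tmul, mul_left_comm]

lemma ten_add_left (φ φ' : Dual k V) (ψ : Dual k W) :
    ten (φ + φ') ψ = ten φ ψ + ten φ' ψ := ext' fun v w => by simp [ten_tmul, add_mul]

lemma ten_add_right (φ : Dual k V) (ψ ψ' : Dual k W) :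
    ten φ (ψ + ψ') = ten φ ψ + ten φ ψ' := ext' fun v w => by simp [ten_tmul, mul_add]

lemma ten_comp_map {V' W' : Type*} [AddCommGroup V'] [Module k V'] [AddCommGroup W'] [Module k W']
    (φ : Dual k V) (ψ : Dual k W) (f : V' →ₗ[k] V) (g : W' →ₗ[k] W) :
    ten φ ψ ∘ₗ map f g = ten (φ ∘ₗ f) (ψ ∘ₗ g) :=
  ext' fun v w => by simp [ten_tmul]

lemma ten_assoc (φ : Dual k V) (ψ : Dual k W) (χ : Dual k X) : ten φ (ten ψ χ) ∘ₗ (assoc k V W X).1 = ten (ten φ ψ) χ :=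
  ext_threefold fun v w x => by simp [ten_tmul, mul_assoc]

lemma dual_apply {i p : ℤ} {φ : Dual k V} (hφ : φ ∈ dualGr gr i) {v : V} (hv : v ∈ gr p)
    (h : p ≠ -i) : φ v = 0 := hφ p h v hv

lemma dual_comp_sg (h : IsInternal gr) {i : ℤ} {φ : Dual k V}
    (hφ : φ ∈ dualGr gr i) (e : ZMod 2) : φ ∘ₗ sg gr e = ksign k ((i : ZMod 2) * e) • φ :=
  homog_ext h fun p v hv => by
    rw [comp_apply, sg_of_mem h e hv, map_smul, LinearMap.smul_apply]
    by_cases hp : p = -i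
    · subst hp; refine ksign_congr ?_ _; push_cast; rw [ZMod.neg_eq_self_mod_two]
    · rw [dual_apply hφ hv hp, smul_zero, smul_zero]

lemma dual_comp {i e : ℤ} {φ : Dual k W} (hφ : φ ∈ dualGr gr' i) {f : V →ₗ[k] W}
    (hf : HasDeg gr gr' e f) {n : ℤ} (hn : n = i + e) : φ ∘ₗ f ∈ dualGr gr n := fun p hp v hv =>
  hφ (p + e) (by omega) _ (hf p v hv)

lemma ten_mem {i j n : ℤ} {φ : Dual k V} {ψ : Dual k W} (hφ : φ ∈ dualGr gr i)
    (hψ : ψ ∈ dualGr gr' j) (hn : n = i + j) : ten φ ψ ∈ dualGr (tensorGr gr gr') n := fun p hp t ht => by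
  have := map_mem_of_tensorGr (gr'' := (⊥ : Submodule k k)) (ten φ ψ) (n := p) (fun a b hab v hv w hw => by
    rw [Submodule.mem_bot, ten_tmul]
    by_cases ha : a = -i
    · rw [dual_apply hψ hw (by omega), mul_zero]
    · rw [dual_apply hφ hv ha, zero_mul]) ht
  exact this

lemma ten_kswap (h : IsInternal gr) (h' : IsInternal gr') {i j : ℤ}
    {φ : Dual k W} {ψ : Dual k V} (hφ : φ ∈ dualGr gr' i) (hψ : ψ ∈ dualGr gr j) :
    ten φ ψ ∘ₗ kswap gr gr' = ksign k ((i : ZMod 2) * j) • ten ψ φ :=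
  tensor_homog_ext h h' fun p q v hv w hw => by
    rw [comp_apply, kswap_of_mem h h' hv hw, map_smul, LinearMap.smul_apply, ten_tmul, ten_tmul, mul_comm (φ w)]
    by_cases hp : p = -j
    · by_cases hq : q = -i
      · subst hp hq; refine ksign_congr ?_ _; push_cast; ring
      · rw [dual_apply hφ hw hq, mul_zero, smul_zero, smul_zero]
    · rw [dual_apply hψ hv hp, zero_mul, smul_zero, smul_zero]

lemma ten_ksgn (h : IsInternal gr) (h' : IsInternal gr') {i j : ℤ}
    {φ : Dual k V} {ψ : Dual k W} (hφ : φ ∈ dualGr gr i) (hψ : ψ ∈ dualGr gr' j) :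
    ten φ ψ ∘ₗ ksgn gr gr' = ksign k ((i : ZMod 2) * j) • ten φ ψ :=
  tensor_homog_ext h h' fun p q v hv w hw => by
    rw [comp_apply, ksgn_of_mem h h' hv hw, map_smul, LinearMap.smul_apply, ten_tmul]
    by_cases hp : p = -i
    · by_cases hq : q = -j
      · subst hp hq; refine ksign_congr ?_ _; push_cast; ring
      · rw [dual_apply hψ hw hq, mul_zero, smul_zero, smul_zero]
    · rw [dual_apply hφ hv hp, zero_mul, smul_zero, smul_zero]

lemma hasProj_dual (h : IsInternal gr) : HasProj (dualGr gr) fun i => LinearMap.lcomp k k (prj h (-i)) where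
  mem i φ _ := fun p hp v hv => by
    change φ (prj h (-i) v) = 0
    rw [prj_of_mem h _ hv, if_neg hp, map_zero]
  self i φ hφ := homog_ext h fun p v hv => by
    change φ (prj h (-i) v) = φ v
    rw [prj_of_mem h _ hv]
    split_ifs with hp
    · rfl
    · rw [dual_apply hφ hv hp, map_zero]
  other i j hij φ hφ := homog_ext h fun p v hv => by
    change φ (prj h (-i) v) = 0
    rw [prj_of_mem h _ hv]
    split_ifs with hp
    · exact dual_apply hφ hv (by omega)
    · rw [map_zero]

lemma oddDual_of_mem (h : IsInternal gr) {i : ℤ} {φ : Dual k V} (hφ : φ ∈ dualGr gr i)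
    (D : V →ₗ[k] V) : oddDual gr D φ = ksign k (i : ZMod 2) • (φ ∘ₗ D) := by
  change φ ∘ₗ (sg gr 1 ∘ₗ D) = _
  rw [← comp_assoc, dual_comp_sg h hφ, mul_one, smul_comp]

lemma oddDual_hasDeg (h : IsInternal gr) {e : ℤ} {D : V →ₗ[k] V} (hD : HasDeg gr gr e D) :
    HasDeg (dualGr gr) (dualGr gr) e (oddDual gr D) := fun i φ hφ => by
  rw [oddDual_of_mem h hφ]
  exact ksign_mem (dual_comp hφ hD rfl)

/-- The product on the dual of a coalgebra. -/
def dualMul (gr : ℤ → Submodule k V) (θ : V →ₗ[k] V ⊗[k] V) : Dual k V →ₗ[k] Dual k V →ₗ[k] Dual k V :=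
  mk₂ k (fun φ ψ => ten φ ψ ∘ₗ ksgn gr gr ∘ₗ θ) (fun φ φ' ψ => by rw [ten_add_left, add_comp])
    (fun c φ ψ => by rw [ten_smul_left]; rfl)
    (fun φ ψ ψ' => by rw [ten_add_right, add_comp])
    (fun c φ ψ => by rw [ten_smul_right]; rfl)

variable {θ : V →ₗ[k] V ⊗[k] V}

lemma dualMul_of_mem (h : IsInternal gr) {i j : ℤ} {φ ψ : Dual k V} (hφ : φ ∈ dualGr gr i) (hψ : ψ ∈ dualGr gr j) :
    dualMul gr θ φ ψ = ksign k ((i : ZMod 2) * j) • (ten φ ψ ∘ₗ θ) := by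
  change ten φ ψ ∘ₗ ksgn gr gr ∘ₗ θ = _
  rw [← comp_assoc, ten_ksgn h h hφ hψ, smul_comp]

lemma dualMul_mem (h : IsInternal gr) (hθ : HasDeg gr (tensorGr gr gr) 0 θ) {i j n : ℤ}
    {φ ψ : Dual k V} (hφ : φ ∈ dualGr gr i) (hψ : ψ ∈ dualGr gr j) (hn : n = i + j) :
    dualMul gr θ φ ψ ∈ dualGr gr n := by
  rw [dualMul_of_mem h hφ hψ]
  exact ksign_mem (dual_comp (ten_mem hφ hψ rfl) hθ (by omega))

lemma ten_comp_tensorOdd (h : IsInternal gr) {i : ℤ} {φ : Dual k V}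
    (hφ : φ ∈ dualGr gr i) (ψ : Dual k W) (D : V →ₗ[k] V) (D' : W →ₗ[k] W) :
    ten φ ψ ∘ₗ tensorOdd gr D D' = ten (φ ∘ₗ D) ψ + ksign k (i : ZMod 2) • ten φ (ψ ∘ₗ D') := by
  rw [tensorOdd, comp_add, ten_comp_map, ten_comp_map, dual_comp_sg h hφ, mul_one, ten_smul_left, comp_id]

/-- The differential is a derivation of the product. -/
lemma oddDual_dualMul (h : IsInternal gr) (hθ : HasDeg gr (tensorGr gr gr) 0 θ)
    {D : V →ₗ[k] V} (hD : HasDeg gr gr 1 D) (hθD : θ ∘ₗ D = tensorOdd gr D D ∘ₗ θ) {i j : ℤ}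
    {φ ψ : Dual k V} (hφ : φ ∈ dualGr gr i) (hψ : ψ ∈ dualGr gr j) :
    oddDual gr D (dualMul gr θ φ ψ) =
      dualMul gr θ (oddDual gr D φ) ψ + ksign k (i : ZMod 2) • dualMul gr θ φ (oddDual gr D ψ) := by
  rw [oddDual_of_mem h (dualMul_mem h hθ hφ hψ rfl), dualMul_of_mem h hφ hψ,
    dualMul_of_mem h (oddDual_hasDeg h hD i φ hφ) hψ, dualMul_of_mem h hφ (oddDual_hasDeg h hD j ψ hψ),
    oddDual_of_mem h hφ, oddDual_of_mem h hψ, ten_smul_left, ten_smul_right, smul_comp,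
    comp_assoc, hθD, ← comp_assoc, ten_comp_tensorOdd h hφ, add_comp,
    smul_comp, smul_comp, smul_comp]
  refine LinearMap.ext fun x => ?_
  simp only [LinearMap.add_apply, LinearMap.smul_apply, smul_add, ksign_smul_smul]
  refine congrArg₂ (· + ·) (ksign_congr ?_ _) (ksign_congr ?_ _) <;> push_cast <;> clear * - <;> grind [icast_sq]

end DualGraded

section InducedProduct

variable {k : Type u} [CommRing k]
variable {V : Type v} [AddCommGroup V] [Module k V] {gr : ℤ → Submodule k V} {D : V →ₗ[k] V}

lemma exists_inducesMul (M : V →ₗ[k] V →ₗ[k] V) (hc : ∀ z ∈ cyc gr D, ∀ z' ∈ cyc gr D, M z z' ∈ cyc gr D)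
    (hl : ∀ z ∈ bdry gr D, ∀ z' ∈ cyc gr D, M z z' ∈ bdry gr D)
    (hr : ∀ z ∈ cyc gr D, ∀ z' ∈ bdry gr D, M z z' ∈ bdry gr D) :
    ∃ mulH : Homology gr D →ₗ[k] Homology gr D →ₗ[k] Homology gr D,
      ∀ z z' : cyc gr D, mulH (cls gr D z) (cls gr D z') = cls gr D ⟨M z z', hc z z.2 z' z'.2⟩ := by
  let F : cyc gr D →ₗ[k] cyc gr D →ₗ[k] Homology gr D := mk₂ k (fun z z' => cls gr D ⟨M z z', hc z z.2 z' z'.2⟩)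
      (fun a b c => by rw [← map_add]; congr 1; ext1; simp)
      (fun a b c => by rw [← map_smul]; congr 1; ext1; simp)
      (fun a b c => by rw [← map_add]; congr 1; ext1; simp)
      (fun a b c => by rw [← map_smul]; congr 1; ext1; simp)
  have h1 : ∀ z, (bdry gr D).submoduleOf (cyc gr D) ≤ ker (F z) := fun z z' hz' =>
    cls_eq_zero.2 (hr z z.2 z' hz')
  let G : cyc gr D →ₗ[k] Homology gr D →ₗ[k] Homology gr D :=
    { toFun := fun z => Submodule.liftQ _ (F z) (h1 z)
      map_add' := fun a b => LinearMap.ext fun y => by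
        obtain ⟨z, rfl⟩ := cls_surjective y
        change F (a + b) z = F a z + F b z
        rw [map_add]; rfl
      map_smul' := fun c a => LinearMap.ext fun y => by
        obtain ⟨z, rfl⟩ := cls_surjective y
        change F (c • a) z = c • F a z
        rw [map_smul]; rfl }
  have h2 : (bdry gr D).submoduleOf (cyc gr D) ≤ ker G := fun z hz => LinearMap.ext fun y => by
    obtain ⟨z', rfl⟩ := cls_surjective y
    exact cls_eq_zero.2 (hl z hz z' z'.2)
  exact ⟨Submodule.liftQ _ G h2, fun z z' => rfl⟩

end InducedProduct

section DualBV

variable {k : Type u} [CommRing k]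
variable {V : Type v} [AddCommGroup V] [Module k V] {gr : ℤ → Submodule k V} {D B : V →ₗ[k] V}
variable {θ : V →ₗ[k] V ⊗[k] V}

lemma IsHomotopyCoBV.comul_hasDeg (H : IsHomotopyCoBV gr D θ B) : HasDeg gr (tensorGr gr gr) 0 θ :=
  fun i v hv => by rw [add_zero]; exact H.comul_mem i v hv

lemma dualMul_dualMul (H : IsHomotopyCoBV gr D θ B) {i j l : ℤ} {a b c : Dual k V}
    (ha : a ∈ dualGr gr i) (hb : b ∈ dualGr gr j) (hc : c ∈ dualGr gr l) :
    dualMul gr θ (dualMul gr θ a b) c = ksign k ((i : ZMod 2) * j + i * l + j * l) •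
      (ten a (ten b c) ∘ₗ map .id θ ∘ₗ θ) := by
  have hθ := H.comul_hasDeg
  have h := H.internal
  rw [dualMul_of_mem h (dualMul_mem h hθ ha hb rfl) hc, dualMul_of_mem h ha hb, ten_smul_left,
    ← H.coassoc, ← comp_assoc, ten_assoc, ← comp_assoc, ten_comp_map, comp_id]
  refine LinearMap.ext fun x => ?_
  simp only [LinearMap.smul_apply, comp_apply, ksign_smul_smul]
  refine ksign_congr ?_ _; push_cast; clear * -; grind

lemma dualMul_assoc (H : IsHomotopyCoBV gr D θ B) {i j l : ℤ} {a b c : Dual k V}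
    (ha : a ∈ dualGr gr i) (hb : b ∈ dualGr gr j) (hc : c ∈ dualGr gr l) :
    dualMul gr θ (dualMul gr θ a b) c = dualMul gr θ a (dualMul gr θ b c) := by
  have hθ := H.comul_hasDeg
  have h := H.internal
  rw [dualMul_dualMul H ha hb hc, dualMul_of_mem h ha (dualMul_mem h hθ hb hc rfl), dualMul_of_mem h hb hc,
    ten_smul_right, ← comp_assoc, ten_comp_map, comp_id]
  refine LinearMap.ext fun x => ?_
  simp only [LinearMap.smul_apply, comp_apply, ksign_smul_smul]
  refine ksign_congr ?_ _; push_cast; clear * -; grind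

lemma comp_eq_zero_of_oddDual (h : IsInternal gr) {i : ℤ} {a : Dual k V}
    (ha : a ∈ dualGr gr i) (ha' : oddDual gr D a = 0) : a ∘ₗ D = 0 := by
  rw [oddDual_of_mem h ha] at ha'
  refine LinearMap.ext fun x => ?_
  have h1 := congrArg (fun y => ksign k (i : ZMod 2) • y) (congr_fun ha' x)
  simp only [LinearMap.smul_apply, ksign_smul_self, LinearMap.zero_apply, smul_zero] at h1
  exact h1

lemma ten_comp_tensorOdd_eq_zero {W : Type w} [AddCommGroup W] [Module k W] (h : IsInternal gr)
    {i : ℤ} {a : Dual k V} {b : Dual k W} {D' : W →ₗ[k] W} (ha : a ∈ dualGr gr i)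
    (ha' : a ∘ₗ D = 0) (hb' : b ∘ₗ D' = 0) : ten a b ∘ₗ tensorOdd gr D D' = 0 := by
  rw [ten_comp_tensorOdd h ha, ha', hb', ten, ten, map_zero_left, map_zero_right, comp_zero, smul_zero, add_zero]

/-- A functional vanishing on boundaries carries a null homotopic map to a coboundary. -/
lemma comp_chainHomotopic {W : Type w} [AddCommGroup W] [Module k W] {gr' : ℤ → Submodule k W}
    {D' : W →ₗ[k] W} (h : IsInternal gr) {n e : ℤ} {T : Dual k W} (hT : T ∈ dualGr gr' n)
    (hT' : T ∘ₗ D' = 0) {f g : V →ₗ[k] W} (hfg : ChainHomotopic e gr D gr' D' f g) :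
    ∃ y ∈ dualGr gr (n + e - 1), T ∘ₗ f - T ∘ₗ g = oddDual gr D y := by
  obtain ⟨K, hK, e1⟩ := hfg
  have hK : HasDeg gr gr' (e - 1) K := fun p v hv => by rw [← add_sub_assoc]; exact hK p v hv
  have hy : T ∘ₗ K ∈ dualGr gr (n + e - 1) := dual_comp hT hK (by ring)
  refine ⟨ksign k ((n - 1 : ℤ) : ZMod 2) • (T ∘ₗ K), smul_mem _ _ hy, ?_⟩
  rw [map_smul, oddDual_of_mem h hy, ← comp_sub, e1, comp_add, ← comp_assoc, hT']
  refine LinearMap.ext fun x => ?_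
  simp only [LinearMap.smul_apply, comp_apply, ksign_smul_smul, LinearMap.add_apply,
    LinearMap.zero_apply, zero_add, map_smul]
  refine ksign_congr ?_ _; push_cast; clear * -; grind

lemma dualMul_comm (H : IsHomotopyCoBV gr D θ B) {i j : ℤ} {a b : Dual k V}
    (ha : a ∈ dualGr gr i) (hb : b ∈ dualGr gr j) (ha' : oddDual gr D a = 0) (hb' : oddDual gr D b = 0) :
    ∃ y ∈ dualGr gr (i + j - 1), dualMul gr θ a b - ksign k ((i : ZMod 2) * j) • dualMul gr θ b a = oddDual gr D y := by
  have h := H.internal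
  obtain ⟨y, hy, e⟩ := comp_chainHomotopic h (ten_mem hb ha (add_comm i j)) (ten_comp_tensorOdd_eq_zero h hb
    (comp_eq_zero_of_oddDual h hb hb') (comp_eq_zero_of_oddDual h ha ha')) H.cocomm
  refine ⟨y, by rwa [add_zero] at hy, ?_⟩
  rw [← e, dualMul_of_mem h ha hb, dualMul_of_mem h hb ha, ← comp_assoc, ten_kswap h h hb ha]
  refine LinearMap.ext fun x => ?_
  simp only [LinearMap.sub_apply, LinearMap.smul_apply, comp_apply, ksign_smul_smul]
  refine congrArg₂ (· - ·) (ksign_congr ?_ _) ?_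
  · ring
  · rw [show (i * j + j * i : ZMod 2) = 0 by clear * -; grind, ksign_zero, one_smul]

/-- The seven-term relation for functionals, in terms of the two sides of the seven-term coBV
relation. -/
lemma dual_seven (H : IsHomotopyCoBV gr D θ B) {i j l : ℤ} {a b c : Dual k V}
    (ha : a ∈ dualGr gr i) (hb : b ∈ dualGr gr j) (hc : c ∈ dualGr gr l) :
    oddDual gr B (dualMul gr θ (dualMul gr θ a b) c) - (dualMul gr θ (oddDual gr B (dualMul gr θ a b)) c
        + ksign k (i : ZMod 2) • dualMul gr θ a (oddDual gr B (dualMul gr θ b c))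
        + ksign k (((i - 1) * j : ℤ) : ZMod 2) • dualMul gr θ b (oddDual gr B (dualMul gr θ a c))
        - dualMul gr θ (dualMul gr θ (oddDual gr B a) b) c
        - ksign k (i : ZMod 2) • dualMul gr θ (dualMul gr θ a (oddDual gr B b)) c
        - ksign k ((i + j : ℤ) : ZMod 2) • dualMul gr θ (dualMul gr θ a b) (oddDual gr B c)) =
    ksign k ((i : ZMod 2) + j + l + i * j + i * l + j * l) •
      (ten a (ten b c) ∘ₗ coSevenLeft θ B - ten a (ten b c) ∘ₗ coSevenRight gr θ B) := by
  have hθ := H.comul_hasDeg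
  have h := H.internal
  have hB : HasDeg gr gr (-1) B := H.op_mem
  have oB : ∀ {n : ℤ} {φ : Dual k V}, φ ∈ dualGr gr n → oddDual gr B φ ∈ dualGr gr (n - 1) :=
    fun hφ => oddDual_hasDeg h hB _ _ hφ
  have hab := dualMul_mem h hθ ha hb rfl
  have hbc := dualMul_mem h hθ hb hc rfl
  have hac := dualMul_mem h hθ ha hc rfl
  have c0 : oddDual gr B (dualMul gr θ (dualMul gr θ a b) c) =
      ksign k ((i : ZMod 2) + j + l + i * j + i * l + j * l) • (ten a (ten b c) ∘ₗ coSevenLeft θ B) := by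
    rw [oddDual_of_mem h (dualMul_mem h hθ hab hc rfl), dualMul_dualMul H ha hb hc]
    refine LinearMap.ext fun x => ?_
    simp only [LinearMap.smul_apply, comp_apply, ksign_smul_smul, coSevenLeft]
    refine ksign_congr ?_ _; push_cast; clear * -; grind
  have c1 : dualMul gr θ (oddDual gr B (dualMul gr θ a b)) c =
      ksign k ((i : ZMod 2) + j + l + i * j + i * l + j * l) • (ten a (ten b c) ∘ₗ
        (assoc k V V V).1 ∘ₗ map (θ ∘ₗ B) .id ∘ₗ θ) := by
    rw [dualMul_of_mem h (oB hab) hc, oddDual_of_mem h hab, dualMul_of_mem h ha hb]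
    simp only [smul_comp, ten_smul_left]
    rw [← comp_assoc _ _ (ten a (ten b c)), ten_assoc, ← comp_assoc, ten_comp_map, comp_id, comp_assoc]
    refine LinearMap.ext fun x => ?_
    simp only [LinearMap.smul_apply, comp_apply, ksign_smul_smul]
    refine ksign_congr ?_ _; push_cast; clear * -; grind
  have c2 : ∀ {i j l : ℤ} {a b c : Dual k V}, a ∈ dualGr gr i → b ∈ dualGr gr j → c ∈ dualGr gr l →
      ksign k (i : ZMod 2) • dualMul gr θ a (oddDual gr B (dualMul gr θ b c)) =
      ksign k ((i : ZMod 2) + j + l + i * j + i * l + j * l) • (ten a (ten b c) ∘ₗ map (sg gr 1) (θ ∘ₗ B) ∘ₗ θ) := by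
    intro i j l a b c ha hb hc
    have hbc := dualMul_mem h hθ hb hc rfl
    rw [dualMul_of_mem h ha (oB hbc), oddDual_of_mem h hbc, dualMul_of_mem h hb hc]
    simp only [smul_comp, ten_smul_right]
    rw [← comp_assoc θ, ten_comp_map, dual_comp_sg h ha, ten_smul_left, comp_assoc]
    refine LinearMap.ext fun x => ?_
    simp only [LinearMap.smul_apply, comp_apply, ksign_smul_smul]
    refine ksign_congr ?_ _; push_cast; clear * -; grind
  have c3 : ksign k (((i - 1) * j : ℤ) : ZMod 2) • dualMul gr θ b (oddDual gr B (dualMul gr θ a c)) =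
      ksign k ((i : ZMod 2) + j + l + i * j + i * l + j * l) • (ten a (ten b c) ∘ₗ (assoc k V V V).1 ∘ₗ
        map (kswap gr gr) .id ∘ₗ
        (assoc k V V V).symm.1 ∘ₗ
        map (sg gr 1) (θ ∘ₗ B) ∘ₗ θ) := by
    have e : ten a (ten b c) ∘ₗ (assoc k V V V).1 ∘ₗ map (kswap gr gr) .id =
        ksign k ((i : ZMod 2) * j) • (ten b (ten a c) ∘ₗ (assoc k V V V).1) := by
      rw [← comp_assoc, ten_assoc, ten_comp_map, ten_kswap h h ha hb, ten_smul_left, ten_assoc, comp_id]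
    have e2 := c2 hb ha hc
    have e3 : dualMul gr θ b (oddDual gr B (dualMul gr θ a c)) = ksign k (j : ZMod 2) •
      ksign k (j : ZMod 2) • dualMul gr θ b (oddDual gr B (dualMul gr θ a c)) :=
      LinearMap.ext fun x => by rw [LinearMap.smul_apply, LinearMap.smul_apply, ksign_smul_self]
    rw [e3, e2]
    refine LinearMap.ext fun x => ?_
    have e4 := fun t => congr_fun e ((assoc k V V V).symm t)
    simp only [LinearMap.smul_apply, comp_apply, LinearEquiv.coe_coe, LinearEquiv.apply_symm_apply] at e4
    simp only [LinearMap.smul_apply, comp_apply, LinearEquiv.coe_coe, e4, ksign_smul_smul]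
    refine ksign_congr ?_ _; push_cast; clear * -; grind
  have c4 : dualMul gr θ (dualMul gr θ (oddDual gr B a) b) c +
      ksign k (i : ZMod 2) • dualMul gr θ (dualMul gr θ a (oddDual gr B b)) c +
      ksign k ((i + j : ℤ) : ZMod 2) • dualMul gr θ (dualMul gr θ a b) (oddDual gr B c) =
      ksign k ((i : ZMod 2) + j + l + i * j + i * l + j * l) • (ten a (ten b c) ∘ₗ
        tensorOdd gr B (tensorOdd gr B B) ∘ₗ map .id θ ∘ₗ θ) := by
    rw [← comp_assoc, ten_comp_tensorOdd h ha, ten_comp_tensorOdd h hb,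
      dualMul_dualMul H (oB ha) hb hc, dualMul_dualMul H ha (oB hb) hc, dualMul_dualMul H ha hb (oB hc),
      oddDual_of_mem h ha, oddDual_of_mem h hb, oddDual_of_mem h hc, ten_smul_left, ten_smul_left,
      ten_smul_right, ten_smul_right]
    rw [ten_add_right, ten_smul_right, ten_smul_right]
    refine LinearMap.ext fun x => ?_
    simp only [LinearMap.smul_apply, LinearMap.add_apply, comp_apply, smul_add, ksign_smul_smul, add_assoc]
    refine congrArg₂ (· + ·) (ksign_congr ?_ _) (congrArg₂ (· + ·) (ksign_congr ?_ _) (ksign_congr ?_ _)) <;>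
      push_cast <;> clear * - <;> grind
  rw [c0, c1, c2 ha hb hc, c3, sub_sub, sub_sub, ← add_assoc, c4, coSevenRight, comp_sub,
    comp_add, comp_add, smul_sub, smul_sub, smul_add, smul_add]

end DualBV

section CycleInduction

variable {k : Type u} [CommRing k]
variable {V : Type v} [AddCommGroup V] [Module k V] {gr : ℤ → Submodule k V} {D : V →ₗ[k] V}
variable {X : Type x} [AddCommGroup X] [Module k X] {P : ℤ → V →ₗ[k] V}

lemma cyc_induction (hP : HasProj gr P) (hD : HasDeg gr gr 1 D) {N : Submodule k V}
    (h : ∀ i, ∀ z ∈ gr i, D z = 0 → z ∈ N) {z : V} (hz : z ∈ cyc gr D) : z ∈ N := by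
  have : (⨆ i, (gr i).submoduleOf (cyc gr D)) ≤ N.comap (cyc gr D).subtype := iSup_le fun i z hz => h i z hz z.2.1
  exact this (cyc_le_iSup hP hD ⟨z, hz⟩)

lemma cyc_induction₂ (hP : HasProj gr P) (hD : HasDeg gr gr 1 D) (M : V →ₗ[k] V →ₗ[k] X)
    {N : Submodule k X} (h : ∀ i j, ∀ z ∈ gr i, ∀ z' ∈ gr j, D z = 0 → D z' = 0 → M z z' ∈ N) {z z' : V}
    (hz : z ∈ cyc gr D) (hz' : z' ∈ cyc gr D) : M z z' ∈ N := by
  refine cyc_induction hP hD (N := N.comap (M.flip z')) (fun i z hzi hz0 => ?_) hz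
  exact cyc_induction hP hD (N := N.comap (M z)) (fun j z' hzj hz0' => h i j z hzi z' hzj hz0 hz0') hz'

end CycleInduction

section DualBV

variable {k : Type u} [CommRing k]
variable {V : Type v} [AddCommGroup V] [Module k V] {gr : ℤ → Submodule k V} {D B : V →ₗ[k] V}
variable {θ : V →ₗ[k] V ⊗[k] V}

lemma oddDual_oddDual {D D' : V →ₗ[k] V} (h : IsInternal gr) {d e : ℤ} (hD : HasDeg gr gr d D) (he : (d : ZMod 2) = e)
    (hD' : HasDeg gr gr e D') (hDD : D' ∘ₗ D + D ∘ₗ D' = 0) {φ : Dual k V} (hφ : φ ∈ ⨆ i, dualGr gr i) :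
    oddDual gr D (oddDual gr D' φ) = -oddDual gr D' (oddDual gr D φ) := by
  have : (⨆ i, dualGr gr i) ≤ eqLocus (oddDual gr D ∘ₗ oddDual gr D')
      (-(oddDual gr D' ∘ₗ oddDual gr D)) := iSup_le fun i φ hφ => by
    change oddDual gr D (oddDual gr D' φ) = -oddDual gr D' (oddDual gr D φ)
    rw [oddDual_of_mem h (oddDual_hasDeg h hD' i φ hφ), oddDual_of_mem h (oddDual_hasDeg h hD i φ hφ),
      oddDual_of_mem h hφ, oddDual_of_mem h hφ]
    refine LinearMap.ext fun x => ?_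
    have e1 : D' (D x) = -D (D' x) := eq_neg_of_add_eq_zero_left (congr_fun hDD x)
    simp only [LinearMap.smul_apply, LinearMap.neg_apply, comp_apply, e1, map_neg, smul_neg]
    push_cast; rw [he]
  exact this hφ

/-- The homology of the dual of a homotopy coBV-algebra is a BV-algebra. -/
lemma IsHomotopyCoBV.exists_dual_isBV (H : IsHomotopyCoBV gr D θ B) :
    ∃ (mulH : Homology (dualGr gr) (oddDual gr D) →ₗ[k] Homology (dualGr gr) (oddDual gr D) →ₗ[k]
        Homology (dualGr gr) (oddDual gr D))
      (ΔH : Homology (dualGr gr) (oddDual gr D) →ₗ[k] Homology (dualGr gr) (oddDual gr D)),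
      InducesMul (dualGr gr) (oddDual gr D) (fun φ ψ => dualMul gr θ φ ψ) mulH ∧
      Induces (dualGr gr) (oddDual gr D) (dualGr gr) (oddDual gr D) (oddDual gr B) ΔH ∧
      IsBV (homologyGr (dualGr gr) (oddDual gr D)) mulH ΔH := by
  have h := H.internal
  have hθ := H.comul_hasDeg
  have hD : HasDeg gr gr 1 D := H.diff_mem
  have hB : HasDeg gr gr (-1) B := H.op_mem
  have hP := hasProj_dual h
  have hd := oddDual_hasDeg h hD
  have hΔ := oddDual_hasDeg h hB
  have hle : ∀ {i : ℤ} {φ : Dual k V}, φ ∈ dualGr gr i → φ ∈ ⨆ i, dualGr gr i := fun hφ => mem_iSup_of_mem _ hφ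
  have hder : ∀ {i j : ℤ} {φ ψ : Dual k V}, φ ∈ dualGr gr i → ψ ∈ dualGr gr j →
      oddDual gr D (dualMul gr θ φ ψ) = dualMul gr θ (oddDual gr D φ) ψ +
        ksign k (i : ZMod 2) • dualMul gr θ φ (oddDual gr D ψ) :=
    fun hφ hψ => oddDual_dualMul h hθ hD H.comul_diff hφ hψ
  have hmc : ∀ z ∈ cyc (dualGr gr) (oddDual gr D), ∀ z' ∈ cyc (dualGr gr) (oddDual gr D),
      dualMul gr θ z z' ∈ cyc (dualGr gr) (oddDual gr D) := fun z hz z' hz' =>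
    cyc_induction₂ hP hd (dualMul gr θ) (N := cyc (dualGr gr) (oddDual gr D)) (fun i j z hz z' hz' hz0 hz0' =>
      ⟨mem_ker.2 (by rw [hder hz hz', hz0, hz0']; simp), hle (dualMul_mem h hθ hz hz' rfl)⟩) hz hz'
  have hml : ∀ z ∈ bdry (dualGr gr) (oddDual gr D), ∀ z' ∈ cyc (dualGr gr) (oddDual gr D),
      dualMul gr θ z z' ∈ bdry (dualGr gr) (oddDual gr D) := by
    rintro _ ⟨y, hy, rfl⟩ z' hz'
    have : (⨆ i, dualGr gr i) ≤ (bdry (dualGr gr) (oddDual gr D)).comap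
        ((dualMul gr θ).flip z' ∘ₗ oddDual gr D) := iSup_le fun i y hy =>
      cyc_induction hP hd (N := (bdry (dualGr gr) (oddDual gr D)).comap (dualMul gr θ (oddDual gr D y)))
        (fun j z' hz' hz0 => ⟨dualMul gr θ y z', hle (dualMul_mem h hθ hy hz' rfl), by
          rw [hder hy hz', hz0]; simp⟩) hz'
    exact this hy
  have hmr : ∀ z ∈ cyc (dualGr gr) (oddDual gr D), ∀ z' ∈ bdry (dualGr gr) (oddDual gr D),
      dualMul gr θ z z' ∈ bdry (dualGr gr) (oddDual gr D) := by
    rintro z hz _ ⟨y, hy, rfl⟩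
    have : (⨆ i, dualGr gr i) ≤ (bdry (dualGr gr) (oddDual gr D)).comap
        (dualMul gr θ z ∘ₗ oddDual gr D) := iSup_le fun i y hy =>
      cyc_induction hP hd (N := (bdry (dualGr gr) (oddDual gr D)).comap ((dualMul gr θ).flip (oddDual gr D y)))
        (fun j z hz hz0 => ⟨ksign k (j : ZMod 2) • dualMul gr θ z y,
          smul_mem _ _ (hle (dualMul_mem h hθ hz hy rfl)), by
          rw [map_smul, hder hz hy, hz0]
          refine LinearMap.ext fun x => ?_
          simp [ksign_smul_self, ← mul_assoc, ksign_mul_self]⟩) hz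
    exact this hy
  have hanti : ∀ {φ : Dual k V}, φ ∈ ⨆ i, dualGr gr i →
      oddDual gr D (oddDual gr B φ) = -oddDual gr B (oddDual gr D φ) :=
    oddDual_oddDual h hD (by decide) hB H.op_diff
  have hBc : ∀ z ∈ cyc (dualGr gr) (oddDual gr D), oddDual gr B z ∈ cyc (dualGr gr) (oddDual gr D) :=
    fun z hz => ⟨mem_ker.2 (by
      rw [hanti hz.2, show oddDual gr D z = 0 from hz.1, map_zero, neg_zero]), hΔ.mem_iSup hz.2⟩
  have hBb : ∀ z ∈ bdry (dualGr gr) (oddDual gr D), oddDual gr B z ∈ bdry (dualGr gr) (oddDual gr D) := by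
    rintro _ ⟨y, hy, rfl⟩
    exact ⟨-oddDual gr B y, neg_mem (hΔ.mem_iSup hy), by rw [map_neg, hanti hy, neg_neg]⟩
  obtain ⟨mulH, hmul⟩ := exists_inducesMul (dualMul gr θ) hmc hml hmr
  have hop := homMap_cls (oddDual gr B) hBc hBb
  refine ⟨mulH, homMap (oddDual gr B) hBc hBb, fun z z' => ⟨hmc z z.2 z' z'.2, hmul z z'⟩,
    fun z => ⟨hBc z z.2, hop z⟩, ?_⟩
  set ΔH := homMap (oddDual gr B) hBc hBb
  clear_value ΔH
  refine ⟨homologyGr_internal hP hd, ?_, ?_, ?_, ?_, ?_, ?_⟩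
  · rintro i j _ ⟨a, ha, rfl⟩ _ ⟨b, hb, rfl⟩
    rw [hmul]
    exact cls_mem (dualMul_mem h hθ ha hb rfl)
  · intro a b c
    obtain ⟨a, rfl⟩ := cls_surjective a
    obtain ⟨b, rfl⟩ := cls_surjective b
    obtain ⟨c, rfl⟩ := cls_surjective c
    rw [hmul, hmul, hmul, hmul]
    congr 1; ext1
    have : dualMul gr θ (dualMul gr θ a b) c - dualMul gr θ a (dualMul gr θ b c) ∈ (⊥ : Submodule k (Dual k V)) := by
      refine cyc_induction hP hd (N := Submodule.comap
        ((dualMul gr θ).flip c ∘ₗ (dualMul gr θ).flip b - (dualMul gr θ).flip (dualMul gr θ b c)) ⊥)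
        (fun i a ha _ => ?_) a.2
      refine cyc_induction hP hd (N := Submodule.comap
        ((dualMul gr θ).flip c ∘ₗ dualMul gr θ a - dualMul gr θ a ∘ₗ (dualMul gr θ).flip c) ⊥)
        (fun j b hb _ => ?_) b.2
      refine cyc_induction hP hd (N := Submodule.comap
        (dualMul gr θ (dualMul gr θ a b) - dualMul gr θ a ∘ₗ dualMul gr θ b) ⊥)
        (fun l c hc _ => ?_) c.2
      exact sub_eq_zero.2 (dualMul_assoc H ha hb hc)
    exact sub_eq_zero.1 this
  · rintro i j _ ⟨a, ha, rfl⟩ _ ⟨b, hb, rfl⟩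
    rw [hmul, hmul, ← map_smul, cls_eq]
    obtain ⟨y, hy, e⟩ := dualMul_comm H ha hb a.2.1 b.2.1
    exact ⟨y, hle hy, e.symm⟩
  · rintro i _ ⟨a, ha, rfl⟩
    rw [hop]
    exact cls_mem (hΔ i a ha)
  · intro a
    obtain ⟨a, rfl⟩ := cls_surjective a
    rw [hop, hop, cls_eq_zero]
    have h0 : oddDual gr B (oddDual gr B a) = 0 := by
      have : (⨆ i, dualGr gr i) ≤ ker (oddDual gr B ∘ₗ oddDual gr B) := iSup_le fun i φ hφ => by
        rw [mem_ker, comp_apply, oddDual_of_mem h (hΔ i φ hφ), oddDual_of_mem h hφ,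
          smul_comp, comp_assoc, H.op_op, comp_zero, smul_zero, smul_zero]
      exact this a.2.2
    change oddDual gr B (oddDual gr B a) ∈ _
    rw [h0]; exact zero_mem _
  · rintro i j l _ ⟨a, ha, rfl⟩ _ ⟨b, hb, rfl⟩ _ ⟨c, hc, rfl⟩
    simp only [hmul, hop, ← map_smul, ← map_add, ← map_sub]
    rw [cls_eq]
    have e := dual_seven H ha hb hc
    have za := comp_eq_zero_of_oddDual h ha a.2.1
    have zb := comp_eq_zero_of_oddDual h hb b.2.1
    have zc := comp_eq_zero_of_oddDual h hc c.2.1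
    obtain ⟨y, hy, e2⟩ := comp_chainHomotopic h (ten_mem ha (ten_mem hb hc rfl) rfl)
      (ten_comp_tensorOdd_eq_zero h ha za (ten_comp_tensorOdd_eq_zero h hb zb zc)) H.seven_term
    rw [e2] at e
    exact ⟨_, smul_mem _ _ (hle hy), (map_smul _ _ _).trans e.symm⟩

end DualBV

section Rescale

variable {k : Type u} [CommRing k]
variable {V : Type v} [AddCommGroup V] [Module k V] {gr : ℤ → Submodule k V} {D B : V →ₗ[k] V}
variable {θ : V →ₗ[k] V ⊗[k] V}

lemma coSevenLeft_smul {c : k} (hc : c * c = 1) : coSevenLeft (c • θ) B = coSevenLeft θ B := by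
  refine LinearMap.ext fun x => ?_
  simp only [coSevenLeft, comp_apply, map_smul_right, LinearMap.smul_apply, map_smul, smul_smul, hc, one_smul]

lemma coSevenRight_smul {c : k} (hc : c * c = 1) : coSevenRight gr (c • θ) B = coSevenRight gr θ B := by
  refine LinearMap.ext fun x => ?_
  simp only [coSevenRight, LinearMap.add_apply, LinearMap.sub_apply, comp_apply,
    map_smul_right, map_smul_left, LinearMap.smul_apply, map_smul, smul_comp,
    smul_smul, hc, one_smul]

lemma IsHomotopyCoBV.smul (H : IsHomotopyCoBV gr D θ B) {c : k} (hc : c * c = 1) : IsHomotopyCoBV gr D (c • θ) B where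
  internal := H.internal
  diff_mem := H.diff_mem
  diff_diff := H.diff_diff
  comul_mem i a ha := smul_mem _ c (H.comul_mem i a ha)
  comul_diff := by rw [smul_comp, H.comul_diff, comp_smul]
  coassoc := by
    refine LinearMap.ext fun x => ?_
    have := congr_fun H.coassoc x
    simp only [comp_apply] at this
    simp only [comp_apply, map_smul_right, map_smul_left, LinearMap.smul_apply, map_smul, this]
  op_mem := H.op_mem
  op_op := H.op_op
  op_diff := H.op_diff
  cocomm := by
    obtain ⟨K, hK, e⟩ := H.cocomm
    refine ⟨c • K, fun i v hv => smul_mem _ c (hK i v hv), ?_⟩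
    refine LinearMap.ext fun x => ?_
    have := congrArg (fun y => c • y) (congr_fun e x)
    simp only [LinearMap.sub_apply, LinearMap.add_apply, LinearMap.smul_apply, comp_apply, smul_sub,
      smul_add, smul_comm c] at this
    simpa only [LinearMap.sub_apply, LinearMap.add_apply, LinearMap.smul_apply, comp_apply, map_smul] using this
  seven_term := by
    rw [coSevenLeft_smul hc, coSevenRight_smul hc]
    exact H.seven_term

lemma map_sg_comp_ksgn (h : IsInternal gr) (m : ℤ) : map .id (sg gr (m : ZMod 2)) ∘ₗ ksgn gr gr =
      ksign k (m : ZMod 2) • (ksgn (shiftGr m gr) (shiftGr m gr) ∘ₗ map (sg gr (m : ZMod 2)) .id) :=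
  tensor_homog_ext h h fun p q v hv w hw => by
    have hv' : v ∈ shiftGr m gr (p - m) := by rw [shiftGr, sub_add_cancel]; exact hv
    have hw' : w ∈ shiftGr m gr (q - m) := by rw [shiftGr, sub_add_cancel]; exact hw
    have h' := shiftGr_internal h m
    rw [LinearMap.smul_apply, comp_apply, comp_apply, ksgn_of_mem h h hv hw, map_smul,
      map_tmul, map_tmul, sg_of_mem h _ hv, sg_of_mem h _ hw,
      tmul_smul, ← smul_tmul', map_smul, id_apply, id_apply,
      ksgn_of_mem h' h' hv' hw', ksign_smul_smul, ksign_smul_smul, ksign_smul_smul]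
    refine ksign_congr ?_ _; push_cast; clear * -; grind [icast_sq]

end Rescale

namespace DGAug

variable {k : Type u} {A : Type v} [CommRing k] [Ring A] [Algebra k A] {S : DGAug k A}

lemma odot_eq_dualMul {m : ℤ} (δ : A →ₗ[k] A ⊗[k] A) (f g : Dual k S.C) :
    S.odot m δ f g = dualMul (S.cgrShift m) (ksign k (m : ZMod 2) • S.thetaShift m δ) f g := by
  have e1 : map f (g ∘ₗ sg S.cgr (m : ZMod 2)) = map f g ∘ₗ map .id (sg S.cgr (m : ZMod 2)) := by
    rw [← map_comp, comp_id]
  refine LinearMap.ext fun x => ?_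
  have e2 := congr_fun (map_sg_comp_ksgn S.cgr_internal m) (S.theta δ x)
  simp only [comp_apply, LinearMap.smul_apply] at e2
  change mul' k k (map f (g ∘ₗ sg S.cgr (m : ZMod 2)) (ksgn S.cgr S.cgr (S.theta δ x))) =
    mul' k k (map f g (ksgn (S.cgrShift m) (S.cgrShift m)
      (ksign k (m : ZMod 2) • map (sg S.cgr (m : ZMod 2)) .id (S.theta δ x))))
  rw [e1, comp_apply, e2, map_smul (ksgn (S.cgrShift m) (S.cgrShift m))]; rfl

lemma exists_isCoBV_homology {m : ℤ} {δ : A →ₗ[k] A ⊗[k] A} (h : S.IsOpenFrobenius m δ)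
    (hs : S.IsSymmetric m δ) (hK : IsField k ∨ KunnethIso (S.cgrShift m) S.D) :
    ∃ (θH : Homology (S.cgrShift m) S.D →ₗ[k]
          TensorProduct k (Homology (S.cgrShift m) S.D) (Homology (S.cgrShift m) S.D))
      (BH : Homology (S.cgrShift m) S.D →ₗ[k] Homology (S.cgrShift m) S.D),
      InducesComul (S.cgrShift m) S.D (S.thetaShift m δ) θH ∧
      Induces (S.cgrShift m) S.D (S.cgrShift m) S.D S.B BH ∧
      IsCoBV (homologyGr (S.cgrShift m) S.D) θH BH := by
  have H := isHomotopyCoBV_thetaShift h hs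
  exact H.exists_isCoBV (hK.elim (fun hk => kunnethIso_of_isField hk H.internal H.diff_mem H.diff_diff) id)

lemma exists_isBV_dual {m : ℤ} {δ : A →ₗ[k] A ⊗[k] A} (h : S.IsOpenFrobenius m δ) (hs : S.IsSymmetric m δ) :
    ∃ (mulH : Homology (S.dgr m) (S.DDual m) →ₗ[k] Homology (S.dgr m) (S.DDual m) →ₗ[k] Homology (S.dgr m) (S.DDual m))
      (ΔH : Homology (S.dgr m) (S.DDual m) →ₗ[k] Homology (S.dgr m) (S.DDual m)),
      InducesMul (S.dgr m) (S.DDual m) (S.odot m δ) mulH ∧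
      Induces (S.dgr m) (S.DDual m) (S.dgr m) (S.DDual m) (S.BDual m) ΔH ∧
      IsBV (homologyGr (S.dgr m) (S.DDual m)) mulH ΔH := by
  obtain ⟨mulH, ΔH, h1, h2, h3⟩ :=
    ((isHomotopyCoBV_thetaShift h hs).smul (ksign_mul_self (k := k) (m : ZMod 2))).exists_dual_isBV
  refine ⟨mulH, ΔH, fun z z' => ?_, h2, h3⟩
  obtain ⟨h4, h5⟩ := h1 z z'
  have e := odot_eq_dualMul (m := m) δ (z : Dual k S.C) z'
  rw [e]
  exact ⟨h4, h5⟩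

variable {m : ℤ} {form : A →ₗ[k] A →ₗ[k] k} {δ : A →ₗ[k] A ⊗[k] A}
variable {X : Type w} [AddCommGroup X] [Module k X]

namespace IsClosedFrobenius

variable (h : S.IsClosedFrobenius m form)
include h

lemma flip_mem {p n : ℤ} {a : A} (ha : a ∈ S.gr p) (hn : n = p - m) : form.flip a ∈ dualGr S.gr n :=
  fun j hj v hv => h.degree j p (by omega) v hv a ha

lemma form_mem {p n : ℤ} {a : A} (ha : a ∈ S.gr p) (hn : n = p - m) : form a ∈ dualGr S.gr n :=
  fun j hj v hv => h.degree p j (by omega) a ha v hv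

lemma form_eq_flip {p : ℤ} {a : A} (ha : a ∈ S.gr p) : form a = ksign k ((p : ZMod 2) * (m + 1)) • form.flip a :=
  homog_ext S.internal fun j v hv => by
    by_cases hj : j = m - p
    · subst hj
      rw [h.symmetric _ _ a ha v hv, LinearMap.smul_apply, flip_apply, smul_eq_mul]
      congr 2; push_cast; clear * -; grind [icast_sq]
    · rw [dual_apply (h.form_mem ha rfl) hv (by omega), LinearMap.smul_apply,
        dual_apply (h.flip_mem ha rfl) hv (by omega), smul_zero]

lemma form_eq_flip_sg (a : A) : form a = form.flip (sg S.gr ((m : ZMod 2) + 1) a) :=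
  LinearMap.congr_fun (f := form) (g := form.flip ∘ₗ sg S.gr ((m : ZMod 2) + 1)) (homog_ext S.internal fun p a ha => by
      rw [h.form_eq_flip ha, comp_apply, sg_of_mem S.internal _ ha, map_smul]) a

lemma flip_bijective : Function.Bijective form.flip := by
  have e : form.flip = form ∘ₗ sg S.gr ((m : ZMod 2) + 1) := LinearMap.ext fun a => by
    rw [comp_apply, h.form_eq_flip_sg, sg_sg S.internal]
  have hs : Function.Involutive (sg S.gr ((m : ZMod 2) + 1)) := sg_sg S.internal _
  rw [e]
  exact h.perfect.comp hs.bijective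

lemma exists_dual_basis : ∃ (n : ℕ) (e f : Fin n → A), (∀ x, ∑ i, form x (f i) • e i = x) ∧
    ∀ a, ∑ i, form (e i) a • f i = a := by
  have := h.finite
  have := h.projective
  obtain ⟨n, g, s, -, -, hgs⟩ := Module.Finite.exists_comp_eq_id_of_projective k A
  choose f hf using fun i : Fin n => h.flip_bijective.2 (proj i ∘ₗ s)
  have h1 : ∀ x, ∑ i, form x (f i) • g (Pi.single i 1) = x := fun x => by
    have e1 : ∀ i, form x (f i) = s x i := fun i => congr_fun (hf i) x
    have e2 : s x = ∑ i, s x i • (Pi.single i 1 : Fin n → k) := by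
      ext j; simp [Finset.sum_apply, Pi.single_apply]
    have e3 := congr_fun hgs x
    rw [comp_apply, e2, map_sum] at e3
    simp only [e1]
    simpa only [map_smul, id_apply] using e3
  refine ⟨n, fun i => g (Pi.single i 1), f, h1, fun a => h.flip_bijective.1 (LinearMap.ext fun x => ?_)⟩
  rw [flip_apply, flip_apply, map_sum]
  conv_rhs => rw [← h1 x]
  simp [mul_comm]

lemma eq_zero_of_flip {x : A} (hx : ∀ p, ∀ a ∈ S.gr p, form.flip a x = 0) : x = 0 :=
  h.perfect.1 (by rw [map_zero]; exact homog_ext S.internal hx)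

/-- A family of functionals separating the points of `Y` yields one for `A ⊗ Y`. -/
lemma tensor_eq_zero {Y : Type w} [AddCommGroup Y] [Module k Y] {Φ : Set (Dual k Y)}
    (hΦ : ∀ y, (∀ ψ ∈ Φ, ψ y = 0) → y = 0) {t : A ⊗[k] Y}
    (ht : ∀ p, ∀ a ∈ S.gr p, ∀ ψ ∈ Φ, ten (form.flip a) ψ t = 0) : t = 0 := by
  obtain ⟨n, e, e', he, -⟩ := h.exists_dual_basis
  let con : A → A ⊗[k] Y →ₗ[k] Y := fun a => lid k Y ∘ₗ map (form.flip a) .id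
  have hcon : ∀ a x y, con a (x ⊗ₜ y) = form x a • y := fun a x y => by
    change lid k Y (map (form.flip a) .id (x ⊗ₜ[k] y)) = _
    rw [map_tmul, TensorProduct.lid_tmul]; rfl
  have h1 : ∀ t : A ⊗[k] Y, ∑ i, e i ⊗ₜ[k] con (e' i) t = t := fun t => by
    induction t with
    | zero => simp
    | add x y hx hy =>
      simp only [map_add, tmul_add, Finset.sum_add_distrib]
      rw [hx, hy]
    | tmul x y =>
      conv_rhs => rw [← he x, sum_tmul]
      refine Finset.sum_congr rfl fun i _ => ?_
      rw [hcon, tmul_smul, smul_tmul']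
  have h2 : ∀ a ψ, ψ ∘ₗ con a = ten (form.flip a) ψ := fun a ψ => ext' fun x y => by
    rw [comp_apply, hcon, map_smul, ten_tmul]; rfl
  have h3 : ∀ a, con a t = 0 := fun a => hΦ _ fun ψ hψ => by
    rw [← comp_apply, h2]
    refine homog_induction S.internal a (fun p a ha => ht p a ha ψ hψ) ?_ fun a b ha hb => ?_
    · rw [map_zero, ten, map_zero_left]; simp
    · rw [map_add, ten_add_left, LinearMap.add_apply, ha, hb, add_zero]
  rw [← h1 t]
  exact Finset.sum_eq_zero fun i _ => by rw [h3, tmul_zero]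

lemma tensor_ext {f g : X →ₗ[k] A ⊗[k] A} (hfg : ∀ p q, ∀ a ∈ S.gr p, ∀ b ∈ S.gr q,
    ten (form.flip b) (form.flip a) ∘ₗ f = ten (form.flip b) (form.flip a) ∘ₗ g) : f = g := by
  refine LinearMap.ext fun x => sub_eq_zero.1 (h.tensor_eq_zero
    (Φ := {ψ | ∃ p, ∃ a ∈ S.gr p, ψ = form.flip a}) (fun y hy => h.eq_zero_of_flip fun p a ha => hy _ ⟨p, a, ha, rfl⟩) ?_)
  rintro q b hb _ ⟨p, a, ha, rfl⟩
  rw [map_sub, sub_eq_zero]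
  exact congr_fun (hfg p q a ha b hb) x

lemma tensor_ext₃ {f g : X →ₗ[k] A ⊗[k] (A ⊗[k] A)} (hfg : ∀ p q r, ∀ a ∈ S.gr p, ∀ b ∈ S.gr q, ∀ c ∈ S.gr r,
    ten (form.flip c) (ten (form.flip b) (form.flip a)) ∘ₗ f =
      ten (form.flip c) (ten (form.flip b) (form.flip a)) ∘ₗ g) : f = g := by
  refine LinearMap.ext fun x => sub_eq_zero.1 (h.tensor_eq_zero
    (Φ := {χ | ∃ q, ∃ b ∈ S.gr q, ∃ p, ∃ a ∈ S.gr p, χ = ten (form.flip b) (form.flip a)}) (fun y hy =>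
      h.tensor_eq_zero (Φ := {ψ | ∃ p, ∃ a ∈ S.gr p, ψ = form.flip a})
        (fun y hy => h.eq_zero_of_flip fun p a ha => hy _ ⟨p, a, ha, rfl⟩) fun q b hb ψ ⟨p, a, ha, e⟩ =>
          hy _ ⟨q, b, hb, p, a, ha, by rw [e]⟩) ?_)
  rintro r c hc _ ⟨q, b, hb, p, a, ha, rfl⟩
  rw [map_sub, sub_eq_zero]
  exact congr_fun (hfg p q r a ha b hb c hc) x

lemma isDualCoproduct_iff : S.IsDualCoproduct m form δ ↔ ∀ p q, ∀ a ∈ S.gr p, ∀ b ∈ S.gr q,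
    ten (form.flip b) (form.flip a) ∘ₗ δ = ksign k ((m : ZMod 2) * (1 + q)) • form.flip (a * b) := by
  have key : ∀ q, ∀ b ∈ S.gr q, ∀ a x, mul' k k (map (form.flip b ∘ₗ sg S.gr (m : ZMod 2)) (form.flip a) (δ x)) =
      ksign k ((m : ZMod 2) * (1 + q)) • ten (form.flip b) (form.flip a) (δ x) := fun q b hb a x => by
    rw [dual_comp_sg S.internal (h.flip_mem hb rfl), map_smul_left, LinearMap.smul_apply, map_smul]
    refine ksign_congr ?_ _; push_cast; clear * -; grind [icast_sq]
  constructor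
  · intro H p q a ha b hb
    refine LinearMap.ext fun x => ?_
    have := H x a b
    rw [key q b hb] at this
    rw [LinearMap.smul_apply, flip_apply, this, ksign_smul_self]; rfl
  · intro H x a b
    induction b using homog_induction S.internal with
    | h0 => simp
    | ha b b' e e' =>
      rw [mul_add, map_add, e, e', map_add, add_comp, map_add_left, LinearMap.add_apply, map_add]
    | hg q b hb =>
      induction a using homog_induction S.internal with
      | h0 => simp
      | ha a a' e e' =>
        rw [add_mul, map_add, e, e', map_add, map_add_right, LinearMap.add_apply, map_add]
      | hg p a ha =>
        have := congr_fun (H p q a ha b hb) x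
        rw [comp_apply] at this
        rw [key q b hb, this, LinearMap.smul_apply, ksign_smul_self, flip_apply]

lemma existsUnique_dualCoproduct : ∃! δ : A →ₗ[k] A ⊗[k] A, S.IsDualCoproduct m form δ := by
  obtain ⟨n, e, f, he, hf⟩ := h.exists_dual_basis
  have hex : S.IsDualCoproduct m form (map (sg S.gr (m : ZMod 2)) .id ∘ₗ
      ∑ i, ∑ j, LinearMap.smulRight (form.flip (f i * f j)) (e j ⊗ₜ[k] e i)) := fun x a b => by
    simp only [comp_apply, LinearMap.sum_apply, LinearMap.smulRight_apply, map_sum, map_smul,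
      map_tmul, mul'_apply, sg_sg S.internal, flip_apply, id_apply]
    conv_lhs => rw [← hf a, ← hf b]
    simp only [Finset.sum_mul, Finset.mul_sum, map_sum, smul_mul_smul_comm, map_smul, smul_eq_mul]
    rw [Finset.sum_comm]
    refine Finset.sum_congr rfl fun i _ => Finset.sum_congr rfl fun j _ => ?_
    ring
  exact ⟨_, hex, fun δ hδ => h.tensor_ext fun p q a ha b hb => by
    rw [h.isDualCoproduct_iff.1 hδ p q a ha b hb, h.isDualCoproduct_iff.1 hex p q a ha b hb]⟩

end IsClosedFrobenius

namespace IsClosedFrobenius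

variable (h : S.IsClosedFrobenius m form)
include h

lemma cyclic {i j l : ℤ} {x y z : A} (hx : x ∈ S.gr i) (hy : y ∈ S.gr j) (hz : z ∈ S.gr l) :
    form (x * y) z = ksign k ((i : ZMod 2) * (j + l)) • form y (z * x) := by
  rw [h.invariant, h.symmetric i (j + l) x hx _ (S.mul_mem j l y hy z hz), h.invariant, smul_eq_mul]
  push_cast; rfl

lemma flip_comp_mulLeft {i q : ℤ} {x b : A} (hx : x ∈ S.gr i) (hb : b ∈ S.gr q) :
    form.flip b ∘ₗ mulLeft k x = ksign k ((i : ZMod 2) * (m + 1)) • form.flip (b * x) :=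
  homog_ext S.internal fun j z hz => by
    rw [comp_apply, mulLeft_apply, flip_apply, LinearMap.smul_apply, flip_apply]
    by_cases hj : i + j + q = m
    · rw [h.cyclic hx hz hb]
      refine ksign_congr ?_ _
      rw [← hj]; push_cast; clear * -; grind [icast_sq]
    · rw [h.degree _ _ hj _ (S.mul_mem i j x hx z hz) _ hb,
        h.degree j (q + i) (by omega) z hz _ (S.mul_mem q i b hb x hx), smul_zero]

lemma flip_comp_mulRight (a y : A) : form.flip a ∘ₗ mulRight k y = form.flip (y * a) :=
  LinearMap.ext fun z => h.invariant z y a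

lemma flip_comp_d {q : ℤ} {b : A} (hb : b ∈ S.gr q) :
    form.flip b ∘ₗ S.d = ksign k ((m : ZMod 2) + q) • form.flip (S.d b) :=
  homog_ext S.internal fun j z hz => by
    rw [comp_apply, flip_apply, LinearMap.smul_apply, flip_apply]
    by_cases hj : j + 1 + q = m
    · rw [h.diff j z hz, ← smul_eq_mul, neg_ksign_smul]
      refine ksign_congr ?_ _
      rw [← hj]; push_cast; clear * -; grind
    · rw [h.degree _ _ hj _ (S.d_mem j z hz) _ hb, h.degree j (q + 1) (by omega) z hz _ (S.d_mem q b hb), smul_zero]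

variable (hδ : S.IsDualCoproduct m form δ)
include hδ

lemma ten_flip_comp {p q : ℤ} {a b : A} (ha : a ∈ S.gr p) (hb : b ∈ S.gr q) :
    ten (form.flip b) (form.flip a) ∘ₗ δ = ksign k ((m : ZMod 2) * (1 + q)) • form.flip (a * b) :=
  h.isDualCoproduct_iff.1 hδ p q a ha b hb

lemma ten_flip_apply {p q : ℤ} {a b : A} (ha : a ∈ S.gr p) (hb : b ∈ S.gr q) (x : A) :
    ten (form.flip b) (form.flip a) (δ x) = ksign k ((m : ZMod 2) * (1 + q)) • form x (a * b) :=
  congr_fun (h.ten_flip_comp hδ ha hb) x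

lemma dualCoproduct_mem {i : ℤ} {x : A} (hx : x ∈ S.gr i) : δ x ∈ tensorGr S.gr S.gr (i + m) := by
  have h2 := tensorGr_internal S.internal S.internal
  have e : (.id - prj h2 (i + m)) ∘ₗ δ ∘ₗ (S.gr i).subtype = 0 := by
    refine h.tensor_ext fun p q a ha b hb => LinearMap.ext fun x => ?_
    have hT := ten_mem (h.flip_mem hb rfl) (h.flip_mem ha rfl) rfl
    simp only [comp_apply, LinearMap.sub_apply, id_apply, map_sub, LinearMap.zero_apply,
      map_zero, Submodule.subtype_apply]
    by_cases hi : i + m = -(q - m + (p - m))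
    · have := congr_fun ((hasProj_dual h2).self _ _ hT) (δ x)
      rw [← hi] at this
      exact sub_eq_zero.2 this.symm
    · have := congr_fun ((hasProj_dual h2).other (-(i + m)) _ (by omega) _ hT) (δ x)
      rw [neg_neg] at this
      rw [show (ten (form.flip b) (form.flip a)) (prj h2 (i + m) (δ x)) = 0 from this,
        h.ten_flip_apply hδ ha hb, h.degree i (p + q) (by omega) x x.2 _ (S.mul_mem p q a ha b hb), smul_zero, sub_zero]
  have := congr_fun e ⟨x, hx⟩
  rw [sub_eq_zero.1 (show δ x - prj h2 (i + m) (δ x) = 0 from this)]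
  exact prj_mem _ _ _

/-- A closed Frobenius algebra is an open Frobenius algebra. -/
lemma isOpenFrobenius : S.IsOpenFrobenius m δ where
  comul_mem i a ha := h.dualCoproduct_mem hδ ha
  coassoc := by
    refine h.tensor_ext₃ fun p q r a ha b hb c hc => ?_
    have e1 : ten (form.flip c) (ten (form.flip b) (form.flip a)) ∘ₗ (assoc k A A A).1 ∘ₗ map δ .id ∘ₗ δ =
        ksign k ((m : ZMod 2) * (1 + r)) • ksign k ((m : ZMod 2) * (1 + (q + r : ℤ))) • form.flip (a * b * c) := by
      rw [← comp_assoc, ten_assoc, ← comp_assoc, ten_comp_map, comp_id,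
        h.ten_flip_comp hδ hb hc, ten_smul_left, smul_comp,
        h.ten_flip_comp hδ ha (S.mul_mem q r b hb c hc), mul_assoc a]
    have e2 : ten (form.flip c) (ten (form.flip b) (form.flip a)) ∘ₗ map (sg S.gr (m : ZMod 2)) δ ∘ₗ δ =
        ksign k (((r - m : ℤ) : ZMod 2) * m) • ksign k ((m : ZMod 2) * (1 + q)) •
          ksign k ((m : ZMod 2) * (1 + r)) • form.flip (a * b * c) := by
      rw [← comp_assoc, ten_comp_map, dual_comp_sg S.internal (h.flip_mem hc rfl),
        h.ten_flip_comp hδ ha hb, ten_smul_left, ten_smul_right, smul_comp, smul_comp,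
        h.ten_flip_comp hδ (S.mul_mem p q a ha b hb) hc]
    refine LinearMap.ext fun x => ?_
    have e1 := congr_fun e1 x
    have e2 := congr_fun e2 x
    simp only [LinearMap.smul_apply, ksign_smul_smul] at e1 e2
    refine e1.trans (Eq.trans ?_ (congrArg (fun y => ksign k (m : ZMod 2) • y) e2.symm |>.trans
      (LinearMap.congr_fun (comp_smul _ _ _) x).symm))
    simp only [ksign_smul_smul]
    refine ksign_congr ?_ _; push_cast; clear * -; grind [icast_sq]
  comul_diff := by
    refine h.tensor_ext fun p q a ha b hb => ?_
    have e : ten (form.flip b) (form.flip a) ∘ₗ tensorOdd S.gr S.d S.d =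
        ksign k ((m : ZMod 2) + q) • ten (form.flip (S.d b)) (form.flip a) +
        ksign k ((q : ZMod 2) + p) • ten (form.flip b) (form.flip (S.d a)) := by
      rw [ten_comp_tensorOdd S.internal (h.flip_mem hb rfl), h.flip_comp_d hb, h.flip_comp_d ha, ten_smul_left,
        ten_smul_right]
      refine LinearMap.ext fun t => ?_
      simp only [LinearMap.add_apply, LinearMap.smul_apply, ksign_smul_smul]
      refine congrArg₂ (· + ·) rfl (ksign_congr ?_ _)
      push_cast; clear * -; grind
    refine LinearMap.ext fun x => ?_
    have e2 := congr_fun e (δ x)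
    simp only [comp_apply, LinearMap.add_apply, LinearMap.smul_apply] at e2
    have e3 : form (S.d x) (a * b) = ksign k ((m : ZMod 2) + (p + q)) • form x (S.d (a * b)) := by
      have := congr_fun (h.flip_comp_d (S.mul_mem p q a ha b hb)) x
      push_cast at this
      exact this
    simp only [comp_apply, LinearMap.smul_apply, map_smul]
    rw [e2, h.ten_flip_apply hδ ha hb, h.ten_flip_apply hδ ha (S.d_mem q b hb),
      h.ten_flip_apply hδ (S.d_mem p a ha) hb, e3, S.leibniz p a ha b, map_add, map_smul]
    simp only [smul_add, ksign_smul_smul]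
    rw [add_comm]
    refine congrArg₂ (· + ·) (ksign_congr ?_ _) (ksign_congr ?_ _) <;> push_cast <;> clear * - <;> grind [icast_sq]
  comul_mul_left i x hx y := by
    have e : δ ∘ₗ mulLeft k x = ksign k ((m : ZMod 2) * (i : ZMod 2)) • (map (mulLeft k x) .id ∘ₗ δ) := by
      refine h.tensor_ext fun p q a ha b hb => ?_
      rw [← comp_assoc, h.ten_flip_comp hδ ha hb, smul_comp,
        h.flip_comp_mulLeft hx (S.mul_mem p q a ha b hb), comp_smul, ← comp_assoc, ten_comp_map,
        h.flip_comp_mulLeft hx hb, comp_id, ten_smul_left, smul_comp,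
        h.ten_flip_comp hδ ha (S.mul_mem q i b hb x hx), mul_assoc]
      refine LinearMap.ext fun z => ?_
      simp only [LinearMap.smul_apply, ksign_smul_smul]
      refine ksign_congr ?_ _; push_cast; clear * -; grind [icast_sq]
    exact congr_fun e y
  comul_mul_right x y := by
    have e : δ ∘ₗ mulRight k y = map .id (mulRight k y) ∘ₗ δ := by
      refine h.tensor_ext fun p q a ha b hb => ?_
      rw [← comp_assoc, h.ten_flip_comp hδ ha hb, smul_comp, h.flip_comp_mulRight,
        ← comp_assoc, ten_comp_map, comp_id, h.flip_comp_mulRight]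
      induction y using homog_induction S.internal with
      | hg j y hy => rw [h.ten_flip_comp hδ (S.mul_mem j p y hy a ha) hb, mul_assoc]
      | h0 =>
        simp only [zero_mul, map_zero, smul_zero, ten, map_zero_right, comp_zero, LinearMap.zero_comp]
      | ha y y' e e' => rw [add_mul, add_mul, map_add, map_add, smul_add, ten_add_right, add_comp, e, e']
    exact congr_fun e x

lemma isSymmetric : S.IsSymmetric m δ := by
  have e : δ ∘ₗ Algebra.linearMap k A = (ksign k (m : ZMod 2) • (kswap S.gr S.gr ∘ₗ δ)) ∘ₗ Algebra.linearMap k A := by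
    refine h.tensor_ext fun p q a ha b hb => LinearMap.ext_ring ?_
    have e2 := congr_fun (ten_kswap S.internal S.internal (h.flip_mem hb rfl) (h.flip_mem ha rfl)) (δ 1)
    simp only [comp_apply, LinearMap.smul_apply] at e2
    simp only [comp_apply, LinearMap.smul_apply, map_smul, Algebra.linearMap_apply, map_one, e2]
    rw [h.ten_flip_apply hδ ha hb, h.ten_flip_apply hδ hb ha, ← h.invariant, ← h.invariant, one_mul, one_mul]
    by_cases hpq : p + q = m
    · rw [show form a b = ksign k ((p : ZMod 2) * q) • form b a from h.symmetric p q a ha b hb, ksign_smul_smul, ksign_smul_smul, ksign_smul_smul]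
      refine ksign_congr ?_ _
      rw [← hpq]; push_cast; clear * -; grind [icast_sq]
    · rw [h.degree p q hpq a ha b hb, h.degree q p (by omega) b hb a ha]; simp
  have e1 := congr_fun e 1
  simp only [comp_apply, LinearMap.smul_apply, Algebra.linearMap_apply, map_one] at e1
  exact e1

end IsClosedFrobenius

variable {M : Type w} [AddCommGroup M] [Module k M]

/-! ### Cochains on words -/

lemma coch_mem {i : ℤ} {f : S.T →ₗ[k] A} (hf : f ∈ S.cochGr i) (t : S.Wd) :
    f (word t) ∈ S.gr (wd t + i) := hf _ _ (word_mem t)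

lemma tw_of_mem {i : ℤ} {f : S.T →ₗ[k] A} (hf : f ∈ S.cochGr i) (e : ZMod 2) :
    S.tw e f = ksign k ((i : ZMod 2) * e) • f :=
  word_ext fun t => by
    change sg S.gr e (f (sg S.tgr e (word t))) = _
    rw [sg_of_mem tgr_internal e (word_mem t), map_smul, map_smul, sg_of_mem S.internal e (coch_mem hf t),
      ksign_smul_smul]
    refine ksign_congr ?_ _; push_cast; clear * -; grind

lemma sum_par_tmul {V : Type*} [AddCommGroup V] [Module k V] {gr : ℤ → Submodule k V} (h : IsInternal gr)
    {j : ℤ} {v : V} (hv : v ∈ gr j) (F : ZMod 2 → V → M) (h0 : ∀ e, F e 0 = 0) :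
    ∑ e : ZMod 2, F e (par gr e v) = F j v := by
  rw [Finset.sum_eq_single (j : ZMod 2) (fun e _ he => by rw [par_of_mem gr h _ j v hv, if_neg he.symm, h0])
    (by simp), par_of_mem gr h _ j v hv, if_pos rfl]

lemma DCoch_word {i : ℤ} {f : S.T →ₗ[k] A} (hf : f ∈ S.cochGr i) (t : S.Wd) :
    S.DCoch f (word t) = S.d (f (word t)) + (isg k (i + 1) • f (dl word t) +
      onHead (fun b u => isg k (i * (b.deg - 1) + 1) • ((b.val : A) * f (word u))) t +
      onLast (fun u b => isg k (wd u + i) • (f (word u) * b.val)) t) := by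
  have h1 : (∑ e : ZMod 2, mul' k A ∘ₗ map (S.bar.subtype ∘ₗ par S.sgr e) (S.tw e f) ∘ₗ
      S.popL) (word t) = -onHead (fun b u => isg k (i * (b.deg - 1) + 1) • ((b.val : A) * f (word u))) t := by
    rw [LinearMap.sum_apply]
    refine (Finset.sum_congr rfl fun e _ => (congrArg _ (popL_word t)).trans (map_onHead (M := ↥S.bar ⊗[k] S.T)
      (mul' k A ∘ₗ map (S.bar.subtype ∘ₗ par S.sgr e) (S.tw e f)) _ t)).trans ?_
    rw [← onHead_sum, ← onHead_neg]
    refine onHead_congr _ fun b u _ => ?_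
    simp only [map_tmul, mul'_apply, comp_apply]
    rw [sum_par_tmul S.sgr_internal b.mem_sgr (fun e v => S.bar.subtype v * S.tw e f (word u)) (by simp),
      tw_of_mem hf, neg_isg_smul, LinearMap.smul_apply, mul_smul_comm]
    refine (ksign_congr ?_ _)
    push_cast; clear * -; grind
  have h2 : mul' k A (map (sg S.gr 1 ∘ₗ f) S.bar.subtype (S.popR (word t))) =
      onLast (fun u b => isg k (wd u + i) • (f (word u) * b.val)) t := by
    rw [popR_word, map_onLast, map_onLast]
    refine onLast_congr _ fun u b _ => ?_
    rw [map_tmul, mul'_apply, comp_apply, sg_of_mem S.internal 1 (coch_mem hf u), mul_one, smul_mul_assoc]; rfl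
  change S.d (f (word t)) - S.tw 1 f (S.dT (word t)) - (∑ e : ZMod 2, mul' k A ∘ₗ
    map (S.bar.subtype ∘ₗ par S.sgr e) (S.tw e f) ∘ₗ S.popL) (word t) - S.tw 1 f (S.bT (word t)) +
    mul' k A (map (sg S.gr 1 ∘ₗ f) S.bar.subtype (S.popR (word t))) = _
  have h3 : isg k (i + 1) • f (dl word t) = -(S.tw 1 f (S.dT (word t)) + S.tw 1 f (S.bT (word t))) := by
    rw [← dT_bT_word, ← map_add, tw_of_mem hf, LinearMap.smul_apply, mul_one, neg_ksign_smul, isg]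
    push_cast; rfl
  rw [h1, h2, h3]; abel

lemma cup_word {j : ℤ} (f : S.T →ₗ[k] A) {g : S.T →ₗ[k] A} (hg : g ∈ S.cochGr j) (t : S.Wd) :
    S.cup f g (word t) = spl (fun u v => isg k (j * wd u) • (f (word u) * g (word v))) t := by
  simp only [cup, LinearMap.sum_apply, comp_apply, cut_word, map_spl]
  rw [← spl_sum]
  refine spl_congr' _ fun u v _ => ?_
  simp only [map_tmul, mul'_apply, comp_apply]
  rw [sum_par_tmul tgr_internal (word_mem u) (fun e w => f w * S.tw e g (word v)) (by simp), tw_of_mem hg,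
    LinearMap.smul_apply, mul_smul_comm, isg]
  push_cast; rfl

lemma insertion_word {j : ℤ} {g : S.T →ₗ[k] A} (hg : g ∈ S.cochGr j) (t : S.Wd) :
    S.insertion g (word t) = spl (fun t1 => spl fun t2 t3 => isg k ((j + 1) * wd t1) •
      (word t1 * (TensorAlgebra.ι k (S.toBar (g (word t2))) * word t3))) t := by
  simp only [insertion, LinearMap.sum_apply, comp_apply, cut_word, map_spl]
  rw [← spl_sum]
  refine spl_congr' _ fun u v _ => ?_
  have hL : ∀ e, (lift S.consL ∘ₗ map (S.toBar ∘ₗ S.tw e g) .id ∘ₗ S.cut)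
      (word v) = spl (fun t2 t3 => lift S.consL (S.toBar (S.tw e g (word t2)) ⊗ₜ[k] word t3)) v :=
    fun e => (congrArg _ (cut_word v)).trans (map_spl _ v (lift S.consL ∘ₗ map (S.toBar ∘ₗ S.tw e g) .id))
  simp only [map_tmul, mul'_apply, LinearMap.smul_apply, hL]
  rw [sum_par_tmul tgr_internal (word_mem u) (fun e w => w * ksign k e • spl (fun t2 t3 => lift S.consL
    (S.toBar (S.tw e g (word t2)) ⊗ₜ[k] word t3)) v) (by simp), mul_smul_comm, ← mulLeft_apply (R := k),
    map_spl, ← spl_smul]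
  refine spl_congr' _ fun t2 t3 _ => ?_
  rw [tw_of_mem hg, LinearMap.smul_apply, map_smul, ← smul_tmul', map_smul, map_smul, ksign_smul_smul]
  refine (ksign_congr ?_ _)
  push_cast; clear * -; grind

/-! ### The pairing with chains -/

namespace IsClosedFrobenius

variable (h : S.IsClosedFrobenius m form)

lemma tilde_tmul {p : ℤ} {a : A} (ha : a ∈ S.gr p) (f : S.T →ₗ[k] A) (t : S.T) :
    S.tilde form f (a ⊗ₜ t) = form a (S.tw (p + 1) f t) := by
  change (∑ e : ZMod 2, lift (form.compl₁₂ (par S.gr e) (S.tw (e + 1) f))) (a ⊗ₜ t) = _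
  rw [LinearMap.sum_apply]
  exact sum_par_tmul S.internal ha (fun e v => form v (S.tw (e + 1) f t)) (by simp)

lemma tilde_gen_of_mem {i : ℤ} {f : S.T →ₗ[k] A} (hf : f ∈ S.cochGr i) (x : S.Mark) (t : S.Wd) :
    S.tilde form f (gen x t) = isg k ((x.deg + 1) * i) • form x.val (f (word t)) := by
  rw [gen, tilde_tmul x.mem, tw_of_mem hf, LinearMap.smul_apply, map_smul]
  refine ksign_congr ?_ _
  push_cast; ring

include h

lemma tilde_gen (f : S.T →ₗ[k] A) (x : S.Mark) (t : S.Wd) :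
    S.tilde form f (gen x t) = isg k ((x.deg + 1) * (m + wd t)) • form x.val (f (word t)) := by
  rw [gen, tilde_tmul x.mem]
  change form x.val (sg S.gr _ (f (sg S.tgr _ (word t)))) = _
  rw [sg_of_mem tgr_internal _ (word_mem t), map_smul, map_smul, map_smul]
  have := congr_fun (dual_comp_sg S.internal (h.form_mem x.mem rfl) (x.deg + 1 : ZMod 2)) (f (word t))
  rw [comp_apply] at this
  rw [this, LinearMap.smul_apply, ksign_smul_smul]
  refine ksign_congr ?_ _; push_cast; clear * -; grind [icast_sq]

lemma mem_cochGr_iff {i : ℤ} {f : S.T →ₗ[k] A} : f ∈ S.cochGr i ↔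
    ∀ (x : S.Mark) (t : S.Wd), x.deg + wd t + i ≠ m → form x.val (f (word t)) = 0 := by
  refine ⟨fun hf x t hx => h.degree _ _ (by omega) _ x.mem _ (coch_mem hf t), fun H j t ht => ?_⟩
  have key : ∀ t : S.Wd, f (word t) ∈ S.gr (wd t + i) := fun t => by
    have e : prj S.internal (wd t + i) (f (word t)) = f (word t) := by
      refine h.flip_bijective.1 (homog_ext S.internal fun p a ha => ?_)
      rw [flip_apply, flip_apply]
      by_cases hp : p + wd t + i = m
      · have := congr_fun ((hasProj_dual S.internal).self _ _ (h.form_mem ha rfl)) (f (word t))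
        rw [show -(p - m) = wd t + i by omega] at this
        exact this
      · rw [show form a (f (word t)) = 0 from H ⟨p, a, ha⟩ t hp]
        exact h.degree _ _ (by omega) _ ha _ (prj_mem _ _ _)
    exact e ▸ prj_mem _ _ _
  refine Submodule.span_le (p := (S.gr (j + i)).comap f).2 ?_ ht
  rintro _ hw
  obtain ⟨l, rfl, rfl⟩ := IsWord.exists_list hw
  exact key l

omit h in
lemma _root_.OpenFrobenius.DGAug.mem_dgr_iff {i : ℤ} {φ : Dual k S.C} : φ ∈ S.dgr m i ↔
    ∀ (x : S.Mark) (t : S.Wd), x.deg + wd t + i ≠ m → φ (gen x t) = 0 := by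
  refine ⟨fun hφ x t hx => hφ (x.deg + wd t - m) (by omega) _ (gen_mem_shift (by omega)), fun H j hj c hc => ?_⟩
  exact cgr_induction (n := j + m) (P := ker φ) (fun x t hx => H x t (by omega)) hc

omit h in
lemma _root_.OpenFrobenius.DGAug.DDual_of_mem {i : ℤ} {φ : Dual k S.C} (hφ : φ ∈ S.dgr m i) :
    S.DDual m φ = ksign k (i : ZMod 2) • (φ ∘ₗ S.D) :=
  oddDual_of_mem (V := S.C) (gr := S.cgrShift m) (cgrShift_internal m) (i := i) hφ S.D

lemma tilde_mem_iff (i : ℤ) (f : S.T →ₗ[k] A) : f ∈ S.cochGr i ↔ S.tilde form f ∈ S.dgr m i := by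
  rw [h.mem_cochGr_iff, mem_dgr_iff]
  refine forall_congr' fun x => forall_congr' fun t => imp_congr_right fun _ => ?_
  rw [h.tilde_gen]
  refine ⟨fun e => by rw [e, smul_zero], fun e => ?_⟩
  have := ksign_smul_self (k := k) (((x.deg + 1) * (m + wd t) : ℤ) : ZMod 2) (form x.val (f (word t)))
  rw [← this, show ksign k _ • form x.val (f (word t)) = 0 from e, smul_zero]

lemma tilde_bijective : Function.Bijective (S.tilde form) := by
  refine ⟨(injective_iff_map_eq_zero _).2 fun f hf => word_ext fun t => ?_, fun φ => ?_⟩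
  · refine h.flip_bijective.1 (homog_ext S.internal fun p a ha => ?_)
    have := h.tilde_gen f ⟨p, a, ha⟩ t
    rw [hf, LinearMap.zero_apply] at this
    have h2 := congrArg (isg k ((p + 1) * (m + wd t)) • ·) this
    simp only [isg, ksign_smul_self, smul_zero] at h2
    rw [LinearMap.zero_apply, map_zero, LinearMap.zero_apply, h2]; rfl
  · let σ : S.C →ₗ[k] S.C := ksign k (m : ZMod 2) • (map (sg S.gr m) (sg S.tgr 1) ∘ₗ ksgn S.gr S.tgr)
    refine ⟨(LinearEquiv.ofBijective _ h.flip_bijective).symm ∘ₗ (TensorProduct.curry (φ ∘ₗ σ)).flip, gen_ext fun x t => ?_⟩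
    have e1 : ∀ y (ψ : Dual k A), form y ((LinearEquiv.ofBijective _ h.flip_bijective).symm ψ) = ψ y :=
      fun y ψ => congr_fun ((LinearEquiv.ofBijective _ h.flip_bijective).apply_symm_apply ψ) y
    have e2 : σ (gen x t) = isg k ((x.deg + 1) * (m + wd t)) • gen x t := by
      simp only [σ, LinearMap.smul_apply, comp_apply]
      rw [gen, ksgn_of_mem S.internal tgr_internal x.mem (word_mem t), map_smul, map_tmul,
        sg_of_mem S.internal _ x.mem, sg_of_mem tgr_internal _ (word_mem t), tmul_smul,
        ← smul_tmul', smul_smul, smul_smul, smul_smul, ← ksign_add, ← ksign_add, ← ksign_add, isg]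
      congr 2; push_cast; clear * -; grind
    rw [h.tilde_gen, comp_apply, LinearEquiv.coe_coe, e1]
    change isg k _ • φ (σ (gen x t)) = _
    rw [e2, map_smul]
    exact ksign_smul_self _ _

lemma tilde_DCoch {i : ℤ} {f : S.T →ₗ[k] A} (hf : f ∈ S.cochGr i) :
    S.DCoch f ∈ S.cochGr (i + 1) ∧ S.tilde form (S.DCoch f) = S.DDual m (S.tilde form f) := by
  have key : ∀ (x : S.Mark) (t : S.Wd), isg k ((x.deg + 1) * (i + 1)) • form x.val (S.DCoch f (word t)) =
      S.DDual m (S.tilde form f) (gen x t) := fun x t => by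
    rw [DDual_of_mem ((h.tilde_mem_iff i f).1 hf), LinearMap.smul_apply, comp_apply, D_gen, DCoch_word hf]
    simp only [tilde_gen_of_mem hf, D1, slot, map_add, smul_add, map_smul]
    have h1 := (map_dl (isg k x.deg • isg k ((x.deg + 1) * i) • (form x.val ∘ₗ f)) word t).symm
    have h2 : form x.d.val (f (word t)) = isg k (x.deg + 1) • form x.val (S.d (f (word t))) := by
      rw [Mark.d_val, h.diff _ _ x.mem, ← smul_eq_mul, neg_ksign_smul, isg]; push_cast; rfl
    simp only [LinearMap.smul_apply, comp_apply] at h1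
    rw [h1, h2, map_onHead, map_onLast, ← onHead_smul, ← onLast_smul, ← onHead_smul, ← onLast_smul]
    simp only [← show ∀ n : ℤ, isg k n = ksign k (n : ZMod 2) from fun _ => rfl, isg_smul, map_smul]
    refine congrArg₂ (· + ·) (isg_congr ?_ _) (congrArg₂ (· + ·) (congrArg₂ (· + ·) (isg_congr ?_ _)
      (onHead_congr _ fun b u _ => ?_)) (onLast_congr _ fun u b _ => ?_))
    · change _ = ((_ + (((x.deg + 1 : ℤ) + 1) * i + _) : ℤ) : ZMod 2)
      push_cast; clear * -; grind
    · push_cast; clear * -; grind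
    · rw [Mark.mul_val, h.invariant]
      refine isg_congr ?_ _
      change _ = ((_ + (_ + ((x.deg + b.deg : ℤ) + 1) * i) : ℤ) : ZMod 2)
      push_cast; clear * -; grind
    · rw [Mark.mul_val, h.cyclic b.mark.mem x.mem (coch_mem hf u), isg, isg, ksign_smul_smul]
      refine ksign_congr ?_ _
      change _ = ((_ + (_ + ((b.deg + x.deg : ℤ) + 1) * i) : ℤ) : ZMod 2) + (b.deg : ZMod 2) * _
      push_cast; clear * -; grind [icast_sq]
  have hm : S.DDual m (S.tilde form f) ∈ S.dgr m (i + 1) :=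
    oddDual_hasDeg (V := S.C) (gr := S.cgrShift m) (cgrShift_internal m) (D_hasDeg m) i _ ((h.tilde_mem_iff i f).1 hf)
  have hm' : S.DCoch f ∈ S.cochGr (i + 1) := h.mem_cochGr_iff.2 fun x t hx => by
    have := congrArg (isg k ((x.deg + 1) * (i + 1)) • ·) ((key x t).trans (mem_dgr_iff.1 hm x t hx))
    simpa only [isg, ksign_smul_self, smul_zero] using this
  exact ⟨hm', gen_ext fun x t => by rw [tilde_gen_of_mem hm', key]⟩

end IsClosedFrobenius

lemma odot_of_mem {ω : S.Casimir m} (hth : S.thetaShift m δ = ω.th) {i j : ℤ} {F G : Dual k S.C}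
    (hF : F ∈ S.dgr m i) (hG : G ∈ S.dgr m j) : S.odot m δ F G = isg k (i * j + m) • (ten F G ∘ₗ ω.th) := by
  have := dualMul_of_mem (V := S.C) (θ := ksign k (m : ZMod 2) • S.thetaShift m δ) (cgrShift_internal m) hF hG
  rw [odot_eq_dualMul, this, hth, comp_smul, isg]
  refine LinearMap.ext fun c => ?_
  simp only [LinearMap.smul_apply, ksign_smul_smul]
  refine ksign_congr ?_ _
  push_cast; rfl

namespace IsClosedFrobenius

variable (h : S.IsClosedFrobenius m form) (hδ : S.IsDualCoproduct m form δ) {ω : S.Casimir m}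
  (hω : ∀ x, δ x = ∑ i, isg k (m * (1 + (ω.p i).deg)) • ((ω.p i).val ⊗ₜ[k] ((ω.q i).val * x)))
include h hδ hω

lemma cas_form {γ : ℤ} {c : A} (hc : c ∈ S.gr γ) (L : Dual k A) (e : ℤ → ℤ) :
    ω.cas (fun p q => isg k (e q.deg) • (L p.val * form q.val c)) = isg k (e (m - γ) + m) • L c := by
  have h1 : ω.cas (fun p q => L p.val * form q.val c) = isg k m • L c := by
    obtain ⟨a, rfl⟩ := h.flip_bijective.2 L
    induction a using homog_induction S.internal with
    | h0 => simp [ω.cas_zero]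
    | ha a a' e e' => simp only [map_add, LinearMap.add_apply, add_mul, smul_add, ω.cas_add, e, e']
    | hg α a ha =>
      have e1 := h.ten_flip_apply hδ hc ha 1
      rw [← h.invariant, one_mul, hω, map_sum] at e1
      have e2 : ω.cas (fun p q => isg k (m * (1 + p.deg)) • (form p.val a * form q.val c)) =
          isg k (m * (1 + α)) • form c a := by
        refine Eq.trans (Finset.sum_congr rfl fun i _ => ?_) (e1.trans ?_)
        · rw [map_smul, ten_tmul, mul_one]; rfl
        · refine ksign_congr ?_ _; push_cast; rfl
      have e3 : ω.cas (fun p q => form p.val a * form q.val c) = isg k (m * α) •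
          ω.cas (fun p q => isg k (m * (1 + p.deg)) • (form p.val a * form q.val c)) := by
        rw [← ω.cas_smul]
        refine ω.cas_congr fun p q hpq => ?_
        rw [isg_smul]
        by_cases hp : p.deg + α = m
        · refine (isg_eq_one ?_ _).symm
          rw [← hp]; push_cast; clear * -; grind [icast_sq]
        · rw [h.degree _ _ hp _ p.mem _ ha, zero_mul, smul_zero]
      refine e3.trans ?_
      rw [e2, isg_smul]; refine isg_congr ?_ _; push_cast; clear * -; grind
  rw [← isg_smul, ← h1, ← ω.cas_smul]
  refine ω.cas_congr fun p q _ => ?_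
  by_cases hq : q.deg + γ = m
  · rw [show q.deg = m - γ by omega]
  · rw [h.degree _ _ hq _ q.mem _ hc, mul_zero, smul_zero, smul_zero]

lemma tilde_cup (hth : S.thetaShift m δ = ω.th) {i j : ℤ} {f g : S.T →ₗ[k] A} (hf : f ∈ S.cochGr i)
    (hg : g ∈ S.cochGr j) :
    S.tilde form (S.cup f g) = S.odot m δ (S.tilde form f) (S.tilde form g) := by
  have hF := (h.tilde_mem_iff i f).1 hf
  have hG := (h.tilde_mem_iff j g).1 hg
  have hod := odot_of_mem (δ := δ) hth hF hG
  have key : ∀ (x : S.Mark) (t : S.Wd),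
      isg k ((x.deg + 1) * i + i * j + m * j + j * wd t) • form x.val (S.cup f g (word t)) =
      S.odot m δ (S.tilde form f) (S.tilde form g) (gen x t) := fun x t => by
    rw [hod, LinearMap.smul_apply, comp_apply, ω.th_gen, Casimir.split, cup_word f hg, map_spl, ← spl_smul, ← spl_smul]
    refine spl_congr' _ fun u v huv => ?_
    have e := h.cas_form hδ hω (coch_mem hg v) (form.flip (x.val * f (word u)))
      fun q => (m - q) * (x.deg + wd u) + (m - q + x.deg + 1) * i + (q + 1) * j
    have e1 : (ω.cas fun p q => isg k (p.deg * (x.deg + wd u)) •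
        ten (S.tilde form f) (S.tilde form g) (gen (p.mul x) u ⊗ₜ gen q v)) = _ := Eq.trans
      (ω.cas_congr fun p q hpq => ?_) e
    · have hs := h.symmetric _ _ _ (coch_mem hg v) _ (S.mul_mem _ _ _ x.mem _ (coch_mem hf u))
      rw [h.invariant] at hs
      rw [e1, isg_smul, map_smul, isg_smul, flip_apply, hs, isg, isg, ← huv, wd_append]
      refine Eq.trans ?_ (ksign_smul_smul _ _ (form x.val (f (word u) * g (word v)))).symm
      refine ksign_congr ?_ _; push_cast; clear * -; grind [icast_sq]
    · rw [ten_tmul, tilde_gen_of_mem hf, tilde_gen_of_mem hg, smul_mul_smul_comm, ← isg_add, isg_smul,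
        Mark.mul_val, h.invariant, flip_apply, ← hpq]
      refine isg_congr ?_ _
      rw [Mark.mul_deg]; push_cast; clear * -; grind
  have hm : S.odot m δ (S.tilde form f) (S.tilde form g) ∈ S.dgr m (i + j) := by
    rw [hod]
    exact ksign_mem (dual_comp (gr := S.cgrShift m) (ten_mem hF hG rfl) ω.homotopies.θ_mem (by ring))
  refine gen_ext fun x t => ?_
  rw [← key, h.tilde_gen]
  by_cases hx : x.deg + wd t + (i + j) = m
  · refine isg_congr ?_ _
    rw [← hx]; push_cast; clear * -; grind [icast_sq]
  · have := congrArg (isg k ((x.deg + 1) * i + i * j + m * j + j * wd t) • ·)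
      ((key x t).trans (mem_dgr_iff.1 hm x t hx))
    simp only [isg, ksign_smul_self, smul_zero] at this
    rw [this, smul_zero, smul_zero]

lemma tilde_comp_insertion {i j : ℤ} {f g : S.T →ₗ[k] A} (hf : f ∈ S.cochGr i) (hg : g ∈ S.cochGr j) :
    S.tilde form (f ∘ₗ S.insertion g) = isg k (i * j + j + 1 + m) • (ten (S.tilde form f) (S.tilde form g) ∘ₗ ω.h) := by
  have hF := (h.tilde_mem_iff i f).1 hf
  have hG := (h.tilde_mem_iff j g).1 hg
  have key : ∀ (x : S.Mark) (t : S.Wd),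
      isg k ((x.deg + 1) * (i + j + 1) + j * (x.deg + wd t + m + 1) + 1 + m) • form x.val (f (S.insertion g (word t))) =
      ten (S.tilde form f) (S.tilde form g) (ω.h (gen x t)) := fun x t => by
    rw [ω.h_gen, Casimir.pinch, insertion_word hg, map_spl, map_spl, ← spl_smul]
    refine spl_congr' _ fun t1 s hs => ?_
    rw [map_spl, map_spl, ← spl_smul]
    refine spl_congr' _ fun t2 t3 hs' => ?_
    let L : Dual k A := form x.val ∘ₗ f ∘ₗ mulLeft k (word t1) ∘ₗ mulRight k (word t3) ∘ₗ TensorAlgebra.ι k ∘ₗ S.toBar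
    have e := h.cas_form hδ hω (coch_mem hg t2) L fun q => wd t3 * (m + q + wd t2) + (x.deg + wd t1) +
      ((x.deg + 1) * i + (q + 1) * j)
    refine Eq.trans ?_ (Eq.trans e.symm (ω.cas_congr fun p q hpq => ?_))
    · rw [map_smul, map_smul, isg_smul, ← hs, ← hs', wd_append, wd_append]
      refine isg_congr ?_ _; push_cast; clear * -; grind [icast_sq]
    · rw [ten_tmul, tilde_gen_of_mem hf, tilde_gen_of_mem hg, smul_mul_smul_comm, ← isg_add, isg_smul,
        isg_smul, word_append, word_cons, add_assoc]
      rfl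
  have hm : ten (S.tilde form f) (S.tilde form g) ∘ₗ ω.h ∈ S.dgr m (i + j - 1) :=
    dual_comp (gr := S.cgrShift m) (ten_mem hF hG rfl) ω.homotopies.h_mem (by ring)
  refine gen_ext fun x t => ?_
  rw [h.tilde_gen, LinearMap.smul_apply, comp_apply, comp_apply, ← key, isg_smul]
  by_cases hx : x.deg + wd t + (i + j - 1) = m
  · refine isg_congr ?_ _
    rw [← hx]; push_cast; clear * -; grind [icast_sq]
  · have := congrArg (isg k ((x.deg + 1) * (i + j + 1) + j * (x.deg + wd t + m + 1) + 1 + m) • ·)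
      ((key x t).trans (mem_dgr_iff.1 hm x t hx))
    simp only [isg, ksign_smul_self, smul_zero] at this
    rw [this, smul_zero, smul_zero]

end IsClosedFrobenius

end DGAug

section Transport

variable {k : Type u} [CommRing k] {V : Type v} [AddCommGroup V] [Module k V] {W : Type w} [AddCommGroup W] [Module k W]
variable {gr : ℤ → Submodule k V} {D : V →ₗ[k] V} {gr' : ℤ → Submodule k W} {D' : W →ₗ[k] W}

set_option maxHeartbeats 400000 in
/-- Transport of a BV-structure on homology along an isomorphism of complexes. -/
lemma exists_isBV_transport (E : V →ₗ[k] W) (hE : Function.Bijective E) (hgr : ∀ i v, v ∈ gr i ↔ E v ∈ gr' i)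
    (hED : ∀ v ∈ ⨆ i, gr i, E (D v) = D' (E v)) {mulV : V → V → V} {mulW : W → W → W} {ΔW : W → W}
    (hEm : ∀ v v', v ∈ ⨆ i, gr i → v' ∈ ⨆ i, gr i → E (mulV v v') = mulW (E v) (E v'))
    {mulH : Homology gr' D' →ₗ[k] Homology gr' D' →ₗ[k] Homology gr' D'} {ΔH : Homology gr' D' →ₗ[k] Homology gr' D'}
    (hm : InducesMul gr' D' mulW mulH) (hΔ : Induces gr' D' gr' D' ΔW ΔH)
    (hBV : IsBV (homologyGr gr' D') mulH ΔH) :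
    (∀ v, v ∈ cyc gr D ↔ E v ∈ cyc gr' D') ∧
    ∃ (mulH' : Homology gr D →ₗ[k] Homology gr D →ₗ[k] Homology gr D) (ΔH' : Homology gr D →ₗ[k] Homology gr D)
      (Φ : Homology gr D ≃ₗ[k] Homology gr' D'), InducesMul gr D mulV mulH' ∧ Induces gr D gr' D' E Φ ∧
      Induces gr' D' gr' D' ΔW (fun x => Φ (ΔH' (Φ.symm x))) ∧ IsBV (homologyGr gr D) mulH' ΔH' ∧
      (∀ a b, Φ (mulH' a b) = mulH (Φ a) (Φ b)) ∧ ∀ a, Φ (ΔH' a) = ΔH (Φ a) := by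
  have hmap : ∀ i, (gr i).map E = gr' i := fun i => by
    ext w
    obtain ⟨v, rfl⟩ := hE.2 w
    rw [← hgr, Submodule.mem_map]
    exact ⟨fun ⟨y, hy, e⟩ => hE.1 e ▸ hy, fun hv => ⟨v, hv, rfl⟩⟩
  have hsup : ∀ v, v ∈ ⨆ i, gr i ↔ E v ∈ ⨆ i, gr' i := fun v => by
    rw [← iSup_congr hmap, ← Submodule.map_iSup]
    exact ⟨fun hv => ⟨v, hv, rfl⟩, fun ⟨y, hy, e⟩ => hE.1 e ▸ hy⟩
  have hc : ∀ v, v ∈ cyc gr D ↔ E v ∈ cyc gr' D' := fun v => by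
    refine ⟨fun hv => ⟨?_, (hsup v).1 hv.2⟩, fun hv => ⟨hE.1 ?_, (hsup v).2 hv.2⟩⟩
    · exact mem_ker.2 (by rw [← hED v hv.2, show D v = 0 from hv.1, map_zero])
    · rw [hED v ((hsup v).2 hv.2), show D' (E v) = 0 from hv.1, map_zero]
  have hb : ∀ v, v ∈ bdry gr D ↔ E v ∈ bdry gr' D' := fun v => by
    constructor
    · rintro ⟨y, hy, rfl⟩
      exact ⟨E y, (hsup y).1 hy, (hED y hy).symm⟩
    · rintro ⟨w, hw, e⟩
      obtain ⟨y, rfl⟩ := hE.2 w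
      exact ⟨y, (hsup y).2 hw, hE.1 ((hED y ((hsup y).2 hw)).trans e)⟩
  have hΦ : Function.Bijective (homMap E (fun v => (hc v).1) (fun v => (hb v).1)) := by
    refine ⟨(injective_iff_map_eq_zero _).2 fun a ha => ?_, fun b => ?_⟩
    · obtain ⟨z, rfl⟩ := cls_surjective a
      rw [homMap_cls, cls_eq_zero] at ha
      exact cls_eq_zero.2 ((hb z).2 ha)
    · obtain ⟨⟨w, hw⟩, rfl⟩ := cls_surjective b
      obtain ⟨v, rfl⟩ := hE.2 w
      exact ⟨cls gr D ⟨v, (hc v).2 hw⟩, homMap_cls _ _ _ _⟩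
  let Φ : Homology gr D ≃ₗ[k] Homology gr' D' := LinearEquiv.ofBijective _ hΦ
  have hcl : ∀ z : cyc gr D, Φ (cls gr D z) = cls gr' D' ⟨E z, (hc z).1 z.2⟩ := fun z =>
    homMap_cls E (fun v => (hc v).1) (fun v => (hb v).1) z
  clear_value Φ
  have hhg : ∀ i a, a ∈ homologyGr gr D i ↔ Φ a ∈ homologyGr gr' D' i := fun i a => by
    constructor
    · rintro ⟨z, hz, rfl⟩
      rw [hcl]
      exact cls_mem ((hgr i z).1 hz)
    · rintro ⟨⟨w, hw⟩, hz, e⟩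
      obtain ⟨v, rfl⟩ := hE.2 w
      rw [← hcl ⟨v, (hc v).2 hw⟩] at e
      rw [← Φ.injective e]
      exact cls_mem ((hgr i v).2 hz)
  obtain ⟨mulH', hmm⟩ : ∃ mulH' : Homology gr D →ₗ[k] Homology gr D →ₗ[k] Homology gr D,
      ∀ a b, Φ (mulH' a b) = mulH (Φ a) (Φ b) :=
    ⟨(mulH.compl₁₂ Φ.toLinearMap Φ.toLinearMap).compr₂ Φ.symm.toLinearMap, fun a b => Φ.apply_symm_apply _⟩
  obtain ⟨ΔH', hΔΔ⟩ : ∃ ΔH' : Homology gr D →ₗ[k] Homology gr D, ∀ a, Φ (ΔH' a) = ΔH (Φ a) :=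
    ⟨Φ.symm.toLinearMap ∘ₗ ΔH ∘ₗ Φ.toLinearMap, fun a => Φ.apply_symm_apply _⟩
  refine ⟨hc, mulH', ΔH', Φ, fun z z' => ?_, fun z => ⟨(hc z).1 z.2, hcl z⟩, fun z => ?_, ?_, hmm, hΔΔ⟩
  · obtain ⟨e1, e2⟩ := hm ⟨E z, (hc z).1 z.2⟩ ⟨E z', (hc z').1 z'.2⟩
    have e3 := hEm z z' z.2.2 z'.2.2
    refine ⟨(hc _).2 (e3 ▸ e1), Φ.injective ?_⟩
    rw [hmm, hcl, hcl, hcl, e2]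
    congr 1; exact Subtype.ext e3.symm
  · obtain ⟨e1, e2⟩ := hΔ z
    refine ⟨e1, ?_⟩
    change Φ _ = _
    rw [hΔΔ, Φ.apply_symm_apply, e2]
  · constructor
    · refine isInternal_of_proj (fun i => Φ.symm.toLinearMap ∘ₗ prj hBV.internal i ∘ₗ Φ.toLinearMap)
        (fun i a ha => ?_) (fun i j hij a ha => ?_) (eq_top_iff.2 fun a _ => ?_)
      · change Φ.symm (prj hBV.internal i (Φ a)) = a
        rw [prj_self _ ((hhg i a).1 ha), Φ.symm_apply_apply]
      · change Φ.symm (prj hBV.internal i (Φ a)) = 0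
        rw [prj_of_mem _ _ ((hhg j a).1 ha), if_neg hij, map_zero]
      · have : ∀ b, Φ.symm b ∈ ⨆ i, homologyGr gr D i := fun b => by
          induction b using homog_induction hBV.internal with
          | h0 => rw [map_zero]; exact zero_mem _
          | ha b b' e e' => rw [map_add]; exact add_mem e e'
          | hg i b hb =>
            exact mem_iSup_of_mem i ((hhg i _).2 (by rwa [Φ.apply_symm_apply]))
        rw [← Φ.symm_apply_apply a]
        exact this _
    · intro i j a ha b hb
      rw [hhg, hmm]
      exact hBV.mul_mem i j _ ((hhg i a).1 ha) _ ((hhg j b).1 hb)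
    · intro a b c
      exact Φ.injective (by simp only [hmm, hBV.mul_assoc])
    · intro i j a ha b hb
      exact Φ.injective (by rw [map_smul, hmm, hmm, hBV.mul_comm i j _ ((hhg i a).1 ha) _ ((hhg j b).1 hb)])
    · intro i a ha
      rw [hhg, hΔΔ]
      exact hBV.op_mem i _ ((hhg i a).1 ha)
    · intro a
      exact Φ.injective (by rw [hΔΔ, hΔΔ, hBV.op_op, map_zero])
    · intro i j l a ha b hb c hc'
      refine Φ.injective ?_
      simp only [map_add, map_sub, map_smul, hmm, hΔΔ]
      exact hBV.seven_term i j l _ ((hhg i a).1 ha) _ ((hhg j b).1 hb) _ ((hhg l c).1 hc')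

end Transport

namespace DGAug

variable {k : Type u} {A : Type v} [CommRing k] [Ring A] [Algebra k A] {S : DGAug k A}
variable {m : ℤ} {form : A →ₗ[k] A →ₗ[k] k} {δ : A →ₗ[k] A ⊗[k] A} {ω : S.Casimir m}

lemma BDual_of_mem {i : ℤ} {φ : Dual k S.C} (hφ : φ ∈ S.dgr m i) : S.BDual m φ = ksign k (i : ZMod 2) • (φ ∘ₗ S.B) :=
  oddDual_of_mem (V := S.C) (gr := S.cgrShift m) (cgrShift_internal m) (i := i) hφ S.B

set_option maxHeartbeats 1000000 in
/-- The chain level formula for the bracket of the BV-algebra `HH^*(A, A^∨)[m]`. -/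
lemma bvBracket_dual (hth : S.thetaShift m δ = ω.th)
    {mulH : Homology (S.dgr m) (S.DDual m) →ₗ[k] Homology (S.dgr m) (S.DDual m) →ₗ[k] Homology (S.dgr m) (S.DDual m)}
    {ΔH : Homology (S.dgr m) (S.DDual m) →ₗ[k] Homology (S.dgr m) (S.DDual m)}
    (hm : InducesMul (S.dgr m) (S.DDual m) (S.odot m δ) mulH)
    (hΔ : Induces (S.dgr m) (S.DDual m) (S.dgr m) (S.DDual m) (S.BDual m) ΔH) {i j : ℤ}
    (F G : cyc (S.dgr m) (S.DDual m)) (hF : (F : Dual k S.C) ∈ S.dgr m i)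
    (hG : (G : Dual k S.C) ∈ S.dgr m j) {Y : Dual k S.C} (hY : Y = isg k (i * j + j + 1 + m) •
      (ten F G ∘ₗ (ω.h + kswap (S.cgrShift m) (S.cgrShift m) ∘ₗ ω.h))) :
    ∃ h : Y ∈ cyc (S.dgr m) (S.DDual m),
      bvBracket mulH ΔH i (cls _ _ F) (cls _ _ G) = cls (S.dgr m) (S.DDual m) ⟨Y, h⟩ := by
  have hi := cgrShift_internal (S := S) m
  obtain ⟨c1, e1⟩ := hm F G
  obtain ⟨c2, e2⟩ := hΔ ⟨_, c1⟩
  obtain ⟨c3, e3⟩ := hΔ F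
  obtain ⟨c4, e4⟩ := hm ⟨_, c3⟩ G
  obtain ⟨c5, e5⟩ := hΔ G
  obtain ⟨c6, e6⟩ := hm F ⟨_, c5⟩
  let X : cyc (S.dgr m) (S.DDual m) := ksign k (i : ZMod 2) • ⟨_, c2⟩ - ksign k (i : ZMod 2) • ⟨_, c4⟩ - ⟨_, c6⟩
  have hX : bvBracket mulH ΔH i (cls _ _ F) (cls _ _ G) = cls _ _ X := by
    rw [bvBracket, e1, e2, e3, e4, e5, e6]; rfl
  have hFB : (F : Dual k S.C) ∘ₗ S.B ∈ S.dgr m (i - 1) :=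
    dual_comp (V := S.C) (gr := S.cgrShift m) (gr' := S.cgrShift m) hF (B_hasDeg m) (by ring)
  have hGB : (G : Dual k S.C) ∘ₗ S.B ∈ S.dgr m (j - 1) :=
    dual_comp (V := S.C) (gr := S.cgrShift m) (gr' := S.cgrShift m) hG (B_hasDeg m) (by ring)
  have hFG : ten F.1 G.1 ∘ₗ ω.th ∈ S.dgr m (i + j) :=
    dual_comp (gr := S.cgrShift m) (ten_mem hF hG rfl) ω.homotopies.θ_mem (by ring)
  have hX' : (X : Dual k S.C) - Y = isg k (i * j + j + m) • (ten F.1 G.1 ∘ₗ (ω.th ∘ₗ S.B -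
      tensorOdd (S.cgrShift m) S.B S.B ∘ₗ ω.th + (ω.h + kswap (S.cgrShift m) (S.cgrShift m) ∘ₗ ω.h))) := by
    change ksign k (i : ZMod 2) • S.BDual m (S.odot m δ F G) - ksign k (i : ZMod 2) • S.odot m δ (S.BDual m F) G -
      S.odot m δ F (S.BDual m G) - Y = _
    have hB := congr_fun (ten_comp_tensorOdd (V := S.C) (W := S.C) hi hF (G : Dual k S.C) S.B S.B)
    rw [odot_of_mem hth hF hG, map_smul, BDual_of_mem hFG, BDual_of_mem hF, BDual_of_mem hG,
      odot_of_mem hth (smul_mem _ _ hFB) hG, odot_of_mem hth hF (smul_mem _ _ hGB), ten_smul_left,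
      ten_smul_right, hY]
    refine LinearMap.ext fun x => ?_
    have hB := hB (ω.th x)
    simp only [comp_apply, LinearMap.add_apply, LinearMap.smul_apply] at hB
    simp only [LinearMap.sub_apply, LinearMap.add_apply, LinearMap.smul_apply, comp_apply, map_add, map_sub,
      hB, smul_sub, smul_add, isg, ksign_smul_smul]
    have hs : ∀ z : k, ksign k ((i * j + j + 1 + m : ℤ) : ZMod 2) • z = -(ksign k ((i * j + j + m : ℤ) : ZMod 2) • z) :=
      fun z => by rw [neg_ksign_smul]; refine ksign_congr ?_ _; push_cast; clear * -; grind
    rw [hs, hs, ksign_congr (b := ((i * j + j + m : ℤ) : ZMod 2)) (by push_cast; clear * -; grind [icast_sq])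
      (ten F.1 G.1 (ω.th (S.B x))), ksign_congr (b := ((i * j + j + m : ℤ) : ZMod 2))
      (by push_cast; clear * -; grind [icast_sq]) (ten (F.1 ∘ₗ S.B) G.1 (ω.th x)),
      ksign_congr (b := ((i * j + j + m : ℤ) : ZMod 2) + i) (by push_cast; clear * -; grind [icast_sq])
      (ten F.1 (G.1 ∘ₗ S.B) (ω.th x))]
    abel
  obtain ⟨K, hK, eK⟩ := ω.homotopies.deviation_mem
  have hch : ChainHomotopic (-1) (S.cgrShift m) S.D (tensorGr (S.cgrShift m) (S.cgrShift m))
      (tensorOdd (S.cgrShift m) S.D S.D) (ω.th ∘ₗ S.B - tensorOdd (S.cgrShift m) S.B S.B ∘ₗ ω.th +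
        (ω.h + kswap (S.cgrShift m) (S.cgrShift m) ∘ₗ ω.h)) 0 :=
    ⟨K, fun i v hv => by rw [add_sub_assoc]; exact hK i v hv, (sub_zero _).trans eK⟩
  obtain ⟨y, hy, ey⟩ := comp_chainHomotopic (V := S.C) (W := S.C ⊗[k] S.C) hi (ten_mem hF hG rfl)
    (ten_comp_tensorOdd_eq_zero (V := S.C) (W := S.C) hi hF (comp_eq_zero_of_oddDual (V := S.C) hi hF F.2.1)
      (comp_eq_zero_of_oddDual (V := S.C) hi hG G.2.1)) hch
  have hy : y ∈ S.dgr m (i + j + -1 - 1) := hy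
  rw [(sub_eq_self.2 (comp_zero _)).symm.trans (ey : _ = S.DDual m y), ← map_smul] at hX'
  have hX' : (X : Dual k S.C) - Y = S.DDual m (isg k (i * j + j + m) • y) := hX'
  have hYX : Y = X - S.DDual m (isg k (i * j + j + m) • y) := by rw [← hX']; abel
  have hyd : S.DDual m y ∈ S.dgr m (i + j + -1 - 1 + 1) :=
    oddDual_hasDeg (V := S.C) (gr := S.cgrShift m) hi (D_hasDeg m) _ _ hy
  have hDD : S.DDual m (S.DDual m y) = 0 := by
    rw [DDual_of_mem hyd, DDual_of_mem hy]
    refine LinearMap.ext fun x => ?_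
    simp only [LinearMap.smul_apply, comp_apply]
    rw [show S.D (S.D x) = 0 from congr_fun D_D x, map_zero, smul_zero, smul_zero, LinearMap.zero_apply]
  have hYc : Y ∈ cyc (S.dgr m) (S.DDual m) := by
    rw [hYX]
    refine sub_mem X.2 ⟨?_, ?_⟩
    · exact mem_ker.2 (by rw [map_smul, map_smul, hDD, smul_zero])
    · rw [map_smul]; exact smul_mem _ _ (mem_iSup_of_mem _ hyd)
  refine ⟨hYc, hX.trans (cls_eq.2 ?_)⟩
  exact ⟨_, smul_mem _ _ (mem_iSup_of_mem _ hy), hX'.symm⟩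

lemma IsClosedFrobenius.tilde_gerstenhaber (h : S.IsClosedFrobenius m form) (hδ : S.IsDualCoproduct m form δ)
    (hω : ∀ x, δ x = ∑ i, isg k (m * (1 + (ω.p i).deg)) • ((ω.p i).val ⊗ₜ[k] ((ω.q i).val * x)))
    {i j : ℤ} {f g : S.T →ₗ[k] A} (hf : f ∈ S.cochGr i) (hg : g ∈ S.cochGr j) :
    S.tilde form (S.gerstenhaber i j f g) = isg k (i * j + j + 1 + m) • (ten (S.tilde form f) (S.tilde form g) ∘ₗ
      (ω.h + kswap (S.cgrShift m) (S.cgrShift m) ∘ₗ ω.h)) := by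
  rw [gerstenhaber, map_sub, map_smul, h.tilde_comp_insertion hδ hω hf hg, h.tilde_comp_insertion hδ hω hg hf]
  have e := ten_kswap (V := S.C) (W := S.C) (cgrShift_internal m) (cgrShift_internal m)
    ((h.tilde_mem_iff i f).1 hf) ((h.tilde_mem_iff j g).1 hg)
  refine LinearMap.ext fun x => ?_
  have e := congr_fun e (ω.h x)
  simp only [comp_apply, LinearMap.smul_apply] at e
  simp only [LinearMap.sub_apply, LinearMap.add_apply, LinearMap.smul_apply, comp_apply, map_add, e,
    smul_add, isg, ksign_smul_smul]
  rw [sub_eq_add_neg, neg_ksign_smul]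
  refine congrArg₂ (· + ·) rfl (ksign_congr ?_ _)
  push_cast; clear * -; grind

variable (S) in
/-- The cup product as a bilinear map. -/
def cupLin : (S.T →ₗ[k] A) →ₗ[k] (S.T →ₗ[k] A) →ₗ[k] (S.T →ₗ[k] A) := mk₂ k S.cup (fun f f' g => by
      simp only [cup, add_comp, map_add_left, comp_add, Finset.sum_add_distrib])
    (fun c f g => by
      simp only [cup, smul_comp, map_smul_left, comp_smul, Finset.smul_sum])
    (fun f g g' => by
      simp only [cup, map_add, add_comp, map_add_right, comp_add, Finset.sum_add_distrib])
    (fun c f g => by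
      simp only [cup, map_smul, smul_comp, map_smul_right, comp_smul, Finset.smul_sum])

namespace IsClosedFrobenius

variable (h : S.IsClosedFrobenius m form)
include h

lemma tilde_DCoch_of_mem_iSup {f : S.T →ₗ[k] A} (hf : f ∈ ⨆ i, S.cochGr i) :
    S.tilde form (S.DCoch f) = S.DDual m (S.tilde form f) := by
  have : (⨆ i, S.cochGr i) ≤ eqLocus (S.tilde form ∘ₗ S.DCoch) (S.DDual m ∘ₗ S.tilde form) :=
    iSup_le fun i f hf => (h.tilde_DCoch hf).2
  exact this hf

variable (hδ : S.IsDualCoproduct m form δ)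
include hδ

lemma tilde_cup_of_mem_iSup {f g : S.T →ₗ[k] A} (hf : f ∈ ⨆ i, S.cochGr i) (hg : g ∈ ⨆ i, S.cochGr i) :
    S.tilde form (S.cup f g) = S.odot m δ (S.tilde form f) (S.tilde form g) := by
  obtain ⟨ω, hth, hω⟩ := exists_casimir_thetaShift (h.isOpenFrobenius hδ) (h.isSymmetric hδ)
  let od := dualMul (S.cgrShift m) (ksign k (m : ZMod 2) • S.thetaShift m δ)
  have h1 : (⨆ i, S.cochGr i) ≤ eqLocus ((S.cupLin.compr₂ (S.tilde form)).flip g)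
      ((od.compl₁₂ (S.tilde form) (S.tilde form)).flip g) := iSup_le fun i f hf => by
    have h2 : (⨆ i, S.cochGr i) ≤ eqLocus (S.cupLin.compr₂ (S.tilde form) f)
        (od.compl₁₂ (S.tilde form) (S.tilde form) f) := iSup_le fun j g hg =>
      (h.tilde_cup hδ hω hth hf hg).trans (odot_eq_dualMul _ _ _)
    exact h2 hg
  exact (h1 hf : _).trans (odot_eq_dualMul _ _ _).symm

set_option maxHeartbeats 1000000 in
/-- For a closed Frobenius algebra, the cup product and the operator corresponding to the Connes operator make
Hochschild cohomology a BV-algebra, whose bracket is the Gerstenhaber bracket. -/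
lemma exists_isBV_coch : ∃ (cupH : Homology S.cochGr S.DCoch →ₗ[k] Homology S.cochGr S.DCoch →ₗ[k]
        Homology S.cochGr S.DCoch) (ΔH : Homology S.cochGr S.DCoch →ₗ[k] Homology S.cochGr S.DCoch)
      (Φ : Homology S.cochGr S.DCoch ≃ₗ[k] Homology (S.dgr m) (S.DDual m)),
      InducesMul S.cochGr S.DCoch S.cup cupH ∧
      Induces S.cochGr S.DCoch (S.dgr m) (S.DDual m) (S.tilde form) Φ ∧
      Induces (S.dgr m) (S.DDual m) (S.dgr m) (S.DDual m) (S.BDual m) (fun x => Φ (ΔH (Φ.symm x))) ∧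
      IsBV (homologyGr S.cochGr S.DCoch) cupH ΔH ∧
      ∀ (i j : ℤ) (f g : cyc S.cochGr S.DCoch), (f : S.T →ₗ[k] A) ∈ S.cochGr i → (g : S.T →ₗ[k] A) ∈ S.cochGr j →
        ∃ h : S.gerstenhaber i j f g ∈ cyc S.cochGr S.DCoch,
          bvBracket cupH ΔH i (cls S.cochGr S.DCoch f) (cls S.cochGr S.DCoch g) =
            cls S.cochGr S.DCoch ⟨S.gerstenhaber i j f g, h⟩ := by
  have ho := h.isOpenFrobenius hδ
  have hs := h.isSymmetric hδ
  obtain ⟨ω, hth, hω⟩ := exists_casimir_thetaShift ho hs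
  obtain ⟨mulH, ΔH, hm, hΔ, hBV⟩ := exists_isBV_dual ho hs
  obtain ⟨hc, cupH, ΔH', Φ, h1, h2, h3, h4, h5, h6⟩ := exists_isBV_transport (S.tilde form) h.tilde_bijective h.tilde_mem_iff
    (fun f hf => h.tilde_DCoch_of_mem_iSup hf) (fun f g hf hg => h.tilde_cup_of_mem_iSup hδ hf hg) hm hΔ hBV
  refine ⟨cupH, ΔH', Φ, h1, h2, h3, h4, fun i j f g hf hg => ?_⟩
  obtain ⟨hF, eF⟩ := h2 f
  obtain ⟨hG, eG⟩ := h2 g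
  obtain ⟨hY, eY⟩ := bvBracket_dual hth hm hΔ ⟨_, hF⟩ ⟨_, hG⟩ ((h.tilde_mem_iff i f).1 hf) ((h.tilde_mem_iff j g).1 hg)
    (h.tilde_gerstenhaber hδ hω hf hg)
  refine ⟨(hc _).2 hY, Φ.injective ?_⟩
  obtain ⟨_, eY'⟩ := h2 ⟨_, (hc _).2 hY⟩
  rw [eY', ← eY, ← eF, ← eG, bvBracket, bvBracket]
  simp only [map_sub, map_smul, h5, h6]

end IsClosedFrobenius

end DGAug

end OpenFrobenius
end

open OpenFrobenius in
theorem theorem3p1 {k : Type*} {A : Type*} [CommRing k] [Ring A] [Algebra k A]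
    (S : DGAug k A) (m : ℤ) :
    (∀ δ : A →ₗ[k] TensorProduct k A A, S.IsOpenFrobenius m δ → S.IsSymmetric m δ →
      IsHomotopyCoBV (S.cgrShift m) S.D (S.thetaShift m δ) S.B ∧
      (IsField k ∨ KunnethIso (S.cgrShift m) S.D →
        ∃ (θH : Homology (S.cgrShift m) S.D →ₗ[k]
              TensorProduct k (Homology (S.cgrShift m) S.D) (Homology (S.cgrShift m) S.D))
          (BH : Homology (S.cgrShift m) S.D →ₗ[k] Homology (S.cgrShift m) S.D),
          InducesComul (S.cgrShift m) S.D (S.thetaShift m δ) θH ∧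
          Induces (S.cgrShift m) S.D (S.cgrShift m) S.D S.B BH ∧
          IsCoBV (homologyGr (S.cgrShift m) S.D) θH BH) ∧
      (∃ (mulH : Homology (S.dgr m) (S.DDual m) →ₗ[k] Homology (S.dgr m) (S.DDual m) →ₗ[k]
              Homology (S.dgr m) (S.DDual m))
          (ΔH : Homology (S.dgr m) (S.DDual m) →ₗ[k] Homology (S.dgr m) (S.DDual m)),
          InducesMul (S.dgr m) (S.DDual m) (S.odot m δ) mulH ∧
          Induces (S.dgr m) (S.DDual m) (S.dgr m) (S.DDual m) (S.BDual m) ΔH ∧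
          IsBV (homologyGr (S.dgr m) (S.DDual m)) mulH ΔH)) ∧
    (∀ form : A →ₗ[k] A →ₗ[k] k, S.IsClosedFrobenius m form →
      (∃! δ : A →ₗ[k] TensorProduct k A A, S.IsDualCoproduct m form δ) ∧
      ∀ δ : A →ₗ[k] TensorProduct k A A, S.IsDualCoproduct m form δ →
        S.IsOpenFrobenius m δ ∧ S.IsSymmetric m δ ∧
        Function.Bijective (S.tilde form) ∧
        (∀ i f, f ∈ S.cochGr i ↔ S.tilde form f ∈ S.dgr m i) ∧
        (∀ f, f ∈ ⨆ i, S.cochGr i →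
          S.tilde form (S.DCoch f) = S.DDual m (S.tilde form f)) ∧
        (∀ f g, f ∈ ⨆ i, S.cochGr i → g ∈ ⨆ i, S.cochGr i →
          S.tilde form (S.cup f g) = S.odot m δ (S.tilde form f) (S.tilde form g)) ∧
        ∃ (cupH : Homology S.cochGr S.DCoch →ₗ[k] Homology S.cochGr S.DCoch →ₗ[k]
              Homology S.cochGr S.DCoch)
          (ΔH : Homology S.cochGr S.DCoch →ₗ[k] Homology S.cochGr S.DCoch)
          (Φ : Homology S.cochGr S.DCoch ≃ₗ[k] Homology (S.dgr m) (S.DDual m)),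
          InducesMul S.cochGr S.DCoch S.cup cupH ∧
          Induces S.cochGr S.DCoch (S.dgr m) (S.DDual m) (S.tilde form) Φ ∧
          Induces (S.dgr m) (S.DDual m) (S.dgr m) (S.DDual m) (S.BDual m)
            (fun x => Φ (ΔH (Φ.symm x))) ∧
          IsBV (homologyGr S.cochGr S.DCoch) cupH ΔH ∧
          ∀ (i j : ℤ) (f g : cyc S.cochGr S.DCoch),
            (f : S.T →ₗ[k] A) ∈ S.cochGr i → (g : S.T →ₗ[k] A) ∈ S.cochGr j →
            ∃ h : S.gerstenhaber i j f g ∈ cyc S.cochGr S.DCoch,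
              bvBracket cupH ΔH i (cls S.cochGr S.DCoch f) (cls S.cochGr S.DCoch g) =
                cls S.cochGr S.DCoch ⟨S.gerstenhaber i j f g, h⟩) := by 
  refine ⟨fun δ h hs => ⟨DGAug.isHomotopyCoBV_thetaShift h hs, DGAug.exists_isCoBV_homology h hs, DGAug.exists_isBV_dual h hs⟩,
    fun form h => ⟨h.existsUnique_dualCoproduct, fun δ hδ => ⟨h.isOpenFrobenius hδ, h.isSymmetric hδ,
      h.tilde_bijective, h.tilde_mem_iff, fun f hf => h.tilde_DCoch_of_mem_iSup hf,
      fun f g hf hg => h.tilde_cup_of_mem_iSup hδ hf hg, h.exists_isBV_coch hδ⟩⟩⟩
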